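/- **Setting.** Let $\mathcal A$ be a finite set of $A\ge 1$ actions, $\mathcal X$ a measurable context space and $\Phi$ a finite nonempty class of regressors $\phi:\mathcal X\times\mathcal A\to[0,1]$, measurable in the context. Let $T\ge 2$ and $0<\delta<1$. The environment fixes in advance, for each round $t$, a context distribution $\mathcal D_t$ and a regressor $\phi^\star_t\in\Phi$, both unknown to the learner. In round $t=1,\dots,T$ a context $x_t\sim\mathcal D_t$ is drawn independently of the past, the learner chooses an action $a_t$ (possibly at random), and receives a reward $R_t\in[0,1]$ with conditional mean $\phi^\star_t(x_t,a_t)$ given the past, $x_t$ and $a_t$. For $\phi\in\Phi$ let $\pi_\phi(x)\in\operatorname{argmax}_a\phi(x,a)$; put $f_t(\pi)=\mathbb E_{x\sim\mathcal D_t}[\phi_t^\star(x,\pi(x))]$, $f_t^\star=\max_{\phi\in\Phi}f_t(\pi_\phi)$ and $\text{D-Reg}=\sum_{t=1}^T(f_t^\star-R_t)$. Ties in argmax/argmin are broken by any fixed rule choosing from the set of optimizers. Write $\Lambda=\log(|\Phi|T/\delta)$, $$\rho_0(t)=\sqrt{\tfrac{A\Lambda}{t}},\quad \gamma_t=\sqrt{\tfrac{At}{\Lambda}},\quad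 \Delta_0(t)=\sqrt A\,\sup_{x,a}|\phi^\star_t(x,a)-\phi^\star_{t+1}(x,a)|+\int|\mathcal D_t(x)-\mathcal D_{t+1}(x)|\,dx,$$ where the integral is the total variation mass of $\mathcal D_t-\mathcal D_{t+1}$. For a function $\Delta(\cdot)$ let $\Delta_{[s,e]}=\sum_{\tau=s}^{e-1}\Delta(\tau)$; let $\Delta_0=(\Delta_0)_{[1,T]}$ and $L=1+\#\{1\le \tau<T:\Delta_0(\tau)\ne0\}$. **Modified FALCON** (constant $c$). In its round $t$ it computes $\widehat\phi_t\in\operatorname{argmin}_{\phi\in\Phi}\sum_{\tau<t}(\phi(x_\tau,a_\tau)-R_\tau)^2$ and outputs $\widetilde f_t=\min\{1,\ \frac1{t-1}\sum_{\tau<t}\widehat\phi_t(x_\tau,\pi_{\widehat\phi_t}(x_\tau))+c\,\rho_0(t)\}$ (an empty average is $0$). On context $x$, with $\widehat a=\pi_{\widehat\phi_t}(x)$, it samples from $p_t(a|x)=\big(A+\gamma_t(\widehat\phi_t(x,\widehat a)-\widehat\phi_t(x,a))\big)^{-1}$ for $a\ne\widehat a$, and $p_t(\widehat a|x)=1-\sum_{a\ne\widehat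 a}p_t(a|x)$. **Assumption 1** (for an algorithm run alone with output $\widetilde f_t\in[0,1]$, a measure $\Delta(\cdot)$ and a rate $\rho(\cdot)$). $\Delta(t)\ge\max_{\phi\in\Phi}|f_t(\pi_\phi)-f_{t+1}(\pi_\phi)|$ for $1\le t<T$; on $[1,T]$, $\rho$ is non-increasing, $\rho(t)\ge1/\sqrt t$ and $C(t)=t\rho(t)$ is non-decreasing; and for every $t\in[1,T]$ with $\Delta_{[1,t]}\le\rho(t)$, with probability at least $1-\delta/T$, $$\widetilde f_t\ge\min_{\tau\in[1,t]}f^\star_\tau-\Delta_{[1,t]}\quad\text{and}\quad\frac1t\sum_{\tau=1}^t(\widetilde f_\tau-R_\tau)\le\rho(t)+\Delta_{[1,t]}.$$ **MASTER** (base algorithm ALG, rate $\rho$). Let $\widehat\rho(t)=6(\log_2T+1)\log(T/\delta)\rho(t)$. For $n=0,1,\dots$ it runs a block of $2^n$ rounds starting at the current round $t_n$. For each $m\le n$ the block is cut into sub-intervals of length $2^m$, and on each, independently with probability $\rho(2^n)/\rho(2^m)$, a fresh order-$m$ instance of ALG is scheduled. In each round the shortest scheduled instance covering that round is active; it alone chooses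 the action, supplies $\widetilde g_t$ (its $\widetilde f$) and is updated. Let $U_t=\min_{\tau\in[t_n,t]}\widetilde g_\tau$. After round $t$, MASTER restarts at round $t+1$ with $n=0$ if (Test 1) some order-$m$ instance with interval $[b,t]$ ends at $t$ and $2^{-m}\sum_{\tau=b}^tR_\tau\ge U_t+9\widehat\rho(2^m)$, or (Test 2) $\frac1{t-t_n+1}\sum_{\tau=t_n}^t(\widetilde g_\tau-R_\tau)\ge3\widehat\rho(t-t_n+1)$. **Theorem.** All constants below are universal, except that $C_b$ depends only on $b$. (a) For every $b>0$ there is $C_b$ such that, when FALCON is run alone and $t\in[1,T]$ satisfies $(\Delta_0)_{[1,t]}\le b\,\rho_0(t)$, with probability at least $1-\delta/T$, $$\sum_{\tau=1}^{t-1}\mathbb E_{x\sim\mathcal D_\tau,\,a\sim p_\tau(\cdot|x)}\big[(\widehat\phi_t(x,a)-\phi^\star_\tau(x,a))^2\big]\le C_b\,\Lambda .$$ (b) For every $b>0$ there is $C_b$ such that, if $(\Delta_0)_{[1,t]}\le b\,\rho_0(t)$, then for all observations and every measurable $\pi:\mathcal X\to\mathcal A$, $$\max_{\tau\in[1,t]}\mathbb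 E_{x\sim\mathcal D_\tau}\Big[\frac1{p_\tau(\pi(x)|x)}\Big]\le C_bA+\max_{\tau\in[1,t-1]}\gamma_{\tau+1}\widehat{\mathrm{Reg}}_{[1,\tau]}(\pi),$$ where $\widehat{\mathrm{Reg}}_{[1,\tau]}(\pi)=\frac1\tau\sum_{s=1}^\tau\mathbb E_{x\sim\mathcal D_s}[\widehat\phi_{\tau+1}(x,\pi_{\widehat\phi_{\tau+1}}(x))-\widehat\phi_{\tau+1}(x,\pi(x))]$ and the maximum over the empty set is $0$. Moreover there are universal $c,K,C>0$ and $k\in\mathbb N$ such that: (c) FALCON with constant $c$, run alone, satisfies Assumption 1 with $\Delta(t)=K\Delta_0(t)$ and $\rho(t)=K\rho_0(t)$, i.e. $C(t)=K\sqrt{At\Lambda}$. The same holds if in $\widetilde f_t$ the average over observed contexts is replaced by $\frac1{t-1}\sum_{\tau<t}\mathbb E_{x\sim\mathcal D_\tau}[\widehat\phi_t(x,\pi_{\widehat\phi_t}(x))]$. If $|\Phi|\ge2$, then for all $t\in[1,T]$, $C(t)\le C\sqrt{\log(T/\delta)}\,\big(\sqrt{At\log|\Phi|}+A\log|\Phi|\big)$.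 (d) MASTER with base algorithm FALCON (constant $c$) and rate $\rho=K\rho_0$, which uses no knowledge of $L$, $\Delta_0$, $(\mathcal D_t)$ or $(\phi_t^\star)$, satisfies with probability at least $1-\delta$ $$\text{D-Reg}\le C\,\log(T/\delta)^k\,\min\Big\{\sqrt{A\Lambda\,LT},\ (A\Lambda\,\Delta_0)^{1/3}T^{2/3}+\sqrt{A\Lambda\,T}\Big\}.$$ -/

import Mathlib

open MeasureTheory ProbabilityTheory

namespace RealizableBandit

/-- What the learner of a realizable contextual bandit problem is given: a finite class of
regressors with values in `[0,1]`, indexed by `ι`, tie-breaking rules used whenever an `argmax`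
over actions or an `argmin` over regressors is taken (any rule choosing from the set of optimal
elements is allowed), the number of rounds `T` and the confidence parameter `δ`. -/
structure Setup (X A ι : Type*) [MeasurableSpace X] where
  reg : ι → X → A → ℝ
  reg_mem : ∀ i x a, reg i x a ∈ Set.Icc (0 : ℝ) 1
  reg_meas : ∀ i a, Measurable fun x => reg i x a
  pickAct : Finset A → A
  pickAct_mem : ∀ s : Finset A, s.Nonempty → pickAct s ∈ s
  pickReg : Finset ι → ι
  pickReg_mem : ∀ s : Finset ι, s.Nonempty → pickReg s ∈ s
  T : ℕ
  two_le_T : 2 ≤ T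
  δ : ℝ
  δ_pos : 0 < δ
  δ_lt_one : δ < 1

/-- The environment, fixed ahead of time and unknown to the learner: the context distribution
`D t` and (the index of) the true regressor `star t` of every round `t`. Rounds are `1, …, T`. -/
structure World (X ι : Type*) [MeasurableSpace X] where
  D : ℕ → Measure X
  D_prob : ∀ t, IsProbabilityMeasure (D t)
  star : ℕ → ι

attribute [instance] World.D_prob

/-- What is observed in one round: context, action, reward. -/
abbrev Obs (X A : Type*) := X × A × ℝ

/-- A base algorithm. From the list of its own past observations it determines the distribution
of the next action for every context, and the auxiliary optimistic quantity of the next round. -/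
structure BaseAlg (X A : Type*) where
  prob : List (Obs X A) → X → A → ℝ
  opt : List (Obs X A) → ℝ

section Falcon

variable {X A ι : Type*} [MeasurableSpace X] [Fintype A] [Fintype ι]

/-- The number of actions, as a real number. -/
noncomputable def Setup.numA (_S : Setup X A ι) : ℝ := (Fintype.card A : ℝ)

/-- `log (|Φ| T / δ)`. -/
noncomputable def Setup.logTerm (S : Setup X A ι) : ℝ :=
  Real.log ((Fintype.card ι : ℝ) * (S.T : ℝ) / S.δ)

/-- `√(A log (|Φ| T / δ) / t)`. -/
noncomputable def Setup.rho (S : Setup X A ι) (t : ℕ) : ℝ :=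
  √(S.numA * S.logTerm / (t : ℝ))

/-- The exploration parameter `γ_t = √(A t / log (|Φ| T / δ))`. -/
noncomputable def Setup.gam (S : Setup X A ι) (t : ℕ) : ℝ :=
  √(S.numA * (t : ℝ) / S.logTerm)

open Classical in
/-- The policy `π_φ(x) = argmax_a φ(x, a)`. -/
noncomputable def Setup.greedy (S : Setup X A ι) (i : ι) (x : X) : A :=
  S.pickAct (Finset.univ.filter fun a => ∀ b, S.reg i x b ≤ S.reg i x a)

/-- Squared loss of a regressor on past observations. -/
noncomputable def Setup.sqLoss (S : Setup X A ι) (h : List (Obs X A)) (i : ι) : ℝ :=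
  (h.map fun o => (S.reg i o.1 o.2.1 - o.2.2) ^ 2).sum

open Classical in
/-- The regression oracle: a least-squares regressor for the past observations. -/
noncomputable def Setup.oracle (S : Setup X A ι) (h : List (Obs X A)) : ι :=
  S.pickReg (Finset.univ.filter fun i => ∀ j, S.sqLoss h i ≤ S.sqLoss h j)

/-- `φ(x, π_φ(x)) - φ(x, a)`. -/
noncomputable def Setup.gap (S : Setup X A ι) (i : ι) (x : X) (a : A) : ℝ :=
  S.reg i x (S.greedy i x) - S.reg i x a

/-- Inverse gap weighting with parameter `g`, for the actions other than the greedy one. -/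
noncomputable def Setup.igw (S : Setup X A ι) (g : ℝ) (i : ι) (x : X) (a : A) : ℝ :=
  1 / (S.numA + g * S.gap i x a)

open Classical in
/-- The action distribution of FALCON after the observations `h`, i.e. in its round
`t = h.length + 1`, with the regression oracle called in every round. -/
noncomputable def Setup.falconProb (S : Setup X A ι) (h : List (Obs X A)) (x : X) (a : A) : ℝ :=
  if a = S.greedy (S.oracle h) x then
    1 - ∑ b ∈ Finset.univ.erase (S.greedy (S.oracle h) x),
      S.igw (S.gam (h.length + 1)) (S.oracle h) x b
  else S.igw (S.gam (h.length + 1)) (S.oracle h) x a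

/-- FALCON's optimistic quantity: the average over its past contexts of the predicted value of the
greedy policy of the current regressor, plus a bonus, capped at `1`. -/
noncomputable def Setup.falconOpt (S : Setup X A ι) (c : ℝ) (h : List (Obs X A)) : ℝ :=
  min 1 ((h.map fun o => S.reg (S.oracle h) o.1 (S.greedy (S.oracle h) o.1)).sum
    / (h.length : ℝ) + c * S.rho (h.length + 1))

/-- FALCON as a base algorithm; `c` is the constant of the bonus. -/
noncomputable def Setup.falcon (S : Setup X A ι) (c : ℝ) : BaseAlg X A where
  prob := S.falconProb
  opt := S.falconOpt c

end Falcon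

section Environment

variable {X A ι : Type*} [MeasurableSpace X] [Fintype A] [Fintype ι]

/-- `f_t(π) = E_{x ∼ D_t} [φ*_t(x, π(x))]`. -/
noncomputable def value (S : Setup X A ι) (W : World X ι) (t : ℕ) (π : X → A) : ℝ :=
  ∫ x, S.reg (W.star t) x (π x) ∂(W.D t)

/-- `f*_t`, the maximum of `f_t` over the policies `π_φ`, `φ ∈ Φ`. -/
noncomputable def bestValue (S : Setup X A ι) (W : World X ι) (t : ℕ) : ℝ :=
  ⨆ i : ι, value S W t (S.greedy i)

/-- `∫ |D_t(x) - D_{t+1}(x)| dx`, the total mass of the total variation of `D_t - D_{t+1}`. -/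
noncomputable def contextDrift (W : World X ι) (t : ℕ) : ℝ :=
  (((W.D t).toSignedMeasure - (W.D (t + 1)).toSignedMeasure).totalVariation Set.univ).toReal

/-- `√A max_{x,a} |φ*_t(x,a) - φ*_{t+1}(x,a)| + ∫ |D_t(x) - D_{t+1}(x)| dx`. -/
noncomputable def drift (S : Setup X A ι) (W : World X ι) (t : ℕ) : ℝ :=
  √S.numA * (⨆ q : X × A, |S.reg (W.star t) q.1 q.2 - S.reg (W.star (t + 1)) q.1 q.2|)
    + contextDrift W t

/-- `Δ_{[s,e]} = ∑_{τ=s}^{e-1} Δ(τ)`. -/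
def total (Δ : ℕ → ℝ) (s e : ℕ) : ℝ := ∑ τ ∈ Finset.Ico s e, Δ τ

open Classical in
/-- `L_{[s,e]} = 1 + ∑_{τ=s}^{e-1} 1[Δ(τ) ≠ 0]`. -/
noncomputable def changes (Δ : ℕ → ℝ) (s e : ℕ) : ℝ :=
  1 + (((Finset.Ico s e).filter fun τ => Δ τ ≠ 0).card : ℝ)

end Environment

section Interaction

variable {X A ι Ω Ξ : Type*} [MeasurableSpace X] [MeasurableSpace A] [Fintype A] [Fintype ι]
  [MeasurableSpace Ω] [MeasurableSpace Ξ]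

/-- The observations of rounds `1, …, t - 1` in order. -/
def history (obs : ℕ → Obs X A) (t : ℕ) : List (Obs X A) := (List.range' 1 (t - 1)).map obs

/-- The information generated by the observations of rounds `1, …, t - 1`. -/
abbrev obsInfo (obs : ℕ → Ω → Obs X A) (t : ℕ) : MeasurableSpace Ω :=
  ⨆ s ∈ Finset.Ico 1 t, MeasurableSpace.comap (obs s) inferInstance

/-- The information generated by the learner's internal random seeds of rounds `1, …, t - 1`. -/
abbrev seedInfo (seed : ℕ → Ω → Ξ) (t : ℕ) : MeasurableSpace Ω :=
  ⨆ s ∈ Finset.Ico 1 t, MeasurableSpace.comap (seed s) inferInstance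

/-- The information before the context of round `t` is revealed: earlier observations and the seeds
up to and including that of round `t`. -/
abbrev preInfo (seed : ℕ → Ω → Ξ) (obs : ℕ → Ω → Obs X A) (t : ℕ) : MeasurableSpace Ω :=
  obsInfo obs t ⊔ seedInfo seed (t + 1)

/-- `obs` is the process of observations when a learner, playing the distribution `p t ω x` over
actions in round `t` on context `x`, interacts with the environment for `T` rounds: the context
`x_t` is drawn from `D_t` independently of the past, then the action from `p t ω x_t`,
and the reward in `[0,1]` has conditional mean `φ*_t(x_t, a_t)`. -/
structure IsRun (S : Setup X A ι) (W : World X ι) (P : Measure Ω) (seed : ℕ → Ω → Ξ)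
    (obs : ℕ → Ω → Obs X A) (p : ℕ → Ω → X → A → ℝ) : Prop where
  seed_meas : ∀ t, Measurable (seed t)
  obs_meas : ∀ t, Measurable (obs t)
  reward_mem : ∀ t ω, (obs t ω).2.2 ∈ Set.Icc (0 : ℝ) 1
  context_law : ∀ t ∈ Finset.Icc 1 S.T, P.map (fun ω => (obs t ω).1) = W.D t
  context_indep : ∀ t ∈ Finset.Icc 1 S.T,
    Indep (MeasurableSpace.comap (fun ω => (obs t ω).1) inferInstance) (preInfo seed obs t) P
  action_law : ∀ t ∈ Finset.Icc 1 S.T, ∀ b : A,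
    P[Set.indicator {ω | (obs t ω).2.1 = b} (fun _ => (1 : ℝ)) |
      preInfo seed obs t ⊔ MeasurableSpace.comap (fun ω => (obs t ω).1) inferInstance]
      =ᵐ[P] fun ω => p t ω (obs t ω).1 b
  reward_mean : ∀ t ∈ Finset.Icc 1 S.T,
    P[fun ω => (obs t ω).2.2 |
      preInfo seed obs t ⊔
        MeasurableSpace.comap (fun ω => ((obs t ω).1, (obs t ω).2.1)) inferInstance]
      =ᵐ[P] fun ω => S.reg (W.star t) (obs t ω).1 (obs t ω).2.1

/-- A base algorithm is run alone for `T` rounds. It uses no randomness besides the sampling of its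
actions, so the seeds are trivial. -/
def IsAloneRun (S : Setup X A ι) (W : World X ι) (B : BaseAlg X A) (P : Measure Ω)
    (obs : ℕ → Ω → Obs X A) : Prop :=
  IsRun S W P (fun _ _ => PUnit.unit.{1}) obs
    (fun t ω => B.prob (history (fun s => obs s ω) t))

/-- The requirement on a base algorithm, for a given non-stationarity measure `Δ`, rate `ρ`,
auxiliary process `ft` and observation process `obs` of a run of the algorithm. -/
structure Assumption1 (S : Setup X A ι) (W : World X ι) (P : Measure Ω)
    (obs : ℕ → Ω → Obs X A) (ft : ℕ → Ω → ℝ) (Δ ρ : ℕ → ℝ) : Prop where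
  measure : ∀ t, 1 ≤ t → t < S.T →
    ∀ i : ι, |value S W t (S.greedy i) - value S W (t + 1) (S.greedy i)| ≤ Δ t
  rate_antitone : ∀ s t, 1 ≤ s → s ≤ t → t ≤ S.T → ρ t ≤ ρ s
  rate_lower : ∀ t ∈ Finset.Icc 1 S.T, 1 / √(t : ℝ) ≤ ρ t
  cumulative_monotone : ∀ s t : ℕ, 1 ≤ s → s ≤ t → t ≤ S.T → (s : ℝ) * ρ s ≤ (t : ℝ) * ρ t
  aux_mem : ∀ t ∈ Finset.Icc 1 S.T, ∀ ω, ft t ω ∈ Set.Icc (0 : ℝ) 1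
  guarantee : ∀ t ∈ Finset.Icc 1 S.T, total Δ 1 t ≤ ρ t →
    1 - S.δ / (S.T : ℝ) ≤ P.real {ω |
      (⨅ τ : Finset.Icc 1 t, bestValue S W (τ : ℕ)) - total Δ 1 t ≤ ft t ω ∧
      (∑ τ ∈ Finset.Icc 1 t, (ft τ ω - (obs τ ω).2.2)) / (t : ℝ) ≤ ρ t + total Δ 1 t}

end Interaction

section FalconQuantities

variable {X A ι : Type*} [MeasurableSpace X] [Fintype A] [Fintype ι]

/-- The regressor `φ̂_t` that FALCON, run alone, computes in round `t`. -/
noncomputable def regAt (S : Setup X A ι) (obs : ℕ → Obs X A) (t : ℕ) : ι :=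
  S.oracle (history obs t)

/-- `∑_{τ=1}^{t-1} E_{x ∼ D_τ, a ∼ p_τ(·|x)} [(φ̂_t(x,a) - φ*_τ(x,a))²]`. -/
noncomputable def regressionError (S : Setup X A ι) (W : World X ι) (obs : ℕ → Obs X A)
    (t : ℕ) : ℝ :=
  ∑ τ ∈ Finset.Ico 1 t, ∫ x, ∑ a, S.falconProb (history obs τ) x a *
    (S.reg (regAt S obs t) x a - S.reg (W.star τ) x a) ^ 2 ∂(W.D τ)

/-- The predicted average reward over rounds `1, …, t`,
`(1/t) ∑_{s=1}^{t} E_{x ∼ D_s} [φ̂_{t+1}(x, π(x))]`. -/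
noncomputable def predValue (S : Setup X A ι) (W : World X ι) (obs : ℕ → Obs X A)
    (t : ℕ) (π : X → A) : ℝ :=
  (∑ s ∈ Finset.Icc 1 t, ∫ x, S.reg (regAt S obs (t + 1)) x (π x) ∂(W.D s)) / (t : ℝ)

/-- The predicted average regret of `π` over rounds `1, …, t`. -/
noncomputable def predRegret (S : Setup X A ι) (W : World X ι) (obs : ℕ → Obs X A)
    (t : ℕ) (π : X → A) : ℝ :=
  predValue S W obs t (S.greedy (regAt S obs (t + 1))) - predValue S W obs t π

/-- `V_t(p_t, π) = E_{x ∼ D_t} [1 / p_t(π(x)|x)]`. -/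
noncomputable def invProb (S : Setup X A ι) (W : World X ι) (obs : ℕ → Obs X A)
    (t : ℕ) (π : X → A) : ℝ :=
  ∫ x, 1 / S.falconProb (history obs t) x (π x) ∂(W.D t)

/-- `max_{τ ∈ [1,t]} V_τ(p_τ, π)`. -/
noncomputable def maxInvProb (S : Setup X A ι) (W : World X ι) (obs : ℕ → Obs X A)
    (t : ℕ) (π : X → A) : ℝ :=
  ⨆ τ : Finset.Icc 1 t, invProb S W obs (τ : ℕ) π

/-- The variant of FALCON's optimistic quantity in which the average over past contexts is replaced
by its expectation under the (unknown) past context distributions. -/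
noncomputable def popOpt (S : Setup X A ι) (W : World X ι) (c : ℝ) (obs : ℕ → Obs X A)
    (t : ℕ) : ℝ :=
  min 1 (predValue S W obs (t - 1) (S.greedy (regAt S obs t)) + c * S.rho t)

end FalconQuantities

/-! ### The black-box reduction

All definitions are for a fixed realization: `u t m` is the uniform random number that decides
whether an order-`m` instance is scheduled to start in round `t`, and `obs t` is the observation
of round `t`. A block is given by its first round `s` and its order `n` (length `2 ^ n`). Since
every round lies in exactly one block, every `u t m` is used at most once. -/

section Master

variable {X A : Type*}

/-- In the block `(s, n)` an order-`m` instance is scheduled to start in round `t`. -/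
def Scheduled (ρ : ℕ → ℝ) (u : ℕ → ℕ → ℝ) (s n m t : ℕ) : Prop :=
  m ≤ n ∧ 2 ^ m ∣ t - s ∧ u t m ≤ ρ (2 ^ n) / ρ (2 ^ m)

/-- First round of the length-`2 ^ m` sub-interval of a block starting at `s` that contains `t`. -/
def subStart (s m t : ℕ) : ℕ := s + 2 ^ m * ((t - s) / 2 ^ m)

/-- The order of the active instance in round `t`: the shortest scheduled instance covering `t`. -/
noncomputable def activeOrder (ρ : ℕ → ℝ) (u : ℕ → ℕ → ℝ) (s n t : ℕ) : ℕ :=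
  sInf {m | Scheduled ρ u s n m (subStart s m t)}

/-- The active instance in round `t`, identified by its order and its first round. -/
noncomputable def activeInst (ρ : ℕ → ℝ) (u : ℕ → ℕ → ℝ) (s n t : ℕ) : ℕ × ℕ :=
  (activeOrder ρ u s n t, subStart s (activeOrder ρ u s n t) t)

open Classical in
/-- The observations made so far by the instance active in round `t`: those of the earlier rounds
of the block in which the same instance was active. -/
noncomputable def instHistory (ρ : ℕ → ℝ) (u : ℕ → ℕ → ℝ) (obs : ℕ → Obs X A)
    (s n t : ℕ) : List (Obs X A) :=
  ((List.range' s (t - s)).filter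
    fun τ => activeInst ρ u s n τ = activeInst ρ u s n t).map obs

/-- The scalar `g̃_t`, i.e. the optimistic quantity of the active instance. -/
noncomputable def multiOpt (B : BaseAlg X A) (ρ : ℕ → ℝ) (u : ℕ → ℕ → ℝ)
    (obs : ℕ → Obs X A) (s n t : ℕ) : ℝ :=
  B.opt (instHistory ρ u obs s n t)

/-- `ρ̂(t) = 6 (log₂ T + 1) log(T/δ) ρ(t)`. -/
noncomputable def rateHat (T : ℕ) (δ : ℝ) (ρ : ℕ → ℝ) (t : ℕ) : ℝ :=
  6 * (Real.logb 2 (T : ℝ) + 1) * Real.log ((T : ℝ) / δ) * ρ t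

/-- Test 1 fails at the end of round `t`: some order-`m` instance ends in round `t`, and the average
reward over its interval is at least `U_t + 9 ρ̂(2 ^ m)`, where `U_t = min_{τ ∈ [s,t]} g̃_τ`. -/
def Test1Fails (B : BaseAlg X A) (T : ℕ) (δ : ℝ) (ρ : ℕ → ℝ) (u : ℕ → ℕ → ℝ)
    (obs : ℕ → Obs X A) (s n t : ℕ) : Prop :=
  ∃ m b : ℕ, s ≤ b ∧ b + 2 ^ m = t + 1 ∧ Scheduled ρ u s n m b ∧
    (⨅ τ : Finset.Icc s t, multiOpt B ρ u obs s n (τ : ℕ)) + 9 * rateHat T δ ρ (2 ^ m) ≤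
      (∑ τ ∈ Finset.Icc b t, (obs τ).2.2) / (2 : ℝ) ^ m

/-- Test 2 fails at the end of round `t`. -/
def Test2Fails (B : BaseAlg X A) (T : ℕ) (δ : ℝ) (ρ : ℕ → ℝ) (u : ℕ → ℕ → ℝ)
    (obs : ℕ → Obs X A) (s n t : ℕ) : Prop :=
  3 * rateHat T δ ρ (t - s + 1) ≤
    (∑ τ ∈ Finset.Icc s t, (multiOpt B ρ u obs s n τ - (obs τ).2.2)) / ((t - s + 1 : ℕ) : ℝ)

open Classical in
/-- The block (first round, order) containing round `t`, for `t ≥ 1`. After a failed test the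
reduction restarts with a block of order `0`; a block that reaches its full length is followed by a
block of the next order. -/
noncomputable def blockAt (B : BaseAlg X A) (T : ℕ) (δ : ℝ) (ρ : ℕ → ℝ) (u : ℕ → ℕ → ℝ)
    (obs : ℕ → Obs X A) : ℕ → ℕ × ℕ
  | 0 => (1, 0)
  | 1 => (1, 0)
  | t + 2 =>
    let blk := blockAt B T δ ρ u obs (t + 1)
    if Test1Fails B T δ ρ u obs blk.1 blk.2 (t + 1) ∨
        Test2Fails B T δ ρ u obs blk.1 blk.2 (t + 1) then (t + 2, 0)
    else if t + 2 = blk.1 + 2 ^ blk.2 then (t + 2, blk.2 + 1)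
    else blk

/-- The action distribution that the reduction plays in round `t`. -/
noncomputable def masterProb (B : BaseAlg X A) (T : ℕ) (δ : ℝ) (ρ : ℕ → ℝ) (u : ℕ → ℕ → ℝ)
    (obs : ℕ → Obs X A) (t : ℕ) : X → A → ℝ :=
  B.prob (instHistory ρ u obs (blockAt B T δ ρ u obs t).1 (blockAt B T δ ρ u obs t).2 t)

end Master

section MasterRun

variable {X A ι Ω : Type*} [MeasurableSpace X] [MeasurableSpace A] [Fintype A] [Fintype ι]
  [MeasurableSpace Ω]

/-- The reduction with base algorithm `B` and rate `ρ` is run for `T` rounds: the scheduling numbers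
`u t m` are independent and uniform on `[0,1]`, those of round `t` being independent of
everything that happened before. -/
structure IsMasterRun (S : Setup X A ι) (W : World X ι) (B : BaseAlg X A) (ρ : ℕ → ℝ)
    (P : Measure Ω) (u : ℕ → Ω → ℕ → ℝ) (obs : ℕ → Ω → Obs X A) : Prop where
  run : IsRun S W P u obs
    (fun t ω => masterProb B S.T S.δ ρ (fun s => u s ω) (fun s => obs s ω) t)
  uniform : ∀ t ∈ Finset.Icc 1 S.T, ∀ m,
    P.map (fun ω => u t ω m) = volume.restrict (Set.Icc (0 : ℝ) 1)
  indep_orders : ∀ t ∈ Finset.Icc 1 S.T, iIndepFun (fun m ω => u t ω m) P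
  indep_past : ∀ t ∈ Finset.Icc 1 S.T,
    Indep (MeasurableSpace.comap (u t) inferInstance) (obsInfo obs t ⊔ seedInfo u t) P

/-- The dynamic regret `∑_{t=1}^T (f*_t - R_t)`. -/
noncomputable def dynRegret (S : Setup X A ι) (W : World X ι) (obs : ℕ → Obs X A) : ℝ :=
  ∑ t ∈ Finset.Icc 1 S.T, (bestValue S W t - (obs t).2.2)

end MasterRun

end RealizableBandit

set_option linter.unusedSectionVars false
set_option linter.unusedVariables false
set_option linter.style.haveILetI false

/-! Everything rests on one deterministic analysis of FALCON along an arbitrary, predictably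
selected set of rounds, valid whenever losses, predictions and rewards are concentrated
(`Concentrated`) and the drift since a base round is below the rate at the instance's own clock
(`NearStationary`). Selecting all rounds gives the statements about FALCON run alone. Selecting the
rounds in which one instance of MASTER is active gives the inputs for the regret bound, so (d) does
not go through Assumption 1.

Regression. By realizability the conditional mean of the excess squared loss of φ over φ*_τ is the
expected squared error, and its second moment is at most four times that. Freedman's inequality then
costs half the error plus O(Λ) (`IsRun.sqDiff_tail`). The least-squares regressor is compared with
the true regressor of the base round. The factor √A in the drift matches the A in ρ_0², so the
regressor drift contributes only O(Λ) (`sum_qErr_oracle_le`). This gives (a).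

Decisions. Inverse gap weighting has 1/p ≤ A + γ·gap, which yields (b) after moving contexts by the
drift. AM-GM converts squared error into value error at the price of 1/p, hence of the regrets
predicted by earlier regressors. Induction on the round closes the loop: predicted regret is at most
twice the true regret plus O(ρ) (`gapValue_oracle_le`). Consequently the optimistic quantity lies
between the optimum and the optimum plus O(ρ), and the played policy has regret O(ρ)
(`falconOpt_bounds`, `polRegret_falconProb_le`); summation gives (c).

MASTER. Each block is cut greedily into pieces whose drift stays below the rate. In a nearly
stationary stretch the optimistic quantities exceed the rewards by at most ρ̂ on average, because
order-m instances are rare enough that every scale costs the same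
(`MasterContext.sum_mopt_sub_reward_le`). So a test fails only in a block that contains a cut
(`MasterContext.rho_lt_total_of_fail`). Conversely, if an optimistic quantity is too small at scale
m, any order-m instance inside the rest of the piece would trigger Test 1. Its scheduling is
independent of the past, so in a surviving block few such starts are missed
(`MasterContext.card_gap_le`). Summing over dyadic scales bounds the regret of a block by √(AΛ)
times the sum of the square roots of its piece lengths and of its length, up to logarithms
(`MasterContext.blockRegret_le`).

Counting. Let V be the number of cuts. Every restart is paid for by a cut, so there are O(V+1)
blocks and pieces up to logarithms, and Cauchy-Schwarz gives √(AΛ(V+1)T). Each cut contains a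
change, so V+1 ≤ L. Each cut also consumes drift larger than the rate at its length, so AΛV³ ≤
2Δ_0²T by a Hölder argument (`card_cuts_cube_le`). -/

namespace RealizableBandit

/-! ### Rates, exploration parameter and inverse gap weighting -/

section Basics

variable {X A ι : Type*} [MeasurableSpace X] [Fintype A] [Fintype ι] (S : Setup X A ι)

theorem Setup.nonempty_act (S : Setup X A ι) : Nonempty A := ⟨S.pickAct ∅⟩

theorem Setup.nonempty_reg (S : Setup X A ι) : Nonempty ι := ⟨S.pickReg ∅⟩

theorem Setup.one_le_numA : 1 ≤ S.numA := by
  have := S.nonempty_act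
  unfold Setup.numA
  exact_mod_cast Fintype.card_pos

theorem Setup.numA_pos : 0 < S.numA := lt_of_lt_of_le one_pos S.one_le_numA

theorem Setup.two_le_T_real : (2 : ℝ) ≤ S.T := by exact_mod_cast S.two_le_T

theorem Setup.T_le_T_div : (S.T : ℝ) ≤ (S.T : ℝ) / S.δ := by
  rw [le_div_iff₀ S.δ_pos]
  have := S.two_le_T_real
  nlinarith [S.δ_lt_one]

theorem Setup.two_le_T_div : (2 : ℝ) ≤ (S.T : ℝ) / S.δ := S.two_le_T_real.trans S.T_le_T_div

theorem Setup.one_le_card_reg (S : Setup X A ι) : (1 : ℝ) ≤ Fintype.card ι := by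
  have := S.nonempty_reg
  exact_mod_cast Fintype.card_pos

theorem Setup.log_T_div_le_logTerm : Real.log ((S.T : ℝ) / S.δ) ≤ S.logTerm := by
  unfold Setup.logTerm
  have h2 := S.two_le_T_div
  rw [mul_div_assoc]
  exact Real.log_le_log (by linarith) (by nlinarith [S.one_le_card_reg])

theorem Setup.half_lt_log : (1 / 2 : ℝ) < Real.log ((S.T : ℝ) / S.δ) := by
  have h1 : Real.log 2 ≤ Real.log ((S.T : ℝ) / S.δ) :=
    Real.log_le_log (by norm_num) S.two_le_T_div
  linarith [Real.log_two_gt_d9]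

theorem Setup.half_lt_logTerm : (1 / 2 : ℝ) < S.logTerm :=
  S.half_lt_log.trans_le S.log_T_div_le_logTerm

theorem Setup.logTerm_pos : 0 < S.logTerm := by linarith [S.half_lt_logTerm]

theorem Setup.rho_nonneg (t : ℕ) : 0 ≤ S.rho t := Real.sqrt_nonneg _

theorem Setup.rho_pos {t : ℕ} (ht : 1 ≤ t) : 0 < S.rho t := by
  unfold Setup.rho
  have : (0 : ℝ) < t := by exact_mod_cast ht
  have := S.numA_pos
  have := S.logTerm_pos
  positivity

theorem Setup.rho_antitone {s t : ℕ} (hs : 1 ≤ s) (hst : s ≤ t) : S.rho t ≤ S.rho s := by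
  unfold Setup.rho
  have h0 : (0 : ℝ) < s := by exact_mod_cast hs
  have h1 : (s : ℝ) ≤ t := by exact_mod_cast hst
  have := S.numA_pos
  have := S.logTerm_pos
  gcongr

theorem Setup.mul_rho (t : ℕ) : (t : ℝ) * S.rho t = √(S.numA * S.logTerm * t) := by
  unfold Setup.rho
  rcases Nat.eq_zero_or_pos t with rfl | ht
  · simp
  have h0 : (0 : ℝ) < t := by exact_mod_cast ht
  have h1 := S.numA_pos
  have h2 := S.logTerm_pos
  rw [Real.sqrt_div (by positivity), Real.sqrt_mul (by positivity) (t : ℝ)]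
  have := Real.mul_self_sqrt h0.le
  field_simp
  nlinarith

theorem Setup.gam_pos {t : ℕ} (ht : 1 ≤ t) : 0 < S.gam t := by
  unfold Setup.gam
  have : (0 : ℝ) < t := by exact_mod_cast ht
  have := S.numA_pos
  have := S.logTerm_pos
  positivity

theorem Setup.gam_nonneg (t : ℕ) : 0 ≤ S.gam t := Real.sqrt_nonneg _

theorem Setup.gam_mono {s t : ℕ} (hst : s ≤ t) : S.gam s ≤ S.gam t := by
  unfold Setup.gam
  have h1 : (s : ℝ) ≤ t := by exact_mod_cast hst
  have := S.numA_pos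
  have := S.logTerm_pos
  gcongr

/-- γ is tuned so that A/γ, the cost of exploration per round, equals the rate. -/
theorem Setup.gam_mul_rho {t : ℕ} (ht : 1 ≤ t) : S.gam t * S.rho t = S.numA := by
  unfold Setup.gam Setup.rho
  have h0 : (0 : ℝ) < t := by exact_mod_cast ht
  have h1 := S.numA_pos
  have h2 := S.logTerm_pos
  rw [← Real.sqrt_mul (by positivity)]
  rw [show S.numA * t / S.logTerm * (S.numA * S.logTerm / t) = S.numA ^ 2 by field_simp]
  exact Real.sqrt_sq h1.le

/-- The other half of the balance: a total regression error of order Λ, averaged over t rounds and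
weighted by γ, is again of the size of the rate. -/
theorem Setup.gam_mul_logTerm_div {t : ℕ} (ht : 1 ≤ t) :
    S.gam t * S.logTerm / t = S.rho t := by
  have h0 : (0 : ℝ) < t := by exact_mod_cast ht
  have h1 := S.numA_pos
  have h2 := S.logTerm_pos
  have h3 : S.rho t ^ 2 = S.numA * S.logTerm / t := by
    unfold Setup.rho
    rw [Real.sq_sqrt (by positivity)]
  have h4 := S.gam_mul_rho ht
  have h5 := S.rho_pos ht
  have h6 : S.gam t = S.numA / S.rho t := by rw [← h4]; field_simp
  rw [h6]
  rw [div_mul_eq_mul_div, div_div, div_eq_iff (by positivity)]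
  have : S.rho t * (S.rho t * t) = S.rho t ^ 2 * t := by ring
  rw [this, h3]
  field_simp

/-- Since AΛ > 1/2. Values lie in [0,1], so every bound by a large multiple of the rate is trivial
for an instance without observations. -/
theorem Setup.half_le_rho_one : (1 / 2 : ℝ) ≤ S.rho 1 := by
  unfold Setup.rho
  apply Real.le_sqrt_of_sq_le
  have := S.half_lt_logTerm
  have := S.one_le_numA
  norm_num
  nlinarith

theorem Setup.half_div_sqrt_le_rho {t : ℕ} (ht : 1 ≤ t) : 1 / 2 / √(t : ℝ) ≤ S.rho t := by
  unfold Setup.rho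
  have h0 : (0 : ℝ) < t := by exact_mod_cast ht
  apply Real.le_sqrt_of_sq_le
  rw [div_pow, Real.sq_sqrt h0.le]
  have := S.half_lt_logTerm
  have := S.one_le_numA
  gcongr
  nlinarith

theorem Setup.greedy_spec (i : ι) (x : X) (b : A) :
    S.reg i x b ≤ S.reg i x (S.greedy i x) := by
  classical
  have := S.nonempty_act
  obtain ⟨a, ha⟩ := Finite.exists_max (S.reg i x)
  have h := S.pickAct_mem (Finset.univ.filter fun a => ∀ b, S.reg i x b ≤ S.reg i x a)
    ⟨a, by simpa using ha⟩
  have h2 := (Finset.mem_filter.1 h).2 b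
  unfold Setup.greedy
  convert h2

theorem Setup.oracle_spec (h : List (Obs X A)) (j : ι) :
    S.sqLoss h (S.oracle h) ≤ S.sqLoss h j := by
  classical
  have := S.nonempty_reg
  obtain ⟨a, ha⟩ := Finite.exists_min (S.sqLoss h)
  have h1 := S.pickReg_mem (Finset.univ.filter fun i => ∀ j, S.sqLoss h i ≤ S.sqLoss h j)
    ⟨a, by simpa using ha⟩
  have h2 := (Finset.mem_filter.1 h1).2 j
  unfold Setup.oracle
  convert h2

theorem Setup.reg_nonneg (i : ι) (x : X) (a : A) : 0 ≤ S.reg i x a := (S.reg_mem i x a).1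

theorem Setup.reg_le_one (i : ι) (x : X) (a : A) : S.reg i x a ≤ 1 := (S.reg_mem i x a).2

theorem Setup.gap_nonneg (i : ι) (x : X) (a : A) : 0 ≤ S.gap i x a :=
  sub_nonneg.2 (S.greedy_spec i x a)

theorem Setup.gap_le_one (i : ι) (x : X) (a : A) : S.gap i x a ≤ 1 := by
  unfold Setup.gap
  linarith [S.reg_nonneg i x a, S.reg_le_one i x (S.greedy i x)]

theorem Setup.gap_greedy (i : ι) (x : X) : S.gap i x (S.greedy i x) = 0 := sub_self _

open Classical in
/-- Inverse gap weighting with parameter `g` for the regressor `i`. -/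
noncomputable def Setup.igwProb (g : ℝ) (i : ι) (x : X) (a : A) : ℝ :=
  if a = S.greedy i x then
    1 - ∑ b ∈ Finset.univ.erase (S.greedy i x), S.igw g i x b
  else S.igw g i x a

/-- The past matters only through a regressor and a number of observations, that is, through a
countable index; the conditional laws are later computed by splitting on it. -/
theorem Setup.falconProb_eq (h : List (Obs X A)) :
    S.falconProb h = S.igwProb (S.gam (h.length + 1)) (S.oracle h) := rfl

variable {S}

theorem igw_pos {g : ℝ} (hg : 0 ≤ g) (i : ι) (x : X) (a : A) : 0 < S.igw g i x a := by
  unfold Setup.igw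
  have := S.numA_pos
  have := S.gap_nonneg i x a
  positivity

theorem igw_le {g : ℝ} (hg : 0 ≤ g) (i : ι) (x : X) (a : A) : S.igw g i x a ≤ 1 / S.numA := by
  unfold Setup.igw
  have := S.numA_pos
  have := S.gap_nonneg i x a
  gcongr
  nlinarith [mul_nonneg hg this]

theorem igwProb_of_ne {g : ℝ} {i : ι} {x : X} {a : A} (h : a ≠ S.greedy i x) :
    S.igwProb g i x a = S.igw g i x a := if_neg h

/-- Each of the other A - 1 actions receives at most 1/A. -/
theorem one_div_numA_le_igwProb_greedy {g : ℝ} (hg : 0 ≤ g) (i : ι) (x : X) :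
    1 / S.numA ≤ S.igwProb g i x (S.greedy i x) := by
  classical
  have h : S.igwProb g i x (S.greedy i x) =
      1 - ∑ b ∈ Finset.univ.erase (S.greedy i x), S.igw g i x b := by
    unfold Setup.igwProb
    rw [if_pos rfl]
  rw [h]
  have h1 : ∑ b ∈ Finset.univ.erase (S.greedy i x), S.igw g i x b ≤
      ∑ b ∈ Finset.univ.erase (S.greedy i x), 1 / S.numA :=
    Finset.sum_le_sum fun b _ => igw_le hg i x b
  have h2 : ∑ b ∈ Finset.univ.erase (S.greedy i x), 1 / S.numA + 1 / S.numA = 1 := by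
    rw [Finset.sum_erase_add _ _ (Finset.mem_univ (S.greedy i x))]
    have := S.numA_pos
    simp only [Finset.sum_const, Finset.card_univ, nsmul_eq_mul]
    unfold Setup.numA at *
    field_simp
  linarith

theorem igwProb_pos {g : ℝ} (hg : 0 ≤ g) (i : ι) (x : X) (a : A) : 0 < S.igwProb g i x a := by
  by_cases h : a = S.greedy i x
  · rw [h]
    have := S.numA_pos
    exact lt_of_lt_of_le (by positivity) (one_div_numA_le_igwProb_greedy hg i x)
  · rw [igwProb_of_ne h]
    exact igw_pos hg i x a

theorem sum_igwProb (g : ℝ) (i : ι) (x : X) : ∑ a, S.igwProb g i x a = 1 := by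
  classical
  rw [← Finset.sum_erase_add _ _ (Finset.mem_univ (S.greedy i x))]
  have h1 : ∑ a ∈ Finset.univ.erase (S.greedy i x), S.igwProb g i x a =
      ∑ a ∈ Finset.univ.erase (S.greedy i x), S.igw g i x a :=
    Finset.sum_congr rfl fun a ha => igwProb_of_ne (Finset.ne_of_mem_erase ha)
  have h : S.igwProb g i x (S.greedy i x) =
      1 - ∑ b ∈ Finset.univ.erase (S.greedy i x), S.igw g i x b := by
    unfold Setup.igwProb
    rw [if_pos rfl]
  rw [h1, h]
  ring

theorem igwProb_le_one {g : ℝ} (hg : 0 ≤ g) (i : ι) (x : X) (a : A) : S.igwProb g i x a ≤ 1 := by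
  rw [← sum_igwProb (S := S) g i x]
  exact Finset.single_le_sum (f := fun a => S.igwProb g i x a)
    (fun b _ => (igwProb_pos hg i x b).le) (Finset.mem_univ a)

theorem one_div_igwProb_le {g : ℝ} (hg : 0 ≤ g) (i : ι) (x : X) (a : A) :
    1 / S.igwProb g i x a ≤ S.numA + g * S.gap i x a := by
  by_cases h : a = S.greedy i x
  · rw [h, S.gap_greedy, mul_zero, add_zero]
    have := S.numA_pos
    rw [one_div_le (igwProb_pos hg i x _) this]
    exact one_div_numA_le_igwProb_greedy hg i x
  · rw [igwProb_of_ne h, Setup.igw, one_div_one_div]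

/-- Each action contributes at most gap/(A + g·gap) ≤ 1/g: the worse an action looks, the less mass
it gets. -/
theorem sum_igwProb_mul_gap_le {g : ℝ} (hg : 0 < g) (i : ι) (x : X) :
    ∑ a, S.igwProb g i x a * S.gap i x a ≤ S.numA / g := by
  have h : ∀ a ∈ (Finset.univ : Finset A), S.igwProb g i x a * S.gap i x a ≤ 1 / g := by
    intro a _
    by_cases h : a = S.greedy i x
    · rw [h, S.gap_greedy, mul_zero]
      positivity
    · rw [igwProb_of_ne h, Setup.igw, div_mul_eq_mul_div, one_mul]
      have := S.numA_pos
      have := S.gap_nonneg i x a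
      rw [div_le_div_iff₀ (by positivity) hg]
      nlinarith
  refine (Finset.sum_le_sum h).trans ?_
  simp only [Finset.sum_const, Finset.card_univ, nsmul_eq_mul, Setup.numA]
  rw [mul_one_div]

end Basics

/-! ### Measurability of greedy policies and of inverse gap weighting -/

section Measurability

variable {X A ι : Type*} [MeasurableSpace X] [Fintype A] [Fintype ι] {S : Setup X A ι}

/-- Meant for sets of optimizers. A tie-breaking rule is a function of that set, which has finitely
many values, so an arbitrary rule causes no measurability problem. -/
theorem measurable_finset_filter {α Y : Type*} [Fintype α] [MeasurableSpace Y]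
    (p : Y → α → Prop) [∀ y, DecidablePred (p y)] (hp : ∀ a, MeasurableSet {y | p y a})
    (s : Finset α) : MeasurableSet {y | Finset.univ.filter (p y) = s} := by
  have : {y | Finset.univ.filter (p y) = s} = ⋂ a, {y | p y a ↔ a ∈ s} := by
    ext y
    simp [Finset.ext_iff]
  rw [this]
  refine MeasurableSet.iInter fun a => ?_
  by_cases h : a ∈ s
  · simpa [h] using hp a
  · simp only [h, iff_false]
    exact (hp a).compl

theorem measurableSet_greedy_eq (i : ι) (a : A) : MeasurableSet {x | S.greedy i x = a} := by
  classical
  have : {x | S.greedy i x = a} = ⋃ s : Finset A, ⋃ _ : S.pickAct s = a,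
      {x | Finset.univ.filter (fun a => ∀ b, S.reg i x b ≤ S.reg i x a) = s} := by
    ext x
    simp only [Set.mem_ofPred_eq, Set.mem_iUnion, exists_prop]
    constructor
    · intro h
      refine ⟨_, ?_, rfl⟩
      rw [← h]
      unfold Setup.greedy
      congr!
    · rintro ⟨s, h1, h2⟩
      rw [← h1, ← h2]
      unfold Setup.greedy
      congr!
  rw [this]
  refine MeasurableSet.iUnion fun s => MeasurableSet.iUnion fun _ => ?_
  refine measurable_finset_filter _ (fun a => ?_) s
  have : {x | ∀ b, S.reg i x b ≤ S.reg i x a} = ⋂ b, {x | S.reg i x b ≤ S.reg i x a} := by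
    ext; simp
  rw [this]
  exact MeasurableSet.iInter fun b => measurableSet_le (S.reg_meas i b) (S.reg_meas i a)

theorem measurable_greedy [MeasurableSpace A] [MeasurableSingletonClass A] (i : ι) : Measurable (S.greedy i) :=
  measurable_to_countable' fun a => measurableSet_greedy_eq i a

theorem measurable_comp_act [MeasurableSpace A] [MeasurableSingletonClass A] {h : X → A → ℝ} (hh : ∀ a, Measurable fun x => h x a)
    {π : X → A} (hπ : Measurable π) : Measurable fun x => h x (π x) := by
  classical
  have : (fun x => h x (π x)) = fun x => ∑ a, if π x = a then h x a else 0 := by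
    ext x
    simp
  rw [this]
  refine Finset.measurable_sum _ fun a _ => ?_
  exact Measurable.ite (hπ (measurableSet_singleton a)) (hh a) measurable_const

theorem measurable_reg_greedy (i j : ι) : Measurable fun x => S.reg i x (S.greedy j x) := by
  letI : MeasurableSpace A := ⊤
  haveI : MeasurableSingletonClass A := ⟨fun _ => trivial⟩
  exact measurable_comp_act (fun a => S.reg_meas i a) (measurable_greedy j)

theorem measurable_gap (i : ι) (a : A) : Measurable fun x => S.gap i x a :=
  (measurable_reg_greedy i i).sub (S.reg_meas i a)

theorem measurable_igw (g : ℝ) (i : ι) (a : A) : Measurable fun x => S.igw g i x a :=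
  Measurable.div measurable_const ((measurable_gap i a).const_mul g |>.const_add _)

theorem measurable_igwProb (g : ℝ) (i : ι) (a : A) : Measurable fun x => S.igwProb g i x a := by
  classical
  have : (fun x => S.igwProb g i x a) = fun x => if S.greedy i x = a then
      1 - ∑ b, (if b = a then 0 else S.igw g i x b) else S.igw g i x a := by
    ext x
    by_cases h : S.greedy i x = a
    · rw [if_pos h, ← h]
      have h1 : S.igwProb g i x (S.greedy i x) =
          1 - ∑ b ∈ Finset.univ.erase (S.greedy i x), S.igw g i x b := by
        unfold Setup.igwProb
        rw [if_pos rfl]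
      rw [h1]
      congr 1
      rw [← Finset.sum_erase_add _ _ (Finset.mem_univ (S.greedy i x)), if_pos rfl, add_zero]
      exact Finset.sum_congr rfl fun b hb => (if_neg (Finset.ne_of_mem_erase hb)).symm
    · rw [if_neg h, igwProb_of_ne (Ne.symm h)]
  rw [this]
  refine Measurable.ite (measurableSet_greedy_eq i a) ?_ (measurable_igw g i a)
  refine measurable_const.sub (Finset.measurable_sum _ fun b _ => ?_)
  by_cases hb : b = a
  · simp [hb]
  · simpa [hb] using measurable_igw g i b

end Measurability

/-! ### Drift of the environment and values of randomized policies -/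

section Drift

variable {X A ι : Type*} [MeasurableSpace X] [Fintype A] [Fintype ι]

theorem integrable_of_mem_Icc {μ : Measure X} [IsFiniteMeasure μ] {g : X → ℝ} (hg : Measurable g)
    {c d : ℝ} (h : ∀ x, g x ∈ Set.Icc c d) : Integrable g μ :=
  Integrable.of_bound hg.aestronglyMeasurable (max |c| |d|)
    (Filter.Eventually.of_forall fun x => by
      rw [Real.norm_eq_abs]; exact abs_le_max_abs_abs (h x).1 (h x).2)

theorem integral_mem_Icc {μ : Measure X} [IsProbabilityMeasure μ] {g : X → ℝ} (hg : Measurable g)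
    {c d : ℝ} (h : ∀ x, g x ∈ Set.Icc c d) : ∫ x, g x ∂μ ∈ Set.Icc c d := by
  have hi := integrable_of_mem_Icc (μ := μ) hg h
  constructor
  · have := integral_mono (integrable_const c) hi (fun x => (h x).1)
    simpa using this
  · have := integral_mono hi (integrable_const d) (fun x => (h x).2)
    simpa using this

/-- The Jordan decomposition gives μ + n = ν + p with p, n the positive and negative parts. The
difference of integrals is therefore ∫g dp - ∫g dn, and both integrals lie between 0 and the
respective mass. -/
theorem abs_integral_sub_integral_le (μ ν : Measure X) [IsFiniteMeasure μ] [IsFiniteMeasure ν]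
    {g : X → ℝ} (hg : Measurable g) (h : ∀ x, g x ∈ Set.Icc (0 : ℝ) 1) :
    |∫ x, g x ∂μ - ∫ x, g x ∂ν| ≤
      ((μ.toSignedMeasure - ν.toSignedMeasure).totalVariation Set.univ).toReal := by
  set s := μ.toSignedMeasure - ν.toSignedMeasure with hs
  set p := s.toJordanDecomposition.posPart with hp
  set n := s.toJordanDecomposition.negPart with hn
  have h1 : p.toSignedMeasure - n.toSignedMeasure = s :=
    s.toSignedMeasure_toJordanDecomposition
  have h2 : μ + n = ν + p := by
    have : (μ + n).toSignedMeasure = (ν + p).toSignedMeasure := by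
      rw [Measure.toSignedMeasure_add, Measure.toSignedMeasure_add]
      have : μ.toSignedMeasure - ν.toSignedMeasure = p.toSignedMeasure - n.toSignedMeasure := by
        rw [h1]
      rw [sub_eq_sub_iff_add_eq_add] at this
      rw [this, add_comm]
    exact (Measure.toSignedMeasure_eq_toSignedMeasure_iff).1 this
  have hi : ∀ κ : Measure X, IsFiniteMeasure κ → Integrable g κ := fun κ _ =>
    integrable_of_mem_Icc hg h
  have h3 : ∫ x, g x ∂μ + ∫ x, g x ∂n = ∫ x, g x ∂ν + ∫ x, g x ∂p := by
    rw [← integral_add_measure (hi μ inferInstance) (hi n inferInstance),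
      ← integral_add_measure (hi ν inferInstance) (hi p inferInstance), h2]
  have hb : ∀ κ : Measure X, IsFiniteMeasure κ →
      0 ≤ ∫ x, g x ∂κ ∧ ∫ x, g x ∂κ ≤ (κ Set.univ).toReal := by
    intro κ _
    refine ⟨integral_nonneg fun x => (h x).1, ?_⟩
    have := integral_mono (hi κ inferInstance) (integrable_const (1 : ℝ)) (fun x => (h x).2)
    simpa [Measure.real] using this
  have h4 : (s.totalVariation Set.univ).toReal = (p Set.univ).toReal + (n Set.univ).toReal := by
    rw [SignedMeasure.totalVariation, Measure.add_apply,
      ENNReal.toReal_add (measure_ne_top _ _) (measure_ne_top _ _)]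
  rw [h4, abs_le]
  have hp' := hb p inferInstance
  have hn' := hb n inferInstance
  constructor <;> linarith

variable (S : Setup X A ι) (W : World X ι)

/-- The supremum distance of the regressors of rounds `t` and `t + 1`. -/
noncomputable def regDrift (t : ℕ) : ℝ :=
  ⨆ q : X × A, |S.reg (W.star t) q.1 q.2 - S.reg (W.star (t + 1)) q.1 q.2|

theorem drift_eq (t : ℕ) : drift S W t = √S.numA * regDrift S W t + contextDrift W t := rfl

theorem regDrift_nonneg (t : ℕ) : 0 ≤ regDrift S W t :=
  Real.iSup_nonneg fun _ => abs_nonneg _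

theorem contextDrift_nonneg (t : ℕ) : 0 ≤ contextDrift W t := ENNReal.toReal_nonneg

theorem drift_nonneg (t : ℕ) : 0 ≤ drift S W t := by
  rw [drift_eq]
  have := regDrift_nonneg S W t
  have := contextDrift_nonneg W t
  positivity

theorem abs_reg_sub_le_regDrift (t : ℕ) (x : X) (a : A) :
    |S.reg (W.star t) x a - S.reg (W.star (t + 1)) x a| ≤ regDrift S W t := by
  refine le_ciSup (f := fun q : X × A =>
    |S.reg (W.star t) q.1 q.2 - S.reg (W.star (t + 1)) q.1 q.2|) ⟨1, ?_⟩ (x, a)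
  rintro _ ⟨q, rfl⟩
  rw [abs_le]
  constructor <;> linarith [S.reg_nonneg (W.star t) q.1 q.2, S.reg_le_one (W.star t) q.1 q.2,
    S.reg_nonneg (W.star (t + 1)) q.1 q.2, S.reg_le_one (W.star (t + 1)) q.1 q.2]

theorem total_nonneg {Δ : ℕ → ℝ} (h : ∀ t, 0 ≤ Δ t) (s e : ℕ) : 0 ≤ total Δ s e :=
  Finset.sum_nonneg fun t _ => h t

theorem total_mono {Δ : ℕ → ℝ} (h : ∀ t, 0 ≤ Δ t) {s e s' e' : ℕ} (hs : s' ≤ s) (he : e ≤ e') :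
    total Δ s e ≤ total Δ s' e' :=
  Finset.sum_le_sum_of_subset_of_nonneg (Finset.Ico_subset_Ico hs he) fun t _ _ => h t

theorem total_const_mul (K : ℝ) (Δ : ℕ → ℝ) (s e : ℕ) :
    total (fun t => K * Δ t) s e = K * total Δ s e := (Finset.mul_sum _ _ _).symm

theorem total_drift_eq (s e : ℕ) : total (drift S W) s e =
    √S.numA * total (regDrift S W) s e + total (contextDrift W) s e := by
  simp only [total, drift_eq, Finset.sum_add_distrib, Finset.mul_sum]

theorem abs_sub_le_total {f Δ : ℕ → ℝ} (h : ∀ t, |f t - f (t + 1)| ≤ Δ t) {s e : ℕ}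
    (hse : s ≤ e) : |f s - f e| ≤ total Δ s e := by
  induction e, hse using Nat.le_induction with
  | base => simp [total]
  | succ e hse ih =>
    rw [total, Finset.sum_Ico_succ_top hse]
    calc |f s - f (e + 1)| ≤ |f s - f e| + |f e - f (e + 1)| := abs_sub_le _ _ _
      _ ≤ _ := add_le_add ih (h e)

theorem abs_reg_star_sub_le {s e : ℕ} (hse : s ≤ e) (x : X) (a : A) :
    |S.reg (W.star s) x a - S.reg (W.star e) x a| ≤ total (regDrift S W) s e :=
  abs_sub_le_total (f := fun t => S.reg (W.star t) x a)
    (fun t => abs_reg_sub_le_regDrift S W t x a) hse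

theorem abs_integral_sub_le {s e : ℕ} (hse : s ≤ e) {g : X → ℝ} (hg : Measurable g)
    (h : ∀ x, g x ∈ Set.Icc (0 : ℝ) 1) :
    |∫ x, g x ∂(W.D s) - ∫ x, g x ∂(W.D e)| ≤ total (contextDrift W) s e :=
  abs_sub_le_total (f := fun t => ∫ x, g x ∂(W.D t))
    (fun t => abs_integral_sub_integral_le _ _ hg h) hse

theorem sqrt_mul_total_regDrift_le (s e : ℕ) :
    √S.numA * total (regDrift S W) s e ≤ total (drift S W) s e := by
  rw [total_drift_eq]
  linarith [total_nonneg (contextDrift_nonneg W) s e]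

/-- Because √A ≥ 1, the drift dominates the unweighted sum of the two distances, which is what moves
the value of a fixed policy. -/
theorem total_regDrift_add_le (s e : ℕ) :
    total (regDrift S W) s e + total (contextDrift W) s e ≤ total (drift S W) s e := by
  rw [total_drift_eq]
  have h1 : 1 ≤ √S.numA := by rw [Real.one_le_sqrt]; exact S.one_le_numA
  nlinarith [total_nonneg (regDrift_nonneg S W) s e]

theorem total_contextDrift_le (s e : ℕ) :
    total (contextDrift W) s e ≤ total (drift S W) s e := by
  linarith [total_regDrift_add_le S W s e, total_nonneg (regDrift_nonneg S W) s e]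

/-- A randomized policy: `w x a` is the probability of playing `a` on the context `x`. -/
structure IsPolicy (w : X → A → ℝ) : Prop where
  meas : ∀ a, Measurable fun x => w x a
  nonneg : ∀ x a, 0 ≤ w x a
  sum_one : ∀ x, ∑ a, w x a = 1

theorem isPolicy_igwProb {g : ℝ} (hg : 0 ≤ g) (i : ι) : IsPolicy (S.igwProb g i) where
  meas := measurable_igwProb g i
  nonneg x a := (igwProb_pos hg i x a).le
  sum_one := sum_igwProb g i

open Classical in
/-- A deterministic policy as a randomized one. -/
noncomputable def pureWeight (π : X → A) (x : X) (a : A) : ℝ := if a = π x then 1 else 0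

theorem sum_pureWeight (π : X → A) (h : A → ℝ) (x : X) :
    ∑ a, pureWeight π x a * h a = h (π x) := by
  classical
  simp [pureWeight]

theorem isPolicy_pureWeight [MeasurableSpace A] [MeasurableSingletonClass A] {π : X → A}
    (hπ : Measurable π) : IsPolicy (pureWeight π) where
  meas a := by
    have : (fun x => pureWeight π x a) = fun x => Set.indicator (π ⁻¹' {a}) (fun _ => (1 : ℝ)) x := by
      ext x
      by_cases h : a = π x
      · simp [pureWeight, h]
      · simp [pureWeight, h, Ne.symm h]
    rw [this]
    exact measurable_const.indicator (hπ (measurableSet_singleton a))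
  nonneg x a := by
    unfold pureWeight
    split_ifs <;> norm_num
  sum_one x := by simpa using sum_pureWeight π (fun _ => 1) x

theorem isPolicy_pureWeight_greedy (i : ι) : IsPolicy (pureWeight (S.greedy i)) := by
  letI : MeasurableSpace A := ⊤
  haveI : MeasurableSingletonClass A := ⟨fun _ => trivial⟩
  exact isPolicy_pureWeight (measurable_greedy i)

variable {S W}

theorem IsPolicy.measurable_sum {w : X → A → ℝ} (hw : IsPolicy w) {h : X → A → ℝ}
    (hh : ∀ a, Measurable fun x => h x a) : Measurable fun x => ∑ a, w x a * h x a :=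
  Finset.measurable_sum _ fun a _ => (hw.meas a).mul (hh a)

theorem IsPolicy.sum_mem_Icc {w : X → A → ℝ} (hw : IsPolicy w) {h : X → A → ℝ} {c d : ℝ}
    (hh : ∀ x a, h x a ∈ Set.Icc c d) (x : X) : ∑ a, w x a * h x a ∈ Set.Icc c d := by
  constructor
  · calc c = ∑ a, w x a * c := by rw [← Finset.sum_mul, hw.sum_one, one_mul]
      _ ≤ _ := Finset.sum_le_sum fun a _ => mul_le_mul_of_nonneg_left (hh x a).1 (hw.nonneg x a)
  · calc _ ≤ ∑ a, w x a * d :=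
          Finset.sum_le_sum fun a _ => mul_le_mul_of_nonneg_left (hh x a).2 (hw.nonneg x a)
      _ = d := by rw [← Finset.sum_mul, hw.sum_one, one_mul]

/-- The value of a randomized policy for the regressor `i` and the context distribution `μ`. -/
noncomputable def polValue (S : Setup X A ι) (μ : Measure X) (i : ι) (w : X → A → ℝ) : ℝ :=
  ∫ x, ∑ a, w x a * S.reg i x a ∂μ

theorem IsPolicy.integrable_reg {w : X → A → ℝ} (hw : IsPolicy w) (i : ι) (μ : Measure X)
    [IsProbabilityMeasure μ] : Integrable (fun x => ∑ a, w x a * S.reg i x a) μ :=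
  integrable_of_mem_Icc (hw.measurable_sum (S.reg_meas i)) (hw.sum_mem_Icc (S.reg_mem i))

theorem polValue_mem {w : X → A → ℝ} (hw : IsPolicy w) (i : ι) (μ : Measure X)
    [IsProbabilityMeasure μ] : polValue S μ i w ∈ Set.Icc (0 : ℝ) 1 :=
  integral_mem_Icc (hw.measurable_sum (S.reg_meas i)) (hw.sum_mem_Icc (S.reg_mem i))

theorem polValue_pureWeight (μ : Measure X) (i : ι) (π : X → A) :
    polValue S μ i (pureWeight π) = ∫ x, S.reg i x (π x) ∂μ := by
  simp [polValue, sum_pureWeight]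

theorem polValue_le_greedy {w : X → A → ℝ} (hw : IsPolicy w) (i : ι) (μ : Measure X)
    [IsProbabilityMeasure μ] :
    polValue S μ i w ≤ polValue S μ i (pureWeight (S.greedy i)) := by
  refine integral_mono (hw.integrable_reg i μ)
    ((isPolicy_pureWeight_greedy S i).integrable_reg i μ) fun x => ?_
  simp only [sum_pureWeight]
  calc ∑ a, w x a * S.reg i x a ≤ ∑ a, w x a * S.reg i x (S.greedy i x) :=
        Finset.sum_le_sum fun a _ => mul_le_mul_of_nonneg_left (S.greedy_spec i x a) (hw.nonneg x a)
    _ = _ := by rw [← Finset.sum_mul, hw.sum_one, one_mul]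

theorem integral_sum_gap {w : X → A → ℝ} (hw : IsPolicy w) (i : ι) (μ : Measure X)
    [IsProbabilityMeasure μ] : ∫ x, ∑ a, w x a * S.gap i x a ∂μ =
      polValue S μ i (pureWeight (S.greedy i)) - polValue S μ i w := by
  unfold polValue
  rw [← integral_sub ((isPolicy_pureWeight_greedy S i).integrable_reg i μ)
    (hw.integrable_reg i μ)]
  congr 1
  ext x
  simp only [sum_pureWeight, Setup.gap, mul_sub, Finset.sum_sub_distrib]
  rw [← Finset.sum_mul, hw.sum_one, one_mul]

/-- The value of a fixed randomized policy changes by at most the total drift. -/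
theorem abs_polValue_star_sub_le {w : X → A → ℝ} (hw : IsPolicy w) {s e : ℕ} (hse : s ≤ e) :
    |polValue S (W.D s) (W.star s) w - polValue S (W.D e) (W.star e) w| ≤
      total (drift S W) s e := by
  have h1 : |polValue S (W.D s) (W.star s) w - polValue S (W.D s) (W.star e) w| ≤
      total (regDrift S W) s e := by
    unfold polValue
    rw [← integral_sub (hw.integrable_reg _ _) (hw.integrable_reg _ _)]
    have hm : Measurable fun x => ∑ a, w x a * S.reg (W.star s) x a -
        ∑ a, w x a * S.reg (W.star e) x a :=
      (hw.measurable_sum (S.reg_meas _)).sub (hw.measurable_sum (S.reg_meas _))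
    have := integral_mem_Icc (μ := W.D s) (c := -total (regDrift S W) s e)
      (d := total (regDrift S W) s e) hm (fun x => by
        rw [← Finset.sum_sub_distrib]
        simp only [← mul_sub]
        exact hw.sum_mem_Icc (h := fun x a => S.reg (W.star s) x a - S.reg (W.star e) x a)
          (fun x a => abs_le.1 (abs_reg_star_sub_le S W hse x a)) x)
    exact abs_le.2 this
  have h2 : |polValue S (W.D s) (W.star e) w - polValue S (W.D e) (W.star e) w| ≤
      total (contextDrift W) s e :=
    abs_integral_sub_le W hse (hw.measurable_sum (S.reg_meas _)) (hw.sum_mem_Icc (S.reg_mem _))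
  calc _ ≤ _ := abs_sub_le _ _ _
    _ ≤ _ := add_le_add h1 h2
    _ ≤ _ := total_regDrift_add_le S W s e

theorem value_eq_polValue (t : ℕ) (π : X → A) :
    value S W t π = polValue S (W.D t) (W.star t) (pureWeight π) :=
  (polValue_pureWeight _ _ _).symm

/-- The value of the best policy in round `t` is attained by the greedy policy of the true
regressor, which is optimal among all policies. -/
theorem bestValue_eq (t : ℕ) : bestValue S W t =
    polValue S (W.D t) (W.star t) (pureWeight (S.greedy (W.star t))) := by
  have := S.nonempty_reg
  unfold bestValue
  simp only [value_eq_polValue]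
  apply le_antisymm
  · exact ciSup_le fun i => polValue_le_greedy (isPolicy_pureWeight_greedy S i) _ _
  · exact le_ciSup (f := fun i => polValue S (W.D t) (W.star t) (pureWeight (S.greedy i)))
      (Set.finite_range _).bddAbove (W.star t)

theorem polValue_le_bestValue {w : X → A → ℝ} (hw : IsPolicy w) (t : ℕ) :
    polValue S (W.D t) (W.star t) w ≤ bestValue S W t := by
  rw [bestValue_eq]
  exact polValue_le_greedy hw _ _

theorem bestValue_mem (t : ℕ) : bestValue S W t ∈ Set.Icc (0 : ℝ) 1 := by
  rw [bestValue_eq]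
  exact polValue_mem (isPolicy_pureWeight_greedy S _) _ _

/-- An optimal policy of one round, carried to the other, loses at most the drift and cannot beat
the optimum there. -/
theorem abs_bestValue_sub_le {s e : ℕ} (hse : s ≤ e) :
    |bestValue S W s - bestValue S W e| ≤ total (drift S W) s e := by
  have h1 := abs_le.1 (abs_polValue_star_sub_le (W := W) (S := S)
    (isPolicy_pureWeight_greedy S (W.star s)) hse)
  have h2 := abs_le.1 (abs_polValue_star_sub_le (W := W) (S := S)
    (isPolicy_pureWeight_greedy S (W.star e)) hse)
  have h3 := polValue_le_bestValue (S := S) (W := W) (isPolicy_pureWeight_greedy S (W.star s)) e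
  have h4 := polValue_le_bestValue (S := S) (W := W) (isPolicy_pureWeight_greedy S (W.star e)) s
  rw [← bestValue_eq] at h1 h2
  rw [abs_le]
  constructor <;> linarith

end Drift

end RealizableBandit

namespace RealizableBandit

/-! ### Histories along selected rounds -/

section Selection

variable {X A : Type*}

open Classical in
/-- The selected rounds in `[s, t)`. -/
noncomputable def selBefore (Z : ℕ → Prop) (s t : ℕ) : Finset ℕ := (Finset.Ico s t).filter Z

open Classical in
/-- The observations of the selected rounds in `[s, t)`. -/
noncomputable def selHist (Z : ℕ → Prop) (obs : ℕ → Obs X A) (s t : ℕ) : List (Obs X A) :=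
  ((List.range' s (t - s)).filter fun τ => Z τ).map obs

theorem mem_selBefore {Z : ℕ → Prop} {s t τ : ℕ} :
    τ ∈ selBefore Z s t ↔ (s ≤ τ ∧ τ < t) ∧ Z τ := by
  simp [selBefore]

theorem selBefore_mono (Z : ℕ → Prop) (s : ℕ) {t t' : ℕ} (h : t ≤ t') :
    selBefore Z s t ⊆ selBefore Z s t' := fun τ hτ => by
  rw [mem_selBefore] at *
  exact ⟨⟨hτ.1.1, hτ.1.2.trans_le h⟩, hτ.2⟩

theorem card_selBefore_mono (Z : ℕ → Prop) (s : ℕ) {t t' : ℕ} (h : t ≤ t') :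
    (selBefore Z s t).card ≤ (selBefore Z s t').card :=
  Finset.card_le_card (selBefore_mono Z s h)

theorem card_selBefore_le (Z : ℕ → Prop) (s t : ℕ) : (selBefore Z s t).card ≤ t - s := by
  classical
  unfold selBefore
  refine (Finset.card_filter_le _ _).trans ?_
  simp

theorem selBefore_succ_of_sel {Z : ℕ → Prop} {s t : ℕ} (hst : s ≤ t) (hZ : Z t) :
    selBefore Z s (t + 1) = insert t (selBefore Z s t) := by
  ext τ
  rw [Finset.mem_insert, mem_selBefore, mem_selBefore]
  constructor
  · rintro ⟨⟨h1, h2⟩, h3⟩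
    rcases Nat.lt_succ_iff_lt_or_eq.1 h2 with h | h
    · exact Or.inr ⟨⟨h1, h⟩, h3⟩
    · exact Or.inl h
  · rintro (rfl | ⟨⟨h1, h2⟩, h3⟩)
    · exact ⟨⟨hst, by omega⟩, hZ⟩
    · exact ⟨⟨h1, by omega⟩, h3⟩

theorem selBefore_succ_of_not_sel {Z : ℕ → Prop} {s t : ℕ} (hZ : ¬ (s ≤ t ∧ Z t)) :
    selBefore Z s (t + 1) = selBefore Z s t := by
  ext τ
  rw [mem_selBefore, mem_selBefore]
  constructor
  · rintro ⟨⟨h1, h2⟩, h3⟩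
    rcases Nat.lt_succ_iff_lt_or_eq.1 h2 with h | h
    · exact ⟨⟨h1, h⟩, h3⟩
    · exact absurd ⟨h ▸ h1, h ▸ h3⟩ hZ
  · rintro ⟨⟨h1, h2⟩, h3⟩
    exact ⟨⟨h1, by omega⟩, h3⟩

theorem card_selBefore_succ_of_sel {Z : ℕ → Prop} {s t : ℕ} (hst : s ≤ t) (hZ : Z t) :
    (selBefore Z s (t + 1)).card = (selBefore Z s t).card + 1 := by
  rw [selBefore_succ_of_sel hst hZ, Finset.card_insert_of_notMem]
  simp [mem_selBefore]

theorem sum_map_selHist (Z : ℕ → Prop) (obs : ℕ → Obs X A) (s t : ℕ) (g : Obs X A → ℝ) :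
    ((selHist Z obs s t).map g).sum = ∑ τ ∈ selBefore Z s t, g (obs τ) := by
  classical
  have h : selBefore Z s t = ((List.range' s (t - s)).filter fun τ => Z τ).toFinset := by
    ext τ
    rw [mem_selBefore]
    simp only [List.mem_toFinset, List.mem_filter, List.mem_range'_1, decide_eq_true_eq]
    constructor
    · rintro ⟨⟨h1, h2⟩, h3⟩
      exact ⟨⟨h1, by omega⟩, h3⟩
    · rintro ⟨⟨h1, h2⟩, h3⟩
      exact ⟨⟨h1, by omega⟩, h3⟩
  rw [h, List.sum_toFinset _ ((List.nodup_range' ..).filter _), selHist, List.map_map]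
  congr!

theorem length_selHist (Z : ℕ → Prop) (obs : ℕ → Obs X A) (s t : ℕ) :
    (selHist Z obs s t).length = (selBefore Z s t).card := by
  have h := sum_map_selHist Z obs s t (fun _ => 1)
  simp only [List.map_const', List.sum_replicate, nsmul_eq_mul, mul_one, Finset.sum_const] at h
  exact_mod_cast h

theorem selHist_congr {Z Z' : ℕ → Prop} (obs : ℕ → Obs X A) {s t : ℕ}
    (h : ∀ τ, s ≤ τ → τ < t → (Z τ ↔ Z' τ)) : selHist Z obs s t = selHist Z' obs s t := by
  classical
  unfold selHist
  congr 1
  refine List.filter_congr fun τ hτ => ?_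
  rw [List.mem_range'_1] at hτ
  simp [h τ hτ.1 (by omega)]

theorem selHist_true (obs : ℕ → Obs X A) (t : ℕ) :
    selHist (fun _ => True) obs 1 t = history obs t := by
  simp [selHist, history]

theorem selBefore_true (s t : ℕ) : selBefore (fun _ => True) s t = Finset.Ico s t := by
  simp [selBefore]

end Selection

/-! ### Deterministic analysis of FALCON along selected rounds -/

section FalconAnalysis

variable {X A ι : Type*} [MeasurableSpace X] [Fintype A] [Fintype ι]

/-- The expected squared error of the regressor `i` in round `τ` under the action probabilities
`q`. -/
noncomputable def qErr (S : Setup X A ι) (W : World X ι) (q : X → A → ℝ) (τ : ℕ) (i : ι) : ℝ :=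
  ∫ x, ∑ a, q x a * (S.reg i x a - S.reg (W.star τ) x a) ^ 2 ∂(W.D τ)

/-- The excess squared loss of the regressor `i` over the true regressor on an observation of
round `τ`. -/
noncomputable def sqDiff (S : Setup X A ι) (W : World X ι) (o : Obs X A) (τ : ℕ) (i : ι) : ℝ :=
  (S.reg i o.1 o.2.1 - o.2.2) ^ 2 - (S.reg (W.star τ) o.1 o.2.1 - o.2.2) ^ 2

/-- The expected prediction of the regressor `i` for its own greedy policy. -/
noncomputable def greedyVal (S : Setup X A ι) (W : World X ι) (τ : ℕ) (i : ι) : ℝ :=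
  ∫ x, S.reg i x (S.greedy i x) ∂(W.D τ)

/-- On the selected rounds, losses, predictions and rewards are close to their conditional means,
given that `p τ` is the action distribution played in round `τ`. -/
structure Concentrated (S : Setup X A ι) (W : World X ι) (Z : ℕ → Prop) (s : ℕ)
    (obs : ℕ → Obs X A) (p : ℕ → X → A → ℝ) : Prop where
  sq_upper : ∀ t ≤ S.T + 1, ∀ i, ∑ τ ∈ selBefore Z s t, qErr S W (p τ) τ i ≤
    2 * ∑ τ ∈ selBefore Z s t, sqDiff S W (obs τ) τ i + 320 * S.logTerm
  sq_lower : ∀ t ≤ S.T + 1, ∀ i, ∑ τ ∈ selBefore Z s t, sqDiff S W (obs τ) τ i ≤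
    3 / 2 * ∑ τ ∈ selBefore Z s t, qErr S W (p τ) τ i + 160 * S.logTerm
  greedy : ∀ t ≤ S.T + 1, ∀ i, |∑ τ ∈ selBefore Z s t,
    (S.reg i (obs τ).1 (S.greedy i (obs τ).1) - greedyVal S W τ i)| ≤
      21 * √(S.logTerm * (selBefore Z s t).card)
  reward : ∀ t ≤ S.T + 1, |∑ τ ∈ selBefore Z s t,
    ((obs τ).2.2 - polValue S (W.D τ) (W.star τ) (p τ))| ≤
      21 * √(S.logTerm * (selBefore Z s t).card)

variable {S : Setup X A ι} {W : World X ι} {Z : ℕ → Prop} {s b : ℕ} {obs : ℕ → Obs X A}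
  {p : ℕ → X → A → ℝ}

theorem isPolicy_falconProb (h : List (Obs X A)) : IsPolicy (S.falconProb h) := by
  rw [S.falconProb_eq]
  exact isPolicy_igwProb S (S.gam_nonneg _) _

theorem sq_sub_mem {a c : ℝ} (ha : a ∈ Set.Icc (0 : ℝ) 1) (hc : c ∈ Set.Icc (0 : ℝ) 1) :
    (a - c) ^ 2 ∈ Set.Icc (0 : ℝ) 1 := by
  obtain ⟨h1, h2⟩ := ha
  obtain ⟨h3, h4⟩ := hc
  exact ⟨sq_nonneg _, by rw [sq_le_one_iff_abs_le_one, abs_le]; constructor <;> linarith⟩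

theorem measurable_sq_reg_sub (i j : ι) (a : A) :
    Measurable fun x => (S.reg i x a - S.reg j x a) ^ 2 :=
  ((S.reg_meas i a).sub (S.reg_meas j a)).pow_const 2

theorem sqLoss_selHist (t : ℕ) (i : ι) : S.sqLoss (selHist Z obs s t) i =
    ∑ τ ∈ selBefore Z s t, (S.reg i (obs τ).1 (obs τ).2.1 - (obs τ).2.2) ^ 2 := by
  unfold Setup.sqLoss
  rw [sum_map_selHist]

/-- The regression oracle is accurate on the selected rounds when the drift is small. -/
theorem sum_qErr_oracle_le (hc : Concentrated S W Z s obs p) {β : ℝ} {t k : ℕ}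
    (ht : t ≤ S.T + 1) (hk : 1 ≤ k) (hcard : (selBefore Z s t).card ≤ k)
    (hb : ∀ τ ∈ selBefore Z s t, b ≤ τ) (hpol : ∀ τ ∈ selBefore Z s t, IsPolicy (p τ))
    (hd : total (drift S W) b t ≤ β * S.rho k) :
    ∑ τ ∈ selBefore Z s t, qErr S W (p τ) τ (S.oracle (selHist Z obs s t)) ≤
      (3 * β ^ 2 + 640) * S.logTerm := by
  have hk0 : (0 : ℝ) < k := by exact_mod_cast hk
  have hA := S.numA_pos
  have hΛ := S.logTerm_pos
  set i := S.oracle (selHist Z obs s t) with hi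
  -- Least squares against the true regressor of the base round `b`, which need not be the true one
  -- in later rounds.
  have h1 : ∑ τ ∈ selBefore Z s t, sqDiff S W (obs τ) τ i ≤
      ∑ τ ∈ selBefore Z s t, sqDiff S W (obs τ) τ (W.star b) := by
    have := S.oracle_spec (selHist Z obs s t) (W.star b)
    rw [sqLoss_selHist, sqLoss_selHist] at this
    unfold sqDiff
    rw [Finset.sum_sub_distrib, Finset.sum_sub_distrib]
    linarith
  have h2 : ∀ τ ∈ selBefore Z s t, qErr S W (p τ) τ (W.star b) ≤ β ^ 2 * S.logTerm / k := by
    intro τ hτ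
    have hbτ := hb τ hτ
    have hτt : τ < t := (mem_selBefore.1 hτ).1.2
    set Dr := total (regDrift S W) b τ with hDr
    have hDr0 : 0 ≤ Dr := total_nonneg (regDrift_nonneg S W) _ _
    have h3 : √S.numA * Dr ≤ β * S.rho k :=
      (sqrt_mul_total_regDrift_le S W b τ).trans
        ((total_mono (drift_nonneg S W) le_rfl hτt.le).trans hd)
    -- The factor `√A` in the drift cancels the `A` in `ρ(k)²`; over at most `k` rounds these
    -- squares add up to `β²Λ`.
    have h4 : Dr ^ 2 ≤ β ^ 2 * S.logTerm / k := by
      have h5 : (√S.numA * Dr) ^ 2 ≤ (β * S.rho k) ^ 2 :=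
        pow_le_pow_left₀ (by positivity) h3 2
      rw [mul_pow, mul_pow, Real.sq_sqrt hA.le, Setup.rho, Real.sq_sqrt (by positivity)] at h5
      have h6 : S.numA * (β ^ 2 * S.logTerm / k) = β ^ 2 * (S.numA * S.logTerm / k) := by ring
      exact le_of_mul_le_mul_left (h5.trans_eq h6.symm) hA
    refine le_trans ?_ h4
    refine (integral_mem_Icc (c := 0) (d := Dr ^ 2)
      ((hpol τ hτ).measurable_sum (measurable_sq_reg_sub _ _)) ?_).2
    refine (hpol τ hτ).sum_mem_Icc fun x a => ⟨sq_nonneg _, ?_⟩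
    exact sq_le_sq' (abs_le.1 (abs_reg_star_sub_le S W hbτ x a)).1
      (abs_le.1 (abs_reg_star_sub_le S W hbτ x a)).2
  have h3 : ∑ τ ∈ selBefore Z s t, qErr S W (p τ) τ (W.star b) ≤ β ^ 2 * S.logTerm := by
    refine (Finset.sum_le_sum h2).trans ?_
    rw [Finset.sum_const, nsmul_eq_mul]
    have : ((selBefore Z s t).card : ℝ) ≤ k := by exact_mod_cast hcard
    calc ((selBefore Z s t).card : ℝ) * (β ^ 2 * S.logTerm / k)
        ≤ k * (β ^ 2 * S.logTerm / k) := by gcongr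
      _ = _ := by field_simp
  -- Both directions of the concentration of squared losses: 2·(3/2·β² + 160) + 320 = 3β² + 640.
  have h4 := hc.sq_upper t ht i
  have h5 := hc.sq_lower t ht (W.star b)
  linarith

/-- AM-GM gives |y| ≤ B/(2η) + ηy²/(2B); then 1/B ≤ q and w ≤ 1. An error under the evaluated policy
`w` is traded for a squared error under the played distribution `q`, at the price of the inverse
probability `B`. -/
theorem mul_abs_le_of_inv_le {w q y B η : ℝ} (hw0 : 0 ≤ w) (hw1 : w ≤ 1) (hq : 0 < q)
    (hB : 1 / q ≤ B) (hη : 0 < η) : w * |y| ≤ w * B / (2 * η) + η / 2 * (q * y ^ 2) := by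
  have hB0 : 0 < B := lt_of_lt_of_le (by positivity) hB
  have h1 : |y| ≤ B / (2 * η) + η / 2 * (1 / B * y ^ 2) := by
    have h := sq_nonneg (B - η * |y|)
    rw [← sq_abs y]
    have h2 : B / (2 * η) + η / 2 * (1 / B * |y| ^ 2) - |y| = (B - η * |y|) ^ 2 / (2 * η * B) := by
      field_simp
      ring
    have h3 : 0 ≤ (B - η * |y|) ^ 2 / (2 * η * B) := by positivity
    linarith
  have h2 : 1 / B ≤ q := by
    rw [one_div_le hB0 hq]
    exact hB
  have h3 : w * (1 / B * y ^ 2) ≤ q * y ^ 2 := by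
    rw [← mul_assoc]
    apply mul_le_mul_of_nonneg_right _ (sq_nonneg _)
    calc w * (1 / B) ≤ 1 * (1 / B) := by gcongr
      _ ≤ q := by rw [one_mul]; exact h2
  calc w * |y| ≤ w * (B / (2 * η) + η / 2 * (1 / B * y ^ 2)) := by gcongr
    _ = w * B / (2 * η) + η / 2 * (w * (1 / B * y ^ 2)) := by ring
    _ ≤ _ := by gcongr

theorem IsPolicy.le_one {w : X → A → ℝ} (hw : IsPolicy w) (x : X) (a : A) : w x a ≤ 1 := by
  rw [← hw.sum_one x]
  exact Finset.single_le_sum (f := fun a => w x a) (fun b _ => hw.nonneg x b) (Finset.mem_univ a)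

/-- The error of the predicted value of a policy, in terms of the squared error under an inverse gap
weighting distribution and of the predicted regret of the policy for the weighting regressor. -/
theorem abs_polValue_sub_star_le {w : X → A → ℝ} (hw : IsPolicy w) {g η : ℝ} (hg : 0 ≤ g)
    (hη : 0 < η) (i j : ι) (τ : ℕ) :
    |polValue S (W.D τ) i w - polValue S (W.D τ) (W.star τ) w| ≤
      (S.numA + g * ∫ x, ∑ a, w x a * S.gap j x a ∂(W.D τ)) / (2 * η) +
        η / 2 * qErr S W (S.igwProb g j) τ i := by
  have hq := isPolicy_igwProb S hg j
  have hgap : ∀ x a, S.gap j x a ∈ Set.Icc (0 : ℝ) 1 := fun x a =>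
    ⟨S.gap_nonneg j x a, S.gap_le_one j x a⟩
  have hi1 : Integrable (fun x => ∑ a, w x a * S.gap j x a) (W.D τ) :=
    integrable_of_mem_Icc (hw.measurable_sum (measurable_gap j)) (hw.sum_mem_Icc hgap)
  have hi2 : Integrable (fun x => ∑ a, S.igwProb g j x a *
      (S.reg i x a - S.reg (W.star τ) x a) ^ 2) (W.D τ) :=
    integrable_of_mem_Icc (hq.measurable_sum (measurable_sq_reg_sub _ _))
      (hq.sum_mem_Icc fun x a => sq_sub_mem (S.reg_mem _ _ _) (S.reg_mem _ _ _))
  have h1 : ∀ x, |∑ a, w x a * S.reg i x a - ∑ a, w x a * S.reg (W.star τ) x a| ≤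
      (S.numA + g * ∑ a, w x a * S.gap j x a) / (2 * η) +
        η / 2 * ∑ a, S.igwProb g j x a * (S.reg i x a - S.reg (W.star τ) x a) ^ 2 := by
    intro x
    rw [← Finset.sum_sub_distrib]
    calc |∑ a, (w x a * S.reg i x a - w x a * S.reg (W.star τ) x a)|
        ≤ ∑ a, |w x a * S.reg i x a - w x a * S.reg (W.star τ) x a| :=
          Finset.abs_sum_le_sum_abs _ _
      _ = ∑ a, w x a * |S.reg i x a - S.reg (W.star τ) x a| := by
          refine Finset.sum_congr rfl fun a _ => ?_
          rw [← mul_sub, abs_mul, abs_of_nonneg (hw.nonneg x a)]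
      _ ≤ ∑ a, (w x a * (S.numA + g * S.gap j x a) / (2 * η) +
            η / 2 * (S.igwProb g j x a * (S.reg i x a - S.reg (W.star τ) x a) ^ 2)) :=
          Finset.sum_le_sum fun a _ => mul_abs_le_of_inv_le (hw.nonneg x a) (hw.le_one x a)
            (igwProb_pos hg j x a) (one_div_igwProb_le hg j x a) hη
      _ = _ := by
          rw [Finset.sum_add_distrib, ← Finset.mul_sum, ← Finset.sum_div]
          congr 2
          simp only [mul_add]
          rw [Finset.sum_add_distrib, ← Finset.sum_mul, hw.sum_one, one_mul, Finset.mul_sum]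
          congr 1
          exact Finset.sum_congr rfl fun a _ => by ring
  have hi3 : Integrable (fun x => (S.numA + g * ∑ a, w x a * S.gap j x a) / (2 * η)) (W.D τ) :=
    ((integrable_const S.numA).add (hi1.const_mul g)).div_const (2 * η)
  unfold polValue
  rw [← integral_sub (hw.integrable_reg _ _) (hw.integrable_reg _ _)]
  refine (abs_integral_le_integral_abs).trans ?_
  refine (integral_mono ((hw.integrable_reg _ _).sub (hw.integrable_reg _ _)).abs
    (hi3.add (hi2.const_mul (η / 2))) h1).trans_eq ?_
  simp only [Pi.add_apply]
  rw [integral_add hi3 (hi2.const_mul (η / 2)), integral_div, integral_const_mul,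
    integral_add (integrable_const _) (hi1.const_mul g), integral_const_mul]
  simp [qErr]

theorem abs_polValue_sub_le {w : X → A → ℝ} (hw : IsPolicy w) (i : ι) {τ : ℕ} (hb : b ≤ τ) :
    |polValue S (W.D b) i w - polValue S (W.D τ) i w| ≤ total (drift S W) b τ :=
  (abs_integral_sub_le W hb (hw.measurable_sum (S.reg_meas _)) (hw.sum_mem_Icc (S.reg_mem _))).trans
    (total_contextDrift_le S W b τ)

theorem integral_gap_le {w : X → A → ℝ} (hw : IsPolicy w) (i : ι) {τ : ℕ} (hb : b ≤ τ) :
    ∫ x, ∑ a, w x a * S.gap i x a ∂(W.D τ) ≤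
      ∫ x, ∑ a, w x a * S.gap i x a ∂(W.D b) + total (drift S W) b τ := by
  have := (abs_le.1 ((abs_integral_sub_le W hb (hw.measurable_sum (measurable_gap i))
    (hw.sum_mem_Icc (fun x a => ⟨S.gap_nonneg i x a, S.gap_le_one i x a⟩))).trans
    (total_contextDrift_le S W b τ))).1
  linarith

/-- The predicted regret of the policy `w` under the contexts of round `b`. -/
noncomputable def gapValue (S : Setup X A ι) (W : World X ι) (b : ℕ) (i : ι) (w : X → A → ℝ) : ℝ :=
  ∫ x, ∑ a, w x a * S.gap i x a ∂(W.D b)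

/-- The regret of the policy `w` in round `b`. -/
noncomputable def polRegret (S : Setup X A ι) (W : World X ι) (b : ℕ) (w : X → A → ℝ) : ℝ :=
  bestValue S W b - polValue S (W.D b) (W.star b) w

theorem polRegret_nonneg {w : X → A → ℝ} (hw : IsPolicy w) : 0 ≤ polRegret S W b w :=
  sub_nonneg.2 (polValue_le_bestValue hw b)

/-- The standing assumptions on a run of FALCON on the selected rounds up to round `t`. -/
structure NearStationary (S : Setup X A ι) (W : World X ι) (Z : ℕ → Prop) (s b : ℕ)
    (obs : ℕ → Obs X A) (p : ℕ → X → A → ℝ) (t : ℕ) : Prop where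
  conc : Concentrated S W Z s obs p
  le_T : t ≤ S.T + 1
  start_le : b ≤ t
  start_le_sel : ∀ τ ∈ selBefore Z s t, b ≤ τ
  plays : ∀ τ ∈ selBefore Z s t, p τ = S.falconProb (selHist Z obs s τ)
  drift_le : total (drift S W) b t ≤ S.rho ((selBefore Z s t).card + 1)

/-- Going back in time the accumulated drift shrinks and the rate at the instance's own clock grows.
This makes the strong induction on rounds possible. -/
theorem NearStationary.of_le {t τ : ℕ} (h : NearStationary S W Z s b obs p t) (hτ : τ ≤ t)
    (hb : b ≤ τ) : NearStationary S W Z s b obs p τ where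
  conc := h.conc
  le_T := hτ.trans h.le_T
  start_le := hb
  start_le_sel σ hσ := h.start_le_sel σ (selBefore_mono Z s hτ hσ)
  plays σ hσ := h.plays σ (selBefore_mono Z s hτ hσ)
  drift_le := (total_mono (drift_nonneg S W) le_rfl hτ).trans (h.drift_le.trans
    (S.rho_antitone (by omega) (by have := card_selBefore_mono Z s hτ; omega)))

/-- The inductive step of the FALCON argument. Averaged over the selected rounds τ, the value error
splits by AM-GM into squared errors, whose sum is O(Λ), and inverse probabilities A + g·(regret
predicted by the regressor used in round τ). The latter are bounded through `ih` by the true regret,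
only a quarter of which survives. -/
theorem abs_polValue_oracle_sub_le {t : ℕ} (h : NearStationary S W Z s b obs p t)
    (hne : (selBefore Z s t).Nonempty) {w : X → A → ℝ} (hw : IsPolicy w)
    (ih : ∀ τ ∈ selBefore Z s t, gapValue S W b (S.oracle (selHist Z obs s τ)) w ≤
      2 * polRegret S W b w + 7000 * S.rho ((selBefore Z s τ).card + 1)) :
    |polValue S (W.D b) (S.oracle (selHist Z obs s t)) w -
      polValue S (W.D b) (W.star b) w| ≤
      polRegret S W b w / 4 + 3500 * S.rho ((selBefore Z s t).card + 1) := by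
  set n := (selBefore Z s t).card with hn
  have hn1 : 1 ≤ n := hne.card_pos
  set ρ := S.rho (n + 1) with hρ
  have hρ0 : 0 < ρ := S.rho_pos (by omega)
  set γ := S.gam (n + 1) with hγ
  have hγ0 : 0 < γ := S.gam_pos (by omega)
  have hγρ : γ * ρ = S.numA := S.gam_mul_rho (by omega)
  set i := S.oracle (selHist Z obs s t) with hi
  set R := polRegret S W b w with hR
  have hR0 : 0 ≤ R := polRegret_nonneg hw
  have hreg := sum_qErr_oracle_le (β := 1) h.conc h.le_T (k := n + 1) (by omega) (by omega)
    h.start_le_sel (fun τ hτ => by rw [h.plays τ hτ]; exact isPolicy_falconProb _)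
    (by rw [one_mul]; exact h.drift_le)
  rw [← hi] at hreg
  have key : ∀ τ ∈ selBefore Z s t, |polValue S (W.D b) i w - polValue S (W.D b) (W.star b) w| ≤
      (2 * ρ + 7002 / 8 * ρ + R / 4) + 2 * γ * qErr S W (p τ) τ i := by
    intro τ hτ
    have hbτ := h.start_le_sel τ hτ
    have hτt : τ < t := (mem_selBefore.1 hτ).1.2
    have hd : total (drift S W) b τ ≤ ρ :=
      (total_mono (drift_nonneg S W) le_rfl hτt.le).trans h.drift_le
    have hd0 : 0 ≤ total (drift S W) b τ := total_nonneg (drift_nonneg S W) _ _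
    set m := (selBefore Z s τ).card with hm
    have hmn : m ≤ n := card_selBefore_mono Z s hτt.le
    set g := S.gam (m + 1) with hg
    have hgγ : g ≤ γ := S.gam_mono (by omega)
    have hg0 : 0 < g := S.gam_pos (by omega)
    set j := S.oracle (selHist Z obs s τ) with hj
    have hp : p τ = S.igwProb g j := by
      rw [h.plays τ hτ, S.falconProb_eq, length_selHist]
    -- With `η = 4γ` the term `2γR` coming from `ih` is divided by `8γ` and becomes `R/4`.
    have h1 := abs_polValue_sub_star_le (S := S) (W := W) hw hg0.le
      (show 0 < 4 * γ by positivity) i j τ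
    rw [← hp] at h1
    have h2 := abs_polValue_sub_le (S := S) (W := W) hw i hbτ
    have h3 := abs_polValue_star_sub_le (S := S) (W := W) hw hbτ
    have h4 := integral_gap_le (S := S) (W := W) hw j hbτ
    have h5 := ih τ hτ
    unfold gapValue at h5
    set I := ∫ x, ∑ a, w x a * S.gap j x a ∂(W.D τ) with hI
    have h6 : I ≤ 2 * R + 7000 * S.rho (m + 1) + ρ := by linarith
    have h7 : S.numA + g * I ≤ 7002 * S.numA + 2 * γ * R := by
      have hgρ : g * S.rho (m + 1) = S.numA := S.gam_mul_rho (by omega)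
      calc S.numA + g * I ≤ S.numA + g * (2 * R + 7000 * S.rho (m + 1) + ρ) := by gcongr
        _ = S.numA + 2 * (g * R) + 7000 * (g * S.rho (m + 1)) + g * ρ := by ring
        _ ≤ S.numA + 2 * (γ * R) + 7000 * S.numA + γ * ρ := by
            rw [hgρ]
            gcongr
        _ = _ := by rw [hγρ]; ring
    have h8 : (S.numA + g * I) / (2 * (4 * γ)) ≤ 7002 / 8 * ρ + R / 4 := by
      rw [div_le_iff₀ (by positivity)]
      calc S.numA + g * I ≤ 7002 * S.numA + 2 * γ * R := h7
        _ = (7002 / 8 * ρ + R / 4) * (2 * (4 * γ)) := by rw [← hγρ]; ring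
    have h9 := abs_sub_le (polValue S (W.D b) i w) (polValue S (W.D τ) i w)
      (polValue S (W.D b) (W.star b) w)
    have h10 := abs_sub_le (polValue S (W.D τ) i w) (polValue S (W.D τ) (W.star τ) w)
      (polValue S (W.D b) (W.star b) w)
    rw [abs_sub_comm] at h3
    linarith
  have hsum := Finset.sum_le_sum key
  rw [Finset.sum_const, nsmul_eq_mul, Finset.sum_add_distrib, Finset.sum_const, nsmul_eq_mul,
    ← Finset.mul_sum, ← hn] at hsum
  set E := |polValue S (W.D b) i w - polValue S (W.D b) (W.star b) w| with hE
  have hn0 : (0 : ℝ) < n := by exact_mod_cast hn1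
  -- The total error is at most 643Λ and γΛ = (n+1)ρ ≤ 2nρ, so the factor is 2·643·2 = 2572.
  -- Altogether 2 + 7002/8 + 2572 < 3500.
  have hbound : 2 * γ * ∑ τ ∈ selBefore Z s t, qErr S W (p τ) τ i ≤ n * (2572 * ρ) := by
    have h1 : γ * S.logTerm = (n + 1) * ρ := by
      have := S.gam_mul_logTerm_div (t := n + 1) (by omega)
      rw [div_eq_iff (by positivity)] at this
      rw [this]
      push_cast
      ring
    have h2 : (n : ℝ) + 1 ≤ 2 * n := by
      have : (1 : ℝ) ≤ n := by exact_mod_cast hn1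
      linarith
    calc 2 * γ * ∑ τ ∈ selBefore Z s t, qErr S W (p τ) τ i
        ≤ 2 * γ * ((3 * 1 ^ 2 + 640) * S.logTerm) := by gcongr
      _ = 1286 * (γ * S.logTerm) := by ring
      _ = 1286 * ((n + 1) * ρ) := by rw [h1]
      _ ≤ 1286 * (2 * n * ρ) := by gcongr
      _ = _ := by ring
  have h1 : (n : ℝ) * E ≤ n * (R / 4 + 3500 * ρ) := by nlinarith
  exact le_of_mul_le_mul_left h1 hn0

theorem gapValue_eq {w : X → A → ℝ} (hw : IsPolicy w) (i : ι) : gapValue S W b i w =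
    polValue S (W.D b) i (pureWeight (S.greedy i)) - polValue S (W.D b) i w :=
  integral_sum_gap hw i _

/-- Predicted regrets are bounded by true regrets. -/
theorem gapValue_oracle_le (t : ℕ) (h : NearStationary S W Z s b obs p t)
    {w : X → A → ℝ} (hw : IsPolicy w) :
    gapValue S W b (S.oracle (selHist Z obs s t)) w ≤
      2 * polRegret S W b w + 7000 * S.rho ((selBefore Z s t).card + 1) := by
  induction t using Nat.strong_induction_on generalizing w with
  | _ t ih =>
    -- Before the first selected round the predicted regret is at most 1, which is below `7000
    -- ρ(1)`.
    rcases Finset.eq_empty_or_nonempty (selBefore Z s t) with he | hne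
    · have h1 : gapValue S W b (S.oracle (selHist Z obs s t)) w ≤ 1 :=
        (integral_mem_Icc (hw.measurable_sum (measurable_gap _))
          (hw.sum_mem_Icc fun x a => ⟨S.gap_nonneg _ x a, S.gap_le_one _ x a⟩)).2
      rw [he, Finset.card_empty, zero_add]
      have := S.half_le_rho_one
      have := polRegret_nonneg (S := S) (W := W) (b := b) hw
      linarith
    · set i := S.oracle (selHist Z obs s t) with hi
      have key : ∀ {v : X → A → ℝ}, IsPolicy v → |polValue S (W.D b) i v -
          polValue S (W.D b) (W.star b) v| ≤
          polRegret S W b v / 4 + 3500 * S.rho ((selBefore Z s t).card + 1) := fun {v} hv =>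
        abs_polValue_oracle_sub_le h hne hv fun τ hτ =>
          ih τ (mem_selBefore.1 hτ).1.2 (h.of_le (mem_selBefore.1 hτ).1.2.le
            (h.start_le_sel τ hτ)) hv
      -- Using `key` for the greedy policy of `i` and for `w`, the predicted regret is at most
      -- (5/4)·R(w) - (3/4)·R(greedy) + 2·3500ρ. Hence the constant 7000 reproduces itself.
      have hg := isPolicy_pureWeight_greedy S i
      have h1 := (abs_le.1 (key hg)).2
      have h2 := (abs_le.1 (key hw)).1
      have h3 := polRegret_nonneg (S := S) (W := W) (b := b) hg
      have h4 := polRegret_nonneg (S := S) (W := W) (b := b) hw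
      rw [gapValue_eq hw]
      unfold polRegret at *
      linarith

theorem abs_polValue_oracle_le {t : ℕ} (h : NearStationary S W Z s b obs p t)
    (hne : (selBefore Z s t).Nonempty) {w : X → A → ℝ} (hw : IsPolicy w) :
    |polValue S (W.D b) (S.oracle (selHist Z obs s t)) w -
      polValue S (W.D b) (W.star b) w| ≤
      polRegret S W b w / 4 + 3500 * S.rho ((selBefore Z s t).card + 1) :=
  abs_polValue_oracle_sub_le h hne hw fun τ hτ =>
    gapValue_oracle_le τ (h.of_le (mem_selBefore.1 hτ).1.2.le (h.start_le_sel τ hτ)) hw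

/-- The oracle predicts the value of its greedy policy well, under the contexts of round `b`. -/
theorem abs_polValue_oracle_greedy_le {t : ℕ} (h : NearStationary S W Z s b obs p t)
    (hne : (selBefore Z s t).Nonempty) :
    |polValue S (W.D b) (S.oracle (selHist Z obs s t))
      (pureWeight (S.greedy (S.oracle (selHist Z obs s t)))) - bestValue S W b| ≤
      3500 * S.rho ((selBefore Z s t).card + 1) := by
  set i := S.oracle (selHist Z obs s t) with hi
  have hg := isPolicy_pureWeight_greedy S i
  have hs := isPolicy_pureWeight_greedy S (W.star b)
  have h1 := abs_le.1 (abs_polValue_oracle_le h hne hg)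
  have h2 := abs_le.1 (abs_polValue_oracle_le h hne hs)
  have h3 := polRegret_nonneg (S := S) (W := W) (b := b) hg
  have h4 := polValue_le_greedy (S := S) hs i (W.D b)
  -- Lower bound: the optimal policy has no regret, so its value is predicted within 3500ρ, and the
  -- greedy policy of `i` maximizes the prediction. Upper bound: the error R/4 of the greedy policy
  -- is absorbed by its own deficit R.
  have h5 : polRegret S W b (pureWeight (S.greedy (W.star b))) = 0 := by
    rw [polRegret, bestValue_eq, sub_self]
  rw [h5] at h2
  rw [polRegret, bestValue_eq] at h1 h3
  rw [← hi] at h1 h2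
  rw [bestValue_eq, abs_le]
  constructor <;> linarith

/-- The policy played by FALCON has small regret. -/
theorem polRegret_falconProb_le {t : ℕ} (h : NearStationary S W Z s b obs p t)
    (hne : (selBefore Z s t).Nonempty) :
    polRegret S W b (S.falconProb (selHist Z obs s t)) ≤
      10000 * S.rho ((selBefore Z s t).card + 1) := by
  set i := S.oracle (selHist Z obs s t) with hi
  set w := S.falconProb (selHist Z obs s t) with hw'
  have hw : IsPolicy w := isPolicy_falconProb _
  have h1 := abs_le.1 (abs_polValue_oracle_le h hne hw)
  have h2 := abs_le.1 (abs_polValue_oracle_greedy_le h hne)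
  rw [← hi] at h1 h2
  -- Exploration costs A/γ = ρ in predicted regret. The true regret R then satisfies R ≤ R/4 +
  -- 7001ρ, so R < 10000ρ.
  have h3 : gapValue S W b i w ≤ S.rho ((selBefore Z s t).card + 1) := by
    refine (integral_mem_Icc (c := 0) (hw.measurable_sum (measurable_gap _)) fun x => ⟨?_, ?_⟩).2
    · exact Finset.sum_nonneg fun a _ => mul_nonneg (hw.nonneg x a) (S.gap_nonneg _ x a)
    · rw [hw', S.falconProb_eq, length_selHist, ← hi]
      have hg := S.gam_pos (t := (selBefore Z s t).card + 1) (by omega)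
      refine (sum_igwProb_mul_gap_le hg i x).trans_eq ?_
      rw [← S.gam_mul_rho (t := (selBefore Z s t).card + 1) (by omega)]
      field_simp
  have h4 := gapValue_eq (S := S) (W := W) (b := b) hw i
  have h5 := S.rho_pos (t := (selBefore Z s t).card + 1) (by omega)
  unfold polRegret at *
  linarith

/-- The policy is played in round `t` but compared with the optimum of round `b`; the extra ρ is the
drift in between. -/
theorem bestValue_sub_le_polValue_falconProb {t : ℕ} (h : NearStationary S W Z s b obs p t) :
    bestValue S W b - 10001 * S.rho ((selBefore Z s t).card + 1) ≤
      polValue S (W.D t) (W.star t) (S.falconProb (selHist Z obs s t)) := by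
  have hw : IsPolicy (S.falconProb (selHist Z obs s t)) := isPolicy_falconProb _
  have h0 := S.rho_pos (t := (selBefore Z s t).card + 1) (by omega)
  rcases Finset.eq_empty_or_nonempty (selBefore Z s t) with he | hne
  · have h1 := (polValue_mem (S := S) hw (W.star t) (W.D t)).1
    have h2 := (bestValue_mem (S := S) (W := W) b).2
    rw [he, Finset.card_empty, zero_add]
    have := S.half_le_rho_one
    linarith
  · have h1 := polRegret_falconProb_le h hne
    have h2 := (abs_le.1 (abs_polValue_star_sub_le (S := S) (W := W) hw h.start_le)).2
    have h3 := h.drift_le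
    unfold polRegret at h1
    linarith

/-- The average prediction of the oracle for its greedy policy over the past contexts
distributions. -/
theorem abs_sum_greedyVal_sub_le {t : ℕ} (h : NearStationary S W Z s b obs p t)
    (hne : (selBefore Z s t).Nonempty) :
    |(∑ τ ∈ selBefore Z s t, greedyVal S W τ (S.oracle (selHist Z obs s t))) /
      ((selBefore Z s t).card : ℝ) - bestValue S W b| ≤
      3501 * S.rho ((selBefore Z s t).card + 1) := by
  set i := S.oracle (selHist Z obs s t) with hi
  have hn0 : (0 : ℝ) < (selBefore Z s t).card := by exact_mod_cast hne.card_pos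
  have h1 := abs_le.1 (abs_polValue_oracle_greedy_le h hne)
  rw [← hi] at h1
  have h2 : ∀ τ ∈ selBefore Z s t, |greedyVal S W τ i - bestValue S W b| ≤
      3501 * S.rho ((selBefore Z s t).card + 1) := by
    intro τ hτ
    have h3 := abs_le.1 (abs_polValue_sub_le (S := S) (W := W) (isPolicy_pureWeight_greedy S i) i
      (h.start_le_sel τ hτ))
    have h4 : total (drift S W) b τ ≤ S.rho ((selBefore Z s t).card + 1) :=
      (total_mono (drift_nonneg S W) le_rfl (mem_selBefore.1 hτ).1.2.le).trans h.drift_le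
    rw [polValue_pureWeight (W.D τ)] at h3
    unfold greedyVal
    rw [abs_le]
    constructor <;> linarith
  have h3 : (∑ τ ∈ selBefore Z s t, greedyVal S W τ i) / ((selBefore Z s t).card : ℝ) -
      bestValue S W b = (∑ τ ∈ selBefore Z s t, (greedyVal S W τ i - bestValue S W b)) /
        ((selBefore Z s t).card : ℝ) := by
    rw [Finset.sum_sub_distrib, Finset.sum_const, nsmul_eq_mul]
    field_simp
  rw [h3, abs_div, abs_of_pos hn0, div_le_iff₀ hn0]
  refine (Finset.abs_sum_le_sum_abs _ _).trans ((Finset.sum_le_sum h2).trans_eq ?_)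
  rw [Finset.sum_const, nsmul_eq_mul]
  ring

/-- Converts a Hoeffding deviation over n rounds into the rate at n + 1; the factor 2 pays for the
shifted index. -/
theorem Setup.sqrt_logTerm_mul_le (S : Setup X A ι) {n : ℕ} (hn : 1 ≤ n) :
    √(S.logTerm * n) ≤ n * (2 * S.rho (n + 1)) := by
  have hn0 : (1 : ℝ) ≤ n := by exact_mod_cast hn
  have hΛ := S.logTerm_pos
  have hA := S.one_le_numA
  rw [Real.sqrt_le_left (by have := S.rho_nonneg (n + 1); positivity), mul_pow, mul_pow, Setup.rho,
    Real.sq_sqrt (by positivity)]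
  push_cast
  rw [← sub_nonneg]
  have : (n : ℝ) ^ 2 * (2 ^ 2 * (S.numA * S.logTerm / (n + 1))) - S.logTerm * n =
      S.logTerm * n * (4 * n * S.numA - (n + 1)) / (n + 1) := by
    field_simp
    ring
  rw [this]
  apply div_nonneg _ (by positivity)
  apply mul_nonneg (by positivity)
  nlinarith

/-- Passing from context distributions to observed contexts adds 21·2 = 42 to the constant 3501. The
rounded total 4000 is the constant of the bonus. -/
theorem abs_sum_greedy_sub_le {t : ℕ} (h : NearStationary S W Z s b obs p t)
    (hne : (selBefore Z s t).Nonempty) :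
    |((selHist Z obs s t).map fun o => S.reg (S.oracle (selHist Z obs s t)) o.1
        (S.greedy (S.oracle (selHist Z obs s t)) o.1)).sum / ((selHist Z obs s t).length : ℝ) -
        bestValue S W b| ≤ 4000 * S.rho ((selBefore Z s t).card + 1) := by
  have h1 := abs_le.1 (abs_sum_greedyVal_sub_le h hne)
  rw [sum_map_selHist, length_selHist]
  set i := S.oracle (selHist Z obs s t) with hi
  have h2 := h.conc.greedy t h.le_T i
  set n := (selBefore Z s t).card with hn
  have hn1 : 1 ≤ n := hne.card_pos
  have hn0 : (0 : ℝ) < n := by exact_mod_cast hn1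
  have h3 := S.sqrt_logTerm_mul_le hn1
  have h4 : |(∑ τ ∈ selBefore Z s t, S.reg i (obs τ).1 (S.greedy i (obs τ).1)) / (n : ℝ) -
      (∑ τ ∈ selBefore Z s t, greedyVal S W τ i) / (n : ℝ)| ≤ 42 * S.rho (n + 1) := by
    rw [← sub_div, ← Finset.sum_sub_distrib, abs_div, abs_of_pos hn0, div_le_iff₀ hn0]
    linarith
  have h5 := abs_le.1 h4
  have h6 := S.rho_pos (t := n + 1) (by omega)
  rw [abs_le]
  constructor <;> linarith

/-- FALCON's optimistic quantity is an upper bound of the optimal value, up to its bonus. -/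
theorem falconOpt_bounds {t : ℕ} (h : NearStationary S W Z s b obs p t) :
    bestValue S W b ≤ S.falconOpt 4000 (selHist Z obs s t) ∧
      S.falconOpt 4000 (selHist Z obs s t) ≤
        bestValue S W b + 8000 * S.rho ((selBefore Z s t).card + 1) := by
  have h2 := bestValue_mem (S := S) (W := W) b
  unfold Setup.falconOpt
  rcases Finset.eq_empty_or_nonempty (selBefore Z s t) with he | hne
  -- Empty history: the average is 0/0 = 0 and the bonus exceeds 1, so the quantity equals its cap
  -- 1.
  · have h1 : (selHist Z obs s t).length = 0 := by rw [length_selHist, he, Finset.card_empty]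
    rw [List.length_eq_zero_iff] at h1
    have := S.half_le_rho_one
    rw [h1, he, Finset.card_empty, zero_add, List.length_nil, zero_add, List.map_nil, List.sum_nil,
      zero_div, zero_add, min_eq_left (by linarith)]
    exact ⟨h2.2, by linarith [h2.1]⟩
  · have h1 := abs_le.1 (abs_sum_greedy_sub_le h hne)
    rw [length_selHist] at *
    constructor
    · exact le_min h2.2 (by linarith)
    · exact (min_le_right _ _).trans (by linarith)

/-- The count of selected rounds advances by one at each selected round, so this is the estimate of
∑ k^(-1/2) by 2√n. -/
theorem sum_rho_card_le (S : Setup X A ι) (Z : ℕ → Prop) (s t : ℕ) :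
    ∑ τ ∈ selBefore Z s t, S.rho ((selBefore Z s τ).card + 1) ≤
      2 * √(S.numA * S.logTerm * (selBefore Z s t).card) := by
  induction t with
  | zero => simp [selBefore]
  | succ t ih =>
    by_cases hZ : s ≤ t ∧ Z t
    · rw [card_selBefore_succ_of_sel hZ.1 hZ.2, selBefore_succ_of_sel hZ.1 hZ.2,
        Finset.sum_insert (by simp [mem_selBefore])]
      set n := (selBefore Z s t).card
      have hA := S.numA_pos
      have hΛ := S.logTerm_pos
      set a := S.numA * S.logTerm with ha
      have ha0 : 0 < a := by positivity
      have h1 : S.rho (n + 1) = √a / √((n + 1 : ℕ) : ℝ) := by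
        rw [Setup.rho, Real.sqrt_div ha0.le]
      have h2 : √a / √((n + 1 : ℕ) : ℝ) + 2 * √(a * n) ≤ 2 * √(a * ((n + 1 : ℕ) : ℝ)) := by
        rw [Real.sqrt_mul ha0.le, Real.sqrt_mul ha0.le]
        have h3 : 0 < √((n + 1 : ℕ) : ℝ) := Real.sqrt_pos.2 (by positivity)
        have h4 := Real.mul_self_sqrt (show (0 : ℝ) ≤ ((n + 1 : ℕ) : ℝ) by positivity)
        have h5 := Real.mul_self_sqrt (show (0 : ℝ) ≤ (n : ℝ) by positivity)
        have h6 := Real.sqrt_nonneg a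
        set u := √((n + 1 : ℕ) : ℝ)
        set v := √(n : ℝ)
        have h7 : 1 / u + 2 * v ≤ 2 * u := by
          rw [← sub_nonneg]
          have : 2 * u - (1 / u + 2 * v) = (u - v) ^ 2 / u := by
            field_simp
            push_cast at h4
            nlinarith
          rw [this]
          positivity
        calc √a / u + 2 * (√a * v) = √a * (1 / u + 2 * v) := by ring
          _ ≤ √a * (2 * u) := by gcongr
          _ = _ := by ring
      linarith
    · rw [selBefore_succ_of_not_sel hZ]
      exact ih

/-- The regret of FALCON on the selected rounds with respect to optimistic quantities `o`. -/
theorem sum_opt_sub_reward_le {t : ℕ} (o : ℕ → ℝ)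
    (hc : Concentrated S W Z s obs p) (hT : t ≤ S.T + 1)
    (hns : ∀ τ ∈ selBefore Z s t, NearStationary S W Z s b obs p τ)
    (hp : ∀ τ ∈ selBefore Z s t, p τ = S.falconProb (selHist Z obs s τ))
    (ho : ∀ τ ∈ selBefore Z s t,
      o τ ≤ bestValue S W b + 8000 * S.rho ((selBefore Z s τ).card + 1)) :
    ∑ τ ∈ selBefore Z s t, (o τ - (obs τ).2.2) ≤
      40000 * √(S.numA * S.logTerm * (selBefore Z s t).card) := by
  have h1 := (abs_le.1 (hc.reward t hT)).1
  rw [Finset.sum_sub_distrib] at h1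
  -- 8000 from the optimistic quantity and 10001 from the played policy. After summation 2·18001 +
  -- 21 < 40000.
  have h2 : ∀ τ ∈ selBefore Z s t, o τ - polValue S (W.D τ) (W.star τ) (p τ) ≤
      18001 * S.rho ((selBefore Z s τ).card + 1) := by
    intro τ hτ
    have h3 := ho τ hτ
    have h4 := bestValue_sub_le_polValue_falconProb (hns τ hτ)
    rw [hp τ hτ]
    linarith
  have h3 := Finset.sum_le_sum h2
  rw [Finset.sum_sub_distrib, ← Finset.mul_sum] at h3
  have h4 := sum_rho_card_le S Z s t
  have h5 : √(S.logTerm * (selBefore Z s t).card) ≤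
      √(S.numA * S.logTerm * (selBefore Z s t).card) := by
    apply Real.sqrt_le_sqrt
    have := S.one_le_numA
    have := S.logTerm_pos
    gcongr
    nlinarith
  rw [Finset.sum_sub_distrib]
  have h6 := Real.sqrt_nonneg (S.numA * S.logTerm * (selBefore Z s t).card)
  linarith

end FalconAnalysis

end RealizableBandit

namespace RealizableBandit

/-! ### Conditional means in a run -/

section Moments

variable {X A ι Ω Ξ : Type*} [MeasurableSpace X] [MeasurableSpace A] [MeasurableSingletonClass A]
  [Fintype A] [Fintype ι] [mΩ : MeasurableSpace Ω] [MeasurableSpace Ξ]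
  {S : Setup X A ι} {W : World X ι} {P : Measure Ω} [IsProbabilityMeasure P]
  {seed : ℕ → Ω → Ξ} {obs : ℕ → Ω → Obs X A} {p : ℕ → Ω → X → A → ℝ}

/-- Conditional expectations enter only in this weak form, tested against bounded functions of the
past. -/
theorem integral_mul_condExp_eq {m : MeasurableSpace Ω} (hm : m ≤ mΩ) {f g : Ω → ℝ} {C : ℝ}
    (hf : Measurable[m] f) (hC : ∀ ω, |f ω| ≤ C) (hg : Integrable g P) :
    ∫ ω, f ω * g ω ∂P = ∫ ω, f ω * (P[g | m]) ω ∂P := by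
  have hfg : Integrable (f * g) P :=
    hg.bdd_mul (hf.mono hm le_rfl).aestronglyMeasurable (c := C) (Filter.Eventually.of_forall hC)
  have h1 := condExp_mul_of_stronglyMeasurable_left (μ := P) (m := m) hf.stronglyMeasurable hfg hg
  calc ∫ ω, f ω * g ω ∂P = ∫ ω, (P[f * g | m]) ω ∂P := (integral_condExp hm).symm
    _ = _ := integral_congr_ae h1

/-- All information before the seed of round `t` is drawn. -/
abbrev pastInfo (seed : ℕ → Ω → Ξ) (obs : ℕ → Ω → Obs X A) (t : ℕ) : MeasurableSpace Ω :=
  obsInfo obs t ⊔ seedInfo seed t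

theorem obsInfo_mono (obs : ℕ → Ω → Obs X A) {s t : ℕ} (h : s ≤ t) :
    obsInfo obs s ≤ obsInfo obs t :=
  biSup_mono fun τ hτ => by rw [Finset.mem_Ico] at *; omega

theorem seedInfo_mono (seed : ℕ → Ω → Ξ) {s t : ℕ} (h : s ≤ t) :
    seedInfo seed s ≤ seedInfo seed t :=
  biSup_mono fun τ hτ => by rw [Finset.mem_Ico] at *; omega

theorem pastInfo_mono (seed : ℕ → Ω → Ξ) (obs : ℕ → Ω → Obs X A) {s t : ℕ} (h : s ≤ t) :
    pastInfo seed obs s ≤ pastInfo seed obs t :=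
  sup_le_sup (obsInfo_mono obs h) (seedInfo_mono seed h)

theorem pastInfo_le_preInfo (seed : ℕ → Ω → Ξ) (obs : ℕ → Ω → Obs X A) (t : ℕ) :
    pastInfo seed obs t ≤ preInfo seed obs t :=
  sup_le_sup le_rfl (seedInfo_mono seed (Nat.le_succ t))

theorem preInfo_le_pastInfo (seed : ℕ → Ω → Ξ) (obs : ℕ → Ω → Obs X A) (t : ℕ) :
    preInfo seed obs t ≤ pastInfo seed obs (t + 1) :=
  sup_le_sup (obsInfo_mono obs (Nat.le_succ t)) le_rfl

theorem measurable_obs_obsInfo (obs : ℕ → Ω → Obs X A) {s t : ℕ} (hs : 1 ≤ s) (hst : s < t) :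
    Measurable[obsInfo obs t] (obs s) := by
  rw [measurable_iff_comap_le]
  exact le_iSup₂_of_le s (Finset.mem_Ico.2 ⟨hs, hst⟩) le_rfl

theorem measurable_obs_pastInfo (seed : ℕ → Ω → Ξ) (obs : ℕ → Ω → Obs X A) {s t : ℕ} (hs : 1 ≤ s)
    (hst : s < t) : Measurable[pastInfo seed obs t] (obs s) :=
  (measurable_obs_obsInfo obs hs hst).mono le_sup_left le_rfl

theorem measurable_seed_seedInfo (seed : ℕ → Ω → Ξ) {s t : ℕ} (hs : 1 ≤ s) (hst : s < t) :
    Measurable[seedInfo seed t] (seed s) := by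
  rw [measurable_iff_comap_le]
  exact le_iSup₂_of_le s (Finset.mem_Ico.2 ⟨hs, hst⟩) le_rfl

theorem IsRun.pastInfo_le (h : IsRun S W P seed obs p) (t : ℕ) : pastInfo seed obs t ≤ mΩ :=
  sup_le (iSup₂_le fun s _ => (h.obs_meas s).comap_le)
    (iSup₂_le fun s _ => (h.seed_meas s).comap_le)

theorem IsRun.preInfo_le (h : IsRun S W P seed obs p) (t : ℕ) : preInfo seed obs t ≤ mΩ :=
  (preInfo_le_pastInfo seed obs t).trans (h.pastInfo_le (t + 1))

/-- The distribution played in round `t` is the inverse gap weighting given by the predictable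
regressor and history length `J t`. -/
structure PlaysIgw (S : Setup X A ι) (seed : ℕ → Ω → Ξ) (obs : ℕ → Ω → Obs X A)
    (p : ℕ → Ω → X → A → ℝ) (J : ℕ → Ω → ι × ℕ) : Prop where
  eq : ∀ t ∈ Finset.Icc 1 S.T, ∀ ω, p t ω = S.igwProb (S.gam ((J t ω).2 + 1)) (J t ω).1
  meas : ∀ t ∈ Finset.Icc 1 S.T, ∀ j, MeasurableSet[preInfo seed obs t] {ω | J t ω = j}
  le : ∀ t ∈ Finset.Icc 1 S.T, ∀ ω, (J t ω).2 ≤ t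

theorem measurable_comp_of_countable {α β : Type*} [Countable α] [MeasurableSpace β]
    {m : MeasurableSpace Ω} {J : Ω → α} (hJ : ∀ j, MeasurableSet[m] {ω | J ω = j}) (G : α → β) :
    Measurable[m] fun ω => G (J ω) := by
  intro s _
  have : (fun ω => G (J ω)) ⁻¹' s = ⋃ j ∈ {j | G j ∈ s}, {ω | J ω = j} := by
    ext ω
    simp
  rw [this]
  exact MeasurableSet.biUnion (Set.to_countable _) fun j _ => hJ j

variable {J : ℕ → Ω → ι × ℕ}

theorem IsRun.measurable_context (h : IsRun S W P seed obs p) (t : ℕ) :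
    Measurable fun ω => (obs t ω).1 := (h.obs_meas t).fst

/-- The conditional mean of a function of context and action. -/
theorem IsRun.integral_mul_context_action (h : IsRun S W P seed obs p)
    (hJ : PlaysIgw S seed obs p J) {t : ℕ} (ht : t ∈ Finset.Icc 1 S.T) {M : Ω → ℝ} {C : ℝ}
    (hM : Measurable[preInfo seed obs t] M) (hMC : ∀ ω, |M ω| ≤ C) {g : X → A → ℝ} {D : ℝ}
    (hg : ∀ a, Measurable fun x => g x a) (hgD : ∀ x a, |g x a| ≤ D) :
    ∫ ω, M ω * g (obs t ω).1 (obs t ω).2.1 ∂P =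
      ∫ ω, M ω * ∫ x, ∑ a, p t ω x a * g x a ∂(W.D t) ∂P := by
  classical
  have hle := h.preInfo_le t
  have hM' : Measurable M := hM.mono hle le_rfl
  have hx := h.measurable_context t
  -- The played distribution is one of finitely many fixed kernels `q j`. Splitting on the
  -- predictable index `J t` replaces the random kernel by a fixed function of the context, and then
  -- independence of the context from the past factors the integral.
  set q : ι × ℕ → X → A → ℝ := fun j => S.igwProb (S.gam (j.2 + 1)) j.1 with hq
  have hqm : ∀ j a, Measurable fun x => q j x a := fun j a => measurable_igwProb _ _ _
  have hq1 : ∀ j x a, |q j x a| ≤ 1 := fun j x a => by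
    rw [abs_of_nonneg (igwProb_pos (S.gam_nonneg _) _ _ _).le]
    exact igwProb_le_one (S.gam_nonneg _) _ _ _
  set F : Finset (ι × ℕ) := Finset.univ ×ˢ Finset.range (t + 1) with hF
  have hJF : ∀ ω, J t ω ∈ F := fun ω => by
    simpa [hF] using Nat.lt_succ_of_le (hJ.le t ht ω)
  set N : ι × ℕ → Ω → ℝ := fun j ω => if J t ω = j then M ω else 0 with hN
  have hNm : ∀ j, Measurable[preInfo seed obs t] (N j) := fun j =>
    Measurable.ite (hJ.meas t ht j) hM measurable_const
  have hNC : ∀ j ω, |N j ω| ≤ C := fun j ω => by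
    simp only [hN]
    split_ifs
    · exact hMC ω
    · rw [abs_zero]
      exact (abs_nonneg _).trans (hMC ω)
  have hbint : ∀ (f : Ω → ℝ) (c : ℝ), Measurable f → (∀ ω, |f ω| ≤ c) → Integrable f P :=
    fun f c hf hc => Integrable.of_bound hf.aestronglyMeasurable c (Filter.Eventually.of_forall hc)
  have hD0 : 0 ≤ D := by
    obtain ⟨a⟩ := S.nonempty_act
    have hX : Nonempty X := by
      have := (W.D t).nonempty_of_neZero
      exact this
    obtain ⟨x⟩ := hX
    exact (abs_nonneg _).trans (hgD x a)
  have hC0 : 0 ≤ C := by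
    obtain ⟨ω⟩ := P.nonempty_of_neZero
    exact (abs_nonneg _).trans (hMC ω)
  -- the part of the integral on one action
  have h1 : ∀ b : A, ∫ ω, M ω * g (obs t ω).1 b *
      Set.indicator {ω | (obs t ω).2.1 = b} (fun _ => (1 : ℝ)) ω ∂P =
      ∑ j ∈ F, ∫ ω, N j ω * ∫ x, g x b * q j x b ∂(W.D t) ∂P := by
    intro b
    have hm : preInfo seed obs t ⊔ MeasurableSpace.comap (fun ω => (obs t ω).1) inferInstance ≤ mΩ :=
      sup_le hle hx.comap_le
    have hf : Measurable[preInfo seed obs t ⊔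
        MeasurableSpace.comap (fun ω => (obs t ω).1) inferInstance]
        fun ω => M ω * g (obs t ω).1 b := by
      refine Measurable.mul (hM.mono le_sup_left le_rfl) ?_
      exact (hg b).comp ((comap_measurable _).mono le_sup_right le_rfl)
    have hind : Integrable (Set.indicator {ω | (obs t ω).2.1 = b} (fun _ => (1 : ℝ))) P :=
      (integrable_const (1 : ℝ)).indicator
        ((h.obs_meas t).snd.fst (measurableSet_singleton b))
    rw [integral_mul_condExp_eq hm (C := C * D) hf (fun ω => by
      rw [abs_mul]; exact mul_le_mul (hMC ω) (hgD _ _) (abs_nonneg _) hC0) hind]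
    have h2 : ∫ ω, M ω * g (obs t ω).1 b * (P[Set.indicator {ω | (obs t ω).2.1 = b}
        (fun _ => (1 : ℝ)) | preInfo seed obs t ⊔
          MeasurableSpace.comap (fun ω => (obs t ω).1) inferInstance]) ω ∂P =
        ∫ ω, ∑ j ∈ F, N j ω * (g (obs t ω).1 b * q j (obs t ω).1 b) ∂P := by
      refine integral_congr_ae ?_
      filter_upwards [h.action_law t ht b] with ω hω
      rw [hω, hJ.eq t ht ω, Finset.sum_eq_single (J t ω)]
      · simp only [hN, if_true, hq]
        ring
      · intro j _ hj
        simp only [hN, if_neg hj.symm, zero_mul]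
      · intro hj
        exact absurd (hJF ω) hj
    rw [h2, integral_finsetSum]
    · refine Finset.sum_congr rfl fun j _ => ?_
      have hG : Measurable fun x => g x b * q j x b := (hg b).mul (hqm j b)
      have hind : IndepFun (N j) (fun ω => g (obs t ω).1 b * q j (obs t ω).1 b) P := by
        rw [IndepFun_iff_Indep]
        refine indep_of_indep_of_le_left (indep_of_indep_of_le_right (h.context_indep t ht).symm ?_)
          (hNm j).comap_le
        rw [← measurable_iff_comap_le]
        exact hG.comp (comap_measurable _)
      have h3 := hind.integral_fun_mul_eq_mul_integral
        ((hNm j).mono hle le_rfl).aestronglyMeasurable (hG.comp hx).aestronglyMeasurable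
      rw [h3, integral_mul_const]
      congr 1
      rw [← h.context_law t ht]
      exact (integral_map hx.aemeasurable hG.aestronglyMeasurable).symm
    · intro j _
      refine hbint _ (C * (D * 1)) ?_ fun ω => ?_
      · exact ((hNm j).mono hle le_rfl).mul (((hg b).mul (hqm j b)).comp hx)
      · rw [abs_mul, abs_mul]
        exact mul_le_mul (hNC j ω) (mul_le_mul (hgD _ _) (hq1 _ _ _) (abs_nonneg _) hD0)
          (by positivity) hC0
  have h4 : ∫ ω, M ω * g (obs t ω).1 (obs t ω).2.1 ∂P = ∫ ω, ∑ b, M ω * g (obs t ω).1 b *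
      Set.indicator {ω | (obs t ω).2.1 = b} (fun _ => (1 : ℝ)) ω ∂P := by
    congr 1
    ext ω
    rw [Finset.sum_eq_single (obs t ω).2.1]
    · simp
    · intro b _ hb
      simp [Set.indicator, hb.symm]
    · simp
  rw [h4, integral_finsetSum]
  · simp only [h1]
    rw [Finset.sum_comm]
    have h5 : ∀ ω, M ω * ∫ x, ∑ a, p t ω x a * g x a ∂(W.D t) =
        ∑ j ∈ F, N j ω * ∑ b, ∫ x, g x b * q j x b ∂(W.D t) := by
      intro ω
      rw [Finset.sum_eq_single (J t ω)]
      · simp only [hN, if_true]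
        rw [← integral_finsetSum, hJ.eq t ht ω]
        · simp only [hq, mul_comm]
        · intro b _
          refine Integrable.of_bound ((hg b).mul (hqm _ b)).aestronglyMeasurable (D * 1)
            (Filter.Eventually.of_forall fun x => ?_)
          rw [Real.norm_eq_abs, abs_mul]
          exact mul_le_mul (hgD _ _) (hq1 _ _ _) (abs_nonneg _) hD0
      · intro j _ hj
        simp only [hN, if_neg hj.symm, zero_mul]
      · intro hj
        exact absurd (hJF ω) hj
    simp only [h5]
    rw [integral_finsetSum]
    · refine Finset.sum_congr rfl fun j _ => ?_
      rw [← integral_finsetSum]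
      · simp only [Finset.mul_sum]
      · intro b _
        exact (hbint _ C ((hNm j).mono hle le_rfl) (hNC j)).mul_const _
    · intro j _
      exact (hbint _ C ((hNm j).mono hle le_rfl) (hNC j)).mul_const _
  · intro b _
    refine hbint _ (C * D * 1) ?_ fun ω => ?_
    · refine (hM'.mul ((hg b).comp hx)).mul (measurable_const.indicator ?_)
      exact (h.obs_meas t).snd.fst (measurableSet_singleton b)
    · rw [abs_mul, abs_mul]
      refine mul_le_mul (mul_le_mul (hMC ω) (hgD _ _) (abs_nonneg _) hC0) ?_ (abs_nonneg _)
        (by positivity)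
      by_cases hb : (obs t ω).2.1 = b <;> simp [Set.indicator, hb]

theorem measurable_uncurry_act {g : X → A → ℝ} (hg : ∀ a, Measurable fun x => g x a) :
    Measurable fun q : X × A => g q.1 q.2 :=
  measurable_from_prod_countable_left hg

/-- The conditional mean of the reward, weighted by a function of context and action. -/
theorem IsRun.integral_mul_reward (h : IsRun S W P seed obs p) {t : ℕ}
    (ht : t ∈ Finset.Icc 1 S.T) {M : Ω → ℝ} {C : ℝ}
    (hM : Measurable[preInfo seed obs t] M) (hMC : ∀ ω, |M ω| ≤ C) {g : X → A → ℝ} {D : ℝ}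
    (hg : ∀ a, Measurable fun x => g x a) (hgD : ∀ x a, |g x a| ≤ D) :
    ∫ ω, M ω * (g (obs t ω).1 (obs t ω).2.1 * (obs t ω).2.2) ∂P =
      ∫ ω, M ω * (g (obs t ω).1 (obs t ω).2.1 *
        S.reg (W.star t) (obs t ω).1 (obs t ω).2.1) ∂P := by
  have hC0 : 0 ≤ C := by
    obtain ⟨ω⟩ := P.nonempty_of_neZero
    exact (abs_nonneg _).trans (hMC ω)
  have hxa : Measurable fun ω => ((obs t ω).1, (obs t ω).2.1) :=
    (h.obs_meas t).fst.prodMk (h.obs_meas t).snd.fst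
  have hm : preInfo seed obs t ⊔ MeasurableSpace.comap
      (fun ω => ((obs t ω).1, (obs t ω).2.1)) inferInstance ≤ mΩ :=
    sup_le (h.preInfo_le t) hxa.comap_le
  have hf : Measurable[preInfo seed obs t ⊔ MeasurableSpace.comap
      (fun ω => ((obs t ω).1, (obs t ω).2.1)) inferInstance]
      fun ω => M ω * g (obs t ω).1 (obs t ω).2.1 := by
    refine Measurable.mul (hM.mono le_sup_left le_rfl) ?_
    exact (measurable_uncurry_act hg).comp ((comap_measurable _).mono le_sup_right le_rfl)
  have hR : Integrable (fun ω => (obs t ω).2.2) P :=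
    Integrable.of_bound (h.obs_meas t).snd.snd.aestronglyMeasurable 1
      (Filter.Eventually.of_forall fun ω => by
        rw [Real.norm_eq_abs, abs_of_nonneg (h.reward_mem t ω).1]
        exact (h.reward_mem t ω).2)
  have h1 := integral_mul_condExp_eq hm (C := C * D) hf (fun ω => by
      rw [abs_mul]; exact mul_le_mul (hMC ω) (hgD _ _) (abs_nonneg _) hC0) hR
  simp only [← mul_assoc]
  rw [h1]
  refine integral_congr_ae ?_
  filter_upwards [h.reward_mean t ht] with ω hω
  rw [hω]

end Moments

/-! ### Exponential supermartingales -/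

section Product

variable {Ω : Type*} [mΩ : MeasurableSpace Ω] {P : Measure Ω} [IsProbabilityMeasure P]

theorem integrable_of_abs_le {f : Ω → ℝ} (hf : Measurable f) {c : ℝ} (hc : ∀ ω, |f ω| ≤ c) :
    Integrable f P :=
  Integrable.of_bound hf.aestronglyMeasurable c (Filter.Eventually.of_forall hc)

theorem integral_add_mul_add_mul {a b c : Ω → ℝ} (ha : Integrable a P) (hb : Integrable b P)
    (hc : Integrable c P) (k l : ℝ) : ∫ ω, (a ω + (k * b ω + l * c ω)) ∂P =
      ∫ ω, a ω ∂P + (k * ∫ ω, b ω ∂P + l * ∫ ω, c ω ∂P) := by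
  have h1 : Integrable (fun ω => k * b ω) P := hb.const_mul k
  have h2 : Integrable (fun ω => l * c ω) P := hc.const_mul l
  have h3 : Integrable (fun ω => k * b ω + l * c ω) P := h1.add h2
  rw [integral_add ha h3, integral_add h1 h2, integral_const_mul, integral_const_mul]

/-- A product of nonnegative factors with conditional means at most one has mean at most one. -/
theorem integral_prod_le_one {G : ℕ → MeasurableSpace Ω} (hG : Monotone G)
    {Y : ℕ → Ω → ℝ} {s N : ℕ} (hY0 : ∀ t ω, 0 ≤ Y t ω)
    (hYm : ∀ t ∈ Finset.Ico s N, Measurable[G (t + 1)] (Y t)) {c : ℝ}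
    (hYc : ∀ t ∈ Finset.Ico s N, ∀ ω, Y t ω ≤ c)
    (hstep : ∀ t ∈ Finset.Ico s N, ∀ (M : Ω → ℝ) (C : ℝ), Measurable[G t] M → (∀ ω, 0 ≤ M ω) →
      (∀ ω, |M ω| ≤ C) → ∫ ω, M ω * Y t ω ∂P ≤ ∫ ω, M ω ∂P) :
    ∫ ω, ∏ t ∈ Finset.Ico s N, Y t ω ∂P ≤ 1 := by
  rcases lt_or_ge N s with hsN | hsN
  · simp [Finset.Ico_eq_empty_of_le hsN.le]
  -- The partial product is itself an admissible weight `M` in `hstep`, which is the weak form of a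
  -- conditional mean at most one.
  have key : ∀ n, s ≤ n → n ≤ N → Measurable[G n] (fun ω => ∏ t ∈ Finset.Ico s n, Y t ω) ∧
      ∫ ω, ∏ t ∈ Finset.Ico s n, Y t ω ∂P ≤ 1 := by
    intro n hsn
    induction n, hsn using Nat.le_induction with
    | base => intro _; simp
    | succ n hsn ih =>
      intro hnN
      obtain ⟨h1, h2⟩ := ih (by omega)
      have hmem : n ∈ Finset.Ico s N := Finset.mem_Ico.2 ⟨hsn, by omega⟩
      simp only [Finset.prod_Ico_succ_top hsn]
      refine ⟨(h1.mono (hG (Nat.le_succ n)) le_rfl).mul (hYm n hmem), ?_⟩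
      refine (hstep n hmem _ (c ^ (Finset.Ico s n).card) h1
        (fun ω => Finset.prod_nonneg fun t _ => hY0 t ω) fun ω => ?_).trans h2
      rw [abs_of_nonneg (Finset.prod_nonneg fun t _ => hY0 t ω), ← Finset.prod_const]
      refine Finset.prod_le_prod (fun t _ => hY0 t ω) fun t ht => hYc t ?_ ω
      rw [Finset.mem_Ico] at *
      omega
  exact (key N hsN le_rfl).2

/-- Exponential tail bound for a product of nonnegative factors with conditional means at most
one. -/
theorem measureReal_exp_le_prod_le {G : ℕ → MeasurableSpace Ω} (hG : Monotone G)
    (hGm : ∀ t, G t ≤ mΩ) {Y : ℕ → Ω → ℝ} {s N : ℕ} (hY0 : ∀ t ω, 0 ≤ Y t ω)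
    (hYm : ∀ t ∈ Finset.Ico s N, Measurable[G (t + 1)] (Y t)) {c : ℝ}
    (hYc : ∀ t ∈ Finset.Ico s N, ∀ ω, Y t ω ≤ c)
    (hstep : ∀ t ∈ Finset.Ico s N, ∀ (M : Ω → ℝ) (C : ℝ), Measurable[G t] M → (∀ ω, 0 ≤ M ω) →
      (∀ ω, |M ω| ≤ C) → ∫ ω, M ω * Y t ω ∂P ≤ ∫ ω, M ω ∂P) (x : ℝ) :
    P.real {ω | Real.exp x ≤ ∏ t ∈ Finset.Ico s N, Y t ω} ≤ Real.exp (-x) := by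
  have h1 := integral_prod_le_one (P := P) hG hY0 hYm hYc hstep
  have h0 : ∀ ω, 0 ≤ ∏ t ∈ Finset.Ico s N, Y t ω := fun ω => Finset.prod_nonneg fun t _ => hY0 t ω
  have hi : Integrable (fun ω => ∏ t ∈ Finset.Ico s N, Y t ω) P := by
    refine integrable_of_abs_le (c := c ^ (Finset.Ico s N).card)
      (Finset.measurable_prod _ fun t ht => (hYm t ht).mono (hGm _) le_rfl) fun ω => ?_
    rw [abs_of_nonneg (h0 ω), ← Finset.prod_const]
    exact Finset.prod_le_prod (fun t _ => hY0 t ω) fun t ht => hYc t ht ω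
  have h2 := mul_meas_ge_le_integral_of_nonneg (Filter.Eventually.of_forall h0) hi (Real.exp x)
  rw [Real.exp_neg, ← one_div, le_div_iff₀ (Real.exp_pos x), mul_comm]
  exact h2.trans h1

end Product

/-! ### One step of Freedman's inequality -/

section Tail

variable {X A ι Ω Ξ : Type*} [MeasurableSpace X] [MeasurableSpace A] [MeasurableSingletonClass A]
  [Fintype A] [Fintype ι] [mΩ : MeasurableSpace Ω] [MeasurableSpace Ξ]
  {S : Setup X A ι} {W : World X ι} {P : Measure Ω} [IsProbabilityMeasure P]
  {seed : ℕ → Ω → Ξ} {obs : ℕ → Ω → Obs X A} {p : ℕ → Ω → X → A → ℝ} {J : ℕ → Ω → ι × ℕ}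

/-- The function `f + g r` of an observation with reward `r` has absolute value at most one and
second moment at most `v`. -/
structure BoundedVar (f g v : X → A → ℝ) : Prop where
  f_meas : ∀ a, Measurable fun x => f x a
  g_meas : ∀ a, Measurable fun x => g x a
  v_meas : ∀ a, Measurable fun x => v x a
  f_le : ∀ x a, |f x a| ≤ 1
  g_le : ∀ x a, |g x a| ≤ 2
  v_le : ∀ x a, |v x a| ≤ 4
  abs_le : ∀ x a, ∀ r ∈ Set.Icc (0 : ℝ) 1, |f x a + g x a * r| ≤ 1
  sq_le : ∀ x a, ∀ r ∈ Set.Icc (0 : ℝ) 1, (f x a + g x a * r) ^ 2 ≤ v x a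

/-- The mean of `g` for the context distribution of round `t` and the action distribution `q`. -/
noncomputable def meanOf (W : World X ι) (t : ℕ) (q : X → A → ℝ) (g : X → A → ℝ) : ℝ :=
  ∫ x, ∑ a, q x a * g x a ∂(W.D t)

theorem exp_le_one_add_sq {y : ℝ} (hy : |y| ≤ 1) : Real.exp y ≤ 1 + y + y ^ 2 := by
  have := abs_le.1 (Real.abs_exp_sub_one_sub_id_le hy)
  linarith [this.2]

theorem abs_meanOf_le (W : World X ι) (t : ℕ) {q g : X → A → ℝ} (hq : IsPolicy q) {c : ℝ}
    (hg : ∀ a, Measurable fun x => g x a) (hgc : ∀ x a, |g x a| ≤ c) : |meanOf W t q g| ≤ c :=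
  abs_le.2 (integral_mem_Icc (hq.measurable_sum hg)
    (hq.sum_mem_Icc fun x a => abs_le.1 (hgc x a)))

theorem PlaysIgw.isPolicy (hJ : PlaysIgw S seed obs p J) {t : ℕ} (ht : t ∈ Finset.Icc 1 S.T)
    (ω : Ω) : IsPolicy (p t ω) := by
  rw [hJ.eq t ht ω]
  exact isPolicy_igwProb S (S.gam_nonneg _) _

theorem PlaysIgw.measurable_meanOf (hJ : PlaysIgw S seed obs p J) (W : World X ι) {t : ℕ}
    (ht : t ∈ Finset.Icc 1 S.T) (g : X → A → ℝ) :
    Measurable[preInfo seed obs t] fun ω => meanOf W t (p t ω) g := by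
  simp only [hJ.eq t ht]
  exact measurable_comp_of_countable (hJ.meas t ht)
    fun j => meanOf W t (S.igwProb (S.gam (j.2 + 1)) j.1) g

open Classical in
/-- The exponent of the supermartingale used for concentration. -/
noncomputable def expTerm (W : World X ι) (obs : ℕ → Ω → Obs X A) (p : ℕ → Ω → X → A → ℝ)
    (Z : ℕ → Ω → Prop) (lam : ℝ) (f g v : ℕ → X → A → ℝ) (m : ℕ → X → A → ℝ) (t : ℕ) (ω : Ω) : ℝ :=
  if Z t ω then lam * (f t (obs t ω).1 (obs t ω).2.1 + g t (obs t ω).1 (obs t ω).2.1 *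
    (obs t ω).2.2 - meanOf W t (p t ω) (m t)) - lam ^ 2 * meanOf W t (p t ω) (v t) else 0

/-- Given the past, E exp(λV) ≤ 1 + λμ + λ²σ ≤ exp(λμ + λ²σ), where σ bounds the second moment and
not just the variance. The compensator is predictable and is moved into the weight `M'`; rounds that
are not selected contribute the factor one. -/
theorem IsRun.integral_mul_exp_le (h : IsRun S W P seed obs p) (hJ : PlaysIgw S seed obs p J)
    {t : ℕ} (ht : t ∈ Finset.Icc 1 S.T) {Z : ℕ → Ω → Prop}
    (hZ : MeasurableSet[preInfo seed obs t] {ω | Z t ω}) {f g v : ℕ → X → A → ℝ}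
    (hb : BoundedVar (f t) (g t) (v t)) {lam : ℝ} (h0 : 0 ≤ lam) (h1 : lam ≤ 1)
    {M : Ω → ℝ} {C : ℝ} (hM : Measurable[preInfo seed obs t] M) (hM0 : ∀ ω, 0 ≤ M ω)
    (hMC : ∀ ω, |M ω| ≤ C) :
    ∫ ω, M ω * Real.exp (expTerm W obs p Z lam f g v
      (fun t x a => f t x a + g t x a * S.reg (W.star t) x a) t ω) ∂P ≤ ∫ ω, M ω ∂P := by
  classical
  have hle := h.preInfo_le t
  have hM' : Measurable M := hM.mono hle le_rfl
  have hx := h.measurable_context t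
  have hxa : Measurable fun ω => ((obs t ω).1, (obs t ω).2.1) :=
    (h.obs_meas t).fst.prodMk (h.obs_meas t).snd.fst
  have hR := (h.obs_meas t).snd.snd
  have hcomp : ∀ g : X → A → ℝ, (∀ a, Measurable fun x => g x a) →
      Measurable fun ω => g (obs t ω).1 (obs t ω).2.1 := fun g hg =>
    (measurable_uncurry_act hg).comp hxa
  set m : X → A → ℝ := fun x a => f t x a + g t x a * S.reg (W.star t) x a with hm
  have hmm : ∀ a, Measurable fun x => m x a := fun a =>
    (hb.f_meas a).add ((hb.g_meas a).mul (S.reg_meas _ a))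
  have hm1 : ∀ x a, |m x a| ≤ 1 := fun x a => hb.abs_le x a _ (S.reg_mem _ x a)
  set μ : Ω → ℝ := fun ω => meanOf W t (p t ω) m with hμ
  set σ : Ω → ℝ := fun ω => meanOf W t (p t ω) (v t) with hσ
  have hμm : Measurable[preInfo seed obs t] μ := hJ.measurable_meanOf W ht m
  have hσm : Measurable[preInfo seed obs t] σ := hJ.measurable_meanOf W ht (v t)
  have hμ1 : ∀ ω, |μ ω| ≤ 1 := fun ω => abs_meanOf_le W t (hJ.isPolicy ht ω) hmm hm1
  have hσ4 : ∀ ω, |σ ω| ≤ 4 := fun ω => abs_meanOf_le W t (hJ.isPolicy ht ω) hb.v_meas hb.v_le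
  set c : Ω → ℝ := fun ω => if Z t ω then lam * μ ω + lam ^ 2 * σ ω else 0 with hc
  have hcm : Measurable[preInfo seed obs t] c :=
    Measurable.ite hZ ((hμm.const_mul lam).add (hσm.const_mul (lam ^ 2))) measurable_const
  have hc5 : ∀ ω, |c ω| ≤ 5 := by
    intro ω
    simp only [hc]
    split_ifs
    · have h2 := abs_le.1 (hμ1 ω)
      have h3 := abs_le.1 (hσ4 ω)
      have h4 : lam ^ 2 ≤ 1 := by nlinarith
      rw [abs_le]
      constructor <;> nlinarith [sq_nonneg lam]
    · norm_num
  set M' : Ω → ℝ := fun ω => M ω * Real.exp (-c ω) with hM'def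
  have hC0 : 0 ≤ C := by
    obtain ⟨ω⟩ := P.nonempty_of_neZero
    exact (abs_nonneg _).trans (hMC ω)
  have hM'm : Measurable[preInfo seed obs t] M' := hM.mul (Real.measurable_exp.comp hcm.neg)
  have hM'0 : ∀ ω, 0 ≤ M' ω := fun ω => mul_nonneg (hM0 ω) (Real.exp_pos _).le
  have hM'C : ∀ ω, |M' ω| ≤ C * Real.exp 5 := fun ω => by
    rw [abs_mul, abs_of_pos (Real.exp_pos _)]
    refine mul_le_mul (hMC ω) ?_ (Real.exp_pos _).le hC0
    exact Real.exp_le_exp.2 (by have := (abs_le.1 (hc5 ω)).1; linarith)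
  have hC'0 : 0 ≤ C * Real.exp 5 := by positivity
  set N : Ω → ℝ := fun ω => if Z t ω then M' ω else 0 with hN
  have hNm : Measurable[preInfo seed obs t] N := Measurable.ite hZ hM'm measurable_const
  have hNC : ∀ ω, |N ω| ≤ C * Real.exp 5 := fun ω => by
    simp only [hN]
    split_ifs
    · exact hM'C ω
    · simpa using hC'0
  have hN0 : ∀ ω, 0 ≤ N ω := fun ω => by
    simp only [hN]
    split_ifs
    · exact hM'0 ω
    · rfl
  -- the pieces of the integrand
  have e1 := h.integral_mul_context_action hJ ht hNm hNC hb.f_meas hb.f_le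
  have e2 := h.integral_mul_reward ht hNm hNC hb.g_meas hb.g_le
  have hgr : ∀ a, Measurable fun x => g t x a * S.reg (W.star t) x a := fun a =>
    (hb.g_meas a).mul (S.reg_meas _ a)
  have e3 := h.integral_mul_context_action hJ ht hNm hNC (g := m) (D := 1) hmm hm1
  have e4 := h.integral_mul_context_action hJ ht hNm hNC hb.v_meas hb.v_le
  have i1 : Integrable (fun ω => N ω * f t (obs t ω).1 (obs t ω).2.1) P :=
    integrable_of_abs_le (c := C * Real.exp 5 * 1)
      ((hNm.mono hle le_rfl).mul (hcomp _ hb.f_meas)) fun ω => by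
        rw [abs_mul]; exact mul_le_mul (hNC ω) (hb.f_le _ _) (abs_nonneg _) hC'0
  have i2 : Integrable (fun ω => N ω * (g t (obs t ω).1 (obs t ω).2.1 * (obs t ω).2.2)) P :=
    integrable_of_abs_le (c := C * Real.exp 5 * (2 * 1))
      ((hNm.mono hle le_rfl).mul ((hcomp _ hb.g_meas).mul hR)) fun ω => by
        rw [abs_mul, abs_mul]
        refine mul_le_mul (hNC ω) (mul_le_mul (hb.g_le _ _) ?_ (abs_nonneg _) (by norm_num))
          (by positivity) hC'0
        rw [abs_of_nonneg (h.reward_mem t ω).1]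
        exact (h.reward_mem t ω).2
  have i2' : Integrable (fun ω => N ω * (g t (obs t ω).1 (obs t ω).2.1 *
      S.reg (W.star t) (obs t ω).1 (obs t ω).2.1)) P :=
    integrable_of_abs_le (c := C * Real.exp 5 * (2 * 1))
      ((hNm.mono hle le_rfl).mul (hcomp _ hgr)) fun ω => by
        rw [abs_mul, abs_mul]
        refine mul_le_mul (hNC ω) (mul_le_mul (hb.g_le _ _) ?_ (abs_nonneg _) (by norm_num))
          (by positivity) hC'0
        rw [abs_of_nonneg (S.reg_nonneg _ _ _)]
        exact S.reg_le_one _ _ _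
  have i4 : Integrable (fun ω => N ω * v t (obs t ω).1 (obs t ω).2.1) P :=
    integrable_of_abs_le (c := C * Real.exp 5 * 4)
      ((hNm.mono hle le_rfl).mul (hcomp _ hb.v_meas)) fun ω => by
        rw [abs_mul]; exact mul_le_mul (hNC ω) (hb.v_le _ _) (abs_nonneg _) hC'0
  have iM' : Integrable M' P := integrable_of_abs_le (hM'm.mono hle le_rfl) hM'C
  have iμ : Integrable (fun ω => N ω * μ ω) P :=
    integrable_of_abs_le (c := C * Real.exp 5 * 1)
      ((hNm.mono hle le_rfl).mul (hμm.mono hle le_rfl)) fun ω => by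
        rw [abs_mul]; exact mul_le_mul (hNC ω) (hμ1 ω) (abs_nonneg _) hC'0
  have iσ : Integrable (fun ω => N ω * σ ω) P :=
    integrable_of_abs_le (c := C * Real.exp 5 * 4)
      ((hNm.mono hle le_rfl).mul (hσm.mono hle le_rfl)) fun ω => by
        rw [abs_mul]; exact mul_le_mul (hNC ω) (hσ4 ω) (abs_nonneg _) hC'0
  have iM : Integrable M P := integrable_of_abs_le hM' hMC
  have s1 : ∀ ω, M ω * Real.exp (expTerm W obs p Z lam f g v (fun t x a => f t x a + g t x a *
      S.reg (W.star t) x a) t ω) ≤ M' ω + (lam * (N ω * f t (obs t ω).1 (obs t ω).2.1 +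
        N ω * (g t (obs t ω).1 (obs t ω).2.1 * (obs t ω).2.2)) +
        lam ^ 2 * (N ω * v t (obs t ω).1 (obs t ω).2.1)) := by
    intro ω
    unfold expTerm
    by_cases hz : Z t ω
    · simp only [hN, hM'def, hc, if_pos hz]
      set V := f t (obs t ω).1 (obs t ω).2.1 + g t (obs t ω).1 (obs t ω).2.1 * (obs t ω).2.2
        with hV
      have hV1 : |V| ≤ 1 := hb.abs_le _ _ _ (h.reward_mem t ω)
      have hV2 : V ^ 2 ≤ v t (obs t ω).1 (obs t ω).2.1 := hb.sq_le _ _ _ (h.reward_mem t ω)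
      have hlV : |lam * V| ≤ 1 := by
        rw [abs_mul, abs_of_nonneg h0]
        exact mul_le_one₀ h1 (abs_nonneg _) hV1
      have h5 := exp_le_one_add_sq hlV
      have h6 : lam * (V - meanOf W t (p t ω) m) - lam ^ 2 * meanOf W t (p t ω) (v t) =
          lam * V + -(lam * μ ω + lam ^ 2 * σ ω) := by
        simp only [hμ, hσ]
        ring
      have h7 : Real.exp (lam * (V - meanOf W t (p t ω) m) -
          lam ^ 2 * meanOf W t (p t ω) (v t)) =
          Real.exp (lam * V) * Real.exp (-(lam * μ ω + lam ^ 2 * σ ω)) := by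
        rw [h6, Real.exp_add]
      rw [h7]
      have h8 : 0 ≤ M ω * Real.exp (-(lam * μ ω + lam ^ 2 * σ ω)) :=
        mul_nonneg (hM0 ω) (Real.exp_pos _).le
      have h9 : Real.exp (lam * V) ≤ 1 + lam * V + lam ^ 2 * v t (obs t ω).1 (obs t ω).2.1 := by
        have : lam ^ 2 * V ^ 2 ≤ lam ^ 2 * v t (obs t ω).1 (obs t ω).2.1 := by gcongr
        linarith [mul_pow lam V 2]
      calc M ω * (Real.exp (lam * V) * Real.exp (-(lam * μ ω + lam ^ 2 * σ ω)))
          = (M ω * Real.exp (-(lam * μ ω + lam ^ 2 * σ ω))) * Real.exp (lam * V) := by ring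
        _ ≤ (M ω * Real.exp (-(lam * μ ω + lam ^ 2 * σ ω))) *
            (1 + lam * V + lam ^ 2 * v t (obs t ω).1 (obs t ω).2.1) := by gcongr
        _ = _ := by rw [hV]; ring
    · simp [hN, hM'def, hc, if_neg hz]
  -- On selected rounds this is `1 + x ≤ exp x`, which undoes the compensator; elsewhere `M' = M`.
  have s2 : ∀ ω, M' ω + (lam * (N ω * μ ω) + lam ^ 2 * (N ω * σ ω)) ≤ M ω := by
    intro ω
    by_cases hz : Z t ω
    · simp only [hN, hM'def, hc, if_pos hz]
      have h5 := Real.add_one_le_exp (lam * μ ω + lam ^ 2 * σ ω)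
      have h8 : 0 ≤ M ω * Real.exp (-(lam * μ ω + lam ^ 2 * σ ω)) :=
        mul_nonneg (hM0 ω) (Real.exp_pos _).le
      calc _ = (M ω * Real.exp (-(lam * μ ω + lam ^ 2 * σ ω))) *
            (lam * μ ω + lam ^ 2 * σ ω + 1) := by ring
        _ ≤ (M ω * Real.exp (-(lam * μ ω + lam ^ 2 * σ ω))) *
            Real.exp (lam * μ ω + lam ^ 2 * σ ω) := by gcongr
        _ = M ω := by rw [mul_assoc, ← Real.exp_add]; simp
    · simp [hN, hM'def, hc, if_neg hz]
  have e5 : ∫ ω, N ω * f t (obs t ω).1 (obs t ω).2.1 ∂P +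
      ∫ ω, N ω * (g t (obs t ω).1 (obs t ω).2.1 * (obs t ω).2.2) ∂P = ∫ ω, N ω * μ ω ∂P := by
    rw [e2, ← integral_add i1 i2']
    simp only [← mul_add]
    exact e3
  have e6 : ∫ ω, N ω * v t (obs t ω).1 (obs t ω).2.1 ∂P = ∫ ω, N ω * σ ω ∂P := e4
  have i12 : Integrable (fun ω => N ω * f t (obs t ω).1 (obs t ω).2.1 +
      N ω * (g t (obs t ω).1 (obs t ω).2.1 * (obs t ω).2.2)) P := i1.add i2
  have iall : Integrable (fun ω => M' ω + (lam * (N ω * f t (obs t ω).1 (obs t ω).2.1 +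
        N ω * (g t (obs t ω).1 (obs t ω).2.1 * (obs t ω).2.2)) +
        lam ^ 2 * (N ω * v t (obs t ω).1 (obs t ω).2.1))) P :=
    iM'.add (((i1.add i2).const_mul lam).add (i4.const_mul (lam ^ 2)))
  calc _ ≤ ∫ ω, (M' ω + (lam * (N ω * f t (obs t ω).1 (obs t ω).2.1 +
        N ω * (g t (obs t ω).1 (obs t ω).2.1 * (obs t ω).2.2)) +
        lam ^ 2 * (N ω * v t (obs t ω).1 (obs t ω).2.1))) ∂P :=
        integral_mono_of_nonneg
          (Filter.Eventually.of_forall fun ω => mul_nonneg (hM0 ω) (Real.exp_pos _).le) iall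
          (Filter.Eventually.of_forall s1)
    _ = ∫ ω, (M' ω + (lam * (N ω * μ ω) + lam ^ 2 * (N ω * σ ω))) ∂P := by
        rw [integral_add_mul_add_mul iM' i12 i4, integral_add_mul_add_mul iM' iμ iσ,
          integral_add i1 i2, e5, e6]
    _ ≤ _ := integral_mono (iM'.add ((iμ.const_mul lam).add (iσ.const_mul (lam ^ 2)))) iM s2

end Tail

end RealizableBandit

namespace RealizableBandit

/-! ### Concentration of losses, predictions and rewards -/

section Concentration

variable {X A ι Ω Ξ : Type*} [MeasurableSpace X] [MeasurableSpace A] [MeasurableSingletonClass A]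
  [Fintype A] [Fintype ι] [mΩ : MeasurableSpace Ω] [MeasurableSpace Ξ]
  {S : Setup X A ι} {W : World X ι} {P : Measure Ω} [IsProbabilityMeasure P]
  {seed : ℕ → Ω → Ξ} {obs : ℕ → Ω → Obs X A} {p : ℕ → Ω → X → A → ℝ} {J : ℕ → Ω → ι × ℕ}

/-- The mean of `f + g R` in round `t` when the actions are drawn from `q`. -/
noncomputable def obsMean (S : Setup X A ι) (W : World X ι) (f g : ℕ → X → A → ℝ) (t : ℕ)
    (q : X → A → ℝ) : ℝ :=
  meanOf W t q fun x a => f t x a + g t x a * S.reg (W.star t) x a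

/-- Freedman's inequality for functions of the observations, along predictably selected rounds. -/
theorem IsRun.tail_le (h : IsRun S W P seed obs p) (hJ : PlaysIgw S seed obs p J)
    {Z : ℕ → Ω → Prop} (hZ : ∀ t ∈ Finset.Icc 1 S.T, MeasurableSet[preInfo seed obs t] {ω | Z t ω})
    {f g v : ℕ → X → A → ℝ} (hb : ∀ t, BoundedVar (f t) (g t) (v t)) {lam : ℝ} (h0 : 0 ≤ lam)
    (h1 : lam ≤ 1) {s N : ℕ} (hs : 1 ≤ s) (hN : N ≤ S.T + 1) (x : ℝ) :
    P.real {ω | x ≤ ∑ t ∈ selBefore (fun t => Z t ω) s N,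
      (lam * (f t (obs t ω).1 (obs t ω).2.1 + g t (obs t ω).1 (obs t ω).2.1 * (obs t ω).2.2 -
        obsMean S W f g t (p t ω)) - lam ^ 2 * meanOf W t (p t ω) (v t))} ≤ Real.exp (-x) := by
  classical
  have hmem : ∀ t ∈ Finset.Ico s N, t ∈ Finset.Icc 1 S.T := fun t ht => by
    rw [Finset.mem_Ico] at ht
    rw [Finset.mem_Icc]
    omega
  set m : ℕ → X → A → ℝ := fun t x a => f t x a + g t x a * S.reg (W.star t) x a with hm
  set Y : ℕ → Ω → ℝ := fun t ω => Real.exp (expTerm W obs p Z lam f g v m t ω) with hY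
  have hmeas : ∀ t ∈ Finset.Ico s N, Measurable[pastInfo seed obs (t + 1)] (Y t) := by
    intro t ht
    have ht' := hmem t ht
    have hle := preInfo_le_pastInfo seed obs t
    have ho : Measurable[pastInfo seed obs (t + 1)] (obs t) :=
      measurable_obs_pastInfo seed obs (Finset.mem_Icc.1 ht').1 (Nat.lt_succ_self t)
    have hc : ∀ u : X → A → ℝ, (∀ a, Measurable fun x => u x a) →
        Measurable[pastInfo seed obs (t + 1)] fun ω => u (obs t ω).1 (obs t ω).2.1 := fun u hu =>
      (measurable_uncurry_act hu).comp (ho.fst.prodMk ho.snd.fst)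
    refine Real.measurable_exp.comp (Measurable.ite (hle _ (hZ t ht')) ?_ measurable_const)
    refine Measurable.sub ?_ (((hJ.measurable_meanOf W ht' _).mono hle le_rfl).const_mul _)
    refine Measurable.const_mul (Measurable.sub ?_
      ((hJ.measurable_meanOf W ht' _).mono hle le_rfl)) _
    exact (hc _ (hb t).f_meas).add ((hc _ (hb t).g_meas).mul ho.snd.snd)
  have hbound : ∀ t ∈ Finset.Ico s N, ∀ ω, Y t ω ≤ Real.exp 6 := by
    intro t ht ω
    have ht' := hmem t ht
    refine Real.exp_le_exp.2 ?_
    unfold expTerm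
    split_ifs
    · have a1 := abs_le.1 ((hb t).abs_le (obs t ω).1 (obs t ω).2.1 _ (h.reward_mem t ω))
      have a2 := abs_le.1 (abs_meanOf_le W t (hJ.isPolicy ht' ω)
        (g := m t) (c := 1) (fun a => ((hb t).f_meas a).add (((hb t).g_meas a).mul (S.reg_meas _ a)))
        fun x a => (hb t).abs_le x a _ (S.reg_mem _ x a))
      have a3 := abs_le.1 (abs_meanOf_le W t (hJ.isPolicy ht' ω) (hb t).v_meas (hb t).v_le)
      have a4 : lam ^ 2 ≤ 1 := by nlinarith
      nlinarith [sq_nonneg lam]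
    · norm_num
  have key := measureReal_exp_le_prod_le (P := P) (G := pastInfo seed obs)
    (fun s t hst => pastInfo_mono seed obs hst) h.pastInfo_le (Y := Y) (s := s) (N := N)
    (fun t ω => (Real.exp_pos _).le) hmeas hbound
    (fun t ht M C hM hM0 hMC => h.integral_mul_exp_le hJ (hmem t ht) (hZ t (hmem t ht)) (hb t)
      h0 h1 (hM.mono (pastInfo_le_preInfo seed obs t) le_rfl) hM0 hMC) x
  refine le_trans (le_of_eq ?_) key
  congr 1
  ext ω
  simp only [Set.mem_ofPred_eq, hY]
  rw [← Real.exp_sum, Real.exp_le_exp]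
  have : ∑ t ∈ Finset.Ico s N, expTerm W obs p Z lam f g v m t ω =
      ∑ t ∈ selBefore (fun t => Z t ω) s N,
      (lam * (f t (obs t ω).1 (obs t ω).2.1 + g t (obs t ω).1 (obs t ω).2.1 * (obs t ω).2.2 -
        obsMean S W f g t (p t ω)) - lam ^ 2 * meanOf W t (p t ω) (v t)) := by
    unfold selBefore expTerm
    rw [Finset.sum_filter]
    rfl
  rw [this]

/-- Hoeffding's inequality, uniformly over prefixes of the rounds. -/
theorem IsRun.hoeffding (h : IsRun S W P seed obs p) (hJ : PlaysIgw S seed obs p J)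
    {Z : ℕ → Ω → Prop} (hZ : ∀ t ∈ Finset.Icc 1 S.T, MeasurableSet[preInfo seed obs t] {ω | Z t ω})
    {f g : ℕ → X → A → ℝ} (hb : ∀ t, BoundedVar (f t) (g t) fun _ _ => 1) {s : ℕ} (hs : 1 ≤ s) :
    P.real {ω | ∃ t ≤ S.T + 1, 21 * √(S.logTerm * (selBefore (fun t => Z t ω) s t).card) <
      ∑ t ∈ selBefore (fun t => Z t ω) s t,
        (f t (obs t ω).1 (obs t ω).2.1 + g t (obs t ω).1 (obs t ω).2.1 * (obs t ω).2.2 -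
          obsMean S W f g t (p t ω))} ≤ (S.T + 2) * S.T * Real.exp (-(20 * S.logTerm)) := by
  have hΛ := S.logTerm_pos
  set V : ℕ → Ω → ℝ := fun t ω => f t (obs t ω).1 (obs t ω).2.1 +
    g t (obs t ω).1 (obs t ω).2.1 * (obs t ω).2.2 - obsMean S W f g t (p t ω) with hV
  -- The best λ depends on the number of selected rounds, which is random. The union bound therefore
  -- runs over the possible numbers `k` as well as over `t`.
  set lam : ℕ → ℝ := fun k => min 1 √(S.logTerm / k) with hlam
  have hsub : {ω | ∃ t ≤ S.T + 1, 21 * √(S.logTerm * (selBefore (fun t => Z t ω) s t).card) <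
      ∑ t ∈ selBefore (fun t => Z t ω) s t, V t ω} ⊆
      ⋃ q ∈ Finset.range (S.T + 2) ×ˢ Finset.Icc 1 S.T, {ω | 20 * S.logTerm ≤
        ∑ t ∈ selBefore (fun t => Z t ω) s q.1,
          (lam q.2 * V t ω - lam q.2 ^ 2 * meanOf W t (p t ω) fun _ _ => 1)} := by
    rintro ω ⟨t, ht, hlt⟩
    set B := selBefore (fun t => Z t ω) s t with hB
    have hBmem : ∀ τ ∈ B, τ ∈ Finset.Icc 1 S.T := fun τ hτ => by
      have := (mem_selBefore.1 hτ).1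
      rw [Finset.mem_Icc]
      omega
    have hpol : ∀ τ ∈ B, IsPolicy (p τ ω) := fun τ hτ => hJ.isPolicy (hBmem τ hτ) ω
    set n := B.card with hn
    have hnT : n ≤ S.T := (card_selBefore_le _ s t).trans (by omega)
    have hn1 : 1 ≤ n := by
      by_contra hn0
      have h0 : n = 0 := by omega
      have h1 : B = ∅ := Finset.card_eq_zero.1 (hn ▸ h0)
      rw [h1, h0] at hlt
      simp at hlt
    have hn0 : (0 : ℝ) < n := by exact_mod_cast hn1
    have hmean : ∀ τ ∈ B, meanOf W τ (p τ ω) (fun _ _ => 1) = 1 := fun τ hτ => by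
      simp [meanOf, (hpol τ hτ).sum_one]
    rcases le_or_gt S.logTerm n with hle | hgt
    · simp only [Set.mem_iUnion]
      refine ⟨(t, n), Finset.mem_product.2 ⟨Finset.mem_range.2 (Nat.lt_succ_of_le ht),
        Finset.mem_Icc.2 ⟨hn1, hnT⟩⟩, ?_⟩
      simp only [Set.mem_ofPred_eq]
      rw [Finset.sum_sub_distrib, ← Finset.mul_sum, ← Finset.mul_sum, Finset.sum_congr rfl hmean,
        Finset.sum_const, nsmul_eq_mul, mul_one, ← hn]
      have hl : lam n = √(S.logTerm / n) := by
        refine min_eq_right ?_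
        rw [Real.sqrt_le_one, div_le_one hn0]
        exact hle
      have hl2 : lam n ^ 2 * n = S.logTerm := by
        rw [hl, Real.sq_sqrt (by positivity)]
        field_simp
      have hl3 : lam n * √(S.logTerm * n) = S.logTerm := by
        rw [hl, ← Real.sqrt_mul (by positivity)]
        rw [show S.logTerm / n * (S.logTerm * n) = S.logTerm ^ 2 by field_simp]
        exact Real.sqrt_sq hΛ.le
      have hl0 : 0 ≤ lam n := le_min zero_le_one (Real.sqrt_nonneg _)
      -- λ·21√(Λn) = 21Λ and λ²n = Λ, which leaves the exponent 20Λ.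
      have h4 := mul_le_mul_of_nonneg_left hlt.le hl0
      linarith
    -- With fewer than Λ selected rounds the trivial bound 2n is already below 21√(Λn).
    · exfalso
      have h1 : ∑ τ ∈ B, V τ ω ≤ ∑ τ ∈ B, 2 := by
        refine Finset.sum_le_sum fun τ hτ => ?_
        have a1 := abs_le.1 ((hb τ).abs_le (obs τ ω).1 (obs τ ω).2.1 _ (h.reward_mem τ ω))
        have a2 := abs_le.1 (abs_meanOf_le W τ (hpol τ hτ)
          (g := fun x a => f τ x a + g τ x a * S.reg (W.star τ) x a) (c := 1)
          (fun a => ((hb τ).f_meas a).add (((hb τ).g_meas a).mul (S.reg_meas _ a)))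
          fun x a => (hb τ).abs_le x a _ (S.reg_mem _ x a))
        simp only [hV, obsMean]
        linarith
      rw [Finset.sum_const, nsmul_eq_mul, ← hn] at h1
      have h2 : (n : ℝ) ≤ √(S.logTerm * n) := by
        apply Real.le_sqrt_of_sq_le
        nlinarith
      linarith
  refine (measureReal_mono hsub (measure_ne_top _ _)).trans ((measureReal_biUnion_finset_le _ _).trans ?_)
  have hterm : ∀ q ∈ Finset.range (S.T + 2) ×ˢ Finset.Icc 1 S.T, P.real {ω | 20 * S.logTerm ≤
        ∑ t ∈ selBefore (fun t => Z t ω) s q.1,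
          (lam q.2 * V t ω - lam q.2 ^ 2 * meanOf W t (p t ω) fun _ _ => 1)} ≤
      Real.exp (-(20 * S.logTerm)) := fun q hq =>
    h.tail_le hJ hZ hb (le_min zero_le_one (Real.sqrt_nonneg _)) (min_le_left _ _) hs
      (by have := Finset.mem_range.1 (Finset.mem_product.1 hq).1; omega) _
  refine (Finset.sum_le_sum hterm).trans_eq ?_
  rw [Finset.sum_const, Finset.card_product, Finset.card_range, Nat.card_Icc, nsmul_eq_mul]
  push_cast
  simp

/-- The difference factors as (a - c)(a + c - 2r). So the second moment of the excess loss is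
controlled by the squared error itself, which is what yields the fast rate O(Λ). -/
theorem sq_sub_sq_bound {a c r : ℝ} (ha : a ∈ Set.Icc (0 : ℝ) 1) (hc : c ∈ Set.Icc (0 : ℝ) 1)
    (hr : r ∈ Set.Icc (0 : ℝ) 1) : |(a - r) ^ 2 - (c - r) ^ 2| ≤ 1 ∧
      ((a - r) ^ 2 - (c - r) ^ 2) ^ 2 ≤ 4 * (a - c) ^ 2 := by
  have h1 := sq_sub_mem ha hr
  have h2 := sq_sub_mem hc hr
  constructor
  · rw [abs_le]
    constructor <;> linarith [h1.1, h1.2, h2.1, h2.2]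
  · have h3 : (a - r) ^ 2 - (c - r) ^ 2 = (a - c) * (a + c - 2 * r) := by ring
    have h4 : (a + c - 2 * r) ^ 2 ≤ 4 := by
      have : |a + c - 2 * r| ≤ 2 := by
        rw [abs_le]
        constructor <;> linarith [ha.1, ha.2, hc.1, hc.2, hr.1, hr.2]
      calc (a + c - 2 * r) ^ 2 = |a + c - 2 * r| ^ 2 := (sq_abs _).symm
        _ ≤ 2 ^ 2 := pow_le_pow_left₀ (abs_nonneg _) this 2
        _ = 4 := by norm_num
    rw [h3, mul_pow]
    nlinarith [sq_nonneg (a - c)]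

theorem boundedVar_sqDiff (S : Setup X A ι) (i j : ι) {e : ℝ} (he : e = 1 ∨ e = -1) :
    BoundedVar (fun x a => e * (S.reg i x a ^ 2 - S.reg j x a ^ 2))
      (fun x a => e * (-2 * (S.reg i x a - S.reg j x a)))
      (fun x a => 4 * (S.reg i x a - S.reg j x a) ^ 2) := by
  have he1 : |e| = 1 := by rcases he with rfl | rfl <;> simp
  have he2 : e ^ 2 = 1 := by rcases he with rfl | rfl <;> simp
  have hcomb : ∀ x a r, e * (S.reg i x a ^ 2 - S.reg j x a ^ 2) +
      e * (-2 * (S.reg i x a - S.reg j x a)) * r =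
      e * ((S.reg i x a - r) ^ 2 - (S.reg j x a - r) ^ 2) := fun x a r => by ring
  have hd : ∀ x a, |S.reg i x a - S.reg j x a| ≤ 1 := fun x a => by
    have h1 := S.reg_mem i x a
    have h2 := S.reg_mem j x a
    rw [abs_le]
    constructor <;> linarith [h1.1, h1.2, h2.1, h2.2]
  refine ⟨fun a => ?_, fun a => ?_, fun a => ?_, fun x a => ?_, fun x a => ?_, fun x a => ?_,
    fun x a r hr => ?_, fun x a r hr => ?_⟩
  · exact (((S.reg_meas i a).pow_const 2).sub ((S.reg_meas j a).pow_const 2)).const_mul e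
  · exact (((S.reg_meas i a).sub (S.reg_meas j a)).const_mul (-2)).const_mul e
  · exact (measurable_sq_reg_sub i j a).const_mul 4
  · have := (sq_sub_sq_bound (S.reg_mem i x a) (S.reg_mem j x a) (r := 0) ⟨le_rfl, zero_le_one⟩).1
    rw [abs_mul, he1, one_mul]
    simpa using this
  · rw [abs_mul, he1, one_mul, abs_mul, abs_neg, abs_two]
    linarith [hd x a]
  · rw [abs_of_nonneg (by positivity)]
    linarith [(sq_sub_mem (S.reg_mem i x a) (S.reg_mem j x a)).2]
  · rw [hcomb, abs_mul, he1, one_mul]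
    exact (sq_sub_sq_bound (S.reg_mem i x a) (S.reg_mem j x a) hr).1
  · rw [hcomb, mul_pow, he2, one_mul]
    exact (sq_sub_sq_bound (S.reg_mem i x a) (S.reg_mem j x a) hr).2

/-- Realizability: the reward enters the excess loss linearly, and replacing it by its mean φ*
completes the square (φ - φ*)². -/
theorem obsMean_sqDiff (t : ℕ) (q : X → A → ℝ) (i : ι) (e : ℝ) :
    obsMean S W (fun t x a => e * (S.reg i x a ^ 2 - S.reg (W.star t) x a ^ 2))
      (fun t x a => e * (-2 * (S.reg i x a - S.reg (W.star t) x a))) t q =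
      e * qErr S W q t i := by
  unfold obsMean meanOf qErr
  rw [← integral_const_mul]
  congr 1
  ext x
  rw [Finset.mul_sum]
  exact Finset.sum_congr rfl fun a _ => by ring

theorem meanOf_four_mul_sq (t : ℕ) (q : X → A → ℝ) (i : ι) :
    meanOf W t q (fun x a => 4 * (S.reg i x a - S.reg (W.star t) x a) ^ 2) =
      4 * qErr S W q t i := by
  unfold meanOf qErr
  rw [← integral_const_mul]
  congr 1
  ext x
  rw [Finset.mul_sum]
  exact Finset.sum_congr rfl fun a _ => by ring

/-- Freedman with λ = 1/8: after division by λ the second-moment term is 4λ = 1/2 times the error,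
and 20Λ becomes 160Λ. The sign `e` selects the tail. -/
theorem IsRun.sqDiff_tail (h : IsRun S W P seed obs p) (hJ : PlaysIgw S seed obs p J)
    {Z : ℕ → Ω → Prop} (hZ : ∀ t ∈ Finset.Icc 1 S.T, MeasurableSet[preInfo seed obs t] {ω | Z t ω})
    {s t : ℕ} (hs : 1 ≤ s) (ht : t ≤ S.T + 1) (i : ι) {e : ℝ} (he : e = 1 ∨ e = -1) :
    P.real {ω | 160 * S.logTerm ≤ e * (∑ τ ∈ selBefore (fun t => Z t ω) s t,
      sqDiff S W (obs τ ω) τ i - ∑ τ ∈ selBefore (fun t => Z t ω) s t, qErr S W (p τ ω) τ i) -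
      1 / 2 * ∑ τ ∈ selBefore (fun t => Z t ω) s t, qErr S W (p τ ω) τ i} ≤
      Real.exp (-(20 * S.logTerm)) := by
  have := h.tail_le hJ hZ (f := fun t x a => e * (S.reg i x a ^ 2 - S.reg (W.star t) x a ^ 2))
    (g := fun t x a => e * (-2 * (S.reg i x a - S.reg (W.star t) x a)))
    (v := fun t x a => 4 * (S.reg i x a - S.reg (W.star t) x a) ^ 2)
    (fun t => boundedVar_sqDiff S i (W.star t) he) (lam := 1 / 8) (by norm_num) (by norm_num)
    hs ht (20 * S.logTerm)
  refine le_trans (measureReal_mono ?_) this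
  intro ω hω
  simp only [Set.mem_ofPred_eq, obsMean_sqDiff, meanOf_four_mul_sq] at *
  rw [Finset.sum_sub_distrib, ← Finset.mul_sum, Finset.sum_sub_distrib, ← Finset.mul_sum,
    ← Finset.mul_sum, ← Finset.mul_sum]
  have h1 : ∑ τ ∈ selBefore (fun t => Z t ω) s t,
      (e * (S.reg i (obs τ ω).1 (obs τ ω).2.1 ^ 2 - S.reg (W.star τ) (obs τ ω).1 (obs τ ω).2.1 ^ 2) +
        e * (-2 * (S.reg i (obs τ ω).1 (obs τ ω).2.1 -
          S.reg (W.star τ) (obs τ ω).1 (obs τ ω).2.1)) * (obs τ ω).2.2) =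
      e * ∑ τ ∈ selBefore (fun t => Z t ω) s t, sqDiff S W (obs τ ω) τ i := by
    rw [Finset.mul_sum]
    exact Finset.sum_congr rfl fun τ _ => by unfold sqDiff; ring
  rw [h1]
  linarith

theorem boundedVar_greedy (S : Setup X A ι) (i : ι) {e : ℝ} (he : e = 1 ∨ e = -1) :
    BoundedVar (A := A) (fun x a => e * S.reg i x (S.greedy i x)) (fun _ _ => 0)
      (fun _ _ => 1) := by
  have he1 : |e| = 1 := by rcases he with rfl | rfl <;> simp
  have he2 : e ^ 2 = 1 := by rcases he with rfl | rfl <;> simp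
  have h1 : ∀ x, |e * S.reg i x (S.greedy i x)| ≤ 1 := fun x => by
    rw [abs_mul, he1, one_mul, abs_of_nonneg (S.reg_nonneg _ _ _)]
    exact S.reg_le_one _ _ _
  refine ⟨fun a => (measurable_reg_greedy i i).const_mul e, fun a => measurable_const,
    fun a => measurable_const, fun x a => h1 x, fun x a => by simp, fun x a => by norm_num,
    fun x a r hr => by simpa using h1 x, fun x a r hr => ?_⟩
  rw [zero_mul, add_zero, mul_pow, he2, one_mul]
  have := S.reg_mem i x (S.greedy i x)
  nlinarith [this.1, this.2]

theorem boundedVar_reward {e : ℝ} (he : e = 1 ∨ e = -1) :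
    BoundedVar (X := X) (A := A) (fun _ _ => 0) (fun _ _ => e) (fun _ _ => 1) := by
  have he1 : |e| = 1 := by rcases he with rfl | rfl <;> simp
  have he2 : e ^ 2 = 1 := by rcases he with rfl | rfl <;> simp
  refine ⟨fun a => measurable_const, fun a => measurable_const, fun a => measurable_const,
    fun x a => by simp, fun x a => by rw [he1]; norm_num, fun x a => by norm_num,
    fun x a r hr => ?_, fun x a r hr => ?_⟩
  · rw [zero_add, abs_mul, he1, one_mul, abs_of_nonneg hr.1]
    exact hr.2
  · rw [zero_add, mul_pow, he2, one_mul]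
    nlinarith [hr.1, hr.2]

theorem IsRun.greedy_tail (h : IsRun S W P seed obs p) (hJ : PlaysIgw S seed obs p J)
    {Z : ℕ → Ω → Prop} (hZ : ∀ t ∈ Finset.Icc 1 S.T, MeasurableSet[preInfo seed obs t] {ω | Z t ω})
    {s : ℕ} (hs : 1 ≤ s) (i : ι) {e : ℝ} (he : e = 1 ∨ e = -1) :
    P.real {ω | ∃ t ≤ S.T + 1, 21 * √(S.logTerm * (selBefore (fun t => Z t ω) s t).card) <
      e * ∑ τ ∈ selBefore (fun t => Z t ω) s t, (S.reg i (obs τ ω).1 (S.greedy i (obs τ ω).1) -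
        greedyVal S W τ i)} ≤ (S.T + 2) * S.T * Real.exp (-(20 * S.logTerm)) := by
  have := h.hoeffding hJ hZ (f := fun _ x _ => e * S.reg i x (S.greedy i x)) (g := fun _ _ _ => 0)
    (fun t => boundedVar_greedy S i he) hs
  refine le_trans (measureReal_mono ?_) this
  rintro ω ⟨t, ht, hlt⟩
  refine ⟨t, ht, hlt.trans_le (le_of_eq ?_)⟩
  rw [Finset.mul_sum]
  refine Finset.sum_congr rfl fun τ hτ => ?_
  have hτ' : τ ∈ Finset.Icc 1 S.T := by
    have := (mem_selBefore.1 hτ).1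
    rw [Finset.mem_Icc]
    omega
  have hp := hJ.isPolicy hτ' ω
  unfold obsMean meanOf greedyVal
  have : ∀ x, ∑ a, p τ ω x a * (e * S.reg i x (S.greedy i x) + 0 * S.reg (W.star τ) x a) =
      e * S.reg i x (S.greedy i x) := fun x => by
    simp only [zero_mul, add_zero]
    rw [← Finset.sum_mul, hp.sum_one, one_mul]
  simp only [this]
  rw [integral_const_mul]
  ring

theorem IsRun.reward_tail (h : IsRun S W P seed obs p) (hJ : PlaysIgw S seed obs p J)
    {Z : ℕ → Ω → Prop} (hZ : ∀ t ∈ Finset.Icc 1 S.T, MeasurableSet[preInfo seed obs t] {ω | Z t ω})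
    {s : ℕ} (hs : 1 ≤ s) {e : ℝ} (he : e = 1 ∨ e = -1) :
    P.real {ω | ∃ t ≤ S.T + 1, 21 * √(S.logTerm * (selBefore (fun t => Z t ω) s t).card) <
      e * ∑ τ ∈ selBefore (fun t => Z t ω) s t, ((obs τ ω).2.2 -
        polValue S (W.D τ) (W.star τ) (p τ ω))} ≤
      (S.T + 2) * S.T * Real.exp (-(20 * S.logTerm)) := by
  have := h.hoeffding hJ hZ (f := fun _ _ _ => 0) (g := fun _ _ _ => e)
    (fun t => boundedVar_reward he) hs
  refine le_trans (measureReal_mono ?_) this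
  rintro ω ⟨t, ht, hlt⟩
  refine ⟨t, ht, hlt.trans_le (le_of_eq ?_)⟩
  rw [Finset.mul_sum]
  refine Finset.sum_congr rfl fun τ hτ => ?_
  have h1 : obsMean S W (fun _ _ _ => 0) (fun _ _ _ => e) τ (p τ ω) =
      e * polValue S (W.D τ) (W.star τ) (p τ ω) := by
    unfold obsMean meanOf polValue
    rw [← integral_const_mul]
    congr 1
    ext x
    rw [Finset.mul_sum]
    exact Finset.sum_congr rfl fun a _ => by ring
  rw [h1]
  ring

/-- Put y = exp Λ = |Φ|T/δ ≥ 2. Then 12 ≤ y⁴, |Φ| ≤ y and T² ≤ y², so seven of the twenty powers are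
used. The remaining thirteen serve the union over all instances of MASTER. -/
theorem Setup.card_mul_exp_le (S : Setup X A ι) :
    12 * Fintype.card ι * (S.T : ℝ) ^ 2 * Real.exp (-(20 * S.logTerm)) ≤
      Real.exp (-(13 * S.logTerm)) := by
  set y := Real.exp S.logTerm with hy
  have hT := S.two_le_T_div
  have hc := S.one_le_card_reg
  have hyeq : y = Fintype.card ι * ((S.T : ℝ) / S.δ) := by
    rw [hy, Setup.logTerm, Real.exp_log (by rw [mul_div_assoc]; positivity), mul_div_assoc]
  have hy2 : 2 ≤ y := by rw [hyeq]; nlinarith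
  have hTy : (S.T : ℝ) ≤ y := by
    have := S.T_le_T_div
    rw [hyeq]
    nlinarith
  have hcy : (Fintype.card ι : ℝ) ≤ y := by rw [hyeq]; nlinarith
  have h1 : Real.exp (-(20 * S.logTerm)) = (y ^ 20)⁻¹ := by
    rw [Real.exp_neg, hy, ← Real.exp_nat_mul]
    norm_num
  have h2 : Real.exp (-(13 * S.logTerm)) = (y ^ 13)⁻¹ := by
    rw [Real.exp_neg, hy, ← Real.exp_nat_mul]
    norm_num
  have hy0 : 0 < y := by linarith
  rw [h1, h2, ← div_eq_mul_inv, ← one_div, div_le_div_iff₀ (by positivity) (by positivity)]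
  have h3 : (12 : ℝ) ≤ y ^ 4 := by
    calc (12 : ℝ) ≤ 2 ^ 4 := by norm_num
      _ ≤ y ^ 4 := by gcongr
  calc 12 * Fintype.card ι * (S.T : ℝ) ^ 2 * y ^ 13
      ≤ y ^ 4 * y * y ^ 2 * y ^ 13 := by gcongr
    _ = 1 * y ^ 20 := by ring

theorem Setup.exp_neg_logTerm_le (S : Setup X A ι) : Real.exp (-S.logTerm) ≤ S.δ / S.T := by
  have h1 := S.log_T_div_le_logTerm
  have h2 := S.two_le_T_div
  calc Real.exp (-S.logTerm) ≤ Real.exp (-Real.log ((S.T : ℝ) / S.δ)) :=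
        Real.exp_le_exp.2 (by linarith)
    _ = S.δ / S.T := by rw [Real.exp_neg, Real.exp_log (by linarith), inv_div]

/-- Concentration holds along predictably selected rounds with high probability. -/
theorem IsRun.measureReal_not_concentrated_le (h : IsRun S W P seed obs p)
    (hJ : PlaysIgw S seed obs p J) {Z : ℕ → Ω → Prop}
    (hZ : ∀ t ∈ Finset.Icc 1 S.T, MeasurableSet[preInfo seed obs t] {ω | Z t ω})
    {s : ℕ} (hs : 1 ≤ s) :
    P.real {ω | ¬ Concentrated S W (fun t => Z t ω) s (fun t => obs t ω) (fun t => p t ω)} ≤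
      Real.exp (-(13 * S.logTerm)) := by
  refine le_trans ?_ S.card_mul_exp_le
  set E := Real.exp (-(20 * S.logTerm)) with hE
  have hE0 : 0 < E := Real.exp_pos _
  set B1 : ℝ → Set Ω := fun e => ⋃ q ∈ (Finset.univ : Finset ι) ×ˢ Finset.range (S.T + 2),
    {ω | 160 * S.logTerm ≤ e * (∑ τ ∈ selBefore (fun t => Z t ω) s q.2,
      sqDiff S W (obs τ ω) τ q.1 - ∑ τ ∈ selBefore (fun t => Z t ω) s q.2, qErr S W (p τ ω) τ q.1) -
      1 / 2 * ∑ τ ∈ selBefore (fun t => Z t ω) s q.2, qErr S W (p τ ω) τ q.1} with hB1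
  set B2 : ℝ → Set Ω := fun e => ⋃ i ∈ (Finset.univ : Finset ι),
    {ω | ∃ t ≤ S.T + 1, 21 * √(S.logTerm * (selBefore (fun t => Z t ω) s t).card) <
      e * ∑ τ ∈ selBefore (fun t => Z t ω) s t, (S.reg i (obs τ ω).1 (S.greedy i (obs τ ω).1) -
        greedyVal S W τ i)} with hB2
  set B3 : ℝ → Set Ω := fun e =>
    {ω | ∃ t ≤ S.T + 1, 21 * √(S.logTerm * (selBefore (fun t => Z t ω) s t).card) <
      e * ∑ τ ∈ selBefore (fun t => Z t ω) s t, ((obs τ ω).2.2 -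
        polValue S (W.D τ) (W.star τ) (p τ ω))} with hB3
  have hsub : {ω | ¬ Concentrated S W (fun t => Z t ω) s (fun t => obs t ω) (fun t => p t ω)} ⊆
      ((B1 1 ∪ B1 (-1)) ∪ (B2 1 ∪ B2 (-1))) ∪ (B3 1 ∪ B3 (-1)) := by
    intro ω hω
    by_contra hn
    simp only [Set.mem_union, not_or] at hn
    obtain ⟨⟨⟨n1, n2⟩, n3, n4⟩, n5, n6⟩ := hn
    simp only [hB1, Set.mem_iUnion, not_exists] at n1 n2
    simp only [hB2, Set.mem_iUnion, not_exists] at n3 n4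
    simp only [hB3] at n5 n6
    refine hω ⟨fun t ht i => ?_, fun t ht i => ?_, fun t ht i => ?_, fun t ht => ?_⟩
    -- The lower tail of the excess loss bounds the error; solving for it doubles 160 to 320. The
    -- upper tail, next, bounds the loss.
    · have := n2 (i, t) (by simp; omega)
      simp only [Set.mem_ofPred_eq, not_le] at this
      linarith
    · have := n1 (i, t) (by simp; omega)
      simp only [Set.mem_ofPred_eq, not_le] at this
      linarith
    · have h1 := n3 i (Finset.mem_univ i)
      have h2 := n4 i (Finset.mem_univ i)
      simp only [Set.mem_ofPred_eq, not_exists, not_and, not_lt] at h1 h2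
      have h3 := h1 t ht
      have h4 := h2 t ht
      rw [abs_le]
      constructor <;> linarith
    · simp only [Set.mem_ofPred_eq, not_exists, not_and, not_lt] at n5 n6
      have h3 := n5 t ht
      have h4 := n6 t ht
      rw [abs_le]
      constructor <;> linarith
  have m1 : ∀ e : ℝ, e = 1 ∨ e = -1 → P.real (B1 e) ≤ Fintype.card ι * (S.T + 2) * E := by
    intro e he
    refine (measureReal_biUnion_finset_le _ _).trans ((Finset.sum_le_sum fun q hq =>
      h.sqDiff_tail hJ hZ hs (t := q.2)
        (by have := Finset.mem_range.1 (Finset.mem_product.1 hq).2; omega) q.1 he).trans_eq ?_)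
    rw [Finset.sum_const, Finset.card_product, Finset.card_range, Finset.card_univ, nsmul_eq_mul]
    push_cast
    ring
  have m2 : ∀ e : ℝ, e = 1 ∨ e = -1 → P.real (B2 e) ≤ Fintype.card ι * ((S.T + 2) * S.T * E) := by
    intro e he
    refine (measureReal_biUnion_finset_le _ _).trans ((Finset.sum_le_sum fun i _ =>
      h.greedy_tail hJ hZ hs i he).trans_eq ?_)
    rw [Finset.sum_const, Finset.card_univ, nsmul_eq_mul]
  have m3 : ∀ e : ℝ, e = 1 ∨ e = -1 → P.real (B3 e) ≤ (S.T + 2) * S.T * E := fun e he =>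
    h.reward_tail hJ hZ hs he
  have hT := S.two_le_T_real
  have hc := S.one_le_card_reg
  calc _ ≤ _ := measureReal_mono hsub (measure_ne_top _ _)
    _ ≤ ((P.real (B1 1) + P.real (B1 (-1))) + (P.real (B2 1) + P.real (B2 (-1)))) +
        (P.real (B3 1) + P.real (B3 (-1))) :=
      (measureReal_union_le _ _).trans (add_le_add ((measureReal_union_le _ _).trans
        (add_le_add (measureReal_union_le _ _) (measureReal_union_le _ _)))
        (measureReal_union_le _ _))
    _ ≤ ((Fintype.card ι * (S.T + 2) * E + Fintype.card ι * (S.T + 2) * E) +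
        (Fintype.card ι * ((S.T + 2) * S.T * E) + Fintype.card ι * ((S.T + 2) * S.T * E))) +
        ((S.T + 2) * S.T * E + (S.T + 2) * S.T * E) := by
      have := m1 1 (Or.inl rfl)
      have := m1 (-1) (Or.inr rfl)
      have := m2 1 (Or.inl rfl)
      have := m2 (-1) (Or.inr rfl)
      have := m3 1 (Or.inl rfl)
      have := m3 (-1) (Or.inr rfl)
      linarith
    _ = (Fintype.card ι * (S.T + 2) * 2 + (Fintype.card ι + 1) * ((S.T + 2) * S.T * 2)) * E := by
      ring
    _ ≤ 12 * Fintype.card ι * (S.T : ℝ) ^ 2 * E := by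
      gcongr
      set c : ℝ := (Fintype.card ι : ℝ)
      have h1 : c * (S.T + 2) * 2 ≤ 4 * c * (S.T : ℝ) ^ 2 := by
        have : (S.T : ℝ) + 2 ≤ 2 * S.T ^ 2 := by nlinarith
        nlinarith
      have h2 : (S.T + 2) * (S.T : ℝ) * 2 ≤ 4 * (S.T : ℝ) ^ 2 := by nlinarith
      have h3 : (c + 1) * ((S.T + 2) * (S.T : ℝ) * 2) ≤ (2 * c) * (4 * (S.T : ℝ) ^ 2) := by
        apply mul_le_mul (by linarith) h2 (by positivity) (by positivity)
      nlinarith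

end Concentration

end RealizableBandit

namespace RealizableBandit

/-! ### Measurability of quantities computed from selected histories -/

section HistoryMeasurability

variable {X A ι Ω : Type*} [MeasurableSpace X] [MeasurableSpace A] [MeasurableSingletonClass A]
  [Fintype A] [Fintype ι] {S : Setup X A ι} {m : MeasurableSpace Ω}
  {obs : ℕ → Ω → Obs X A} {Z : ℕ → Ω → Prop} {s t : ℕ}

theorem measurable_sum_selHist (hobs : ∀ τ ∈ Finset.Ico s t, Measurable (obs τ))
    (hZ : ∀ τ ∈ Finset.Ico s t, MeasurableSet {ω | Z τ ω}) {g : Obs X A → ℝ} (hg : Measurable g) :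
    Measurable fun ω => ((selHist (fun τ => Z τ ω) (fun τ => obs τ ω) s t).map g).sum := by
  classical
  simp only [sum_map_selHist]
  have : (fun ω => ∑ τ ∈ selBefore (fun τ => Z τ ω) s t, g (obs τ ω)) =
      fun ω => ∑ τ ∈ Finset.Ico s t, if Z τ ω then g (obs τ ω) else 0 := by
    ext ω
    unfold selBefore
    rw [Finset.sum_filter]
  rw [this]
  exact Finset.measurable_sum _ fun τ hτ =>
    Measurable.ite (hZ τ hτ) (hg.comp (hobs τ hτ)) measurable_const

theorem measurableSet_length_selHist (hobs : ∀ τ ∈ Finset.Ico s t, Measurable (obs τ))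
    (hZ : ∀ τ ∈ Finset.Ico s t, MeasurableSet {ω | Z τ ω}) (k : ℕ) :
    MeasurableSet {ω | (selHist (fun τ => Z τ ω) (fun τ => obs τ ω) s t).length = k} := by
  have h1 := measurable_sum_selHist hobs hZ (measurable_const (a := (1 : ℝ)))
  have h2 := h1 (measurableSet_singleton (k : ℝ))
  convert h2 using 1
  ext ω
  simp

theorem measurableSet_oracle_selHist (hobs : ∀ τ ∈ Finset.Ico s t, Measurable (obs τ))
    (hZ : ∀ τ ∈ Finset.Ico s t, MeasurableSet {ω | Z τ ω}) (i : ι) :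
    MeasurableSet {ω | S.oracle (selHist (fun τ => Z τ ω) (fun τ => obs τ ω) s t) = i} := by
  classical
  have hloss : ∀ j, Measurable fun ω =>
      S.sqLoss (selHist (fun τ => Z τ ω) (fun τ => obs τ ω) s t) j := fun j => by
    refine measurable_sum_selHist hobs hZ (g := fun o => (S.reg j o.1 o.2.1 - o.2.2) ^ 2) ?_
    refine Measurable.pow_const (Measurable.sub ?_ measurable_snd.snd) 2
    exact (measurable_uncurry_act (S.reg_meas j)).comp (measurable_fst.prodMk measurable_snd.fst)
  have : {ω | S.oracle (selHist (fun τ => Z τ ω) (fun τ => obs τ ω) s t) = i} =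
      ⋃ F : Finset ι, ⋃ _ : S.pickReg F = i, {ω | Finset.univ.filter (fun i => ∀ j,
        S.sqLoss (selHist (fun τ => Z τ ω) (fun τ => obs τ ω) s t) i ≤
        S.sqLoss (selHist (fun τ => Z τ ω) (fun τ => obs τ ω) s t) j) = F} := by
    ext ω
    simp only [Set.mem_ofPred_eq, Set.mem_iUnion, exists_prop]
    constructor
    · intro h
      refine ⟨_, ?_, rfl⟩
      rw [← h]
      unfold Setup.oracle
      congr!
    · rintro ⟨F, h1, h2⟩
      rw [← h1, ← h2]
      unfold Setup.oracle
      congr!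
  rw [this]
  refine MeasurableSet.iUnion fun F => MeasurableSet.iUnion fun _ => ?_
  refine measurable_finset_filter _ (fun a => ?_) F
  have : ∀ a, {ω | ∀ j, S.sqLoss (selHist (fun τ => Z τ ω) (fun τ => obs τ ω) s t) a ≤
        S.sqLoss (selHist (fun τ => Z τ ω) (fun τ => obs τ ω) s t) j} = ⋂ j,
      {ω | S.sqLoss (selHist (fun τ => Z τ ω) (fun τ => obs τ ω) s t) a ≤
        S.sqLoss (selHist (fun τ => Z τ ω) (fun τ => obs τ ω) s t) j} := fun a => by ext; simp
  rw [this]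
  exact MeasurableSet.iInter fun j => measurableSet_le (hloss a) (hloss j)

theorem measurableSet_oracle_length_selHist (hobs : ∀ τ ∈ Finset.Ico s t, Measurable (obs τ))
    (hZ : ∀ τ ∈ Finset.Ico s t, MeasurableSet {ω | Z τ ω}) (j : ι × ℕ) :
    MeasurableSet {ω | (S.oracle (selHist (fun τ => Z τ ω) (fun τ => obs τ ω) s t),
      (selHist (fun τ => Z τ ω) (fun τ => obs τ ω) s t).length) = j} := by
  simp only [Prod.ext_iff]
  exact (measurableSet_oracle_selHist hobs hZ j.1).inter (measurableSet_length_selHist hobs hZ j.2)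

/-- Splitting on the finitely many values of the oracle replaces the random regressor by a fixed
one. -/
theorem measurable_falconOpt_selHist (c : ℝ) (hobs : ∀ τ ∈ Finset.Ico s t, Measurable (obs τ))
    (hZ : ∀ τ ∈ Finset.Ico s t, MeasurableSet {ω | Z τ ω}) :
    Measurable fun ω => S.falconOpt c (selHist (fun τ => Z τ ω) (fun τ => obs τ ω) s t) := by
  classical
  have hlen : Measurable fun ω => c * S.rho
      ((selHist (fun τ => Z τ ω) (fun τ => obs τ ω) s t).length + 1) :=
    measurable_comp_of_countable (measurableSet_length_selHist hobs hZ)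
      fun k => c * S.rho (k + 1)
  have hlen' : Measurable fun ω =>
      ((selHist (fun τ => Z τ ω) (fun τ => obs τ ω) s t).length : ℝ) :=
    measurable_comp_of_countable (measurableSet_length_selHist hobs hZ) fun k => (k : ℝ)
  have : (fun ω => S.falconOpt c (selHist (fun τ => Z τ ω) (fun τ => obs τ ω) s t)) = fun ω =>
      ∑ i, if S.oracle (selHist (fun τ => Z τ ω) (fun τ => obs τ ω) s t) = i then
        min 1 (((selHist (fun τ => Z τ ω) (fun τ => obs τ ω) s t).map fun o =>
          S.reg i o.1 (S.greedy i o.1)).sum /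
          ((selHist (fun τ => Z τ ω) (fun τ => obs τ ω) s t).length : ℝ) + c * S.rho
            ((selHist (fun τ => Z τ ω) (fun τ => obs τ ω) s t).length + 1)) else 0 := by
    ext ω
    rw [Finset.sum_ite_eq]
    simp [Setup.falconOpt]
  rw [this]
  refine Finset.measurable_sum _ fun i _ => Measurable.ite
    (measurableSet_oracle_selHist hobs hZ i) (measurable_const.min ?_) measurable_const
  refine Measurable.add (Measurable.div ?_ hlen') hlen
  exact measurable_sum_selHist hobs hZ (g := fun o => S.reg i o.1 (S.greedy i o.1))
    ((measurable_reg_greedy i i).comp measurable_fst)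

end HistoryMeasurability

/-! ### FALCON run alone: parts (a), (b) and (c) -/

section Alone

variable {X A ι Ω : Type*} [MeasurableSpace X] [MeasurableSpace A] [MeasurableSingletonClass A]
  [Fintype A] [Fintype ι] [mΩ : MeasurableSpace Ω]
  {S : Setup X A ι} {W : World X ι} {P : Measure Ω} [IsProbabilityMeasure P]
  {obs : ℕ → Ω → Obs X A}

theorem length_history (obs : ℕ → Obs X A) (t : ℕ) : (history obs t).length = t - 1 := by
  simp [history]

theorem playsIgw_alone (S : Setup X A ι) (c : ℝ) (obs : ℕ → Ω → Obs X A) :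
    PlaysIgw S (fun _ _ => PUnit.unit.{1}) obs
      (fun t ω => (S.falcon c).prob (history (fun s => obs s ω) t))
      fun t ω => (S.oracle (history (fun s => obs s ω) t), (history (fun s => obs s ω) t).length) where
  eq t _ ω := rfl
  meas t _ j := by
    simp only [← selHist_true]
    refine @measurableSet_oracle_length_selHist X A ι Ω _ _ _ _ _ S (preInfo _ obs t) obs
      (fun _ _ => True) 1 t (fun τ hτ => ?_) (fun τ _ => ?_) j
    · rw [Finset.mem_Ico] at hτ
      exact (measurable_obs_obsInfo obs hτ.1 hτ.2).mono le_sup_left le_rfl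
    · exact @MeasurableSet.univ _ (preInfo _ obs t)
  le t ht ω := by
    rw [length_history]
    omega

/-- When FALCON is run alone, concentration holds with probability at least `1 - δ / T`. -/
theorem measureReal_concentrated_alone {c : ℝ} (h : IsAloneRun S W (S.falcon c) P obs)
    {E : Set Ω} (hE : ∀ ω, Concentrated S W (fun _ => True) 1 (fun t => obs t ω)
      (fun t => S.falconProb (history (fun s => obs s ω) t)) → ω ∈ E) :
    1 - S.δ / (S.T : ℝ) ≤ P.real E := by
  have h1 := IsRun.measureReal_not_concentrated_le h (playsIgw_alone S c obs)
    (Z := fun _ _ => True) (fun t _ => @MeasurableSet.univ _ (preInfo _ obs t)) le_rfl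
  have h2 : Real.exp (-(13 * S.logTerm)) ≤ S.δ / S.T :=
    (Real.exp_le_exp.2 (by linarith [S.logTerm_pos])).trans S.exp_neg_logTerm_le
  -- Only monotonicity and subadditivity are used, so no measurability of `E` is needed.
  have h3 : (1 : ℝ) ≤ P.real E + P.real {ω | ¬ Concentrated S W (fun _ => True) 1
      (fun t => obs t ω) (fun t => S.falconProb (history (fun s => obs s ω) t))} := by
    rw [← probReal_univ (μ := P)]
    refine (measureReal_mono (fun ω _ => ?_) (measure_ne_top _ _)).trans (measureReal_union_le _ _)
    by_cases hc : Concentrated S W (fun _ => True) 1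
      (fun t => obs t ω) (fun t => S.falconProb (history (fun s => obs s ω) t))
    · exact Or.inl (hE ω hc)
    · exact Or.inr hc
  have h4 := h1.trans h2
  simp only [Setup.falcon] at h4
  linarith

/-- The regression oracle of FALCON is accurate in a nearly stationary environment. -/
theorem regressionError_bound {c : ℝ} (h : IsAloneRun S W (S.falcon c) P obs) {b : ℝ} {t : ℕ}
    (ht : t ∈ Finset.Icc 1 S.T) (hd : total (drift S W) 1 t ≤ b * S.rho t) :
    1 - S.δ / (S.T : ℝ) ≤ P.real {ω | regressionError S W (fun s => obs s ω) t ≤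
      (3 * b ^ 2 + 640) * S.logTerm} := by
  rw [Finset.mem_Icc] at ht
  refine measureReal_concentrated_alone h fun ω hω => ?_
  -- Here `b := 1` is the base round; the drift constant of the statement plays the role of `β`.
  have := sum_qErr_oracle_le (b := 1) hω (t := t) (k := t) (by omega) ht.1
    ((card_selBefore_le _ _ _).trans (by omega)) (fun τ hτ => (mem_selBefore.1 hτ).1.1)
    (fun τ _ => isPolicy_falconProb _) hd
  rw [selBefore_true, selHist_true] at this
  exact this

theorem invProb_le (S : Setup X A ι) (W : World X ι) (obs : ℕ → Obs X A) {τ : ℕ} (hτ : 1 ≤ τ)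
    {π : X → A} (hπ : Measurable π) : invProb S W obs τ π ≤
      S.numA + S.gam τ * ∫ x, S.gap (regAt S obs τ) x (π x) ∂(W.D τ) := by
  have hgm : Measurable fun x => S.gap (regAt S obs τ) x (π x) :=
    measurable_comp_act (fun a => measurable_gap _ a) hπ
  have hi : Integrable (fun x => S.gap (regAt S obs τ) x (π x)) (W.D τ) :=
    integrable_of_mem_Icc hgm fun x => ⟨S.gap_nonneg _ _ _, S.gap_le_one _ _ _⟩
  have hr : S.numA + S.gam τ * ∫ x, S.gap (regAt S obs τ) x (π x) ∂(W.D τ) =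
      ∫ x, (S.numA + S.gam τ * S.gap (regAt S obs τ) x (π x)) ∂(W.D τ) := by
    rw [integral_add (integrable_const _) (hi.const_mul _), integral_const_mul]
    simp
  rw [hr]
  unfold invProb
  have hp : ∀ x, S.falconProb (history obs τ) x (π x) =
      S.igwProb (S.gam τ) (regAt S obs τ) x (π x) := fun x => by
    rw [S.falconProb_eq, length_history, Nat.sub_add_cancel hτ]
    rfl
  simp only [hp]
  refine integral_mono_of_nonneg (Filter.Eventually.of_forall fun x => ?_)
    ((integrable_const _).add (hi.const_mul _))
    (Filter.Eventually.of_forall fun x => one_div_igwProb_le (S.gam_nonneg _) _ _ _)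
  exact one_div_nonneg.2 (igwProb_pos (S.gam_nonneg _) _ _ _).le

theorem predRegret_eq (S : Setup X A ι) (W : World X ι) (obs : ℕ → Obs X A) (t : ℕ)
    {π : X → A} (hπ : Measurable π) : predRegret S W obs t π =
      (∑ s ∈ Finset.Icc 1 t, ∫ x, S.gap (regAt S obs (t + 1)) x (π x) ∂(W.D s)) / (t : ℝ) := by
  unfold predRegret predValue
  rw [← sub_div, ← Finset.sum_sub_distrib]
  congr 1
  refine Finset.sum_congr rfl fun s _ => ?_
  rw [← integral_sub]
  · rfl
  · exact integrable_of_mem_Icc (measurable_reg_greedy _ _) fun x => S.reg_mem _ _ _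
  · exact integrable_of_mem_Icc (measurable_comp_act (S.reg_meas _) hπ) fun x => S.reg_mem _ _ _

/-- The inverse probabilities of FALCON are controlled by the predicted regrets. -/
theorem maxInvProb_le (S : Setup X A ι) (W : World X ι) (obs : ℕ → Obs X A) {b : ℝ} (hb : 0 < b)
    {t : ℕ} (ht : 1 ≤ t) (hd : total (drift S W) 1 t ≤ b * S.rho t) {π : X → A}
    (hπ : Measurable π) : maxInvProb S W obs t π ≤ (3 + b) * S.numA +
      ⨆ τ : Finset.Icc 1 (t - 1), S.gam ((τ : ℕ) + 1) * predRegret S W obs (τ : ℕ) π := by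
  have hA := S.one_le_numA
  have hpr : ∀ τ, 0 ≤ predRegret S W obs τ π := fun τ => by
    rw [predRegret_eq S W obs τ hπ]
    exact div_nonneg (Finset.sum_nonneg fun s _ => integral_nonneg fun x => S.gap_nonneg _ _ _)
      (Nat.cast_nonneg _)
  have hsup : 0 ≤ ⨆ τ : Finset.Icc 1 (t - 1),
      S.gam ((τ : ℕ) + 1) * predRegret S W obs (τ : ℕ) π :=
    Real.iSup_nonneg fun τ => mul_nonneg (S.gam_nonneg _) (hpr _)
  have : Nonempty (Finset.Icc 1 t) := ⟨⟨1, Finset.mem_Icc.2 ⟨le_rfl, ht⟩⟩⟩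
  refine ciSup_le fun τ => ?_
  obtain ⟨τ, hτ⟩ := τ
  rw [Finset.mem_Icc] at hτ
  refine (invProb_le S W obs hτ.1 hπ).trans ?_
  -- Round 1 has no predicted regret in the maximum to lean on. There the gap is at most 1 and γ_1 ≤
  -- 2A, because γ_1·ρ(1) = A with ρ(1) ≥ 1/2; this accounts for 3A.
  rcases Nat.eq_or_lt_of_le hτ.1 with h1 | h1
  · subst h1
    have hi : ∫ x, S.gap (regAt S obs 1) x (π x) ∂(W.D 1) ≤ 1 :=
      (integral_mem_Icc (measurable_comp_act (fun a => measurable_gap _ a) hπ)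
        fun x => ⟨S.gap_nonneg _ _ _, S.gap_le_one _ _ _⟩).2
    have hg : S.gam 1 ≤ 2 * S.numA := by
      have h2 := S.gam_mul_rho (t := 1) le_rfl
      have h3 := S.half_le_rho_one
      have h4 := S.gam_nonneg 1
      nlinarith
    have := mul_le_of_le_one_right (S.gam_nonneg 1) hi
    nlinarith
  -- Round n + 1 uses the very regressor whose predicted regret over [1,n] is in the maximum. Only
  -- the contexts differ, which costs γ_{n+1}·bρ(t) ≤ bA.
  · set n := τ - 1 with hn
    have hτn : τ = n + 1 := by omega
    have hn1 : 1 ≤ n := by omega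
    have hn0 : (0 : ℝ) < n := by exact_mod_cast hn1
    simp only [hτn]
    have hle : ∫ x, S.gap (regAt S obs (n + 1)) x (π x) ∂(W.D (n + 1)) ≤
        predRegret S W obs n π + b * S.rho t := by
      rw [predRegret_eq S W obs n hπ]
      have h2 : ∀ s ∈ Finset.Icc 1 n, ∫ x, S.gap (regAt S obs (n + 1)) x (π x) ∂(W.D (n + 1)) -
          b * S.rho t ≤ ∫ x, S.gap (regAt S obs (n + 1)) x (π x) ∂(W.D s) := by
        intro s hs
        rw [Finset.mem_Icc] at hs
        have h3 := (abs_le.1 (abs_integral_sub_le W (s := s) (e := n + 1) (by omega)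
          (measurable_comp_act (fun a => measurable_gap (S := S) (regAt S obs (n + 1)) a) hπ)
          fun x => ⟨S.gap_nonneg _ _ _, S.gap_le_one _ _ _⟩)).1
        have h4 := total_contextDrift_le S W s (n + 1)
        have h5 := total_mono (drift_nonneg S W) (s := s) (e := n + 1) (s' := 1) (e' := t)
          hs.1 (by omega)
        linarith
      have h6 := Finset.sum_le_sum h2
      rw [Finset.sum_const, Nat.card_Icc, nsmul_eq_mul, Nat.add_sub_cancel] at h6
      rw [← sub_le_iff_le_add, le_div_iff₀ hn0]
      linarith
    have h7 : S.gam (n + 1) * (b * S.rho t) ≤ b * S.numA := by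
      have h8 := S.gam_mul_rho ht
      have h9 := S.gam_mono (s := n + 1) (t := t) (by omega)
      have h10 := S.rho_nonneg t
      calc S.gam (n + 1) * (b * S.rho t) ≤ S.gam t * (b * S.rho t) := by gcongr
        _ = b * (S.gam t * S.rho t) := by ring
        _ = _ := by rw [h8]
    have h11 : S.gam (n + 1) * predRegret S W obs n π ≤ ⨆ τ : Finset.Icc 1 (t - 1),
        S.gam ((τ : ℕ) + 1) * predRegret S W obs (τ : ℕ) π :=
      le_ciSup (f := fun τ : Finset.Icc 1 (t - 1) =>
        S.gam ((τ : ℕ) + 1) * predRegret S W obs (τ : ℕ) π) (Set.finite_range _).bddAbove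
        ⟨n, Finset.mem_Icc.2 ⟨hn1, by omega⟩⟩
    have h12 := mul_le_mul_of_nonneg_left hle (S.gam_nonneg (n + 1))
    nlinarith

theorem falconOpt_mem (S : Setup X A ι) {c : ℝ} (hc : 0 ≤ c) (h : List (Obs X A)) :
    S.falconOpt c h ∈ Set.Icc (0 : ℝ) 1 := by
  unfold Setup.falconOpt
  refine ⟨le_min zero_le_one (add_nonneg (div_nonneg (List.sum_nonneg ?_) (Nat.cast_nonneg _))
    (mul_nonneg hc (S.rho_nonneg _))), min_le_left _ _⟩
  intro y hy
  obtain ⟨o, _, rfl⟩ := List.mem_map.1 hy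
  exact S.reg_nonneg _ _ _

theorem popOpt_mem (S : Setup X A ι) (W : World X ι) {c : ℝ} (hc : 0 ≤ c) (obs : ℕ → Obs X A)
    (t : ℕ) : popOpt S W c obs t ∈ Set.Icc (0 : ℝ) 1 := by
  unfold popOpt predValue
  refine ⟨le_min zero_le_one (add_nonneg (div_nonneg (Finset.sum_nonneg fun s _ =>
    integral_nonneg fun x => S.reg_nonneg _ _ _) (Nat.cast_nonneg _))
    (mul_nonneg hc (S.rho_nonneg _))), min_le_left _ _⟩

variable {obs' : ℕ → Obs X A}

/-- With all rounds selected the instance's clock, (τ - 1) + 1, is the round number. -/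
theorem nearStationary_alone (hc : Concentrated S W (fun _ => True) 1 obs'
      (fun t => S.falconProb (history obs' t))) {t τ : ℕ} (ht : t ≤ S.T) (hτ1 : 1 ≤ τ)
    (hτ : τ ≤ t) (hd : total (drift S W) 1 t ≤ S.rho t) :
    NearStationary S W (fun _ => True) 1 1 obs' (fun t => S.falconProb (history obs' t)) τ where
  conc := hc
  le_T := by omega
  start_le := hτ1
  start_le_sel σ hσ := (mem_selBefore.1 hσ).1.1
  plays σ _ := by rw [selHist_true]
  drift_le := by
    rw [selBefore_true, Nat.card_Ico, Nat.sub_add_cancel hτ1]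
    exact (total_mono (drift_nonneg S W) le_rfl hτ).trans (hd.trans (S.rho_antitone hτ1 hτ))

theorem popOpt_bounds (hc : Concentrated S W (fun _ => True) 1 obs'
      (fun t => S.falconProb (history obs' t))) {t τ : ℕ} (ht : t ≤ S.T) (hτ1 : 1 ≤ τ)
    (hτ : τ ≤ t) (hd : total (drift S W) 1 t ≤ S.rho t) :
    bestValue S W 1 ≤ popOpt S W 4000 obs' τ ∧
      popOpt S W 4000 obs' τ ≤ bestValue S W 1 + 8000 * S.rho τ := by
  have h2 := bestValue_mem (S := S) (W := W) 1
  have hns := nearStationary_alone hc ht hτ1 hτ hd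
  have hr := S.rho_pos hτ1
  unfold popOpt
  rcases Nat.eq_or_lt_of_le hτ1 with h1 | h1
  · subst h1
    have := S.half_le_rho_one
    have h3 : predValue S W obs' (1 - 1) (S.greedy (regAt S obs' 1)) = 0 := by
      simp [predValue]
    rw [h3, zero_add, min_eq_left (by linarith)]
    exact ⟨h2.2, by linarith [h2.1]⟩
  · have h3 := abs_sum_greedyVal_sub_le hns
      (by rw [selBefore_true]; exact ⟨1, Finset.mem_Ico.2 ⟨le_rfl, h1⟩⟩)
    rw [selBefore_true, selHist_true, Nat.card_Ico, Nat.sub_add_cancel hτ1] at h3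
    have h4 : predValue S W obs' (τ - 1) (S.greedy (regAt S obs' τ)) =
        (∑ σ ∈ Finset.Ico 1 τ, greedyVal S W σ (S.oracle (history obs' τ))) /
          ((τ - 1 : ℕ) : ℝ) := by
      unfold predValue greedyVal
      rw [Nat.sub_add_cancel hτ1]
      congr 1
    rw [h4]
    have h5 := abs_le.1 h3
    constructor
    · exact le_min h2.2 (by linarith)
    · exact (min_le_right _ _).trans (by linarith)

/-- Both parts of the requirement on base algorithms, for optimistic quantities within the bonus of
the optimal value. -/
theorem assumption1_of_bounds {K : ℝ} (hK : 40000 ≤ K)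
    (h : IsAloneRun S W (S.falcon 4000) P obs) (ft : ℕ → Ω → ℝ)
    (hft : ∀ t ω, ft t ω ∈ Set.Icc (0 : ℝ) 1)
    (hb : ∀ ω t τ, Concentrated S W (fun _ => True) 1 (fun t => obs t ω)
      (fun t => S.falconProb (history (fun s => obs s ω) t)) → t ≤ S.T → 1 ≤ τ → τ ≤ t →
      total (drift S W) 1 t ≤ S.rho t → bestValue S W 1 ≤ ft τ ω ∧
        ft τ ω ≤ bestValue S W 1 + 8000 * S.rho τ) :
    Assumption1 S W P obs ft (fun t => K * drift S W t) (fun t => K * S.rho t) where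
  measure t _ _ i := by
    rw [value_eq_polValue, value_eq_polValue]
    have hg := isPolicy_pureWeight_greedy S i
    have h1 := abs_polValue_star_sub_le (S := S) (W := W) hg (Nat.le_succ t)
    have h2 : total (drift S W) t (t + 1) = drift S W t := by simp [total]
    have h3 := drift_nonneg S W t
    rw [Nat.succ_eq_add_one, h2] at h1
    nlinarith
  rate_antitone s t hs hst _ := by
    have := S.rho_antitone hs hst
    gcongr
  rate_lower t ht := by
    have h1 := S.half_div_sqrt_le_rho (Finset.mem_Icc.1 ht).1
    have h2 : (0 : ℝ) < √(t : ℝ) := Real.sqrt_pos.2 (by exact_mod_cast (Finset.mem_Icc.1 ht).1)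
    have h3 := S.rho_nonneg t
    -- `AΛ` may lie below one, so `ρ_0(t) ≥ 1/(2√t)` is used and the factor is recovered from `K`.
    calc 1 / √(t : ℝ) = 2 * (1 / 2 / √(t : ℝ)) := by ring
      _ ≤ 2 * S.rho t := by gcongr
      _ ≤ K * S.rho t := by gcongr; linarith
  cumulative_monotone s t _ hst _ := by
    have h1 : ∀ t : ℕ, (t : ℝ) * (K * S.rho t) = K * √(S.numA * S.logTerm * t) := fun t => by
      rw [← S.mul_rho]; ring
    simp only [h1]
    have := S.numA_pos
    have := S.logTerm_pos
    have : (s : ℝ) ≤ t := by exact_mod_cast hst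
    gcongr
  aux_mem t _ ω := hft t ω
  guarantee t ht hd := by
    rw [Finset.mem_Icc] at ht
    -- `K` multiplies both drift and rate, so the hypothesis is about `Δ_0` and `ρ_0` whatever `K`
    -- is.
    have hd' : total (drift S W) 1 t ≤ S.rho t := by
      rw [total_const_mul] at hd
      exact le_of_mul_le_mul_left hd (by linarith)
    have htot : 0 ≤ total (fun t => K * drift S W t) 1 t :=
      total_nonneg (fun t => mul_nonneg (by linarith) (drift_nonneg S W t)) _ _
    have ht0 : (0 : ℝ) < t := by exact_mod_cast ht.1
    refine measureReal_concentrated_alone h fun ω hω => ⟨?_, ?_⟩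
    · have h1 := (hb ω t t hω ht.2 ht.1 le_rfl hd').1
      -- Optimism is proved with respect to the optimum of round 1, which is at least the minimum.
      have h2 : (⨅ τ : Finset.Icc 1 t, bestValue S W (τ : ℕ)) ≤ bestValue S W 1 :=
        ciInf_le (f := fun τ : Finset.Icc 1 t => bestValue S W (τ : ℕ))
          (Set.finite_range _).bddBelow ⟨1, Finset.mem_Icc.2 ⟨le_rfl, ht.1⟩⟩
      linarith
    · have hset : selBefore (fun _ => True) 1 (t + 1) = Finset.Icc 1 t := by
        rw [selBefore_true]
        ext τ
        rw [Finset.mem_Ico, Finset.mem_Icc]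
        omega
      have h1 := sum_opt_sub_reward_le (b := 1) (t := t + 1) (fun τ => ft τ ω) hω (by omega)
        (fun τ hτ => by
          rw [hset, Finset.mem_Icc] at hτ
          exact nearStationary_alone hω ht.2 hτ.1 hτ.2 hd')
        (fun τ _ => by rw [selHist_true])
        (fun τ hτ => by
          rw [hset, Finset.mem_Icc] at hτ
          rw [selBefore_true, Nat.card_Ico, Nat.sub_add_cancel hτ.1]
          exact (hb ω t τ hω ht.2 hτ.1 hτ.2 hd').2)
      rw [hset, Nat.card_Icc, Nat.add_sub_cancel, ← S.mul_rho] at h1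
      have h2 : (∑ τ ∈ Finset.Icc 1 t, (ft τ ω - (obs τ ω).2.2)) / (t : ℝ) ≤ K * S.rho t := by
        rw [div_le_iff₀ ht0]
        have := S.rho_nonneg t
        calc _ ≤ 40000 * (t * S.rho t) := h1
          _ ≤ K * (t * S.rho t) := by gcongr
          _ = _ := by ring
      linarith

theorem assumption1_falcon {K : ℝ} (hK : 40000 ≤ K) (h : IsAloneRun S W (S.falcon 4000) P obs) :
    Assumption1 S W P obs
      (fun t ω => (S.falcon 4000).opt (history (fun s => obs s ω) t))
      (fun t => K * drift S W t) (fun t => K * S.rho t) := by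
  refine assumption1_of_bounds hK h _ (fun t ω => falconOpt_mem S (by norm_num) _)
    fun ω t τ hc ht hτ1 hτ hd => ?_
  have h1 := falconOpt_bounds (nearStationary_alone hc ht hτ1 hτ hd)
  rw [selHist_true, selBefore_true, Nat.card_Ico, Nat.sub_add_cancel hτ1] at h1
  exact h1

theorem assumption1_popOpt {K : ℝ} (hK : 40000 ≤ K) (h : IsAloneRun S W (S.falcon 4000) P obs) :
    Assumption1 S W P obs (fun t ω => popOpt S W 4000 (fun s => obs s ω) t)
      (fun t => K * drift S W t) (fun t => K * S.rho t) :=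
  assumption1_of_bounds hK h _ (fun t ω => popOpt_mem S W (by norm_num) _ t)
    fun ω t τ hc ht hτ1 hτ hd => popOpt_bounds hc ht hτ1 hτ hd

/-- Λ = log|Φ| + log(T/δ) with both summands above 1/2, so the sum is at most four times the
product. The term A log|Φ| is only used to be nonnegative. -/
theorem mul_rate_le (S : Setup X A ι) {K C : ℝ} (hK : 0 ≤ K) (hC : 2 * K ≤ C)
    (hι : 2 ≤ Fintype.card ι) (t : ℕ) : (t : ℝ) * (K * S.rho t) ≤
      C * √(Real.log ((S.T : ℝ) / S.δ)) * (√(S.numA * (t : ℝ) * Real.log (Fintype.card ι : ℝ)) +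
        S.numA * Real.log (Fintype.card ι : ℝ)) := by
  have h1 := S.half_lt_log
  have hι' : (2 : ℝ) ≤ Fintype.card ι := by exact_mod_cast hι
  have h2 : (1 / 2 : ℝ) < Real.log (Fintype.card ι : ℝ) := by
    have : Real.log 2 ≤ Real.log (Fintype.card ι : ℝ) := Real.log_le_log (by norm_num) hι'
    linarith [Real.log_two_gt_d9]
  have h3 : S.logTerm = Real.log (Fintype.card ι : ℝ) + Real.log ((S.T : ℝ) / S.δ) := by
    have := S.two_le_T_div
    rw [Setup.logTerm, mul_div_assoc, Real.log_mul (by positivity) (by positivity)]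
  set y := Real.log (Fintype.card ι : ℝ) with hy
  set l := Real.log ((S.T : ℝ) / S.δ) with hl
  have hA := S.numA_pos
  have h4 : S.logTerm ≤ 4 * (y * l) := by rw [h3]; nlinarith
  have h5 : (t : ℝ) * (K * S.rho t) = K * √(S.numA * S.logTerm * t) := by
    rw [← S.mul_rho]; ring
  have h6 : √(S.numA * S.logTerm * t) ≤ 2 * (√l * √(S.numA * t * y)) := by
    rw [← Real.sqrt_mul (by linarith)]
    have : (2 : ℝ) = √(2 ^ 2) := (Real.sqrt_sq (by norm_num)).symm
    rw [this, ← Real.sqrt_mul (by norm_num)]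
    apply Real.sqrt_le_sqrt
    have h7 : S.numA * S.logTerm * t ≤ S.numA * (4 * (y * l)) * t := by gcongr
    linarith
  rw [h5]
  calc K * √(S.numA * S.logTerm * t) ≤ K * (2 * (√l * √(S.numA * t * y))) := by gcongr
    _ = 2 * K * √l * √(S.numA * t * y) := by ring
    _ ≤ C * √l * (√(S.numA * t * y) + S.numA * y) := by
      have h8 : 0 ≤ S.numA * y := by nlinarith
      have h9 : 0 ≤ C := by linarith
      have h10 : √(S.numA * t * y) ≤ √(S.numA * t * y) + S.numA * y := by linarith
      gcongr

end Alone

end RealizableBandit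

namespace RealizableBandit

/-! ### Block structure of MASTER -/

section Blocks

variable {X A : Type*} (B : BaseAlg X A) (T : ℕ) (δ : ℝ) (ρ : ℕ → ℝ) (u : ℕ → ℕ → ℝ)
  (obs : ℕ → Obs X A)

/-- One of the two tests fails at the end of round `t` of the block `(s, n)`. -/
def TestsFail (s n t : ℕ) : Prop :=
  Test1Fails B T δ ρ u obs s n t ∨ Test2Fails B T δ ρ u obs s n t

theorem blockAt_succ_of_fail {t : ℕ} (ht : 1 ≤ t)
    (h : TestsFail B T δ ρ u obs (blockAt B T δ ρ u obs t).1 (blockAt B T δ ρ u obs t).2 t) :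
    blockAt B T δ ρ u obs (t + 1) = (t + 1, 0) := by
  obtain ⟨t, rfl⟩ := Nat.exists_eq_add_of_le' ht
  rw [blockAt]
  exact if_pos h

theorem blockAt_succ_of_full {t : ℕ} (ht : 1 ≤ t)
    (h : ¬ TestsFail B T δ ρ u obs (blockAt B T δ ρ u obs t).1 (blockAt B T δ ρ u obs t).2 t)
    (hf : t + 1 = (blockAt B T δ ρ u obs t).1 + 2 ^ (blockAt B T δ ρ u obs t).2) :
    blockAt B T δ ρ u obs (t + 1) = (t + 1, (blockAt B T δ ρ u obs t).2 + 1) := by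
  obtain ⟨t, rfl⟩ := Nat.exists_eq_add_of_le' ht
  rw [blockAt]
  exact (if_neg h).trans (if_pos hf)

theorem blockAt_succ_of_not {t : ℕ} (ht : 1 ≤ t)
    (h : ¬ TestsFail B T δ ρ u obs (blockAt B T δ ρ u obs t).1 (blockAt B T δ ρ u obs t).2 t)
    (hf : t + 1 ≠ (blockAt B T δ ρ u obs t).1 + 2 ^ (blockAt B T δ ρ u obs t).2) :
    blockAt B T δ ρ u obs (t + 1) = blockAt B T δ ρ u obs t := by
  obtain ⟨t, rfl⟩ := Nat.exists_eq_add_of_le' ht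
  rw [blockAt]
  exact (if_neg h).trans (if_neg hf)

/-- Basic facts on the block `(s, n)` containing round `t`. -/
structure BlockSpec (s n t : ℕ) : Prop where
  pow_le_start : 2 ^ n ≤ s
  start_le : s ≤ t
  lt_end : t < s + 2 ^ n
  same : ∀ σ, s ≤ σ → σ ≤ t → blockAt B T δ ρ u obs σ = (s, n)
  pass : ∀ σ, s ≤ σ → σ < t → ¬ TestsFail B T δ ρ u obs s n σ
  pred : s = 1 ∧ n = 0 ∨ ∃ s' n', blockAt B T δ ρ u obs (s - 1) = (s', n') ∧ 2 ≤ s ∧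
    (n = 0 ∧ TestsFail B T δ ρ u obs s' n' (s - 1) ∨ n = n' + 1 ∧ s = s' + 2 ^ n')

variable {B T δ ρ u obs}

/-- Induction over rounds. `2 ^ n ≤ s` persists because a block of order n + 1 starts at s + 2^n ≥
2^(n+1), and restarts have order 0. It keeps every order below the round number, so union bounds
over T values suffice. -/
theorem blockSpec_blockAt {t : ℕ} (ht : 1 ≤ t) : BlockSpec B T δ ρ u obs
    (blockAt B T δ ρ u obs t).1 (blockAt B T δ ρ u obs t).2 t := by
  induction t, ht using Nat.le_induction with
  | base =>
    have h1 : blockAt B T δ ρ u obs 1 = (1, 0) := by rw [blockAt]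
    rw [h1]
    refine ⟨by norm_num, le_rfl, by norm_num, fun σ h2 h3 => ?_, fun σ h2 h3 => ?_, Or.inl ⟨rfl, rfl⟩⟩
    · obtain rfl : σ = 1 := by simp at h2; omega
      exact h1
    · simp at h2
      omega
  | succ t ht ih =>
    set blk := blockAt B T δ ρ u obs t with hblk
    have hstart : ∀ n, blockAt B T δ ρ u obs (t + 1) = (t + 1, n) → 2 ^ n ≤ t + 1 →
        (n = 0 ∧ TestsFail B T δ ρ u obs blk.1 blk.2 t ∨ n = blk.2 + 1 ∧ t + 1 = blk.1 + 2 ^ blk.2) →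
        BlockSpec B T δ ρ u obs (t + 1) n (t + 1) := fun n h1 h2 h3 =>
      ⟨h2, le_rfl, by simp, fun σ h4 h5 => by rw [le_antisymm h5 h4]; exact h1,
        fun σ h4 h5 => by omega, Or.inr ⟨blk.1, blk.2, by simp [hblk], by omega, by simpa using h3⟩⟩
    by_cases hfail : TestsFail B T δ ρ u obs blk.1 blk.2 t
    · have h1 := blockAt_succ_of_fail B T δ ρ u obs ht hfail
      rw [h1]
      exact hstart 0 h1 (by simp) (Or.inl ⟨rfl, hfail⟩)
    · by_cases hfull : t + 1 = blk.1 + 2 ^ blk.2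
      · have h1 := blockAt_succ_of_full B T δ ρ u obs ht hfail hfull
        rw [h1]
        refine hstart _ h1 ?_ (Or.inr ⟨rfl, hfull⟩)
        have := ih.pow_le_start
        rw [pow_succ]
        simp only [← hblk]
        omega
      · have h1 := blockAt_succ_of_not B T δ ρ u obs ht hfail hfull
        rw [← hblk] at h1
        rw [h1]
        refine ⟨ih.pow_le_start, ih.start_le.trans (Nat.le_succ t), ?_, fun σ h2 h3 => ?_,
          fun σ h2 h3 => ?_, ih.pred⟩
        · have := ih.lt_end
          omega
        · rcases Nat.lt_or_eq_of_le h3 with h4 | rfl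
          · exact ih.same σ h2 (by omega)
          · exact h1
        · rcases Nat.lt_or_eq_of_le (Nat.le_of_lt_succ h3) with h4 | rfl
          · exact ih.pass σ h2 h4
          · exact hfail

theorem BlockSpec.of_eq {s n t : ℕ} (ht : 1 ≤ t) (h : blockAt B T δ ρ u obs t = (s, n)) :
    BlockSpec B T δ ρ u obs s n t := by
  have := blockSpec_blockAt (B := B) (T := T) (δ := δ) (ρ := ρ) (u := u) (obs := obs) ht
  rwa [h] at this

theorem BlockSpec.one_le {s n t : ℕ} (h : BlockSpec B T δ ρ u obs s n t) : 1 ≤ s :=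
  Nat.one_le_two_pow.trans h.pow_le_start

theorem BlockSpec.lt {s n t : ℕ} (h : BlockSpec B T δ ρ u obs s n t) : n < t :=
  Nat.lt_two_pow_self.trans_le (h.pow_le_start.trans h.start_le)

theorem BlockSpec.of_le {s n t τ : ℕ} (h : BlockSpec B T δ ρ u obs s n t) (h1 : s ≤ τ)
    (h2 : τ ≤ t) : BlockSpec B T δ ρ u obs s n τ :=
  .of_eq (h.one_le.trans h1) (h.same τ h1 h2)

end Blocks

/-! ### Dyadic schedule and active instances -/

section Schedule

variable {ρ : ℕ → ℝ} {u : ℕ → ℕ → ℝ} {s n t : ℕ}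

theorem subStart_le (s m : ℕ) {t : ℕ} (h : s ≤ t) : subStart s m t ≤ t := by
  unfold subStart
  have := Nat.mul_div_le (t - s) (2 ^ m)
  omega

theorem le_subStart (s m t : ℕ) : s ≤ subStart s m t := Nat.le_add_right _ _

theorem lt_subStart_add (s m : ℕ) {t : ℕ} (h : s ≤ t) : t < subStart s m t + 2 ^ m := by
  unfold subStart
  have := Nat.lt_mul_div_succ (t - s) (show 0 < 2 ^ m by positivity)
  rw [mul_add, mul_one] at this
  omega

theorem dvd_subStart_sub (s m t : ℕ) : 2 ^ m ∣ subStart s m t - s := by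
  unfold subStart
  rw [Nat.add_sub_cancel_left]
  exact dvd_mul_right _ _

theorem subStart_eq_of_dvd {m b : ℕ} (hsb : s ≤ b) (hd : 2 ^ m ∣ b - s) (h1 : b ≤ t)
    (h2 : t < b + 2 ^ m) : subStart s m t = b := by
  obtain ⟨q, hq⟩ := hd
  have : (t - s) / 2 ^ m = q := by
    rw [Nat.div_eq_iff (by positivity)]
    rw [mul_comm q]
    constructor
    · omega
    · have : 0 < 2 ^ m := by positivity
      omega
  unfold subStart
  rw [this]
  omega

theorem le_subStart_of_dvd {m b : ℕ} (hsb : s ≤ b) (hd : 2 ^ m ∣ b - s) (h1 : b ≤ t) :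
    b ≤ subStart s m t := by
  obtain ⟨q, hq⟩ := hd
  have h2 : q ≤ (t - s) / 2 ^ m := by
    rw [Nat.le_div_iff_mul_le (by positivity), mul_comm]
    omega
  have h3 := Nat.mul_le_mul_left (2 ^ m) h2
  unfold subStart
  omega

/-- The top instance has scheduling probability one. It covers every round of its block, so the
infimum defining `activeOrder` is attained and is not the default value 0 of an empty set. -/
theorem scheduled_top (hρ : ρ (2 ^ n) ≠ 0) (hu : u s n ≤ 1) : Scheduled ρ u s n n s :=
  ⟨le_rfl, by simp, by rwa [div_self hρ]⟩

theorem activeOrder_spec (hρ : ρ (2 ^ n) ≠ 0) (hu : u s n ≤ 1) (h1 : s ≤ t)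
    (h2 : t < s + 2 ^ n) :
    Scheduled ρ u s n (activeOrder ρ u s n t) (subStart s (activeOrder ρ u s n t) t) := by
  have hne : {m | Scheduled ρ u s n m (subStart s m t)}.Nonempty := by
    refine ⟨n, ?_⟩
    have : subStart s n t = s := subStart_eq_of_dvd le_rfl (by simp) h1 h2
    simp only [Set.mem_ofPred_eq, this]
    exact scheduled_top hρ hu
  exact Nat.sInf_mem hne

theorem activeOrder_le {m b : ℕ} (hs : Scheduled ρ u s n m b) (hsb : s ≤ b) (h1 : b ≤ t)
    (h2 : t < b + 2 ^ m) : activeOrder ρ u s n t ≤ m := by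
  refine Nat.sInf_le ?_
  simp only [Set.mem_ofPred_eq]
  rwa [subStart_eq_of_dvd hsb hs.2.1 h1 h2]

end Schedule

/-! ### Greedy cutting into nearly stationary pieces -/

section Pieces

variable {X A ι : Type*} [MeasurableSpace X] [Fintype A] [Fintype ι]

open Classical in
/-- The start of the piece containing round `s + k` when the rounds from `s` on are greedily cut
into nearly stationary pieces. -/
noncomputable def pieceAux (S : Setup X A ι) (W : World X ι) (s : ℕ) : ℕ → ℕ
  | 0 => s
  | k + 1 => if total (drift S W) (pieceAux S W s k) (s + k + 1) ≤
      S.rho (s + k + 1 - pieceAux S W s k + 1) then pieceAux S W s k else s + k + 1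

/-- The start of the nearly stationary piece containing round `t`, cutting from round `s` on. -/
noncomputable def pieceStart (S : Setup X A ι) (W : World X ι) (s t : ℕ) : ℕ :=
  pieceAux S W s (t - s)

variable {S : Setup X A ι} {W : World X ι} {s t : ℕ}

theorem pieceStart_self : pieceStart S W s s = s := by simp [pieceStart, pieceAux]

theorem pieceStart_succ (h : s ≤ t) :
    (pieceStart S W s (t + 1) = pieceStart S W s t ∧
      total (drift S W) (pieceStart S W s t) (t + 1) ≤ S.rho (t + 1 - pieceStart S W s t + 1)) ∨
    (pieceStart S W s (t + 1) = t + 1 ∧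
      S.rho (t + 1 - pieceStart S W s t + 1) < total (drift S W) (pieceStart S W s t) (t + 1)) := by
  obtain ⟨k, rfl⟩ := Nat.exists_eq_add_of_le h
  have h1 : pieceStart S W s (s + k) = pieceAux S W s k := by simp [pieceStart]
  have h2 : pieceStart S W s (s + k + 1) = pieceAux S W s (k + 1) := by
    simp [pieceStart, Nat.add_assoc]
  rw [h1, h2, pieceAux]
  split_ifs with h3
  · exact Or.inl ⟨rfl, h3⟩
  · exact Or.inr ⟨rfl, not_le.1 h3⟩

/-- The last clause, that a piece start lies in its own piece, combines with monotonicity to show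
that pieces are intervals (`pieceStart_eq_of_mem`). -/
theorem pieceStart_spec (h : s ≤ t) : s ≤ pieceStart S W s t ∧ pieceStart S W s t ≤ t ∧
    total (drift S W) (pieceStart S W s t) t ≤ S.rho (t - pieceStart S W s t + 1) ∧
    pieceStart S W s (pieceStart S W s t) = pieceStart S W s t := by
  have hself : ∀ t, total (drift S W) t t ≤ S.rho (t - t + 1) := fun t => by
    rw [total, Finset.Ico_self, Finset.sum_empty]
    exact S.rho_nonneg _
  induction t, h using Nat.le_induction with
  | base =>
    rw [pieceStart_self, pieceStart_self]
    exact ⟨le_rfl, le_rfl, hself s, rfl⟩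
  | succ t h ih =>
    rcases pieceStart_succ (S := S) (W := W) h with ⟨h1, h2⟩ | ⟨h1, h2⟩
    · rw [h1]
      exact ⟨ih.1, ih.2.1.trans (Nat.le_succ t), h2, ih.2.2.2⟩
    · rw [h1, h1]
      exact ⟨h.trans (Nat.le_succ t), le_rfl, hself _, rfl⟩

theorem pieceStart_mono (h : s ≤ t) {t' : ℕ} (h' : t ≤ t') :
    pieceStart S W s t ≤ pieceStart S W s t' := by
  induction t', h' using Nat.le_induction with
  | base => exact le_rfl
  | succ t' h' ih =>
    rcases pieceStart_succ (S := S) (W := W) (h.trans h') with ⟨h1, _⟩ | ⟨h1, _⟩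
    · rw [h1]; exact ih
    · rw [h1]
      have := (pieceStart_spec (S := S) (W := W) h).2.1
      omega

theorem pieceStart_eq_of_mem (h : s ≤ t) {σ : ℕ} (h1 : pieceStart S W s t ≤ σ) (h2 : σ ≤ t) :
    pieceStart S W s σ = pieceStart S W s t := by
  have h3 := pieceStart_spec (S := S) (W := W) h
  apply le_antisymm (pieceStart_mono (h3.1.trans h1) h2)
  have := pieceStart_mono (S := S) (W := W) h3.1 h1
  rwa [h3.2.2.2] at this

end Pieces

/-! ### The good event, and FALCON instances inside MASTER -/

section MasterDeterministic

variable {X A ι : Type*} [MeasurableSpace X] [Fintype A] [Fintype ι]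

/-- The rate used by the reduction. -/
noncomputable def Setup.mrate (S : Setup X A ι) : ℕ → ℝ := fun t => 1000000 * S.rho t

/-- The block containing round `t` when the reduction runs with FALCON. -/
noncomputable def Setup.block (S : Setup X A ι) (u : ℕ → ℕ → ℝ) (obs : ℕ → Obs X A) (t : ℕ) :
    ℕ × ℕ := blockAt (S.falcon 4000) S.T S.δ S.mrate u obs t

/-- The optimistic quantity of the active instance. -/
noncomputable def Setup.mopt (S : Setup X A ι) (u : ℕ → ℕ → ℝ) (obs : ℕ → Obs X A)
    (s n t : ℕ) : ℝ := multiOpt (S.falcon 4000) S.mrate u obs s n t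

/-- The threshold `ρ̂` of the tests. -/
noncomputable def Setup.rhat (S : Setup X A ι) (t : ℕ) : ℝ := rateHat S.T S.δ S.mrate t

/-- The logarithm of `T / δ`. -/
noncomputable def Setup.lg (S : Setup X A ι) : ℝ := Real.log ((S.T : ℝ) / S.δ)

/-- The number of scales, `log₂ T + 1`. -/
noncomputable def Setup.scales (S : Setup X A ι) : ℝ := Real.logb 2 S.T + 1

/-- The probability that an order-`m` instance is scheduled in a block of order `n`. -/
noncomputable def Setup.sprob (S : Setup X A ι) (n m : ℕ) : ℝ := S.mrate (2 ^ n) / S.mrate (2 ^ m)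

/-- The rounds in which the instance `(m, b)` of the block `(s, n)` is active. -/
def Setup.ActiveIn (S : Setup X A ι) (u : ℕ → ℕ → ℝ) (obs : ℕ → Obs X A) (s n : ℕ) (i : ℕ × ℕ)
    (t : ℕ) : Prop := S.block u obs t = (s, n) ∧ activeInst S.mrate u s n t = i

/-- In the block `(s, n)` an order-`m` instance starting in round `b` would notice that an earlier
optimistic quantity of the same piece was too small. -/
def Detectable (S : Setup X A ι) (W : World X ι) (u : ℕ → ℕ → ℝ) (obs : ℕ → Obs X A)
    (s n m b : ℕ) : Prop :=
  2 ^ m ∣ b - s ∧ pieceStart S W s b = pieceStart S W s (b + 2 ^ m - 1) ∧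
    ∃ σ, pieceStart S W s b ≤ σ ∧ σ < b ∧
      11 * S.rhat (2 ^ m) < bestValue S W σ - S.mopt u obs s n σ

open Classical in
/-- The high-probability event on which the regret of the reduction is bounded. -/
structure MasterGood (S : Setup X A ι) (W : World X ι) (u : ℕ → ℕ → ℝ) (obs : ℕ → Obs X A)
    (p : ℕ → X → A → ℝ) : Prop where
  conc : ∀ s ∈ Finset.Icc 1 S.T, ∀ n < S.T, ∀ m < S.T, ∀ b ∈ Finset.Icc 1 S.T,
    Concentrated S W (S.ActiveIn u obs s n (m, b)) s obs p
  rewards : ∀ b ∈ Finset.Icc 1 S.T, Concentrated S W (fun _ => True) b obs p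
  unif : ∀ t ∈ Finset.Icc 1 S.T, ∀ m < S.T, u t m ≤ 1
  counts : ∀ s ∈ Finset.Icc 1 S.T, ∀ b ∈ Finset.Icc 1 S.T, ∀ n < S.T, ∀ m ≤ n, ∀ e ≤ S.T + 1,
    (((Finset.Ico b e).filter fun τ => 2 ^ m ∣ τ - s ∧ u τ m ≤ S.sprob n m).card : ℝ) ≤
      2 * S.sprob n m * ((Finset.Ico b e).filter fun τ => 2 ^ m ∣ τ - s).card + 20 * S.lg
  detect : ∀ s ∈ Finset.Icc 1 S.T, ∀ n < S.T, ∀ m ≤ n, ∀ e ≤ S.T + 1,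
    (∀ b ∈ Finset.Ico s e, Detectable S W u obs s n m b → S.sprob n m < u b m) →
      S.sprob n m * ((Finset.Ico s e).filter fun b => Detectable S W u obs s n m b).card ≤
        20 * S.lg

variable {S : Setup X A ι} {W : World X ι} {u : ℕ → ℕ → ℝ} {obs : ℕ → Obs X A}
  {p : ℕ → X → A → ℝ}

theorem Setup.half_lt_lg (S : Setup X A ι) : 1 / 2 < S.lg := S.half_lt_log

theorem Setup.two_le_scales (S : Setup X A ι) : 2 ≤ S.scales := by
  unfold Setup.scales
  have h : (1 : ℝ) ≤ Real.logb 2 S.T := by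
    rw [Real.le_logb_iff_rpow_le (by norm_num) (by linarith [S.two_le_T_real]), Real.rpow_one]
    exact S.two_le_T_real
  linarith

theorem Setup.succ_le_scales (S : Setup X A ι) {n : ℕ} (h : 2 ^ n ≤ S.T) :
    (n : ℝ) + 1 ≤ S.scales := by
  unfold Setup.scales
  have : (n : ℝ) ≤ Real.logb 2 S.T := by
    rw [Real.le_logb_iff_rpow_le (by norm_num) (by linarith [S.two_le_T_real]), Real.rpow_natCast]
    exact_mod_cast h
  linarith

/-- The factor between the test thresholds and the rate of FALCON. -/
noncomputable def Setup.hfac (S : Setup X A ι) : ℝ := 6000000 * S.scales * S.lg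

theorem Setup.rhat_eq (S : Setup X A ι) (t : ℕ) : S.rhat t = S.hfac * S.rho t := by
  unfold Setup.rhat rateHat Setup.mrate Setup.hfac Setup.scales Setup.lg
  ring

theorem Setup.le_hfac (S : Setup X A ι) : 6000000 ≤ S.hfac := by
  unfold Setup.hfac
  nlinarith [S.half_lt_lg, S.two_le_scales]

theorem Setup.rho_le_rhat (S : Setup X A ι) (t : ℕ) : 6000000 * S.rho t ≤ S.rhat t := by
  rw [S.rhat_eq]
  have := S.rho_nonneg t
  have := S.le_hfac
  gcongr

theorem Setup.rhat_pos (S : Setup X A ι) {t : ℕ} (ht : 1 ≤ t) : 0 < S.rhat t := by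
  have := S.rho_le_rhat t
  have := S.rho_pos ht
  linarith

theorem Setup.mrate_ne_zero (S : Setup X A ι) (n : ℕ) : S.mrate (2 ^ n) ≠ 0 := by
  unfold Setup.mrate
  have := S.rho_pos (t := 2 ^ n) Nat.one_le_two_pow
  positivity

theorem Setup.rho_two_pow (S : Setup X A ι) (n : ℕ) :
    S.rho (2 ^ n) = √(S.numA * S.logTerm) / √(2 ^ n) := by
  unfold Setup.rho
  have := S.numA_pos
  have := S.logTerm_pos
  rw [Real.sqrt_div (by positivity)]
  push_cast
  rfl

theorem Setup.sprob_eq (S : Setup X A ι) (n m : ℕ) : S.sprob n m = √(2 ^ m) / √(2 ^ n) := by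
  unfold Setup.sprob Setup.mrate
  rw [S.rho_two_pow, S.rho_two_pow]
  have := S.numA_pos
  have := S.logTerm_pos
  have : 0 < √(S.numA * S.logTerm) := Real.sqrt_pos.2 (by positivity)
  field_simp

theorem Setup.sprob_pos (S : Setup X A ι) (n m : ℕ) : 0 < S.sprob n m := by
  rw [S.sprob_eq]
  positivity

theorem Setup.sprob_le_one (S : Setup X A ι) {n m : ℕ} (h : m ≤ n) : S.sprob n m ≤ 1 := by
  rw [S.sprob_eq, div_le_one (by positivity)]
  apply Real.sqrt_le_sqrt
  exact pow_le_pow_right₀ (by norm_num) h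

/-- Identifies the history kept for an instance with the history along the rounds selected by
`ActiveIn`, so that the analysis of FALCON along selected rounds applies to instances of MASTER. -/
theorem instHistory_eq {s n t : ℕ} {i : ℕ × ℕ}
    (hb : ∀ σ, s ≤ σ → σ < t → S.block u obs σ = (s, n))
    (ha : activeInst S.mrate u s n t = i) :
    instHistory S.mrate u obs s n t = selHist (S.ActiveIn u obs s n i) obs s t := by
  have h1 : instHistory S.mrate u obs s n t =
      selHist (fun τ => activeInst S.mrate u s n τ = activeInst S.mrate u s n t) obs s t := by
    unfold instHistory selHist
    congr!
  rw [h1, ha]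
  refine selHist_congr obs fun τ h2 h3 => ?_
  simp only [Setup.ActiveIn, hb τ h2 h3, true_and]

/-- The reduction run with FALCON on the event `MasterGood`. -/
structure MasterContext (S : Setup X A ι) (W : World X ι) (u : ℕ → ℕ → ℝ) (obs : ℕ → Obs X A)
    (p : ℕ → X → A → ℝ) : Prop where
  good : MasterGood S W u obs p
  plays : ∀ t, p t = masterProb (S.falcon 4000) S.T S.δ S.mrate u obs t
  reward_mem : ∀ t, (obs t).2.2 ∈ Set.Icc (0 : ℝ) 1
  policy : ∀ t, IsPolicy (p t)

/-- Round `t` lies in the block `(s, n)`. -/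
abbrev InBlock (S : Setup X A ι) (u : ℕ → ℕ → ℝ) (obs : ℕ → Obs X A) (s n t : ℕ) : Prop :=
  BlockSpec (S.falcon 4000) S.T S.δ S.mrate u obs s n t

theorem MasterContext.unif_start (h : MasterContext S W u obs p) {s n t : ℕ}
    (hb : InBlock S u obs s n t) (ht : t ≤ S.T) : u s n ≤ 1 :=
  h.good.unif s (Finset.mem_Icc.2 ⟨hb.one_le, hb.start_le.trans ht⟩) n (hb.lt.trans_le ht)

theorem MasterContext.activeOrder_le (h : MasterContext S W u obs p) {s n t : ℕ}
    (hb : InBlock S u obs s n t) (ht : t ≤ S.T) : activeOrder S.mrate u s n t ≤ n :=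
  RealizableBandit.activeOrder_le (scheduled_top (S.mrate_ne_zero n) (h.unif_start hb ht)) le_rfl
    hb.start_le hb.lt_end

theorem MasterContext.scheduled_active (h : MasterContext S W u obs p) {s n t : ℕ}
    (hb : InBlock S u obs s n t) (ht : t ≤ S.T) : Scheduled S.mrate u s n
      (activeInst S.mrate u s n t).1 (activeInst S.mrate u s n t).2 :=
  activeOrder_spec (S.mrate_ne_zero n) (h.unif_start hb ht) hb.start_le hb.lt_end

theorem ActiveIn.snd_le {s n : ℕ} {i : ℕ × ℕ} {t : ℕ} (hst : s ≤ t)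
    (h : S.ActiveIn u obs s n i t) : s ≤ i.2 ∧ i.2 ≤ t ∧ t < i.2 + 2 ^ i.1 := by
  rw [← h.2]
  exact ⟨le_subStart _ _ _, subStart_le _ _ hst, lt_subStart_add _ _ hst⟩

theorem MasterContext.concentrated (h : MasterContext S W u obs p) {s n t : ℕ} {i : ℕ × ℕ}
    (hb : InBlock S u obs s n t) (ht : t ≤ S.T) (hi : activeInst S.mrate u s n t = i) :
    Concentrated S W (S.ActiveIn u obs s n i) s obs p := by
  have h1 : S.ActiveIn u obs s n i t := ⟨hb.same t hb.start_le le_rfl, hi⟩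
  have h2 := ActiveIn.snd_le hb.start_le h1
  have h3 := h.activeOrder_le hb ht
  have h4 : i.1 ≤ n := by rw [← hi]; exact h3
  have h5 := hb.lt
  have h6 := hb.start_le
  have h7 := hb.one_le
  exact h.good.conc s (Finset.mem_Icc.2 ⟨h7, by omega⟩) n (by omega) i.1 (by omega) i.2
    (Finset.mem_Icc.2 ⟨by omega, by omega⟩)

/-- The instance active in round `t` of a nearly stationary environment satisfies the assumptions
of the analysis of FALCON. -/
theorem MasterContext.nearStationary (h : MasterContext S W u obs p) {s n t b : ℕ} {i : ℕ × ℕ}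
    (hb : InBlock S u obs s n t) (ht : t ≤ S.T) (hi : activeInst S.mrate u s n t = i)
    (hbi : b ≤ i.2) {e : ℕ} (hte : t ≤ e) (hd : total (drift S W) b e ≤ S.rho (e - b + 1)) :
    NearStationary S W (S.ActiveIn u obs s n i) s i.2 obs p t := by
  have h1 : S.ActiveIn u obs s n i t := ⟨hb.same t hb.start_le le_rfl, hi⟩
  have h2 := ActiveIn.snd_le hb.start_le h1
  have hsel : ∀ τ ∈ selBefore (S.ActiveIn u obs s n i) s t, i.2 ≤ τ := fun τ hτ =>
    (ActiveIn.snd_le (mem_selBefore.1 hτ).1.1 (mem_selBefore.1 hτ).2).2.1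
  refine ⟨h.concentrated hb ht hi, by omega, h2.2.1, hsel, fun τ hτ => ?_, ?_⟩
  · obtain ⟨⟨h3, h4⟩, h5⟩ := mem_selBefore.1 hτ
    rw [h.plays τ, masterProb]
    have h6 : blockAt (S.falcon 4000) S.T S.δ S.mrate u obs τ = (s, n) := h5.1
    rw [h6]
    simp only [Setup.falcon]
    rw [instHistory_eq (i := i) (fun σ h7 h8 => hb.same σ h7 (by omega)) h5.2]
  -- The instance has been active in at most `t - i.2` rounds, so the rate at its own clock is no
  -- smaller than that of the surrounding stretch.
  · refine (total_mono (drift_nonneg S W) hbi hte).trans (hd.trans (S.rho_antitone (by omega) ?_))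
    have h7 : selBefore (S.ActiveIn u obs s n i) s t ⊆ Finset.Ico i.2 t := fun τ hτ =>
      Finset.mem_Ico.2 ⟨hsel τ hτ, (mem_selBefore.1 hτ).1.2⟩
    have h8 := Finset.card_le_card h7
    rw [Nat.card_Ico] at h8
    omega

theorem MasterContext.mopt_eq {s n t : ℕ} {i : ℕ × ℕ}
    (hb : InBlock S u obs s n t) (hi : activeInst S.mrate u s n t = i) :
    S.mopt u obs s n t = S.falconOpt 4000 (selHist (S.ActiveIn u obs s n i) obs s t) := by
  rw [← instHistory_eq (i := i) (fun σ h7 h8 => hb.same σ h7 h8.le) hi]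
  rfl

theorem Setup.mopt_mem (S : Setup X A ι) (u : ℕ → ℕ → ℝ) (obs : ℕ → Obs X A) (s n t : ℕ) :
    S.mopt u obs s n t ∈ Set.Icc (0 : ℝ) 1 := by
  have hg : ∀ h : List (Obs X A), S.falconOpt 4000 h ∈ Set.Icc (0 : ℝ) 1 := fun h => by
    unfold Setup.falconOpt
    refine ⟨le_min zero_le_one (add_nonneg (div_nonneg (List.sum_nonneg ?_) (Nat.cast_nonneg _))
      (mul_nonneg (by norm_num) (S.rho_nonneg _))), min_le_left _ _⟩
    intro y hy
    obtain ⟨o, _, rfl⟩ := List.mem_map.1 hy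
    exact S.reg_nonneg _ _ _
  exact hg _

/-- While an instance is scheduled, only instances of at most its order that start within its
interval are active. -/
theorem activeInst_of_scheduled {s n m b t : ℕ} (hs : Scheduled S.mrate u s n m b) (hsb : s ≤ b)
    (h1 : b ≤ t) (h2 : t < b + 2 ^ m) :
    (activeInst S.mrate u s n t).1 ≤ m ∧ b ≤ (activeInst S.mrate u s n t).2 := by
  have h3 := RealizableBandit.activeOrder_le hs hsb h1 h2
  -- Dyadic intervals are nested: `b` is also aligned at the smaller scale.
  exact ⟨h3, le_subStart_of_dvd hsb ((pow_dvd_pow 2 h3).trans hs.2.1) h1⟩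

/-- Optimism of the quantities supplied by the active instances. -/
theorem MasterContext.bestValue_le_mopt (h : MasterContext S W u obs p) {s n m b t e : ℕ}
    (hb : InBlock S u obs s n t) (ht : t ≤ S.T) (hs : Scheduled S.mrate u s n m b) (hsb : s ≤ b)
    (h1 : b ≤ t) (hte : t ≤ e) (h2 : e < b + 2 ^ m)
    (hd : total (drift S W) b e ≤ S.rho (e - b + 1)) {σ : ℕ} (h3 : b ≤ σ) (h4 : σ ≤ e) :
    bestValue S W σ - total (drift S W) b e ≤ S.mopt u obs s n t := by
  have h5 := (activeInst_of_scheduled hs hsb h1 (hte.trans_lt h2)).2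
  set i := activeInst S.mrate u s n t with hi
  have hns := h.nearStationary hb ht hi.symm h5 hte hd
  have h6 := (falconOpt_bounds hns).1
  rw [MasterContext.mopt_eq hb hi.symm]
  have h7 : |bestValue S W σ - bestValue S W i.2| ≤ total (drift S W) b e := by
    have hit : i.2 ≤ t := hns.start_le
    rcases le_total σ i.2 with h8 | h8
    · exact (abs_bestValue_sub_le h8).trans (total_mono (drift_nonneg S W) h3 (by omega))
    · rw [abs_sub_comm]
      exact (abs_bestValue_sub_le h8).trans (total_mono (drift_nonneg S W) h5 h4)
  linarith [(abs_le.1 h7).2]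

end MasterDeterministic

end RealizableBandit

namespace RealizableBandit

/-! ### No false alarms, and detection of too small optimistic quantities -/

section MasterTests

variable {X A ι : Type*} [MeasurableSpace X] [Fintype A] [Fintype ι]
variable {S : Setup X A ι} {W : World X ι} {u : ℕ → ℕ → ℝ} {obs : ℕ → Obs X A}
  {p : ℕ → X → A → ℝ}

theorem MasterContext.plays_falcon (h : MasterContext S W u obs p) {s n t τ : ℕ} {i : ℕ × ℕ}
    (hb : InBlock S u obs s n t) (hτ : τ ≤ t) (ha : S.ActiveIn u obs s n i τ) :
    p τ = S.falconProb (selHist (S.ActiveIn u obs s n i) obs s τ) := by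
  rw [h.plays τ, masterProb]
  have h6 : blockAt (S.falcon 4000) S.T S.δ S.mrate u obs τ = (s, n) := ha.1
  rw [h6]
  simp only [Setup.falcon]
  rw [instHistory_eq (i := i) (fun σ h7 h8 => hb.same σ h7 (by omega)) ha.2]

/-- Distinct aligned rounds are at least 2^m apart, so τ ↦ (τ - b)/2^m is injective on them. -/
theorem card_aligned_le {s b e : ℕ} (hsb : s ≤ b) (hbe : b ≤ e) (m : ℕ) :
    (((Finset.Ico b e).filter fun τ => 2 ^ m ∣ τ - s).card : ℝ) ≤ ((e - b : ℕ) : ℝ) / 2 ^ m + 1 := by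
  have h1 : (((Finset.Ico b e).filter fun τ => 2 ^ m ∣ τ - s).card) ≤ (e - b) / 2 ^ m + 1 := by
    set F := (Finset.Ico b e).filter fun τ => 2 ^ m ∣ τ - s with hF
    have hinj : Set.InjOn (fun τ => (τ - b) / 2 ^ m) (F : Set ℕ) := by
      intro x hx y hy hxy
      simp only [hF, Finset.coe_filter, Finset.mem_Ico, Set.mem_ofPred_eq] at hx hy hxy
      have hpos : 0 < 2 ^ m := by positivity
      have key : ∀ x y : ℕ, b ≤ x → 2 ^ m ∣ x - s → 2 ^ m ∣ y - s → x < y →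
          (x - b) / 2 ^ m < (y - b) / 2 ^ m := fun x y hx hx' hy' hlt => by
        have h3 : 2 ^ m ∣ (y - s) - (x - s) := Nat.dvd_sub hy' hx'
        have h4 : 2 ^ m ≤ y - x := by
          have := Nat.le_of_dvd (by omega) h3
          omega
        rw [← Nat.succ_le_iff, Nat.succ_eq_add_one, ← Nat.add_div_right _ hpos]
        exact Nat.div_le_div_right (by omega)
      rcases lt_trichotomy x y with h3 | h3 | h3
      · exact absurd hxy (key x y hx.1.1 hx.2 hy.2 h3).ne
      · exact h3
      · exact absurd hxy (key y x hy.1.1 hy.2 hx.2 h3).ne'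
    have hmaps : Set.MapsTo (fun τ => (τ - b) / 2 ^ m) (F : Set ℕ)
        (Finset.range ((e - b) / 2 ^ m + 1) : Finset ℕ) := by
      intro x hx
      simp only [hF, Finset.coe_filter, Finset.mem_Ico, Set.mem_ofPred_eq] at hx
      simp only [Finset.coe_range, Set.mem_Iio]
      exact Nat.lt_succ_of_le (Nat.div_le_div_right (by omega))
    simpa using Finset.card_le_card_of_injOn _ hmaps hinj
  have h2 : (((e - b) / 2 ^ m : ℕ) : ℝ) ≤ ((e - b : ℕ) : ℝ) / 2 ^ m := by
    have := @Nat.cast_div_le ℝ _ _ _ (e - b) (2 ^ m)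
    push_cast at this
    exact this
  calc _ ≤ (((e - b) / 2 ^ m + 1 : ℕ) : ℝ) := by exact_mod_cast h1
    _ ≤ _ := by push_cast at h2 ⊢; linarith

theorem Setup.two_pow_le {s n t : ℕ} (hb : InBlock S u obs s n t) (ht : t ≤ S.T) {m : ℕ}
    (hm : m ≤ n) : 2 ^ m ≤ S.T :=
  (Nat.pow_le_pow_right (by norm_num) hm).trans (hb.pow_le_start.trans (hb.start_le.trans ht))

/-- The rounds up to `t` in which a fixed instance is active contribute little to the sum of the
differences of optimistic quantities and rewards. -/
theorem MasterContext.sum_active_le (h : MasterContext S W u obs p) {s n b t : ℕ}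
    {i : ℕ × ℕ} (hb : InBlock S u obs s n t) (ht : t ≤ S.T) (hbi : b ≤ i.2)
    (hd : total (drift S W) b t ≤ S.rho (t - b + 1)) (hc : ∃ τ, s ≤ τ ∧ τ ≤ t ∧
      S.ActiveIn u obs s n i τ) :
    ∑ τ ∈ selBefore (S.ActiveIn u obs s n i) s (t + 1), (S.mopt u obs s n τ - (obs τ).2.2) ≤
      40000 * √(S.numA * S.logTerm) * √(min (2 ^ i.1) ((t - b + 1 : ℕ) : ℝ)) := by
  have hmem : ∀ {τ}, τ ∈ selBefore (S.ActiveIn u obs s n i) s (t + 1) →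
      (s ≤ τ ∧ τ ≤ t) ∧ S.ActiveIn u obs s n i τ := fun hτ => by
    have := mem_selBefore.1 hτ
    exact ⟨⟨this.1.1, Nat.le_of_lt_succ this.1.2⟩, this.2⟩
  obtain ⟨τ₀, h1, h2, h3⟩ := hc
  have hconc := h.concentrated (hb.of_le h1 h2) (h2.trans ht) h3.2
  have hns : ∀ τ ∈ selBefore (S.ActiveIn u obs s n i) s (t + 1),
      NearStationary S W (S.ActiveIn u obs s n i) s i.2 obs p τ := fun τ hτ =>
    h.nearStationary (hb.of_le (hmem hτ).1.1 (hmem hτ).1.2) ((hmem hτ).1.2.trans ht)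
      (hmem hτ).2.2 hbi (hmem hτ).1.2 hd
  have hmain := sum_opt_sub_reward_le (t := t + 1) (S.mopt u obs s n) hconc (by omega) hns
    (fun τ hτ => h.plays_falcon hb (hmem hτ).1.2 (hmem hτ).2) (fun τ hτ => by
      rw [MasterContext.mopt_eq (hb.of_le (hmem hτ).1.1 (hmem hτ).1.2) (hmem hτ).2.2]
      exact (falconOpt_bounds (hns τ hτ)).2)
  refine hmain.trans ?_
  have ha : 0 ≤ S.numA * S.logTerm := (mul_pos S.numA_pos S.logTerm_pos).le
  rw [Real.sqrt_mul ha, ← mul_assoc]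
  -- The active rounds are confined to the interval of the instance and also to `[b, t]`, which may
  -- be the shorter of the two.
  refine mul_le_mul_of_nonneg_left (Real.sqrt_le_sqrt (le_min ?_ ?_)) (by positivity)
  · have : selBefore (S.ActiveIn u obs s n i) s (t + 1) ⊆ Finset.Ico i.2 (i.2 + 2 ^ i.1) :=
      fun τ hτ => Finset.mem_Ico.2 (ActiveIn.snd_le (hmem hτ).1.1 (hmem hτ).2).2
    have := Finset.card_le_card this
    rw [Nat.card_Ico, Nat.add_sub_cancel_left] at this
    exact_mod_cast this
  · have : selBefore (S.ActiveIn u obs s n i) s (t + 1) ⊆ Finset.Ico b (t + 1) :=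
      fun τ hτ => Finset.mem_Ico.2 ⟨hbi.trans (ActiveIn.snd_le (hmem hτ).1.1 (hmem hτ).2).2.1,
        Nat.lt_succ_of_le (hmem hτ).1.2⟩
    have := Finset.card_le_card this
    rw [Nat.card_Ico] at this
    have h5 : t + 1 - b ≤ t - b + 1 := by omega
    exact_mod_cast this.trans h5

/-- The number of instances of order `m` starting in a nearly stationary interval, weighted by the
square root of their lengths. -/
theorem MasterContext.card_instances_le (h : MasterContext S W u obs p) {s n m b t : ℕ}
    (hb : InBlock S u obs s n t) (ht : t ≤ S.T) (hm : m ≤ n) (hsb : s ≤ b) (hbt : b ≤ t) :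
    (((Finset.Ico b (t + 1)).filter fun τ => 2 ^ m ∣ τ - s ∧ u τ m ≤ S.sprob n m).card : ℝ) *
      √(min (2 ^ m) ((t - b + 1 : ℕ) : ℝ)) ≤ 28 * S.lg * √((t - b + 1 : ℕ) : ℝ) := by
  have h1 := h.good.counts s (Finset.mem_Icc.2 ⟨hb.one_le, hb.start_le.trans ht⟩) b
    (Finset.mem_Icc.2 ⟨hb.one_le.trans hsb, hbt.trans ht⟩) n (hb.lt.trans_le ht) m hm (t + 1)
    (by omega)
  have h2 := card_aligned_le (e := t + 1) hsb (by omega) m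
  have h3 : t + 1 - b = t - b + 1 := by omega
  rw [h3] at h2
  set L : ℝ := ((t - b + 1 : ℕ) : ℝ) with hL
  have hL0 : 0 < L := by rw [hL]; positivity
  have hLn : L ≤ 2 ^ n := by
    have h4 : t - b + 1 ≤ 2 ^ n := by
      have := hb.lt_end
      omega
    rw [hL]
    exact_mod_cast h4
  have hp0 := S.sprob_pos n m
  have hp1 := S.sprob_le_one hm
  have hlg := S.half_lt_lg
  set w := √(min (2 ^ m) L) with hw
  have hw0 : 0 ≤ w := Real.sqrt_nonneg _
  have hwL : w ≤ √L := Real.sqrt_le_sqrt (min_le_right _ _)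
  have hwm : w ≤ √(2 ^ m) := Real.sqrt_le_sqrt (min_le_left _ _)
  -- The reason for the scheduling probability √(2^m/2^n): about q·L/2^m instances, each weighing
  -- √(2^m), amount to L/√(2^n), and this is at most √L since L ≤ 2^n. The bound is the same at
  -- every scale.
  have h5 : S.sprob n m * (L / 2 ^ m) * w ≤ √L := by
    calc _ ≤ S.sprob n m * (L / 2 ^ m) * √(2 ^ m) := by gcongr
      _ = L / √(2 ^ n) := by
        rw [S.sprob_eq]
        have e1 : √(2 ^ m : ℝ) * √(2 ^ m) = 2 ^ m := Real.mul_self_sqrt (by positivity)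
        have e2 : (0 : ℝ) < √(2 ^ n) := by positivity
        field_simp
        rw [pow_two, e1]
      _ ≤ L / √L := by gcongr
      _ = √L := Real.div_sqrt
  calc _ ≤ (2 * S.sprob n m * (L / 2 ^ m + 1) + 20 * S.lg) * w := by
        refine mul_le_mul_of_nonneg_right (h1.trans ?_) hw0
        gcongr
    _ = 2 * (S.sprob n m * (L / 2 ^ m) * w) + (2 * S.sprob n m + 20 * S.lg) * w := by ring
    _ ≤ 2 * √L + (2 * 1 + 20 * S.lg) * √L := by gcongr
    _ ≤ 28 * S.lg * √L := by nlinarith [Real.sqrt_nonneg L]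

theorem Setup.rhat_mul (S : Setup X A ι) {t : ℕ} :
    S.rhat t * t = S.hfac * (√(S.numA * S.logTerm) * √t) := by
  rw [S.rhat_eq, mul_assoc, mul_comm (S.rho t), S.mul_rho, Real.sqrt_mul]
  exact (mul_pos S.numA_pos S.logTerm_pos).le

/-- In a nearly stationary interval of a scheduled instance the optimistic quantities exceed the
rewards by at most the test threshold on average. -/
theorem MasterContext.sum_mopt_sub_reward_le (h : MasterContext S W u obs p) {s n m b t : ℕ}
    (hb : InBlock S u obs s n t) (ht : t ≤ S.T) (hs : Scheduled S.mrate u s n m b) (hsb : s ≤ b)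
    (hbt : b ≤ t) (htb : t < b + 2 ^ m)
    (hd : total (drift S W) b t ≤ S.rho (t - b + 1)) :
    ∑ τ ∈ Finset.Icc b t, (S.mopt u obs s n τ - (obs τ).2.2) ≤
      S.rhat (t - b + 1) * ((t - b + 1 : ℕ) : ℝ) := by
  classical
  set act := activeInst S.mrate u s n with hact
  set L : ℝ := ((t - b + 1 : ℕ) : ℝ) with hL
  set a := √(S.numA * S.logTerm) with ha
  -- Rounds are grouped by active instance, and instances by order; there are at most `scales`
  -- orders.
  set I := (Finset.Icc b t).image act with hI
  have hprop : ∀ i ∈ I, i.1 ≤ m ∧ b ≤ i.2 ∧ i.2 ≤ t ∧ Scheduled S.mrate u s n i.1 i.2 ∧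
      ∃ τ, s ≤ τ ∧ τ ≤ t ∧ S.ActiveIn u obs s n i τ := by
    intro i hi
    obtain ⟨τ, h1, rfl⟩ := Finset.mem_image.1 hi
    obtain ⟨h1, h2⟩ := Finset.mem_Icc.1 h1
    have h3 := activeInst_of_scheduled hs hsb h1 (h2.trans_lt htb)
    refine ⟨h3.1, h3.2, (subStart_le _ _ (hsb.trans h1)).trans h2,
      h.scheduled_active (hb.of_le (hsb.trans h1) h2) (h2.trans ht), τ, hsb.trans h1, h2,
      hb.same τ (hsb.trans h1) h2, rfl⟩
  have hfib : ∀ i ∈ I, (Finset.Icc b t).filter (fun τ => act τ = i) =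
      selBefore (S.ActiveIn u obs s n i) s (t + 1) := by
    intro i hi
    ext τ
    rw [Finset.mem_filter, Finset.mem_Icc, mem_selBefore]
    constructor
    · rintro ⟨⟨h1, h2⟩, h3⟩
      exact ⟨⟨hsb.trans h1, Nat.lt_succ_of_le h2⟩, hb.same τ (hsb.trans h1) h2, h3⟩
    · rintro ⟨⟨h1, h2⟩, h3⟩
      have := (ActiveIn.snd_le h1 h3).2.1
      exact ⟨⟨(hprop i hi).2.1.trans this, Nat.le_of_lt_succ h2⟩, h3.2⟩
  have hL0 : 0 ≤ L := Nat.cast_nonneg _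
  have ha0 : 0 ≤ a := Real.sqrt_nonneg _
  have hlg := S.half_lt_lg
  have hcount : ∀ k ∈ Finset.range (m + 1),
      ((I.filter fun i => i.1 = k).card : ℝ) * √(min (2 ^ k) L) ≤ 28 * S.lg * √L := by
    intro k hk
    have hkm : k ≤ m := Nat.le_of_lt_succ (Finset.mem_range.1 hk)
    refine le_trans ?_ (h.card_instances_le hb ht (hkm.trans hs.1) hsb hbt)
    refine mul_le_mul_of_nonneg_right ?_ (Real.sqrt_nonneg _)
    norm_cast
    refine Finset.card_le_card_of_injOn (fun i => i.2) ?_ ?_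
    · intro i hi
      obtain ⟨h1, rfl⟩ := Finset.mem_filter.1 hi
      have h2 := hprop i h1
      refine Finset.mem_coe.2 (Finset.mem_filter.2 ⟨Finset.mem_Ico.2
        ⟨h2.2.1, Nat.lt_succ_of_le h2.2.2.1⟩, ?_⟩)
      exact ⟨h2.2.2.2.1.2.1, h2.2.2.2.1.2.2⟩
    · intro i hi j hj hij
      obtain ⟨-, h1⟩ := Finset.mem_filter.1 hi
      obtain ⟨-, h2⟩ := Finset.mem_filter.1 hj
      exact Prod.ext (h1.trans h2.symm) hij
  have hscale : ((m : ℝ) + 1) ≤ S.scales := S.succ_le_scales (Setup.two_pow_le hb ht hs.1)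
  have hsc := S.two_le_scales
  calc ∑ τ ∈ Finset.Icc b t, (S.mopt u obs s n τ - (obs τ).2.2)
      = ∑ i ∈ I, ∑ τ ∈ (Finset.Icc b t).filter (fun τ => act τ = i),
          (S.mopt u obs s n τ - (obs τ).2.2) :=
        (Finset.sum_fiberwise_of_maps_to (fun τ hτ => Finset.mem_image_of_mem _ hτ) _).symm
    _ ≤ ∑ i ∈ I, 40000 * a * √(min (2 ^ i.1) L) := Finset.sum_le_sum fun i hi => by
        rw [hfib i hi]
        exact h.sum_active_le hb ht (hprop i hi).2.1 hd (hprop i hi).2.2.2.2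
    _ = ∑ k ∈ Finset.range (m + 1), ∑ i ∈ I.filter (fun i => i.1 = k),
          40000 * a * √(min (2 ^ i.1) L) :=
        (Finset.sum_fiberwise_of_maps_to (fun i hi => Finset.mem_range.2
          (Nat.lt_succ_of_le (hprop i hi).1)) _).symm
    _ = ∑ k ∈ Finset.range (m + 1),
          40000 * a * (((I.filter fun i => i.1 = k).card : ℝ) * √(min (2 ^ k) L)) := by
        refine Finset.sum_congr rfl fun k _ => ?_
        rw [Finset.sum_congr rfl (g := fun _ => 40000 * a * √(min (2 ^ k) L)) fun i hi => by
          rw [(Finset.mem_filter.1 hi).2], Finset.sum_const, nsmul_eq_mul]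
        ring
    _ ≤ ∑ k ∈ Finset.range (m + 1), 40000 * a * (28 * S.lg * √L) :=
        Finset.sum_le_sum fun k hk => mul_le_mul_of_nonneg_left (hcount k hk) (by positivity)
    _ = ((m : ℝ) + 1) * (40000 * a * (28 * S.lg * √L)) := by
        rw [Finset.sum_const, Finset.card_range, nsmul_eq_mul]
        push_cast
        ring
    _ ≤ S.scales * (40000 * a * (28 * S.lg * √L)) := by gcongr
    -- 40000·28 is below 6000000 = 6K, the numerical factor of the threshold.
    _ ≤ S.hfac * (a * √L) := by
        unfold Setup.hfac
        have : 0 ≤ S.scales * S.lg * (a * √L) := by positivity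
        nlinarith
    _ = _ := S.rhat_mul.symm

theorem InBlock.scheduled_self (h : MasterContext S W u obs p) {s n t : ℕ}
    (hb : InBlock S u obs s n t) (ht : t ≤ S.T) : Scheduled S.mrate u s n n s :=
  scheduled_top (S.mrate_ne_zero n) (h.unif_start hb ht)

/-- No test fails while the environment is nearly stationary since the start of the block. -/
theorem MasterContext.rho_lt_total_of_fail (h : MasterContext S W u obs p) {s n t : ℕ}
    (hb : InBlock S u obs s n t) (ht : t ≤ S.T)
    (hfail : TestsFail (S.falcon 4000) S.T S.δ S.mrate u obs s n t) :
    S.rho (t - s + 1) < total (drift S W) s t := by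
  by_contra! hd
  have htop := InBlock.scheduled_self h hb ht
  have hst := hb.start_le
  rcases hfail with ⟨m, b, hsb, hbt, hsch, hle⟩ | hfail
  -- Test 1. All optimistic quantities of the block are at least the optimal values minus ρ(2^m),
  -- and the rewards exceed the optimal values by at most 21ρ(2^m) on average. The excess 22ρ(2^m)
  -- is far below 9ρ̂(2^m).
  · have h2m : 0 < 2 ^ m := by positivity
    have hbt' : b ≤ t := by omega
    have hcard : t - b + 1 = 2 ^ m := by omega
    have hopt : ∀ σ ∈ Finset.Icc s t, ∀ τ ∈ Finset.Icc s t,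
        bestValue S W τ - total (drift S W) s t ≤ S.mopt u obs s n σ := by
      intro σ hσ τ hτ
      obtain ⟨h1, h2⟩ := Finset.mem_Icc.1 hσ
      obtain ⟨h3, h4⟩ := Finset.mem_Icc.1 hτ
      exact h.bestValue_le_mopt (hb.of_le h1 h2) (h2.trans ht) htop le_rfl h1 h2 hb.lt_end hd h3 h4
    haveI : Nonempty (Finset.Icc s t) := ⟨⟨s, Finset.mem_Icc.2 ⟨le_rfl, hst⟩⟩⟩
    obtain ⟨σ, hσ⟩ := exists_eq_ciInf_of_finite
      (f := fun τ : Finset.Icc s t => multiOpt (S.falcon 4000) S.mrate u obs s n (τ : ℕ))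
    rw [← hσ] at hle
    have hR := (abs_le.1 ((h.good.rewards b
      (Finset.mem_Icc.2 ⟨hb.one_le.trans hsb, by omega⟩)).reward (t + 1) (by omega))).2
    rw [selBefore_true, Nat.card_Ico] at hR
    have hico : Finset.Ico b (t + 1) = Finset.Icc b t := by ext x; simp
    have h5 : t + 1 - b = 2 ^ m := by omega
    rw [hico, h5, Finset.sum_sub_distrib] at hR
    have hsum : ∑ τ ∈ Finset.Icc b t, polValue S (W.D τ) (W.star τ) (p τ) ≤
        ∑ τ ∈ Finset.Icc b t, (S.mopt u obs s n σ + S.rho (2 ^ m)) := by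
      refine Finset.sum_le_sum fun τ hτ => ?_
      obtain ⟨h1, h2⟩ := Finset.mem_Icc.1 hτ
      have h3 := polValue_le_bestValue (S := S) (W := W) (h.policy τ) τ
      have h4 := hopt σ σ.2 τ (Finset.mem_Icc.2 ⟨hsb.trans h1, h2⟩)
      have h6 : S.rho (t - s + 1) ≤ S.rho (2 ^ m) := S.rho_antitone (by omega) (by omega)
      linarith
    rw [Finset.sum_const, Nat.card_Icc, h5, nsmul_eq_mul] at hsum
    rw [le_div_iff₀ (by positivity)] at hle
    have h6 : √(S.logTerm * ((2 ^ m : ℕ) : ℝ)) ≤ 2 ^ m * S.rho (2 ^ m) := by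
      have := S.mul_rho (2 ^ m)
      push_cast at this
      rw [this]
      refine Real.sqrt_le_sqrt ?_
      push_cast
      have h8 := S.one_le_numA
      have h9 := S.logTerm_pos
      have : S.logTerm ≤ S.numA * S.logTerm := le_mul_of_one_le_left h9.le h8
      gcongr
    have h7 := S.rho_le_rhat (2 ^ m)
    have h8 := S.rho_pos (t := 2 ^ m) Nat.one_le_two_pow
    have h9 : (0 : ℝ) < 2 ^ m := by positivity
    have h10 : S.mopt u obs s n σ = multiOpt (S.falcon 4000) S.mrate u obs s n σ := rfl
    have h11 : S.rhat (2 ^ m) = rateHat S.T S.δ S.mrate (2 ^ m) := rfl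
    rw [← h10, ← h11] at hle
    push_cast at hsum
    have h12 : (S.mopt u obs s n σ + 9 * S.rhat (2 ^ m)) * 2 ^ m ≤
        2 ^ m * (S.mopt u obs s n σ + S.rho (2 ^ m)) + 21 * (2 ^ m * S.rho (2 ^ m)) := by linarith
    have h13 : (9 * S.rhat (2 ^ m) - 22 * S.rho (2 ^ m)) * 2 ^ m ≤ 0 := by linarith
    have h14 : 0 < (9 * S.rhat (2 ^ m) - 22 * S.rho (2 ^ m)) * 2 ^ m := by
      apply mul_pos _ h9
      linarith
    linarith
  -- Test 2. The stretch since `s` lies in the interval of the top instance, so the average is at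
  -- most ρ̂, against a threshold of 3ρ̂.
  · have h1 := h.sum_mopt_sub_reward_le hb ht htop le_rfl hst hb.lt_end hd
    unfold Test2Fails at hfail
    rw [le_div_iff₀ (by positivity)] at hfail
    have h2 := S.rhat_pos (t := t - s + 1) (by omega)
    have h3 : (0 : ℝ) < ((t - s + 1 : ℕ) : ℝ) := by positivity
    have h4 : 3 * S.rhat (t - s + 1) * ((t - s + 1 : ℕ) : ℝ) ≤
      ∑ τ ∈ Finset.Icc s t, (S.mopt u obs s n τ - (obs τ).2.2) := hfail
    nlinarith [mul_pos h2 h3]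

/-- An instance that would notice a too small optimistic quantity within a block is not
scheduled. -/
theorem MasterContext.not_scheduled_of_detectable (h : MasterContext S W u obs p) {s n m b e : ℕ}
    (hb : InBlock S u obs s n e) (he : e ≤ S.T) (hm : m ≤ n) (hsb : s ≤ b) (hbe : b + 2 ^ m ≤ e)
    (hdet : Detectable S W u obs s n m b) : S.sprob n m < u b m := by
  by_contra! hu
  obtain ⟨hdvd, hpst, σ, hqσ, hσb, hgap⟩ := hdet
  have hsch : Scheduled S.mrate u s n m b := ⟨hm, hdvd, hu⟩
  have h2m : 0 < 2 ^ m := by positivity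
  set t := b + 2 ^ m - 1 with ht
  have hst : s ≤ t := by omega
  have hte : t < e := by omega
  have hbt : InBlock S u obs s n t := hb.of_le hst hte.le
  have hq := pieceStart_spec (S := S) (W := W) hst
  rw [← hpst] at hq
  set q := pieceStart S W s b with hqdef
  have hcard : t - b + 1 = 2 ^ m := by omega
  -- The interval ends in the piece in which it starts, so even the drift since the piece start is
  -- below the rate at 2^m.
  have hdq : total (drift S W) q t ≤ S.rho (2 ^ m) :=
    hq.2.2.1.trans (S.rho_antitone (by omega) (by omega))
  have hd : total (drift S W) b t ≤ S.rho (2 ^ m) :=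
    (total_mono (drift_nonneg S W) (by omega) le_rfl).trans hdq
  have h1 := h.sum_mopt_sub_reward_le hbt (by omega) hsch hsb (by omega) (by omega)
    (by rwa [hcard])
  rw [hcard] at h1
  have h2 : ∑ τ ∈ Finset.Icc b t, (bestValue S W σ - 2 * S.rho (2 ^ m)) ≤
      ∑ τ ∈ Finset.Icc b t, S.mopt u obs s n τ := by
    refine Finset.sum_le_sum fun τ hτ => ?_
    obtain ⟨h3, h4⟩ := Finset.mem_Icc.1 hτ
    have h5 := h.bestValue_le_mopt (hbt.of_le (hsb.trans h3) h4) (by omega) hsch hsb h3 h4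
      (by omega) (by rwa [hcard]) (σ := b) le_rfl (by omega)
    have h6 := abs_bestValue_sub_le (S := S) (W := W) hσb.le
    have h7 : total (drift S W) σ b ≤ total (drift S W) q t :=
      total_mono (drift_nonneg S W) hqσ (by omega)
    linarith [(abs_le.1 h6).2]
  have h5 : t + 1 - b = 2 ^ m := by omega
  rw [Finset.sum_const, Nat.card_Icc, h5, nsmul_eq_mul] at h2
  rw [Finset.sum_sub_distrib] at h1
  -- If scheduled, the instance would make Test 1 fail at `t < e`, although the block survives to
  -- `e`: its average reward is at least f*_σ - 2ρ - ρ̂, and f*_σ > g̃_σ + 11ρ̂ with 11 = 9 + 1 + 1.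
  refine hb.pass t hst hte (Or.inl ⟨m, b, hsb, by omega, hsch, ?_⟩)
  rw [le_div_iff₀ (by positivity)]
  have h8 : (⨅ τ : Finset.Icc s t, multiOpt (S.falcon 4000) S.mrate u obs s n (τ : ℕ)) ≤
      S.mopt u obs s n σ :=
    ciInf_le (f := fun τ : Finset.Icc s t => multiOpt (S.falcon 4000) S.mrate u obs s n (τ : ℕ))
      (Set.finite_range _).bddBelow ⟨σ, Finset.mem_Icc.2 ⟨by omega, by omega⟩⟩
  have h11 : S.rhat (2 ^ m) = rateHat S.T S.δ S.mrate (2 ^ m) := rfl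
  rw [← h11]
  have h7 := S.rho_le_rhat (2 ^ m)
  have h9 := S.rho_nonneg (2 ^ m)
  have h10 : (0 : ℝ) < 2 ^ m := by positivity
  push_cast at h1 h2
  calc _ ≤ (S.mopt u obs s n σ + 9 * S.rhat (2 ^ m)) * 2 ^ m := by gcongr
    _ ≤ (bestValue S W σ - 2 * S.rho (2 ^ m) - S.rhat (2 ^ m)) * 2 ^ m := by
      refine mul_le_mul_of_nonneg_right ?_ h10.le
      linarith
    _ ≤ _ := by linarith

end MasterTests

end RealizableBandit

namespace RealizableBandit

/-! ### Regret of one block -/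

section BlockRegret

variable {X A ι : Type*} [MeasurableSpace X] [Fintype A] [Fintype ι]
variable {S : Setup X A ι} {W : World X ι} {u : ℕ → ℕ → ℝ} {obs : ℕ → Obs X A}
  {p : ℕ → X → A → ℝ}

theorem Setup.one_le_rhat_one (S : Setup X A ι) : 1 ≤ S.rhat 1 := by
  have := S.rho_le_rhat 1
  have := S.half_le_rho_one
  linarith

open Classical in
/-- Dyadic decomposition of a gap into multiples of the test thresholds. -/
theorem Setup.le_sum_rhat (S : Setup X A ι) {g : ℝ} (hg : g ≤ 1) (n : ℕ) :
    g ≤ 11 * S.rhat (2 ^ n) + ∑ m ∈ Finset.range n,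
      11 * S.rhat (2 ^ m) * (if 11 * S.rhat (2 ^ (m + 1)) < g then 1 else 0) := by
  have hpos : ∀ m, 0 < S.rhat (2 ^ m) := fun m => S.rhat_pos Nat.one_le_two_pow
  have hnn : ∀ n, 0 ≤ ∑ m ∈ Finset.range n,
      11 * S.rhat (2 ^ m) * (if 11 * S.rhat (2 ^ (m + 1)) < g then (1 : ℝ) else 0) := fun n =>
    Finset.sum_nonneg fun m _ => mul_nonneg (by linarith [hpos m]) (by split_ifs <;> norm_num)
  induction n with
  | zero =>
    have := S.one_le_rhat_one
    simp only [Finset.range_zero, Finset.sum_empty, pow_zero]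
    linarith
  | succ n ih =>
    rw [Finset.sum_range_succ]
    -- If g exceeds the finer level, the new summand is the old remainder; otherwise g is at most
    -- the new remainder.
    split_ifs with h
    · linarith [hpos (n + 1)]
    · linarith [hnn n]

open Classical in
/-- The rounds of one piece of a block whose optimistic quantity is too small. -/
theorem card_piece_le {s n e q m : ℕ} (J : Finset ℕ)
    (hJ : ∀ τ, τ ∈ J ↔ (s ≤ τ ∧ τ ≤ e) ∧ pieceStart S W s τ = q) :
    (J.filter fun τ => 11 * S.rhat (2 ^ m) < bestValue S W τ - S.mopt u obs s n τ).card ≤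
      2 ^ m * (2 + (((Finset.Ico s (e + 1 - 2 ^ m)).filter fun b =>
        Detectable S W u obs s n m b).filter fun b => pieceStart S W s b = q).card) := by
  set F := J.filter fun τ => 11 * S.rhat (2 ^ m) < bestValue S W τ - S.mopt u obs s n τ with hF
  set G := ((Finset.Ico s (e + 1 - 2 ^ m)).filter fun b =>
        Detectable S W u obs s n m b).filter fun b => pieceStart S W s b = q with hG
  rcases F.eq_empty_or_nonempty with h0 | hne
  · rw [h0]
    simp
  have hFJ : ∀ {τ}, τ ∈ F → ((s ≤ τ ∧ τ ≤ e) ∧ pieceStart S W s τ = q) ∧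
      11 * S.rhat (2 ^ m) < bestValue S W τ - S.mopt u obs s n τ := fun hτ => by
    have := Finset.mem_filter.1 hτ
    exact ⟨(hJ _).1 this.1, this.2⟩
  set σ := F.min' hne with hσ
  set r := J.max' (hne.mono (Finset.filter_subset _ _)) with hr
  have hσF := hFJ (F.min'_mem hne)
  have hrJ := (hJ _).1 (J.max'_mem (hne.mono (Finset.filter_subset _ _)))
  have h2m : 0 < 2 ^ m := by positivity
  -- Consider an aligned interval that meets `F` but contains neither the first bad round `σ` nor
  -- the last round `r` of the piece. It starts after `σ` and stays inside the piece, so its start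
  -- is detectable with witness `σ`.
  have hmap : ∀ τ ∈ F, subStart s m τ ∈ insert (subStart s m σ) (insert (subStart s m r) G) := by
    intro τ hτ
    have h1 := hFJ hτ
    have hστ : σ ≤ τ := F.min'_le τ hτ
    have hτr : τ ≤ r := J.le_max' τ (Finset.mem_of_mem_filter τ hτ)
    set b := subStart s m τ with hb
    have hbτ : b ≤ τ := subStart_le s m h1.1.1.1
    have hsb : s ≤ b := le_subStart s m τ
    have hτb : τ < b + 2 ^ m := lt_subStart_add s m h1.1.1.1
    have hdvd : 2 ^ m ∣ b - s := dvd_subStart_sub s m τ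
    rw [Finset.mem_insert, Finset.mem_insert]
    by_cases hbσ : b ≤ σ
    · left
      exact (subStart_eq_of_dvd hsb hdvd hbσ (by omega)).symm
    by_cases hbr : r < b + 2 ^ m
    · right; left
      exact (subStart_eq_of_dvd hsb hdvd (by omega) hbr).symm
    right; right
    push Not at hbσ hbr
    have hre : r ≤ e := hrJ.1.2
    have hqr := pieceStart_spec (S := S) (W := W) hrJ.1.1
    have hqσ : q ≤ σ := by
      have := (pieceStart_spec (S := S) (W := W) hσF.1.1.1).2.1
      rwa [hσF.1.2] at this
    have hpst : ∀ x, σ ≤ x → x ≤ r → pieceStart S W s x = q := fun x h2 h3 => by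
      rw [pieceStart_eq_of_mem hrJ.1.1 (by rw [hrJ.2]; omega) h3, hrJ.2]
    refine Finset.mem_filter.2 ⟨Finset.mem_filter.2 ⟨Finset.mem_Ico.2 ⟨hsb, by omega⟩, hdvd, ?_, ?_⟩,
      hpst b (by omega) (by omega)⟩
    · rw [hpst b (by omega) (by omega), hpst (b + 2 ^ m - 1) (by omega) (by omega)]
    · refine ⟨σ, ?_, hbσ, hσF.2⟩
      rw [hpst b (by omega) (by omega)]
      exact hqσ
  have hfib : ∀ b ∈ F.image (subStart s m), (F.filter fun τ => subStart s m τ = b).card ≤ 2 ^ m := by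
    intro b _
    have : (F.filter fun τ => subStart s m τ = b) ⊆ Finset.Ico b (b + 2 ^ m) := by
      intro τ hτ
      obtain ⟨h1, rfl⟩ := Finset.mem_filter.1 hτ
      exact Finset.mem_Ico.2 ⟨subStart_le s m (hFJ h1).1.1.1, lt_subStart_add s m (hFJ h1).1.1.1⟩
    have := Finset.card_le_card this
    rwa [Nat.card_Ico, Nat.add_sub_cancel_left] at this
  have h3 := Finset.card_le_mul_card_image F (2 ^ m) hfib
  refine h3.trans (Nat.mul_le_mul_left _ ?_)
  have h4 : F.image (subStart s m) ⊆ insert (subStart s m σ) (insert (subStart s m r) G) :=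
    fun b hb => by
      obtain ⟨τ, hτ, rfl⟩ := Finset.mem_image.1 hb
      exact hmap τ hτ
  have h5 := Finset.card_le_card h4
  have h6 := Finset.card_insert_le (subStart s m σ) (insert (subStart s m r) G)
  have h7 := Finset.card_insert_le (subStart s m r) G
  omega

theorem min_le_sqrt_mul_sqrt {x y : ℝ} (hx : 0 ≤ x) (hy : 0 ≤ y) : min x y ≤ √x * √y := by
  rw [← Real.sqrt_mul hx]
  apply Real.le_sqrt_of_sq_le
  have h1 : 0 ≤ min x y := le_min hx hy
  nlinarith [min_le_left x y, min_le_right x y]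

/-- The sum of the square roots of the lengths of the pieces of a block. -/
noncomputable def pieceSqrtSum (S : Setup X A ι) (W : World X ι) (s e : ℕ) : ℝ :=
  ∑ q ∈ (Finset.Icc s e).image (pieceStart S W s),
    √(((Finset.Icc s e).filter fun τ => pieceStart S W s τ = q).card : ℝ)

-- In each piece the bad rounds outside detectable intervals number at most 2·2^m and at most the
-- length of the piece, hence at most the geometric mean. The detectable starts all went unscheduled
-- because the block survived, so over the whole block there are at most 20·log(T/δ) divided by the
-- scheduling probability.
open Classical in
theorem MasterContext.card_gap_le (h : MasterContext S W u obs p) {s n m e : ℕ}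
    (hb : InBlock S u obs s n e) (he : e ≤ S.T) (hm : m ≤ n) :
    (((Finset.Icc s e).filter fun τ =>
      11 * S.rhat (2 ^ m) < bestValue S W τ - S.mopt u obs s n τ).card : ℝ) ≤
      √2 * √(2 ^ m) * pieceSqrtSum S W s e + 20 * S.lg * √(2 ^ m) * √(2 ^ n) := by
  set E := (Finset.Icc s e).image (pieceStart S W s) with hE
  set I : ℕ → Finset ℕ := fun q => (Finset.Icc s e).filter fun τ => pieceStart S W s τ = q with hI
  set bad : ℕ → Prop := fun τ => 11 * S.rhat (2 ^ m) < bestValue S W τ - S.mopt u obs s n τ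
    with hbad
  set Dt := (Finset.Ico s (e + 1 - 2 ^ m)).filter fun b => Detectable S W u obs s n m b with hDt
  have h2m : 0 < 2 ^ m := by positivity
  -- Starts are limited to `b + 2 ^ m ≤ e`: the last round `b + 2 ^ m - 1` then precedes `e`, and
  -- its tests were passed.
  have hdet : S.sprob n m * (Dt.card : ℝ) ≤ 20 * S.lg := by
    refine h.good.detect s (Finset.mem_Icc.2 ⟨hb.one_le, hb.start_le.trans he⟩) n
      (hb.lt.trans_le he) m hm _ (by omega) fun b hb' hdb => ?_
    have := Finset.mem_Ico.1 hb'
    exact h.not_scheduled_of_detectable hb he hm this.1 (by omega) hdb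
  have hsum : ((Finset.Icc s e).filter bad).card = ∑ q ∈ E, ((I q).filter bad).card := by
    rw [Finset.card_eq_sum_card_fiberwise (f := pieceStart S W s) (t := E)
      (fun τ hτ => Finset.mem_coe.2 (Finset.mem_image_of_mem _
        (Finset.mem_of_mem_filter τ (Finset.mem_coe.1 hτ))))]
    refine Finset.sum_congr rfl fun q _ => ?_
    rw [Finset.filter_comm]
  have hdsum : ∑ q ∈ E, (Dt.filter fun b => pieceStart S W s b = q).card = Dt.card := by
    refine (Finset.card_eq_sum_card_fiberwise (f := pieceStart S W s) (t := E) fun b hb' => ?_).symm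
    have := Finset.mem_Ico.1 (Finset.mem_of_mem_filter b (Finset.mem_coe.1 hb'))
    exact Finset.mem_coe.2 (Finset.mem_image_of_mem _ (Finset.mem_Icc.2 ⟨this.1, by omega⟩))
  have hone : ∀ q ∈ E, (((I q).filter bad).card : ℝ) ≤ √2 * √(2 ^ m) * √((I q).card : ℝ) +
      2 ^ m * ((Dt.filter fun b => pieceStart S W s b = q).card : ℝ) := by
    intro q _
    have h1 : ((I q).filter bad).card ≤ 2 ^ m * (2 +
        (Dt.filter fun b => pieceStart S W s b = q).card) :=
      card_piece_le (I q) fun τ => by rw [hI, Finset.mem_filter, Finset.mem_Icc]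
    have h2 : ((I q).filter bad).card ≤ (I q).card := Finset.card_filter_le _ _
    have h1' : (((I q).filter bad).card : ℝ) ≤ 2 ^ m * (2 +
        ((Dt.filter fun b => pieceStart S W s b = q).card : ℝ)) := by exact_mod_cast h1
    have h2' : (((I q).filter bad).card : ℝ) ≤ (I q).card := by exact_mod_cast h2
    have h3 := min_le_sqrt_mul_sqrt (x := (2 * 2 ^ m : ℝ)) (y := ((I q).card : ℝ)) (by positivity)
      (by positivity)
    rw [Real.sqrt_mul (by norm_num)] at h3
    have h4 : (0 : ℝ) ≤ 2 ^ m * ((Dt.filter fun b => pieceStart S W s b = q).card : ℝ) := by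
      positivity
    rcases min_cases (2 * 2 ^ m : ℝ) ((I q).card : ℝ) with ⟨h5, _⟩ | ⟨h5, _⟩ <;>
      rw [h5] at h3 <;> linarith
  have hD : (2 : ℝ) ^ m * (Dt.card : ℝ) ≤ 20 * S.lg * √(2 ^ m) * √(2 ^ n) := by
    rw [S.sprob_eq] at hdet
    have e0 : (0 : ℝ) < √(2 ^ n) := by positivity
    have e1 : √(2 ^ m : ℝ) * √(2 ^ m) = 2 ^ m := Real.mul_self_sqrt (by positivity)
    rw [div_mul_eq_mul_div, div_le_iff₀ e0] at hdet
    have e2 := mul_le_mul_of_nonneg_left hdet (Real.sqrt_nonneg (2 ^ m : ℝ))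
    nlinarith
  calc _ = ∑ q ∈ E, (((I q).filter bad).card : ℝ) := by rw [hsum]; push_cast; rfl
    _ ≤ ∑ q ∈ E, (√2 * √(2 ^ m) * √((I q).card : ℝ) +
      2 ^ m * ((Dt.filter fun b => pieceStart S W s b = q).card : ℝ)) := Finset.sum_le_sum hone
    _ = √2 * √(2 ^ m) * pieceSqrtSum S W s e + 2 ^ m * (Dt.card : ℝ) := by
      rw [Finset.sum_add_distrib, ← Finset.mul_sum, ← Finset.mul_sum, ← hdsum]
      push_cast
      rfl
    _ ≤ _ := by linarith

theorem Setup.rhat_two_pow (S : Setup X A ι) (n : ℕ) :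
    S.rhat (2 ^ n) = S.hfac * √(S.numA * S.logTerm) / √(2 ^ n) := by
  rw [S.rhat_eq, S.rho_two_pow, mul_div_assoc]

theorem Setup.half_le_sqrt (S : Setup X A ι) : 1 / 2 ≤ √(S.numA * S.logTerm) := by
  have := S.half_le_rho_one
  unfold Setup.rho at this
  simpa using this

/-- The regret of the reduction on the rounds of one block. -/
theorem MasterContext.blockRegret_le (h : MasterContext S W u obs p) {s n e : ℕ}
    (hb : InBlock S u obs s n e) (he : e ≤ S.T) :
    ∑ τ ∈ Finset.Icc s e, (bestValue S W τ - (obs τ).2.2) ≤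
      400 * S.hfac * S.scales * S.lg * √(S.numA * S.logTerm) *
        (pieceSqrtSum S W s e + √(2 ^ n)) := by
  classical
  set a := √(S.numA * S.logTerm) with ha
  have ha2 : 1 / 2 ≤ a := S.half_le_sqrt
  have hH := S.le_hfac
  have hsc := S.two_le_scales
  have hlg := S.half_lt_lg
  have hse := hb.start_le
  have hSig : 0 ≤ pieceSqrtSum S W s e := Finset.sum_nonneg fun _ _ => Real.sqrt_nonneg _
  set Sg := pieceSqrtSum S W s e with hSg
  set N := √(2 ^ n : ℝ) with hN
  have hN1 : 1 ≤ N := by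
    rw [hN, Real.one_le_sqrt]
    exact one_le_pow₀ (by norm_num)
  have hNN : N * N = 2 ^ n := Real.mul_self_sqrt (by positivity)
  have hHa : 0 < S.hfac * a := by nlinarith
  -- the gaps
  have hgap : ∑ τ ∈ Finset.Icc s e, (bestValue S W τ - S.mopt u obs s n τ) ≤
      S.hfac * a * (11 * N + n * (11 * (2 * Sg + 30 * S.lg * N))) := by
    have h1 : ∀ τ ∈ Finset.Icc s e, bestValue S W τ - S.mopt u obs s n τ ≤
        11 * S.rhat (2 ^ n) + ∑ m ∈ Finset.range n, 11 * S.rhat (2 ^ m) *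
          (if 11 * S.rhat (2 ^ (m + 1)) < bestValue S W τ - S.mopt u obs s n τ then 1 else 0) :=
      fun τ _ => S.le_sum_rhat (by
        have := (bestValue_mem (S := S) (W := W) τ).2
        have := (S.mopt_mem u obs s n τ).1
        linarith) n
    refine (Finset.sum_le_sum h1).trans ?_
    rw [Finset.sum_add_distrib, Finset.sum_comm, mul_add]
    refine add_le_add ?_ ?_
    · rw [Finset.sum_const, Nat.card_Icc, nsmul_eq_mul, S.rhat_two_pow]
      have h2 : ((e + 1 - s : ℕ) : ℝ) ≤ N * N := by
        rw [hNN]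
        have := hb.lt_end
        have : e + 1 - s ≤ 2 ^ n := by omega
        exact_mod_cast this
      calc ((e + 1 - s : ℕ) : ℝ) * (11 * (S.hfac * a / N)) ≤ N * N * (11 * (S.hfac * a / N)) := by
            gcongr
        _ = _ := by field_simp
    · have h2 : ∀ m ∈ Finset.range n, ∑ τ ∈ Finset.Icc s e, 11 * S.rhat (2 ^ m) *
          (if 11 * S.rhat (2 ^ (m + 1)) < bestValue S W τ - S.mopt u obs s n τ then 1 else 0) ≤
          S.hfac * a * (11 * (2 * Sg + 30 * S.lg * N)) := by
        intro m hm
        rw [← Finset.mul_sum, Finset.sum_boole]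
        -- The count grows like √(2^m) and the threshold shrinks like 1/√(2^m), so each of the `n`
        -- scales costs the same.
        have h3 := h.card_gap_le hb he (Finset.mem_range.1 hm : m + 1 ≤ n)
        have e0 : √(2 : ℝ) * √2 = 2 := Real.mul_self_sqrt (by norm_num)
        have e1 : √((2 : ℝ) ^ (m + 1)) = √2 * √(2 ^ m) := by
          rw [pow_succ', Real.sqrt_mul (by norm_num)]
        have e2 : (0 : ℝ) < √(2 ^ m) := by positivity
        have e3 : √(2 : ℝ) ≤ 3 / 2 := by
          rw [Real.sqrt_le_left (by norm_num)]
          norm_num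
        rw [e1] at h3
        rw [S.rhat_two_pow]
        calc _ ≤ 11 * (S.hfac * a / √(2 ^ m)) * (√2 * (√2 * √(2 ^ m)) * Sg +
              20 * S.lg * (√2 * √(2 ^ m)) * N) := by gcongr
          _ = S.hfac * a * (11 * ((√2 * √2) * Sg + 20 * √2 * S.lg * N)) := by
            field_simp
          _ ≤ S.hfac * a * (11 * (2 * Sg + 20 * (3 / 2) * S.lg * N)) := by
            rw [e0]
            gcongr
          _ = _ := by ring
      refine (Finset.sum_le_sum h2).trans (le_of_eq ?_)
      rw [Finset.sum_const, Finset.card_range, nsmul_eq_mul]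
      ring
  -- the second test
  have hopt : ∑ τ ∈ Finset.Icc s e, (S.mopt u obs s n τ - (obs τ).2.2) ≤
      S.hfac * a * (4 * N) := by
    -- In the last round `e` Test 2 may fail, so it is used one round earlier and round `e` is
    -- counted trivially.
    have hterm : S.mopt u obs s n e - (obs e).2.2 ≤ S.hfac * a * N := by
      have := (S.mopt_mem u obs s n e).2
      have := (h.reward_mem e).1
      have h1 : 1 ≤ S.hfac * a := by nlinarith
      nlinarith
    rcases hse.eq_or_lt with rfl | hlt
    · rw [Finset.Icc_self, Finset.sum_singleton]
      nlinarith
    · obtain ⟨e', rfl⟩ := Nat.exists_eq_add_of_lt hlt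
      set e'' := s + e' with he''
      have h1 := hb.pass e'' (by omega) (by omega)
      have h2 : ¬ Test2Fails (S.falcon 4000) S.T S.δ S.mrate u obs s n e'' := fun h3 => h1 (Or.inr h3)
      unfold Test2Fails at h2
      rw [not_le, div_lt_iff₀ (by positivity)] at h2
      have h3 : ∑ τ ∈ Finset.Icc s e'', (S.mopt u obs s n τ - (obs τ).2.2) <
        3 * S.rhat (e'' - s + 1) * ((e'' - s + 1 : ℕ) : ℝ) := h2
      rw [mul_assoc, S.rhat_mul] at h3
      rw [← Finset.insert_Icc_right_eq_Icc_add_one (by omega), Finset.sum_insert (by simp)]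
      have h4 : √((e'' - s + 1 : ℕ) : ℝ) ≤ N := by
        apply Real.sqrt_le_sqrt
        have := hb.lt_end
        have : e'' - s + 1 ≤ 2 ^ n := by omega
        exact_mod_cast this
      have h5 : 3 * (S.hfac * (a * √((e'' - s + 1 : ℕ) : ℝ))) ≤ 3 * (S.hfac * (a * N)) := by
        gcongr
      linarith
  have hn : (n : ℝ) ≤ S.scales := by
    have := S.succ_le_scales (Setup.two_pow_le hb he le_rfl)
    linarith
  have hsum : ∑ τ ∈ Finset.Icc s e, (bestValue S W τ - (obs τ).2.2) =
      ∑ τ ∈ Finset.Icc s e, (bestValue S W τ - S.mopt u obs s n τ) +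
      ∑ τ ∈ Finset.Icc s e, (S.mopt u obs s n τ - (obs τ).2.2) := by
    rw [← Finset.sum_add_distrib]
    exact Finset.sum_congr rfl fun τ _ => by ring
  rw [hsum]
  calc _ ≤ S.hfac * a * (11 * N + n * (11 * (2 * Sg + 30 * S.lg * N))) + S.hfac * a * (4 * N) :=
        add_le_add hgap hopt
    _ = S.hfac * a * (15 * N + n * (11 * (2 * Sg + 30 * S.lg * N))) := by ring
    _ ≤ S.hfac * a * (15 * N + S.scales * (11 * (2 * Sg + 30 * S.lg * N))) := by gcongr
    _ ≤ S.hfac * a * (400 * (S.scales * S.lg) * (Sg + N)) := by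
        refine mul_le_mul_of_nonneg_left ?_ hHa.le
        have h1 : 1 ≤ S.scales * S.lg := by nlinarith
        have h2 : N ≤ S.scales * S.lg * N := le_mul_of_one_le_left (by linarith) h1
        have h3 : S.scales * Sg ≤ 2 * (S.scales * S.lg * Sg) := by
          have : 0 ≤ S.scales * Sg := by positivity
          nlinarith
        have h4 : 0 ≤ S.scales * S.lg * Sg := by positivity
        have h5 : 0 ≤ S.scales * S.lg * N := by positivity
        nlinarith
    _ = _ := by ring

end BlockRegret

end RealizableBandit

namespace RealizableBandit

/-! ### Counting blocks, pieces and cuts -/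

section Global

variable {X A ι : Type*} [MeasurableSpace X] [Fintype A] [Fintype ι]
variable {S : Setup X A ι} {W : World X ι} {u : ℕ → ℕ → ℝ} {obs : ℕ → Obs X A}
  {p : ℕ → X → A → ℝ}

/-- The start of the nearly stationary piece, within its block, containing round `t`. -/
noncomputable def curPiece (S : Setup X A ι) (W : World X ι) (u : ℕ → ℕ → ℝ) (obs : ℕ → Obs X A)
    (t : ℕ) : ℕ := pieceStart S W (S.block u obs t).1 t

/-- A new nearly stationary piece starts in round `t`, within a block. -/
def IsCut (S : Setup X A ι) (W : World X ι) (u : ℕ → ℕ → ℝ) (obs : ℕ → Obs X A) (t : ℕ) : Prop :=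
  curPiece S W u obs t = t ∧ t ≠ (S.block u obs t).1

open Classical in
/-- The rounds up to `t` in which a new piece starts within a block. -/
noncomputable def cuts (S : Setup X A ι) (W : World X ι) (u : ℕ → ℕ → ℝ) (obs : ℕ → Obs X A)
    (t : ℕ) : Finset ℕ := (Finset.Icc 1 t).filter (IsCut S W u obs)

/-- The blocks started up to round `t`. -/
noncomputable def blocks (S : Setup X A ι) (u : ℕ → ℕ → ℝ) (obs : ℕ → Obs X A) (t : ℕ) :
    Finset (ℕ × ℕ) := (Finset.Icc 1 t).image (S.block u obs)

/-- The pairs of a block and a piece of it met up to round `t`. -/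
noncomputable def keys (S : Setup X A ι) (W : World X ι) (u : ℕ → ℕ → ℝ) (obs : ℕ → Obs X A)
    (t : ℕ) : Finset ((ℕ × ℕ) × ℕ) :=
  (Finset.Icc 1 t).image fun τ => (S.block u obs τ, curPiece S W u obs τ)

theorem Icc_one_succ (t : ℕ) : Finset.Icc 1 (t + 1) = insert (t + 1) (Finset.Icc 1 t) := by
  ext x
  simp only [Finset.mem_Icc, Finset.mem_insert]
  omega

theorem inBlock_block {t : ℕ} (ht : 1 ≤ t) :
    InBlock S u obs (S.block u obs t).1 (S.block u obs t).2 t := blockSpec_blockAt ht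

theorem blocks_succ (t : ℕ) :
    blocks S u obs (t + 1) = insert (S.block u obs (t + 1)) (blocks S u obs t) := by
  rw [blocks, Icc_one_succ, Finset.image_insert, blocks]

theorem keys_succ (t : ℕ) : keys S W u obs (t + 1) =
    insert (S.block u obs (t + 1), curPiece S W u obs (t + 1)) (keys S W u obs t) := by
  rw [keys, Icc_one_succ, Finset.image_insert, keys]

theorem cuts_succ_of_cut {t : ℕ} (h : IsCut S W u obs (t + 1)) :
    cuts S W u obs (t + 1) = insert (t + 1) (cuts S W u obs t) := by
  classical
  unfold cuts
  rw [Icc_one_succ, Finset.filter_insert, if_pos h]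

theorem cuts_succ_of_not {t : ℕ} (h : ¬ IsCut S W u obs (t + 1)) :
    cuts S W u obs (t + 1) = cuts S W u obs t := by
  classical
  unfold cuts
  rw [Icc_one_succ, Finset.filter_insert, if_neg h]

theorem succ_notMem_cuts (t : ℕ) : t + 1 ∉ cuts S W u obs t := fun h => by
  classical
  have := (Finset.mem_Icc.1 (Finset.mem_of_mem_filter _ h)).2
  omega

theorem block_notMem_blocks {t n : ℕ} : (t + 1, n) ∉ blocks S u obs t := fun h => by
  obtain ⟨τ, h1, h2⟩ := Finset.mem_image.1 h
  obtain ⟨h3, h4⟩ := Finset.mem_Icc.1 h1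
  have := (inBlock_block (S := S) (u := u) (obs := obs) h3).start_le
  rw [h2] at this
  simp only at this
  omega

/-- The possible transitions between consecutive rounds. -/
theorem step_cases (S : Setup X A ι) (W : World X ι) (u : ℕ → ℕ → ℝ) (obs : ℕ → Obs X A)
    {t : ℕ} (ht : 1 ≤ t) :
    (S.block u obs (t + 1) = (t + 1, 0) ∧ TestsFail (S.falcon 4000) S.T S.δ S.mrate u obs
      (S.block u obs t).1 (S.block u obs t).2 t) ∨
    (S.block u obs (t + 1) = (t + 1, (S.block u obs t).2 + 1) ∧
      t + 1 = (S.block u obs t).1 + 2 ^ (S.block u obs t).2) ∨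
    (S.block u obs (t + 1) = S.block u obs t ∧ ((curPiece S W u obs (t + 1) = curPiece S W u obs t ∧
      ¬ IsCut S W u obs (t + 1)) ∨ (curPiece S W u obs (t + 1) = t + 1 ∧ IsCut S W u obs (t + 1) ∧
      S.rho (t + 1 - curPiece S W u obs t + 1) <
        total (drift S W) (curPiece S W u obs t) (t + 1)))) := by
  by_cases h1 : TestsFail (S.falcon 4000) S.T S.δ S.mrate u obs
      (S.block u obs t).1 (S.block u obs t).2 t
  · exact Or.inl ⟨blockAt_succ_of_fail _ _ _ _ _ _ ht h1, h1⟩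
  by_cases h2 : t + 1 = (S.block u obs t).1 + 2 ^ (S.block u obs t).2
  · exact Or.inr (Or.inl ⟨blockAt_succ_of_full _ _ _ _ _ _ ht h1 h2, h2⟩)
  have h3 : S.block u obs (t + 1) = S.block u obs t := blockAt_succ_of_not _ _ _ _ _ _ ht h1 h2
  refine Or.inr (Or.inr ⟨h3, ?_⟩)
  have h4 := (inBlock_block (S := S) (u := u) (obs := obs) ht).start_le
  unfold IsCut curPiece
  rw [h3]
  rcases pieceStart_succ (S := S) (W := W) h4 with ⟨h5, -⟩ | ⟨h5, h6⟩
  · refine Or.inl ⟨h5, fun h7 => ?_⟩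
    have := (pieceStart_spec (S := S) (W := W) h4).2.1
    omega
  · exact Or.inr ⟨h5, ⟨h5, by omega⟩, h6⟩

theorem not_isCut_of_start {t n : ℕ} (h : S.block u obs t = (t, n)) : ¬ IsCut S W u obs t :=
  fun h1 => h1.2 (by rw [h])

theorem curPiece_of_start {t n : ℕ} (h : S.block u obs t = (t, n)) : curPiece S W u obs t = t := by
  rw [curPiece, h, pieceStart_self]

theorem block_one : S.block u obs 1 = (1, 0) := by
  unfold Setup.block
  rw [blockAt]

theorem cuts_one : cuts S W u obs 1 = ∅ := by
  have := not_isCut_of_start (W := W) (block_one (S := S) (u := u) (obs := obs))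
  rw [cuts_succ_of_not (t := 0) this]
  simp [cuts]

theorem blocks_one : blocks S u obs 1 = {(1, 0)} := by simp [blocks, block_one]

/-- A potential argument: completing a block of order n adds 3·2^n to both sides, so the invariant
is preserved exactly, and a restart leaves slack. Interrupted blocks are charged their full nominal
length, yet the total stays O(T). -/
theorem sum_two_pow_blocks (S : Setup X A ι) (W : World X ι) (u : ℕ → ℕ → ℝ)
    (obs : ℕ → Obs X A) {t : ℕ}
    (ht : 1 ≤ t) : ∑ β ∈ blocks S u obs t, 2 ^ β.2 + 2 ^ (S.block u obs t).2 + 1 ≤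
      3 * (S.block u obs t).1 := by
  induction t, ht using Nat.le_induction with
  | base => simp [blocks_one, block_one]
  | succ t ht ih =>
    have hst := (inBlock_block (S := S) (u := u) (obs := obs) ht).start_le
    have hpos : 0 < 2 ^ (S.block u obs t).2 := by positivity
    rw [blocks_succ]
    rcases step_cases S W u obs ht with ⟨h, -⟩ | ⟨h, h1⟩ | ⟨h, -⟩
    · rw [h, Finset.sum_insert block_notMem_blocks]
      simp only [pow_zero]
      omega
    · rw [h, Finset.sum_insert block_notMem_blocks]
      simp only [pow_succ]
      omega
    · rw [h, Finset.insert_eq_of_mem]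
      · exact ih
      · exact Finset.mem_image_of_mem _ (Finset.mem_Icc.2 ⟨ht, le_rfl⟩)

/-- A round creates a new pair only by opening a block or by making a cut. -/
theorem card_keys_le (S : Setup X A ι) (W : World X ι) (u : ℕ → ℕ → ℝ) (obs : ℕ → Obs X A)
    {t : ℕ} (ht : 1 ≤ t) :
    (keys S W u obs t).card ≤ (blocks S u obs t).card + (cuts S W u obs t).card := by
  induction t, ht using Nat.le_induction with
  | base => simp [keys, blocks_one]
  | succ t ht ih =>
    have hk := Finset.card_insert_le (S.block u obs (t + 1), curPiece S W u obs (t + 1))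
      (keys S W u obs t)
    have hnew : ∀ n, S.block u obs (t + 1) = (t + 1, n) →
        (keys S W u obs (t + 1)).card ≤
          (blocks S u obs (t + 1)).card + (cuts S W u obs (t + 1)).card := fun n hn => by
      rw [keys_succ, blocks_succ, cuts_succ_of_not (not_isCut_of_start hn),
        hn, Finset.card_insert_of_notMem block_notMem_blocks, ← hn]
      omega
    rcases step_cases S W u obs ht with ⟨h, -⟩ | ⟨h, -⟩ | ⟨h, ⟨h1, h2⟩ | ⟨h1, h2, -⟩⟩
    · exact hnew _ h
    · exact hnew _ h
    · rw [keys_succ, blocks_succ, cuts_succ_of_not h2, h, h1, Finset.insert_eq_of_mem,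
        Finset.insert_eq_of_mem]
      · exact ih
      · exact Finset.mem_image_of_mem _ (Finset.mem_Icc.2 ⟨ht, le_rfl⟩)
      · exact Finset.mem_image_of_mem (fun τ => (S.block u obs τ, curPiece S W u obs τ))
          (Finset.mem_Icc.2 ⟨ht, le_rfl⟩)
    · rw [keys_succ, blocks_succ, cuts_succ_of_cut h2,
        Finset.card_insert_of_notMem (succ_notMem_cuts t), h,
        Finset.insert_eq_of_mem (s := blocks S u obs t)]
      · rw [h] at hk
        omega
      · exact Finset.mem_image_of_mem _ (Finset.mem_Icc.2 ⟨ht, le_rfl⟩)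

open Classical in
/-- Restarts only happen in blocks that are not nearly stationary. -/
theorem MasterContext.card_blocks_le_aux (h : MasterContext S W u obs p) {N : ℕ}
    (hN : ∀ n, 2 ^ n ≤ S.T → n + 1 ≤ N) {t : ℕ} (ht : 1 ≤ t) (htT : t ≤ S.T) :
    ∃ F, (blocks S u obs t).card ≤ N * F + (S.block u obs t).2 + 1 ∧
      F + (if curPiece S W u obs t = (S.block u obs t).1 then 0 else 1) ≤
        (cuts S W u obs t).card := by
  induction t, ht using Nat.le_induction with
  | base =>
    refine ⟨0, by simp [blocks_one, block_one], ?_⟩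
    rw [curPiece_of_start block_one, block_one]
    simp
  | succ t ht ih =>
    -- `F` counts the restarts; the indicator reserves one unspent cut once the current block has
    -- left its first piece.
    obtain ⟨F, h1, h2⟩ := ih (by omega)
    have hb := inBlock_block (S := S) (u := u) (obs := obs) ht
    rcases step_cases S W u obs ht with ⟨h3, h4⟩ | ⟨h3, -⟩ | ⟨h3, ⟨h4, h5⟩ | ⟨h4, h5, -⟩⟩
    · refine ⟨F + 1, ?_, ?_⟩
      · rw [blocks_succ, h3, Finset.card_insert_of_notMem block_notMem_blocks]
        have := hN _ (hb.pow_le_start.trans (hb.start_le.trans (by omega)))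
        rw [mul_add]
        simp only
        omega
      · rw [cuts_succ_of_not (not_isCut_of_start h3), curPiece_of_start h3, h3]
        -- A failed test means drift above the rate since the block start. So the current piece is
        -- not the first of the block, and the reserved cut pays for the restart.
        have h5 := h.rho_lt_total_of_fail hb (by omega) h4
        have h6 := (pieceStart_spec (S := S) (W := W) hb.start_le).2.2.1
        have h7 : curPiece S W u obs t ≠ (S.block u obs t).1 := fun h7 => by
          rw [curPiece] at h7
          rw [h7] at h6
          linarith
        rw [if_neg h7] at h2
        simpa using h2
    · refine ⟨F, ?_, ?_⟩
      · rw [blocks_succ, h3, Finset.card_insert_of_notMem block_notMem_blocks]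
        simp only
        omega
      · rw [cuts_succ_of_not (not_isCut_of_start h3), curPiece_of_start h3, h3]
        simp only [if_true]
        split_ifs at h2 <;> omega
    · refine ⟨F, ?_, ?_⟩
      · rw [blocks_succ, h3, Finset.insert_eq_of_mem]
        · exact h1
        · exact Finset.mem_image_of_mem _ (Finset.mem_Icc.2 ⟨ht, le_rfl⟩)
      · rw [cuts_succ_of_not h5, h4, h3]
        exact h2
    · refine ⟨F, ?_, ?_⟩
      · rw [blocks_succ, h3, Finset.insert_eq_of_mem]
        · exact h1
        · exact Finset.mem_image_of_mem _ (Finset.mem_Icc.2 ⟨ht, le_rfl⟩)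
      · rw [cuts_succ_of_cut h5, Finset.card_insert_of_notMem (succ_notMem_cuts t)]
        split_ifs at h2 ⊢ <;> omega

theorem MasterContext.card_blocks_le (h : MasterContext S W u obs p) :
    (((blocks S u obs S.T).card : ℕ) : ℝ) ≤ S.scales * ((cuts S W u obs S.T).card + 1) := by
  have hT : 1 ≤ S.T := by have := S.two_le_T; omega
  have hN : ∀ n, 2 ^ n ≤ S.T → n + 1 ≤ Nat.log 2 S.T + 1 := fun n hn =>
    Nat.succ_le_succ ((Nat.le_log_iff_pow_le (by norm_num) (by omega)).2 hn)
  obtain ⟨F, h1, h2⟩ := h.card_blocks_le_aux hN hT le_rfl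
  have hb := inBlock_block (S := S) (u := u) (obs := obs) hT
  have h3 := hN _ (hb.pow_le_start.trans hb.start_le)
  have h4 : F ≤ (cuts S W u obs S.T).card := (Nat.le_add_right _ _).trans h2
  have h5 : (blocks S u obs S.T).card ≤
      (Nat.log 2 S.T + 1) * ((cuts S W u obs S.T).card + 1) := by
    calc _ ≤ (Nat.log 2 S.T + 1) * F + (Nat.log 2 S.T + 1) := by omega
      _ = (Nat.log 2 S.T + 1) * (F + 1) := by ring
      _ ≤ _ := by gcongr
  have h6 : ((Nat.log 2 S.T : ℕ) : ℝ) + 1 ≤ S.scales :=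
    S.succ_le_scales (Nat.pow_log_le_self 2 (by omega))
  calc _ ≤ (((Nat.log 2 S.T + 1) * ((cuts S W u obs S.T).card + 1) : ℕ) : ℝ) := by
        exact_mod_cast h5
    _ ≤ _ := by
        push_cast
        gcongr

theorem total_add (g : ℕ → ℝ) {a b c : ℕ} (h1 : a ≤ b) (h2 : b ≤ c) :
    total g a b + total g b c = total g a c := Finset.sum_Ico_consecutive _ h1 h2

theorem curPiece_le {t : ℕ} (ht : 1 ≤ t) : 1 ≤ curPiece S W u obs t ∧ curPiece S W u obs t ≤ t := by
  have hb := inBlock_block (S := S) (u := u) (obs := obs) ht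
  have := pieceStart_spec (S := S) (W := W) hb.start_le
  exact ⟨hb.one_le.trans this.1, this.2.1⟩

/-- The intervals from the start of a piece to the cut that ends it are disjoint. -/
theorem sum_total_cuts_le (S : Setup X A ι) (W : World X ι) (u : ℕ → ℕ → ℝ) (obs : ℕ → Obs X A)
    {g : ℕ → ℝ} (hg : ∀ t, 0 ≤ g t) {t : ℕ} (ht : 1 ≤ t) :
    ∑ c ∈ cuts S W u obs t, total g (curPiece S W u obs (c - 1)) c ≤
      total g 1 (curPiece S W u obs t) := by
  have hmono : ∀ {a b c : ℕ}, b ≤ c → total g a b ≤ total g a c := fun h =>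
    total_mono hg le_rfl h
  induction t, ht using Nat.le_induction with
  | base =>
    rw [cuts_one, Finset.sum_empty]
    exact Finset.sum_nonneg fun _ _ => hg _
  | succ t ht ih =>
    have hle := curPiece_le (S := S) (W := W) (u := u) (obs := obs) ht
    rcases step_cases S W u obs ht with ⟨h3, -⟩ | ⟨h3, -⟩ | ⟨h3, ⟨h4, h5⟩ | ⟨h4, h5, -⟩⟩
    · rw [cuts_succ_of_not (not_isCut_of_start h3), curPiece_of_start h3]
      exact ih.trans (hmono (by omega))
    · rw [cuts_succ_of_not (not_isCut_of_start h3), curPiece_of_start h3]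
      exact ih.trans (hmono (by omega))
    · rw [cuts_succ_of_not h5, h4]
      exact ih
    · rw [cuts_succ_of_cut h5, Finset.sum_insert (succ_notMem_cuts t), h4, Nat.add_sub_cancel,
        ← total_add g hle.1 (show curPiece S W u obs t ≤ t + 1 by omega)]
      linarith

theorem cut_spec {c t : ℕ} (h : c ∈ cuts S W u obs t) :
    curPiece S W u obs (c - 1) < c ∧ S.rho (c - curPiece S W u obs (c - 1) + 1) <
      total (drift S W) (curPiece S W u obs (c - 1)) c := by
  classical
  obtain ⟨h1, h2⟩ := Finset.mem_filter.1 h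
  obtain ⟨c, rfl⟩ := Nat.exists_eq_add_of_le' (Finset.mem_Icc.1 h1).1
  rcases Nat.eq_zero_or_pos c with rfl | hc
  · exact absurd h2 (not_isCut_of_start block_one)
  have := curPiece_le (S := S) (W := W) (u := u) (obs := obs) hc
  rw [Nat.add_sub_cancel]
  refine ⟨by omega, ?_⟩
  rcases step_cases S W u obs hc with ⟨h3, -⟩ | ⟨h3, -⟩ | ⟨h3, ⟨h4, h5⟩ | ⟨h4, h5, h6⟩⟩
  · exact absurd h2 (not_isCut_of_start h3)
  · exact absurd h2 (not_isCut_of_start h3)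
  · exact absurd h2 h5
  · exact h6

theorem sum_total_cuts_le_T (S : Setup X A ι) (W : World X ι) (u : ℕ → ℕ → ℝ)
    (obs : ℕ → Obs X A) {g : ℕ → ℝ} (hg : ∀ t, 0 ≤ g t) :
    ∑ c ∈ cuts S W u obs S.T, total g (curPiece S W u obs (c - 1)) c ≤ total g 1 S.T := by
  have hT : 1 ≤ S.T := by have := S.two_le_T; omega
  exact (sum_total_cuts_le S W u obs hg hT).trans (total_mono hg le_rfl (curPiece_le hT).2)

/-- The number of cuts is at most the number of changes of the environment. -/
theorem card_cuts_add_one_le_changes (S : Setup X A ι) (W : World X ι) (u : ℕ → ℕ → ℝ)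
    (obs : ℕ → Obs X A) :
    ((cuts S W u obs S.T).card : ℝ) + 1 ≤ changes (drift S W) 1 S.T := by
  classical
  set g : ℕ → ℝ := fun t => if drift S W t ≠ 0 then 1 else 0 with hgdef
  have hg : ∀ t, 0 ≤ g t := fun t => by simp only [hgdef]; split_ifs <;> norm_num
  have h1 := sum_total_cuts_le_T S W u obs hg
  have h2 : total g 1 S.T = (((Finset.Ico 1 S.T).filter fun τ => drift S W τ ≠ 0).card : ℝ) := by
    simp only [total, hgdef, Finset.sum_boole]
  have h3 : ∀ c ∈ cuts S W u obs S.T, 1 ≤ total g (curPiece S W u obs (c - 1)) c := by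
    intro c hc
    have h4 := (cut_spec hc).2
    have h5 := S.rho_nonneg (c - curPiece S W u obs (c - 1) + 1)
    -- A cut needs positive drift since the start of the piece, hence a change there; these
    -- stretches are disjoint for different cuts.
    obtain ⟨τ, hτ, hne⟩ : ∃ τ ∈ Finset.Ico (curPiece S W u obs (c - 1)) c, drift S W τ ≠ 0 := by
      by_contra! hall
      rw [total, Finset.sum_eq_zero hall] at h4
      linarith
    have h6 : g τ = 1 := if_pos hne
    rw [← h6]
    exact Finset.single_le_sum (f := g) (fun _ _ => hg _) hτ
  have h4 := Finset.sum_le_sum h3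
  rw [Finset.sum_const, nsmul_eq_mul, mul_one] at h4
  have h5 : changes (drift S W) 1 S.T =
      1 + (((Finset.Ico 1 S.T).filter fun τ => drift S W τ ≠ 0).card : ℝ) := by
    unfold changes
    congr!
  linarith

/-- AM-GM for x, x, w, in the form 3x² - 2x³ ≤ 1, i.e. (x - 1)²(2x + 1) ≥ 0. -/
theorem three_lt_of_one_lt_sq_mul {x w : ℝ} (hx : 0 ≤ x) (hw : 0 ≤ w) (h : 1 < x ^ 2 * w) :
    3 < 2 * x + w := by
  by_contra! h1
  have h2 : x ^ 2 * w ≤ x ^ 2 * (3 - 2 * x) := by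
    apply mul_le_mul_of_nonneg_left _ (sq_nonneg x)
    linarith
  nlinarith [mul_nonneg (sq_nonneg (x - 1)) (show 0 ≤ 2 * x + 1 by linarith)]

/-- The number of cuts is controlled by the total variation of the environment. -/
theorem card_cuts_cube_le (S : Setup X A ι) (W : World X ι) (u : ℕ → ℕ → ℝ)
    (obs : ℕ → Obs X A) :
    S.numA * S.logTerm * ((cuts S W u obs S.T).card : ℝ) ^ 3 ≤
      2 * total (drift S W) 1 S.T ^ 2 * S.T := by
  set V : ℝ := ((cuts S W u obs S.T).card : ℝ) with hV
  set Δ := total (drift S W) 1 S.T with hΔ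
  set q : ℕ → ℕ := fun c => curPiece S W u obs (c - 1) with hq
  have ha : 0 < S.numA * S.logTerm := mul_pos S.numA_pos S.logTerm_pos
  have hT : (0 : ℝ) < S.T := by linarith [S.two_le_T_real]
  have hΔ0 : 0 ≤ Δ := Finset.sum_nonneg fun _ _ => drift_nonneg S W _
  rcases Finset.eq_empty_or_nonempty (cuts S W u obs S.T) with h0 | hne
  · have : V = 0 := by rw [hV, h0]; simp
    rw [this]
    simp only [ne_eq, OfNat.ofNat_ne_zero, not_false_eq_true, zero_pow, mul_zero]
    positivity
  have hVpos : 0 < V := by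
    rw [hV]
    exact_mod_cast hne.card_pos
  have hD := sum_total_cuts_le_T S W u obs (drift_nonneg S W)
  have hL := sum_total_cuts_le_T S W u obs (g := fun _ => 1) (fun _ => zero_le_one)
  -- Hölder in normalized form. A cut with drift D over length l has D²(l + 1) > AΛ, hence 2lD² >
  -- AΛ. If the claim failed, x = DV/Δ and w = lV/T would satisfy x²w > 1, hence 2x + w > 3 for each
  -- of the V cuts, whereas these sums add up to at most 2V + V.
  by_contra! hlt
  have hDpos : ∀ c ∈ cuts S W u obs S.T, 0 < total (drift S W) (q c) c := fun c hc =>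
    (S.rho_nonneg _).trans_lt (cut_spec hc).2
  have hΔpos : 0 < Δ := by
    obtain ⟨c, hc⟩ := hne
    exact (hDpos c hc).trans_le ((Finset.single_le_sum
      (f := fun c => total (drift S W) (q c) c) (fun c hc => (hDpos c hc).le) hc).trans hD)
  have hkey : ∀ c ∈ cuts S W u obs S.T, 3 < 2 * (total (drift S W) (q c) c * (V / Δ)) +
      total (fun _ => 1) (q c) c * (V / S.T) := by
    intro c hc
    obtain ⟨h1, h2⟩ := cut_spec hc
    have hl : total (fun _ => 1) (q c) c = ((c - q c : ℕ) : ℝ) := by simp [total]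
    have hl1 : 1 ≤ ((c - q c : ℕ) : ℝ) := by
      have : 1 ≤ c - q c := by
        have : q c < c := h1
        omega
      exact_mod_cast this
    have hD0 := hDpos c hc
    rw [hl]
    set l := ((c - q c : ℕ) : ℝ) with hl'
    set D := total (drift S W) (q c) c with hD'
    refine three_lt_of_one_lt_sq_mul (by positivity) (by positivity) ?_
    have h3 : S.numA * S.logTerm < D ^ 2 * (2 * l) := by
      have h4 : S.rho (c - q c + 1) < D := h2
      unfold Setup.rho at h4
      rw [Real.sqrt_lt' hD0, div_lt_iff₀ (by positivity)] at h4
      push_cast at h4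
      have h5 : D ^ 2 * (l + 1) ≤ D ^ 2 * (2 * l) := by
        gcongr
        linarith
      linarith
    have h5 : 2 * Δ ^ 2 * S.T < D ^ 2 * (2 * l) * V ^ 3 := by
      calc _ < S.numA * S.logTerm * V ^ 3 := hlt
        _ ≤ _ := by gcongr
    have h6 : (D * (V / Δ)) ^ 2 * (l * (V / S.T)) = D ^ 2 * (2 * l) * V ^ 3 / (2 * Δ ^ 2 * S.T) := by
      field_simp
    rw [h6, one_lt_div (by positivity)]
    exact h5
  have hsum := Finset.sum_lt_sum_of_nonempty hne hkey
  rw [Finset.sum_const, nsmul_eq_mul, Finset.sum_add_distrib, ← Finset.mul_sum, ← Finset.sum_mul,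
    ← Finset.sum_mul] at hsum
  have h7 : total (fun _ => (1 : ℝ)) 1 S.T ≤ S.T := by
    simp [total]
  have h8 : (∑ c ∈ cuts S W u obs S.T, total (drift S W) (q c) c) * (V / Δ) ≤ Δ * (V / Δ) := by
    gcongr
  have h9 : (∑ c ∈ cuts S W u obs S.T, total (fun _ => (1 : ℝ)) (q c) c) * (V / S.T) ≤
      S.T * (V / S.T) := by
    gcongr
    exact hL.trans h7
  rw [mul_div_cancel₀ _ hΔpos.ne'] at h8
  rw [mul_div_cancel₀ _ hT.ne'] at h9
  linarith

end Global

end RealizableBandit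

namespace RealizableBandit

/-! ### Dynamic regret on the good event -/

section GlobalRegret

variable {X A ι : Type*} [MeasurableSpace X] [Fintype A] [Fintype ι]
variable {S : Setup X A ι} {W : World X ι} {u : ℕ → ℕ → ℝ} {obs : ℕ → Obs X A}
  {p : ℕ → X → A → ℝ}

theorem sum_sqrt_le {κ : Type*} (s : Finset κ) {f : κ → ℝ} (hf : ∀ k, 0 ≤ f k) :
    ∑ k ∈ s, √(f k) ≤ √((s.card : ℝ) * ∑ k ∈ s, f k) := by
  have h := Real.sum_sqrt_mul_sqrt_le s (f := fun _ => (1 : ℝ)) (fun _ => zero_le_one) hf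
  simp only [Real.sqrt_one, one_mul, Finset.sum_const, nsmul_eq_mul, mul_one] at h
  rwa [Real.sqrt_mul (Nat.cast_nonneg _)]

/-- The rounds of a block form the interval from its start to its last round within the horizon, and
the keys over it are its pieces; so this is `MasterContext.blockRegret_le` in global notation. -/
theorem MasterContext.sum_fiber_le (h : MasterContext S W u obs p) {β : ℕ × ℕ}
    (hβ : β ∈ blocks S u obs S.T) :
    ∑ τ ∈ (Finset.Icc 1 S.T).filter (fun τ => S.block u obs τ = β), (bestValue S W τ - (obs τ).2.2) ≤
      400 * S.hfac * S.scales * S.lg * √(S.numA * S.logTerm) *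
        (∑ k ∈ (keys S W u obs S.T).filter (fun k => k.1 = β),
          √(((Finset.Icc 1 S.T).filter fun τ =>
            (S.block u obs τ, curPiece S W u obs τ) = k).card : ℝ) + √(2 ^ β.2)) := by
  set J := (Finset.Icc 1 S.T).filter (fun τ => S.block u obs τ = β) with hJ
  have hJmem : ∀ {τ}, τ ∈ J → (1 ≤ τ ∧ τ ≤ S.T) ∧ S.block u obs τ = β := fun hτ => by
    rwa [hJ, Finset.mem_filter, Finset.mem_Icc] at hτ
  have hJin : ∀ {τ}, τ ∈ J → InBlock S u obs β.1 β.2 τ := fun hτ => by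
    have := inBlock_block (S := S) (u := u) (obs := obs) (hJmem hτ).1.1
    rwa [(hJmem hτ).2] at this
  have hne : J.Nonempty := by
    obtain ⟨τ, h1, h2⟩ := Finset.mem_image.1 hβ
    exact ⟨τ, Finset.mem_filter.2 ⟨h1, h2⟩⟩
  set e := J.max' hne with he
  have heJ : e ∈ J := J.max'_mem hne
  have hb := hJin heJ
  have hJe : J = Finset.Icc β.1 e := by
    ext τ
    constructor
    · intro hτ
      exact Finset.mem_Icc.2 ⟨(hJin hτ).start_le, J.le_max' τ hτ⟩
    · intro hτ
      obtain ⟨h1, h2⟩ := Finset.mem_Icc.1 hτ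
      exact Finset.mem_filter.2 ⟨Finset.mem_Icc.2 ⟨hb.one_le.trans h1, h2.trans (hJmem heJ).1.2⟩,
        hb.same τ h1 h2⟩
  rw [hJe]
  refine (h.blockRegret_le hb (hJmem heJ).1.2).trans (le_of_eq ?_)
  congr 2
  have hcur : ∀ {τ}, τ ∈ J → curPiece S W u obs τ = pieceStart S W β.1 τ := fun hτ => by
    rw [curPiece, (hJmem hτ).2]
  have hcur' : ∀ {τ}, S.block u obs τ = β → curPiece S W u obs τ = pieceStart S W β.1 τ :=
    fun hτ => by rw [curPiece, hτ]
  have hkeys : (keys S W u obs S.T).filter (fun k => k.1 = β) =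
      ((Finset.Icc β.1 e).image (pieceStart S W β.1)).image (fun q => (β, q)) := by
    rw [← hJe, Finset.image_image]
    ext k
    simp only [keys, Finset.mem_filter, Finset.mem_image, Function.comp]
    constructor
    · rintro ⟨⟨τ, h1, rfl⟩, h2⟩
      have h3 : τ ∈ J := Finset.mem_filter.2 ⟨h1, h2⟩
      exact ⟨τ, h3, by rw [← hcur h3, ← h2]⟩
    · rintro ⟨τ, h1, rfl⟩
      refine ⟨⟨τ, (Finset.mem_filter.1 h1).1, ?_⟩, rfl⟩
      rw [hcur h1, (hJmem h1).2]
  rw [hkeys, Finset.sum_image (fun x _ y _ hxy => (Prod.ext_iff.1 hxy).2), pieceSqrtSum]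
  refine Finset.sum_congr rfl fun q _ => ?_
  congr 3
  rw [← hJe, hJ, Finset.filter_filter]
  refine Finset.filter_congr fun τ _ => ?_
  constructor
  · rintro ⟨h1, h2⟩
    exact Prod.ext h1 (by rw [← h2, ← hcur' h1])
  · intro h1
    have h2 : S.block u obs τ = β := congrArg Prod.fst h1
    exact ⟨h2, by rw [← hcur' h2]; exact congrArg Prod.snd h1⟩

/-- Cauchy-Schwarz twice: over at most 2·`scales`·(V + 1) pieces, whose lengths sum to T, and over
at most `scales`·(V + 1) blocks, whose nominal lengths sum to at most 3T. -/
theorem MasterContext.dynRegret_le_cuts (h : MasterContext S W u obs p) :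
    dynRegret S W obs ≤ 400 * S.hfac * S.scales * S.lg * √(S.numA * S.logTerm) *
      (4 * S.scales * √(((cuts S W u obs S.T).card + 1 : ℝ) * S.T)) := by
  have hT : 1 ≤ S.T := by have := S.two_le_T; omega
  set M := 400 * S.hfac * S.scales * S.lg * √(S.numA * S.logTerm) with hM
  have hsc := S.two_le_scales
  have hlg := S.half_lt_lg
  have hH := S.le_hfac
  have hM0 : 0 ≤ M := by positivity
  set V : ℝ := ((cuts S W u obs S.T).card : ℝ) with hV
  have hV0 : 0 ≤ V := Nat.cast_nonneg _
  set fib : (ℕ × ℕ) × ℕ → ℝ := fun k => (((Finset.Icc 1 S.T).filter fun τ =>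
            (S.block u obs τ, curPiece S W u obs τ) = k).card : ℝ) with hfib
  have hB := h.card_blocks_le
  have hK := card_keys_le S W u obs hT
  have hK' : ((keys S W u obs S.T).card : ℝ) ≤ 2 * S.scales * (V + 1) := by
    have : ((keys S W u obs S.T).card : ℝ) ≤ ((blocks S u obs S.T).card : ℝ) + V := by
      rw [hV]
      exact_mod_cast hK
    nlinarith
  have h2 : ∑ β ∈ blocks S u obs S.T, ((2 : ℝ) ^ β.2) ≤ 3 * S.T := by
    have h3 := sum_two_pow_blocks S W u obs hT
    have h4 := (inBlock_block (S := S) (u := u) (obs := obs) hT).start_le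
    have h6 : 0 ≤ 2 ^ (S.block u obs S.T).2 := Nat.zero_le _
    have h5 : ∑ β ∈ blocks S u obs S.T, 2 ^ β.2 ≤ 3 * S.T := by omega
    exact_mod_cast h5
  have hfibsum : ∑ k ∈ keys S W u obs S.T, fib k = S.T := by
    have := Finset.card_eq_sum_card_image (fun τ => (S.block u obs τ, curPiece S W u obs τ))
      (Finset.Icc 1 S.T)
    rw [Nat.card_Icc, Nat.add_sub_cancel] at this
    simp only [hfib]
    unfold keys
    exact_mod_cast this.symm
  have hsum1 : ∑ k ∈ keys S W u obs S.T, √(fib k) ≤ √(2 * S.scales * ((V + 1) * S.T)) := by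
    refine (sum_sqrt_le _ fun k => Nat.cast_nonneg _).trans (Real.sqrt_le_sqrt ?_)
    rw [hfibsum, ← mul_assoc]
    gcongr
  have hsum2 : ∑ β ∈ blocks S u obs S.T, √((2 : ℝ) ^ β.2) ≤
      √(3 * S.scales * ((V + 1) * S.T)) := by
    refine (sum_sqrt_le _ fun β => by positivity).trans (Real.sqrt_le_sqrt ?_)
    calc _ ≤ (S.scales * (V + 1)) * (3 * S.T) := by gcongr
      _ = _ := by ring
  calc dynRegret S W obs
      = ∑ β ∈ blocks S u obs S.T, ∑ τ ∈ (Finset.Icc 1 S.T).filter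
          (fun τ => S.block u obs τ = β), (bestValue S W τ - (obs τ).2.2) :=
        (Finset.sum_fiberwise_of_maps_to (fun τ hτ => Finset.mem_image_of_mem _ hτ) _).symm
    _ ≤ ∑ β ∈ blocks S u obs S.T, M * (∑ k ∈ (keys S W u obs S.T).filter (fun k => k.1 = β),
          √(fib k) + √(2 ^ β.2)) := Finset.sum_le_sum fun β hβ => h.sum_fiber_le hβ
    _ = M * (∑ k ∈ keys S W u obs S.T, √(fib k) + ∑ β ∈ blocks S u obs S.T, √((2 : ℝ) ^ β.2)) := by
        rw [← Finset.mul_sum, Finset.sum_add_distrib, Finset.sum_fiberwise_of_maps_to]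
        intro k hk
        obtain ⟨τ, h1, rfl⟩ := Finset.mem_image.1 hk
        exact Finset.mem_image_of_mem _ h1
    _ ≤ M * (√(2 * S.scales * ((V + 1) * S.T)) + √(3 * S.scales * ((V + 1) * S.T))) := by gcongr
    _ ≤ M * (4 * S.scales * √((V + 1) * S.T)) := by
        have h3 : ∀ c : ℝ, 0 ≤ c → c ≤ 4 → √(c * S.scales * ((V + 1) * S.T)) ≤
            2 * S.scales * √((V + 1) * S.T) := fun c hc0 hc => by
          rw [Real.sqrt_mul (by positivity)]
          refine mul_le_mul_of_nonneg_right ?_ (Real.sqrt_nonneg _)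
          apply Real.sqrt_le_iff.2 ⟨by positivity, ?_⟩
          nlinarith
        have h4 := h3 2 (by norm_num) (by norm_num)
        have h5 := h3 3 (by norm_num) (by norm_num)
        refine mul_le_mul_of_nonneg_left ?_ hM0
        linarith

theorem Setup.scales_le (S : Setup X A ι) : S.scales ≤ 4 * S.lg := by
  have hlg := S.half_lt_lg
  have h1 : Real.log S.T ≤ S.lg := by
    unfold Setup.lg
    apply Real.log_le_log (by linarith [S.two_le_T_real])
    rw [le_div_iff₀ S.δ_pos]
    have := S.δ_lt_one
    have := S.two_le_T_real
    nlinarith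
  unfold Setup.scales Real.logb
  have h2 := Real.log_two_gt_d9
  have h3 : Real.log S.T / Real.log 2 ≤ 2 * S.lg := by
    rw [div_le_iff₀ (by linarith)]
    nlinarith
  linarith

/-- With y³ = aΔT², one has (aVT)³ = a²T³·aV³ ≤ 2(aΔT²)² = 2y⁶. -/
theorem sqrt_le_of_cube_le {a V Δ T : ℝ} (ha : 0 ≤ a) (hV : 0 ≤ V) (hΔ : 0 ≤ Δ) (hT : 0 ≤ T)
    (h : a * V ^ 3 ≤ 2 * Δ ^ 2 * T) :
    √(a * V * T) ≤ 2 * ((a * Δ) ^ (1 / 3 : ℝ) * T ^ (2 / 3 : ℝ)) := by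
  set y := (a * Δ) ^ (1 / 3 : ℝ) * T ^ (2 / 3 : ℝ) with hy
  have hy0 : 0 ≤ y := by positivity
  have hy3 : y ^ 3 = a * Δ * T ^ 2 := by
    rw [hy, mul_pow, ← Real.rpow_natCast, ← Real.rpow_natCast, ← Real.rpow_mul (by positivity),
      ← Real.rpow_mul hT]
    norm_num
  rw [Real.sqrt_le_left (by positivity)]
  have h1 : (a * V * T) ^ 3 ≤ ((2 * y) ^ 2) ^ 3 := by
    calc (a * V * T) ^ 3 = a ^ 2 * T ^ 3 * (a * V ^ 3) := by ring
      _ ≤ a ^ 2 * T ^ 3 * (2 * Δ ^ 2 * T) := by gcongr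
      _ = 2 * (a * Δ * T ^ 2) ^ 2 := by ring
      _ = 2 * (y ^ 3) ^ 2 := by rw [hy3]
      _ ≤ 64 * (y ^ 3) ^ 2 := by
        have : 0 ≤ (y ^ 3) ^ 2 := sq_nonneg _
        linarith
      _ = _ := by ring
  exact le_of_pow_le_pow_left₀ (by norm_num) (by positivity) h1

/-- The regret bound for the reduction with FALCON, on the event `MasterGood`. -/
theorem MasterContext.dynRegret_le (h : MasterContext S W u obs p) :
    dynRegret S W obs ≤ 10000000000000 * Real.log ((S.T : ℝ) / S.δ) ^ 5 *
      min (√(S.numA * S.logTerm * changes (drift S W) 1 S.T * (S.T : ℝ)))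
        ((S.numA * S.logTerm * total (drift S W) 1 S.T) ^ (1 / 3 : ℝ) * (S.T : ℝ) ^ (2 / 3 : ℝ)
          + √(S.numA * S.logTerm * (S.T : ℝ))) := by
  change _ ≤ 10000000000000 * S.lg ^ 5 * _
  have h1 := h.dynRegret_le_cuts
  have hchg := card_cuts_add_one_le_changes S W u obs
  have hcube := card_cuts_cube_le S W u obs
  set V : ℝ := ((cuts S W u obs S.T).card : ℝ) with hV
  set Δ := total (drift S W) 1 S.T with hΔ
  set a := S.numA * S.logTerm with ha
  have hV0 : 0 ≤ V := Nat.cast_nonneg _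
  have ha0 : 0 < a := mul_pos S.numA_pos S.logTerm_pos
  have hT : (0 : ℝ) < S.T := by linarith [S.two_le_T_real]
  have hΔ0 : 0 ≤ Δ := Finset.sum_nonneg fun _ _ => drift_nonneg S W _
  have hlg := S.half_lt_lg
  have hsc := S.two_le_scales
  have hsl := S.scales_le
  have h2 : dynRegret S W obs ≤ 1000000000000 * S.lg ^ 5 * √(a * ((V + 1) * S.T)) := by
    refine h1.trans ?_
    rw [Real.sqrt_mul ha0.le]
    unfold Setup.hfac
    -- The threshold and the block regret each bring `scales · lg`, and the number of blocks and
    -- pieces one more `scales`. As `scales ≤ 4 lg`, the exponent is 5.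
    calc _ = 9600000000 * (S.scales ^ 3 * S.lg ^ 2) * (√a * √((V + 1) * S.T)) := by ring
      _ ≤ 9600000000 * ((4 * S.lg) ^ 3 * S.lg ^ 2) * (√a * √((V + 1) * S.T)) := by gcongr
      _ = 614400000000 * S.lg ^ 5 * (√a * √((V + 1) * S.T)) := by ring
      _ ≤ _ := by
        refine mul_le_mul_of_nonneg_right ?_ (by positivity)
        refine mul_le_mul_of_nonneg_right ?_ (by positivity)
        norm_num
  rw [mul_min_of_nonneg _ _ (by positivity), le_min_iff]
  constructor
  · refine h2.trans (mul_le_mul ?_ (Real.sqrt_le_sqrt ?_) (Real.sqrt_nonneg _) (by positivity))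
    · refine mul_le_mul_of_nonneg_right ?_ (by positivity)
      norm_num
    · rw [← mul_assoc]
      gcongr
  · have h3 := sqrt_le_of_cube_le ha0.le hV0 hΔ0 hT.le hcube
    have h4 : √(a * ((V + 1) * S.T)) ≤ √(a * V * S.T) + √(a * S.T) := by
      have : a * ((V + 1) * S.T) = a * V * S.T + a * S.T := by ring
      rw [this]
      rw [Real.sqrt_le_left (by positivity)]
      have h6 := Real.sq_sqrt (show 0 ≤ a * V * S.T by positivity)
      have h7 := Real.sq_sqrt (show 0 ≤ a * S.T by positivity)
      have h8 : 0 ≤ √(a * V * S.T) * √(a * S.T) := by positivity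
      nlinarith
    set y := (a * Δ) ^ (1 / 3 : ℝ) * (S.T : ℝ) ^ (2 / 3 : ℝ) with hy
    have hy0 : 0 ≤ y := by positivity
    have h5 : √(a * ((V + 1) * S.T)) ≤ 2 * (y + √(a * S.T)) := by
      linarith [Real.sqrt_nonneg (a * S.T)]
    calc _ ≤ _ := h2
      _ ≤ 1000000000000 * S.lg ^ 5 * (2 * (y + √(a * S.T))) := by gcongr
      _ = 2000000000000 * S.lg ^ 5 * (y + √(a * S.T)) := by ring
      _ ≤ _ := by
        refine mul_le_mul_of_nonneg_right ?_ (by positivity)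
        refine mul_le_mul_of_nonneg_right ?_ (by positivity)
        norm_num

end GlobalRegret

end RealizableBandit

namespace RealizableBandit

/-! ### Measurability of MASTER's decisions -/

section MasterMeasurability

variable {X A ι Ω : Type*} [MeasurableSpace X] [MeasurableSpace A] [MeasurableSingletonClass A]
  [Fintype A] [Fintype ι] {S : Setup X A ι} {m : MeasurableSpace Ω}
  {u : ℕ → Ω → ℕ → ℝ} {obs : ℕ → Ω → Obs X A} {s n t : ℕ}

theorem measurableSet_and_const {q : Prop} {Q : Ω → Prop} (h : q → MeasurableSet {ω | Q ω}) :
    MeasurableSet {ω | q ∧ Q ω} := by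
  by_cases hq : q
  · simpa [hq] using h hq
  · simp [hq]

/-- The infimum of the empty set is 0, so the value 0 has a second possible cause. -/
theorem measurableSet_sInf_eq {Q : ℕ → Ω → Prop} (hQ : ∀ j, MeasurableSet {ω | Q j ω}) (k : ℕ) :
    MeasurableSet {ω | sInf {j | Q j ω} = k} := by
  have h1 : {ω | sInf {j | Q j ω} = k} =
      ({ω | Q k ω} ∩ ⋂ j ∈ Finset.range k, {ω | Q j ω}ᶜ) ∪
        {ω | k = 0 ∧ ω ∈ ⋂ j, {ω | Q j ω}ᶜ} := by
    ext ω
    simp only [Set.mem_ofPred_eq, Set.mem_union, Set.mem_inter_iff, Set.mem_iInter, Finset.mem_range,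
      Set.mem_compl_iff]
    constructor
    · rintro rfl
      rcases Set.eq_empty_or_nonempty {j | Q j ω} with h | h
      · right
        rw [h]
        refine ⟨Nat.sInf_empty, fun j hj => ?_⟩
        have : j ∈ {j | Q j ω} := hj
        rw [h] at this
        exact this
      · exact Or.inl ⟨Nat.sInf_mem h, fun j hj => Nat.notMem_of_lt_sInf hj⟩
    · rintro (⟨h2, h3⟩ | ⟨rfl, h2⟩)
      · refine le_antisymm (Nat.sInf_le h2) ?_
        by_contra! hlt
        exact h3 _ hlt (Nat.sInf_mem (s := {j | Q j ω}) ⟨k, h2⟩)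
      · rw [Nat.sInf_eq_zero]
        right
        ext j
        simp [h2 j]
  rw [h1]
  refine ((hQ k).inter (Finset.measurableSet_biInter _ fun j _ => (hQ j).compl)).union ?_
  exact measurableSet_and_const fun _ => MeasurableSet.iInter fun j => (hQ j).compl

theorem measurableSet_scheduled (hu : ∀ τ ∈ Finset.Icc 1 t, Measurable (u τ)) {b : ℕ} (hb : 1 ≤ b)
    (hbt : b ≤ t) (ρ : ℕ → ℝ) (s n k : ℕ) :
    MeasurableSet {ω | Scheduled ρ (fun τ => u τ ω) s n k b} := by
  refine measurableSet_and_const fun _ => measurableSet_and_const fun _ => ?_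
  exact measurableSet_le ((measurable_pi_apply k).comp (hu b (Finset.mem_Icc.2 ⟨hb, hbt⟩)))
    measurable_const

theorem measurableSet_activeInst (hu : ∀ τ ∈ Finset.Icc 1 t, Measurable (u τ)) {τ : ℕ} (hs : 1 ≤ s)
    (hsτ : s ≤ τ) (hτ : τ ≤ t) (ρ : ℕ → ℝ) (n : ℕ) (i : ℕ × ℕ) :
    MeasurableSet {ω | activeInst ρ (fun τ => u τ ω) s n τ = i} := by
  have h1 : ∀ k, MeasurableSet {ω | activeOrder ρ (fun τ => u τ ω) s n τ = k} := fun k =>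
    measurableSet_sInf_eq (fun j => measurableSet_scheduled hu (hs.trans (le_subStart s j τ))
      ((subStart_le s j hsτ).trans hτ) ρ s n j) k
  have h2 : {ω | activeInst ρ (fun τ => u τ ω) s n τ = i} =
      {ω | subStart s i.1 τ = i.2 ∧ activeOrder ρ (fun τ => u τ ω) s n τ = i.1} := by
    ext ω
    simp only [activeInst, Prod.ext_iff, Set.mem_ofPred_eq]
    constructor
    · rintro ⟨h3, h4⟩
      rw [h3] at h4
      exact ⟨h4, h3⟩
    · rintro ⟨h3, h4⟩
      rw [h4]
      exact ⟨rfl, h3⟩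
  rw [h2]
  exact measurableSet_and_const fun _ => h1 i.1

theorem instHistory_eq_selHist (ρ : ℕ → ℝ) (u : ℕ → ℕ → ℝ) (obs : ℕ → Obs X A) (s n t : ℕ) :
    instHistory ρ u obs s n t =
      selHist (fun τ => activeInst ρ u s n τ = activeInst ρ u s n t) obs s t := by
  unfold instHistory selHist
  congr!

theorem measurableSet_activeInst_eq (hu : ∀ τ ∈ Finset.Icc 1 t, Measurable (u τ)) (hs : 1 ≤ s)
    (hst : s ≤ t) (ρ : ℕ → ℝ) (n : ℕ) : ∀ τ ∈ Finset.Ico s t, MeasurableSet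
      {ω | activeInst ρ (fun τ => u τ ω) s n τ = activeInst ρ (fun τ => u τ ω) s n t} := by
  intro τ hτ
  rw [Finset.mem_Ico] at hτ
  have : {ω | activeInst ρ (fun τ => u τ ω) s n τ = activeInst ρ (fun τ => u τ ω) s n t} =
      ⋃ i, {ω | activeInst ρ (fun τ => u τ ω) s n τ = i} ∩
        {ω | activeInst ρ (fun τ => u τ ω) s n t = i} := by
    ext ω
    simp only [Set.mem_ofPred_eq, Set.mem_iUnion, Set.mem_inter_iff, exists_eq_left']
    exact eq_comm
  rw [this]
  exact MeasurableSet.iUnion fun i => (measurableSet_activeInst hu hs hτ.1 hτ.2.le ρ n i).inter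
    (measurableSet_activeInst hu hs hst le_rfl ρ n i)

theorem measurableSet_oracle_length_instHistory (hu : ∀ τ ∈ Finset.Icc 1 t, Measurable (u τ))
    (hobs : ∀ τ ∈ Finset.Ico 1 t, Measurable (obs τ)) (hs : 1 ≤ s) (hst : s ≤ t) (ρ : ℕ → ℝ) (n : ℕ)
    (j : ι × ℕ) : MeasurableSet {ω |
      (S.oracle (instHistory ρ (fun τ => u τ ω) (fun τ => obs τ ω) s n t),
        (instHistory ρ (fun τ => u τ ω) (fun τ => obs τ ω) s n t).length) = j} := by
  simp only [instHistory_eq_selHist]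
  exact measurableSet_oracle_length_selHist
    (Z := fun τ ω => activeInst ρ (fun τ => u τ ω) s n τ = activeInst ρ (fun τ => u τ ω) s n t)
    (fun τ hτ => hobs τ (Finset.Ico_subset_Ico_left hs hτ))
    (measurableSet_activeInst_eq hu hs hst ρ n) j

theorem measurable_mopt (hu : ∀ τ ∈ Finset.Icc 1 t, Measurable (u τ))
    (hobs : ∀ τ ∈ Finset.Ico 1 t, Measurable (obs τ)) (hs : 1 ≤ s) (hst : s ≤ t) (n : ℕ) :
    Measurable fun ω => S.mopt (fun τ => u τ ω) (fun τ => obs τ ω) s n t := by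
  have h1 : ∀ ω, S.mopt (fun τ => u τ ω) (fun τ => obs τ ω) s n t = S.falconOpt 4000
      (selHist (fun τ => activeInst S.mrate (fun τ => u τ ω) s n τ =
        activeInst S.mrate (fun τ => u τ ω) s n t) (fun τ => obs τ ω) s t) := fun ω => by
    rw [← instHistory_eq_selHist]
    rfl
  simp only [h1]
  exact measurable_falconOpt_selHist
    (Z := fun τ ω => activeInst S.mrate (fun τ => u τ ω) s n τ =
      activeInst S.mrate (fun τ => u τ ω) s n t) 4000
    (fun τ hτ => hobs τ (Finset.Ico_subset_Ico_left hs hτ))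
    (measurableSet_activeInst_eq hu hs hst S.mrate n)

theorem measurableSet_testsFail (hu : ∀ τ ∈ Finset.Icc 1 t, Measurable (u τ))
    (hobs : ∀ τ ∈ Finset.Icc 1 t, Measurable (obs τ)) (hs : 1 ≤ s) (hst : s ≤ t) (n : ℕ) :
    MeasurableSet {ω | TestsFail (S.falcon 4000) S.T S.δ S.mrate (fun τ => u τ ω)
      (fun τ => obs τ ω) s n t} := by
  have hopt : ∀ τ ∈ Finset.Icc s t, Measurable fun ω =>
      multiOpt (S.falcon 4000) S.mrate (fun τ => u τ ω) (fun τ => obs τ ω) s n τ := fun τ hτ => by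
    rw [Finset.mem_Icc] at hτ
    exact measurable_mopt (S := S)
      (fun σ hσ => hu σ (Finset.Icc_subset_Icc le_rfl hτ.2 hσ))
      (fun σ hσ => hobs σ (by rw [Finset.mem_Icc]; rw [Finset.mem_Ico] at hσ; omega)) hs hτ.1 n
  have hrew : ∀ τ ∈ Finset.Icc s t, Measurable fun ω => (obs τ ω).2.2 := fun τ hτ =>
    (hobs τ (Finset.Icc_subset_Icc hs le_rfl hτ)).snd.snd
  have h1 : MeasurableSet {ω | Test1Fails (S.falcon 4000) S.T S.δ S.mrate (fun τ => u τ ω)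
      (fun τ => obs τ ω) s n t} := by
    simp only [Test1Fails, Set.ofPred_exists]
    refine MeasurableSet.iUnion fun k => MeasurableSet.iUnion fun b =>
      measurableSet_and_const fun hsb => measurableSet_and_const fun hbt => ?_
    have h2k : 0 < 2 ^ k := by positivity
    refine (measurableSet_scheduled hu (hs.trans hsb) (by omega) _ s n k).inter ?_
    refine measurableSet_le (Measurable.add_const (Measurable.iInf fun τ : Finset.Icc s t => hopt τ τ.2) _)
      (Measurable.div_const (Finset.measurable_sum _ fun τ hτ =>
        hrew τ (Finset.Icc_subset_Icc hsb le_rfl hτ)) _)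
  have h2 : MeasurableSet {ω | Test2Fails (S.falcon 4000) S.T S.δ S.mrate (fun τ => u τ ω)
      (fun τ => obs τ ω) s n t} := by
    simp only [Test2Fails]
    exact measurableSet_le measurable_const (Measurable.div_const (Finset.measurable_sum _
      fun τ hτ => (hopt τ hτ).sub (hrew τ hτ)) _)
  exact h1.union h2

/-- The next block is a function of the current one and of its tests. Splitting over the countably
many possible current blocks fixes `s` and `n`, for which the tests are measurable. -/
theorem measurableSet_block (ht : 1 ≤ t) (hu : ∀ τ ∈ Finset.Ico 1 t, Measurable (u τ))
    (hobs : ∀ τ ∈ Finset.Ico 1 t, Measurable (obs τ)) (i : ℕ × ℕ) :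
    MeasurableSet {ω | S.block (fun τ => u τ ω) (fun τ => obs τ ω) t = i} := by
  classical
  induction t, ht using Nat.le_induction generalizing i with
  | base => simp [block_one]
  | succ t ht ih =>
    have hsub : Finset.Ico 1 t ⊆ Finset.Ico 1 (t + 1) :=
      Finset.Ico_subset_Ico_right (Nat.le_succ t)
    have ih' := ih (fun τ hτ => hu τ (hsub hτ)) (fun τ hτ => hobs τ (hsub hτ))
    have hIcc : ∀ τ ∈ Finset.Icc 1 t, τ ∈ Finset.Ico 1 (t + 1) := fun τ hτ => by
      rw [Finset.mem_Icc] at hτ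
      rw [Finset.mem_Ico]
      omega
    set F : ℕ × ℕ → Set Ω := fun j => {ω | TestsFail (S.falcon 4000) S.T S.δ S.mrate
      (fun τ => u τ ω) (fun τ => obs τ ω) j.1 j.2 t} with hF
    set B : ℕ × ℕ → Set Ω := fun j => {ω | S.block (fun τ => u τ ω) (fun τ => obs τ ω) t = j}
      with hB
    have key : {ω | S.block (fun τ => u τ ω) (fun τ => obs τ ω) (t + 1) = i} =
        ⋃ j ∈ {j : ℕ × ℕ | 1 ≤ j.1 ∧ j.1 ≤ t},
          B j ∩ ({ω | (t + 1, 0) = i ∧ ω ∈ F j} ∪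
            {ω | (if t + 1 = j.1 + 2 ^ j.2 then (t + 1, j.2 + 1) else j) = i ∧ ω ∈ (F j)ᶜ}) := by
      ext ω
      set U : ℕ → ℕ → ℝ := fun τ => u τ ω with hU
      set O : ℕ → Obs X A := fun τ => obs τ ω with hO
      have hb := inBlock_block (S := S) (u := U) (obs := O) ht
      have hval : S.block U O (t + 1) =
          if ω ∈ F (S.block U O t) then (t + 1, 0) else
            if t + 1 = (S.block U O t).1 + 2 ^ (S.block U O t).2 then
              (t + 1, (S.block U O t).2 + 1) else S.block U O t := by
        classical
        by_cases h1 : ω ∈ F (S.block U O t)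
        · rw [if_pos h1]
          exact blockAt_succ_of_fail _ _ _ _ _ _ ht h1
        · rw [if_neg h1]
          split_ifs with h2
          · exact blockAt_succ_of_full _ _ _ _ _ _ ht h1 h2
          · exact blockAt_succ_of_not _ _ _ _ _ _ ht h1 h2
      simp only [Set.mem_ofPred_eq, Set.mem_iUnion, exists_prop, Set.mem_inter_iff, Set.mem_union]
      constructor
      · intro h
        refine ⟨S.block U O t, ⟨hb.one_le, hb.start_le⟩, rfl, ?_⟩
        rw [hval] at h
        by_cases h1 : ω ∈ F (S.block U O t)
        · rw [if_pos h1] at h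
          exact Or.inl ⟨h, h1⟩
        · rw [if_neg h1] at h
          exact Or.inr ⟨h, h1⟩
      · rintro ⟨j, -, h1, h2⟩
        have h3 : S.block U O t = j := h1
        rw [hval, h3]
        rcases h2 with ⟨h2, h4⟩ | ⟨h2, h4⟩
        · rw [if_pos h4]
          exact h2
        · rw [if_neg h4]
          exact h2
    rw [key]
    refine MeasurableSet.biUnion (Set.to_countable _) fun j hj => (ih' j).inter ?_
    have hFm : MeasurableSet (F j) := measurableSet_testsFail
      (fun τ hτ => hu τ (hIcc τ hτ)) (fun τ hτ => hobs τ (hIcc τ hτ)) hj.1 hj.2 j.2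
    exact (measurableSet_and_const fun _ => hFm).union (measurableSet_and_const fun _ => hFm.compl)

/-- Only seeds up to round `t` and observations before it enter: the selection is predictable, as
the concentration inequalities require. -/
theorem measurableSet_activeIn (ht : 1 ≤ t) (hu : ∀ τ ∈ Finset.Icc 1 t, Measurable (u τ))
    (hobs : ∀ τ ∈ Finset.Ico 1 t, Measurable (obs τ)) (s n : ℕ) (i : ℕ × ℕ) :
    MeasurableSet {ω | S.ActiveIn (fun τ => u τ ω) (fun τ => obs τ ω) s n i t} := by
  have hB := measurableSet_block (S := S) ht
    (fun τ hτ => hu τ (Finset.Ico_subset_Icc_self hτ)) hobs (s, n)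
  by_cases h : 1 ≤ s ∧ s ≤ t
  · exact hB.inter (measurableSet_activeInst hu h.1 h.2 le_rfl S.mrate n i)
  · convert MeasurableSet.empty (α := Ω)
    ext ω
    simp only [Set.mem_ofPred_eq, Set.mem_empty_iff_false, iff_false]
    intro h1
    have hb := inBlock_block (S := S) (u := fun τ => u τ ω) (obs := fun τ => obs τ ω) ht
    rw [h1.1] at hb
    exact h ⟨hb.one_le, hb.start_le⟩

/-- The pieces are deterministic given `s`, and only optimistic quantities of rounds before `b`
enter. So detectability does not involve the seed of round `b` and is independent of the scheduling
decision there. -/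
theorem measurableSet_detectable (W : World X ι) {b : ℕ}
    (hu : ∀ τ ∈ Finset.Ico 1 b, Measurable (u τ))
    (hobs : ∀ τ ∈ Finset.Ico 1 b, Measurable (obs τ)) (hs : 1 ≤ s) (hsb : s ≤ b) (n k : ℕ) :
    MeasurableSet {ω | Detectable S W (fun τ => u τ ω) (fun τ => obs τ ω) s n k b} := by
  refine measurableSet_and_const fun _ => measurableSet_and_const fun _ => ?_
  simp only [Set.ofPred_exists]
  refine MeasurableSet.iUnion fun σ => measurableSet_and_const fun h1 =>
    measurableSet_and_const fun h2 => ?_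
  have h3 := (pieceStart_spec (S := S) (W := W) hsb).1
  exact measurableSet_lt measurable_const (measurable_const.sub (measurable_mopt
    (fun τ hτ => hu τ (by rw [Finset.mem_Icc] at hτ; rw [Finset.mem_Ico]; omega))
    (fun τ hτ => hobs τ (Finset.Ico_subset_Ico_right h2.le hτ)) hs (h3.trans h1) n))

end MasterMeasurability

end RealizableBandit

namespace RealizableBandit

/-! ### Scheduling probabilities -/

section MasterProbability

variable {X A ι Ω : Type*} [MeasurableSpace X] [MeasurableSpace A] [MeasurableSingletonClass A]
  [Fintype A] [Fintype ι] [mΩ : MeasurableSpace Ω]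
  {S : Setup X A ι} {W : World X ι} {P : Measure Ω} [IsProbabilityMeasure P]
  {u : ℕ → Ω → ℕ → ℝ} {obs : ℕ → Ω → Obs X A}

theorem measurable_seed_preInfo (u : ℕ → Ω → ℕ → ℝ) (obs : ℕ → Ω → Obs X A) {t : ℕ} :
    ∀ τ ∈ Finset.Icc 1 t, Measurable[preInfo u obs t] (u τ) := fun τ hτ => by
  rw [Finset.mem_Icc] at hτ
  exact (measurable_seed_seedInfo u hτ.1 (Nat.lt_succ_of_le hτ.2)).mono le_sup_right le_rfl

theorem measurable_obs_preInfo (u : ℕ → Ω → ℕ → ℝ) (obs : ℕ → Ω → Obs X A) {t : ℕ} :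
    ∀ τ ∈ Finset.Ico 1 t, Measurable[preInfo u obs t] (obs τ) := fun τ hτ => by
  rw [Finset.mem_Ico] at hτ
  exact (measurable_obs_obsInfo obs hτ.1 hτ.2).mono le_sup_left le_rfl

/-- The history of the instance active in round `t`. -/
noncomputable def activeHistory (S : Setup X A ι) (u : ℕ → ℕ → ℝ) (obs : ℕ → Obs X A) (t : ℕ) :
    List (Obs X A) := instHistory S.mrate u obs (S.block u obs t).1 (S.block u obs t).2 t

/-- MASTER plays inverse gap weighting for the history of the active instance, which is predictable;
hence all concentration results for runs apply to it unchanged. -/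
theorem playsIgw_master (S : Setup X A ι) (u : ℕ → Ω → ℕ → ℝ) (obs : ℕ → Ω → Obs X A) :
    PlaysIgw S u obs (fun t ω => masterProb (S.falcon 4000) S.T S.δ S.mrate (fun s => u s ω)
      (fun s => obs s ω) t)
      fun t ω => (S.oracle (activeHistory S (fun s => u s ω) (fun s => obs s ω) t),
        (activeHistory S (fun s => u s ω) (fun s => obs s ω) t).length) where
  eq t _ ω := rfl
  meas t ht j := by
    have h1 := (Finset.mem_Icc.1 ht).1
    have key : {ω | (S.oracle (activeHistory S (fun s => u s ω) (fun s => obs s ω) t),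
        (activeHistory S (fun s => u s ω) (fun s => obs s ω) t).length) = j} =
        ⋃ i ∈ {i : ℕ × ℕ | 1 ≤ i.1 ∧ i.1 ≤ t},
          {ω | S.block (fun s => u s ω) (fun s => obs s ω) t = i} ∩ {ω |
            (S.oracle (instHistory S.mrate (fun τ => u τ ω) (fun τ => obs τ ω) i.1 i.2 t),
              (instHistory S.mrate (fun τ => u τ ω) (fun τ => obs τ ω) i.1 i.2 t).length) = j} := by
      ext ω
      have hb := inBlock_block (S := S) (u := fun τ => u τ ω) (obs := fun τ => obs τ ω) h1
      simp only [Set.mem_ofPred_eq, Set.mem_iUnion, exists_prop, Set.mem_inter_iff]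
      constructor
      · intro h
        exact ⟨_, ⟨hb.one_le, hb.start_le⟩, rfl, h⟩
      · rintro ⟨i, -, rfl, h⟩
        exact h
    rw [key]
    refine MeasurableSet.biUnion (Set.to_countable _) fun i hi => MeasurableSet.inter ?_ ?_
    · exact measurableSet_block (m := preInfo u obs t) h1
        (fun τ hτ => measurable_seed_preInfo u obs τ (Finset.Ico_subset_Icc_self hτ))
        (measurable_obs_preInfo u obs) i
    · exact measurableSet_oracle_length_instHistory (m := preInfo u obs t)
        (measurable_seed_preInfo u obs) (measurable_obs_preInfo u obs) hi.1 hi.2 S.mrate i.2 j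
  le t _ ω := by
    simp only [activeHistory, instHistory_eq_selHist, length_selHist]
    exact (card_selBefore_le _ _ _).trans (Nat.sub_le _ _)

/-- The scheduling indicator of an instance is independent of the past. -/
theorem IsMasterRun.integral_schedule_le
    (hrun : IsMasterRun S W (S.falcon 4000) S.mrate P u obs) {t : ℕ} (ht : t ∈ Finset.Icc 1 S.T)
    (k : ℕ) {q α β : ℝ} (hq0 : 0 ≤ q) (hq1 : q ≤ 1) (hα : 0 ≤ α) (hβ : 0 ≤ β)
    (hαβ : q * α + (1 - q) * β ≤ 1) {B : Ω → Prop} [∀ ω, Decidable (B ω)]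
    (hB : MeasurableSet[pastInfo u obs t] {ω | B ω}) {M : Ω → ℝ} {C : ℝ}
    (hM : Measurable[pastInfo u obs t] M) (hM0 : ∀ ω, 0 ≤ M ω) (hMC : ∀ ω, |M ω| ≤ C) :
    ∫ ω, M ω * (if B ω then (if u t ω k ≤ q then α else β) else 1) ∂P ≤ ∫ ω, M ω ∂P := by
  have hle := hrun.run.pastInfo_le t
  have hut : Measurable fun ω => u t ω k := (measurable_pi_apply k).comp (hrun.run.seed_meas t)
  have hM' : Measurable M := hM.mono hle le_rfl
  have hB' : MeasurableSet {ω | B ω} := hle _ hB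
  -- `α` and `β` are the factors of a scheduled and an unscheduled start; their mean qα + (1 - q)β
  -- is at most one. One choice bounds the number of scheduled starts, another the number of missed
  -- ones.
  set g : ℝ → ℝ := fun x => if x ≤ q then α else β with hg
  have hgm : Measurable g := Measurable.ite measurableSet_Iic measurable_const measurable_const
  set N : Ω → ℝ := fun ω => if B ω then M ω else 0 with hN
  have hNm : Measurable[pastInfo u obs t] N := Measurable.ite hB hM measurable_const
  have hN0 : ∀ ω, 0 ≤ N ω := fun ω => by
    simp only [hN]
    split_ifs
    exacts [hM0 ω, le_rfl]
  have hNM : ∀ ω, N ω ≤ M ω := fun ω => by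
    simp only [hN]
    split_ifs
    exacts [le_rfl, hM0 ω]
  have hNC : ∀ ω, |N ω| ≤ C := fun ω => by
    rw [abs_of_nonneg (hN0 ω)]
    exact (hNM ω).trans ((le_abs_self _).trans (hMC ω))
  have hgb : ∀ x, |g x| ≤ α + β := fun x => by
    simp only [hg]
    split_ifs
    · rw [abs_of_nonneg hα]; linarith
    · rw [abs_of_nonneg hβ]; linarith
  have hC0 : 0 ≤ C := by
    obtain ⟨ω⟩ := P.nonempty_of_neZero
    exact (abs_nonneg _).trans (hMC ω)
  have hNint : Integrable N P := integrable_of_abs_le (hNm.mono hle le_rfl) hNC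
  have hMint : Integrable M P := integrable_of_abs_le hM' hMC
  have hMNint : Integrable (fun ω => M ω - N ω) P := hMint.sub hNint
  have hNgint : Integrable (fun ω => N ω * g (u t ω k)) P :=
    integrable_of_abs_le ((hNm.mono hle le_rfl).mul (hgm.comp hut)) (c := C * (α + β)) fun ω => by
      rw [abs_mul]
      exact mul_le_mul (hNC ω) (hgb _) (abs_nonneg _) hC0
  have hind : IndepFun N (fun ω => g (u t ω k)) P := by
    rw [IndepFun_iff_Indep]
    refine indep_of_indep_of_le_left (indep_of_indep_of_le_right (hrun.indep_past t ht).symm ?_)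
      hNm.comap_le
    rw [← measurable_iff_comap_le]
    exact hgm.comp ((measurable_pi_apply k).comp (comap_measurable _))
  have hgint : ∫ ω, g (u t ω k) ∂P ≤ 1 := by
    have h1 : ∫ ω, g (u t ω k) ∂P = ∫ x, g x ∂(P.map fun ω => u t ω k) :=
      (integral_map hut.aemeasurable hgm.aestronglyMeasurable).symm
    rw [h1, hrun.uniform t ht k]
    have h2 : ∀ x, g x = β + (Set.Iic q).indicator (fun _ => α - β) x := fun x => by
      simp only [hg, Set.indicator, Set.mem_Iic]
      split_ifs <;> ring
    simp only [h2]
    rw [integral_add (integrable_const _) ((integrable_const _).indicator measurableSet_Iic),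
      integral_indicator measurableSet_Iic, Measure.restrict_restrict measurableSet_Iic]
    have h3 : Set.Iic q ∩ Set.Icc (0 : ℝ) 1 = Set.Icc 0 q := by
      ext x
      simp only [Set.mem_inter_iff, Set.mem_Iic, Set.mem_Icc]
      constructor
      · rintro ⟨h4, h5, -⟩
        exact ⟨h5, h4⟩
      · rintro ⟨h4, h5⟩
        exact ⟨h5, h4, h5.trans hq1⟩
    rw [h3]
    simp only [integral_const, MeasurableSet.univ, measureReal_restrict_apply, Set.univ_inter,
      Real.volume_real_Icc_of_le hq0, Real.volume_real_Icc_of_le zero_le_one, smul_eq_mul]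
    linarith
  have hsplit : ∀ ω, M ω * (if B ω then (if u t ω k ≤ q then α else β) else 1) =
      (M ω - N ω) + N ω * g (u t ω k) := fun ω => by
    simp only [hN, hg]
    by_cases h : B ω
    · simp only [if_pos h]
      ring
    · simp only [if_neg h]
      ring
  simp only [hsplit]
  rw [integral_add hMNint hNgint, integral_sub hMint hNint,
    hind.integral_fun_mul_eq_mul_integral (hNm.mono hle le_rfl).aestronglyMeasurable
      (hgm.comp hut).aestronglyMeasurable]
  have h4 : 0 ≤ ∫ ω, N ω ∂P := integral_nonneg hN0
  nlinarith

theorem one_sub_mul_exp_le (q : ℝ) : (1 - q) * Real.exp q ≤ 1 := by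
  have h1 := Real.add_one_le_exp (-q)
  have h2 : Real.exp (-q) * Real.exp q = 1 := by rw [← Real.exp_add]; simp
  have h3 := Real.exp_pos q
  nlinarith

/-- As e ≤ 3, the left side is at most (1 + 2q)·exp(-2q) ≤ 1. This is the origin of the factor 2 in
`counts`. -/
theorem bernoulli_mgf_le {q : ℝ} (hq : 0 ≤ q) :
    q * Real.exp (1 - 2 * q) + (1 - q) * Real.exp (-(2 * q)) ≤ 1 := by
  have h1 : Real.exp (1 - 2 * q) = Real.exp 1 * Real.exp (-(2 * q)) := by
    rw [← Real.exp_add]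
    congr 1
  have h2 : Real.exp 1 ≤ 3 := by linarith [Real.exp_one_lt_d9]
  have h3 := Real.exp_pos (-(2 * q))
  have h4 : (1 + 2 * q) * Real.exp (-(2 * q)) ≤ 1 := by
    have := one_sub_mul_exp_le (-(2 * q))
    simpa using this
  rw [h1]
  have h5 : q * Real.exp 1 ≤ q * 3 := mul_le_mul_of_nonneg_left h2 hq
  nlinarith

/-- An exponential moment bound for the scheduling of instances of order `k`. -/
theorem IsMasterRun.measureReal_schedule_le
    (hrun : IsMasterRun S W (S.falcon 4000) S.mrate P u obs) (k : ℕ) {q α β : ℝ} (hq0 : 0 ≤ q)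
    (hq1 : q ≤ 1) (hα : 0 ≤ α) (hβ : 0 ≤ β) (hαβ : q * α + (1 - q) * β ≤ 1)
    {B : ℕ → Ω → Prop} [∀ t ω, Decidable (B t ω)] {s e : ℕ} (hs : 1 ≤ s) (he : e ≤ S.T + 1)
    (hB : ∀ t ∈ Finset.Ico s e, MeasurableSet[pastInfo u obs t] {ω | B t ω}) (x : ℝ) :
    P.real {ω | Real.exp x ≤ ∏ t ∈ Finset.Ico s e,
      (if B t ω then (if u t ω k ≤ q then α else β) else 1)} ≤ Real.exp (-x) := by
  have hmem : ∀ {t}, t ∈ Finset.Ico s e → t ∈ Finset.Icc 1 S.T := fun ht => by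
    rw [Finset.mem_Ico] at ht
    rw [Finset.mem_Icc]
    omega
  refine measureReal_exp_le_prod_le (G := pastInfo u obs) (c := α + β + 1)
    (fun a b hab => pastInfo_mono u obs hab) hrun.run.pastInfo_le (fun t ω => ?_) (fun t ht => ?_)
    (fun t _ ω => ?_) (fun t ht M C hM hM0 hMC => ?_) x
  · split_ifs
    exacts [hα, hβ, zero_le_one]
  · have h1 := hmem ht
    rw [Finset.mem_Icc] at h1
    refine Measurable.ite (pastInfo_mono u obs (Nat.le_succ t) _ (hB t ht)) (Measurable.ite
      (measurableSet_le ?_ measurable_const) measurable_const measurable_const) measurable_const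
    exact (measurable_pi_apply k).comp
      ((measurable_seed_seedInfo u h1.1 (Nat.lt_succ_self t)).mono le_sup_right le_rfl)
  · split_ifs <;> linarith
  · exact hrun.integral_schedule_le (hmem ht) k hq0 hq1 hα hβ hαβ (hB t ht) hM hM0 hMC

-- Exponential moment with parameter one: an aligned start contributes exp(1 - 2q) if scheduled and
-- exp(-2q) otherwise.
open Classical in
theorem IsMasterRun.measureReal_counts_le
    (hrun : IsMasterRun S W (S.falcon 4000) S.mrate P u obs) {s b n k e : ℕ} (hk : k ≤ n)
    (hb : 1 ≤ b) (he : e ≤ S.T + 1) :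
    P.real {ω | ¬ (((Finset.Ico b e).filter fun τ => 2 ^ k ∣ τ - s ∧ u τ ω k ≤ S.sprob n k).card : ℝ)
      ≤ 2 * S.sprob n k * ((Finset.Ico b e).filter fun τ => 2 ^ k ∣ τ - s).card + 20 * S.lg} ≤
      Real.exp (-(20 * S.lg)) := by
  set q := S.sprob n k with hq
  have hq0 : 0 < q := S.sprob_pos n k
  have hq1 : q ≤ 1 := S.sprob_le_one hk
  refine le_trans (measureReal_mono (fun ω hω => ?_) (measure_ne_top _ _))
    (hrun.measureReal_schedule_le k (B := fun t _ => 2 ^ k ∣ t - s) hq0.le hq1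
      (Real.exp_pos (1 - 2 * q)).le (Real.exp_pos (-(2 * q))).le (bernoulli_mgf_le hq0.le) hb he
      (fun t _ => @MeasurableSet.const _ (pastInfo u obs t) _) (20 * S.lg))
  simp only [Set.mem_ofPred_eq, not_le] at hω ⊢
  have h1 : ∀ t ∈ Finset.Ico b e, (if 2 ^ k ∣ t - s then
      (if u t ω k ≤ q then Real.exp (1 - 2 * q) else Real.exp (-(2 * q))) else 1) =
      Real.exp ((if 2 ^ k ∣ t - s ∧ u t ω k ≤ q then 1 else 0) +
        -(2 * q) * (if 2 ^ k ∣ t - s then 1 else 0)) := by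
    intro t _
    by_cases h2 : 2 ^ k ∣ t - s
    · by_cases h3 : u t ω k ≤ q
      · simp only [h2, h3, if_true, and_self]
        congr 1
        ring
      · simp [h2, h3]
    · simp [h2]
  rw [Finset.prod_congr rfl h1, ← Real.exp_sum, Finset.sum_add_distrib, ← Finset.mul_sum,
    Finset.sum_boole, Finset.sum_boole]
  apply Real.exp_le_exp.2
  linarith

-- A detectable start contributes 0 if scheduled and exp q otherwise. The product vanishes once one
-- of them is scheduled and else equals exp(q·count), so a long run of misses is unlikely even
-- though detectability is adaptive.
open Classical in
theorem IsMasterRun.measureReal_detect_le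
    (hrun : IsMasterRun S W (S.falcon 4000) S.mrate P u obs) {s n k e : ℕ} (hk : k ≤ n)
    (hs : 1 ≤ s) (he : e ≤ S.T + 1) :
    P.real {ω | ¬ ((∀ b ∈ Finset.Ico s e, Detectable S W (fun τ => u τ ω) (fun τ => obs τ ω) s n k b →
        S.sprob n k < u b ω k) →
      S.sprob n k * ((Finset.Ico s e).filter fun b =>
        Detectable S W (fun τ => u τ ω) (fun τ => obs τ ω) s n k b).card ≤ 20 * S.lg)} ≤
      Real.exp (-(20 * S.lg)) := by
  set q := S.sprob n k with hq
  have hq0 : 0 < q := S.sprob_pos n k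
  have hq1 : q ≤ 1 := S.sprob_le_one hk
  refine le_trans (measureReal_mono (fun ω hω => ?_) (measure_ne_top _ _))
    (hrun.measureReal_schedule_le k
      (B := fun t ω => Detectable S W (fun τ => u τ ω) (fun τ => obs τ ω) s n k t) hq0.le hq1
      le_rfl (Real.exp_pos q).le (by simpa using one_sub_mul_exp_le q) hs he
      (fun t ht => ?_) (20 * S.lg))
  · simp only [Set.mem_ofPred_eq, Classical.not_imp, not_le] at hω ⊢
    obtain ⟨h1, h2⟩ := hω
    have h3 : ∀ t ∈ Finset.Ico s e,
        (if Detectable S W (fun τ => u τ ω) (fun τ => obs τ ω) s n k t then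
          (if u t ω k ≤ q then 0 else Real.exp q) else 1) =
        Real.exp (q * (if Detectable S W (fun τ => u τ ω) (fun τ => obs τ ω) s n k t
          then 1 else 0)) := by
      intro t ht
      by_cases h4 : Detectable S W (fun τ => u τ ω) (fun τ => obs τ ω) s n k t
      · rw [if_pos h4, if_pos h4, if_neg (not_le.2 (h1 t ht h4)), mul_one]
      · rw [if_neg h4, if_neg h4, mul_zero, Real.exp_zero]
    rw [Finset.prod_congr rfl h3, ← Real.exp_sum, ← Finset.mul_sum, Finset.sum_boole]
    exact Real.exp_le_exp.2 h2.le
  · rw [Finset.mem_Ico] at ht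
    refine measurableSet_detectable (m := pastInfo u obs t) W (fun τ hτ => ?_) (fun τ hτ => ?_) hs
      ht.1 n k
    · rw [Finset.mem_Ico] at hτ
      exact (measurable_seed_seedInfo u hτ.1 hτ.2).mono le_sup_right le_rfl
    · rw [Finset.mem_Ico] at hτ
      exact measurable_obs_pastInfo u obs hτ.1 hτ.2

theorem IsMasterRun.measureReal_unif
    (hrun : IsMasterRun S W (S.falcon 4000) S.mrate P u obs) {t : ℕ} (ht : t ∈ Finset.Icc 1 S.T)
    (k : ℕ) : P.real {ω | ¬ u t ω k ≤ 1} = 0 := by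
  have hut : Measurable fun ω => u t ω k := (measurable_pi_apply k).comp (hrun.run.seed_meas t)
  have h1 : {ω | ¬ u t ω k ≤ 1} = (fun ω => u t ω k) ⁻¹' Set.Ioi 1 := by
    ext ω
    simp
  rw [h1, measureReal_def, ← Measure.map_apply hut measurableSet_Ioi, hrun.uniform t ht k,
    Measure.restrict_apply measurableSet_Ioi]
  have h2 : Set.Ioi (1 : ℝ) ∩ Set.Icc 0 1 = ∅ := by
    ext x
    simp only [Set.mem_inter_iff, Set.mem_Ioi, Set.mem_Icc, Set.mem_empty_iff_false, iff_false]
    rintro ⟨h3, -, h4⟩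
    linarith
  rw [h2]
  simp

end MasterProbability

end RealizableBandit

namespace RealizableBandit

/-! ### Union bound and conclusion -/

section MasterUnion

variable {X A ι Ω : Type*} [MeasurableSpace X] [MeasurableSpace A] [MeasurableSingletonClass A]
  [Fintype A] [Fintype ι] [mΩ : MeasurableSpace Ω]
  {S : Setup X A ι} {W : World X ι} {P : Measure Ω} [IsProbabilityMeasure P]
  {u : ℕ → Ω → ℕ → ℝ} {obs : ℕ → Ω → Obs X A}

theorem measureReal_biUnion_le_mul {κ : Type*} (F : Finset κ) (B : κ → Set Ω) {c : ℝ}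
    (h : ∀ i ∈ F, P.real (B i) ≤ c) : P.real (⋃ i ∈ F, B i) ≤ F.card * c := by
  refine (measureReal_biUnion_finset_le _ _).trans ((Finset.sum_le_sum h).trans_eq ?_)
  rw [Finset.sum_const, nsmul_eq_mul]

/-- With y = T/δ ≥ 2 and δ = T/y, each of the four terms is at most T^(a+1)/y^b with b ≥ a + 3,
hence at most δ/y² ≤ δ/4. -/
theorem Setup.sum_failure_le (S : Setup X A ι) :
    (S.T : ℝ) ^ 4 * Real.exp (-(13 * S.logTerm)) + S.T * Real.exp (-(13 * S.logTerm)) +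
      (S.T : ℝ) ^ 4 * (S.T + 2) * Real.exp (-(20 * S.lg)) +
      (S.T : ℝ) ^ 3 * (S.T + 2) * Real.exp (-(20 * S.lg)) ≤ S.δ := by
  have hT := S.two_le_T_real
  have hδ := S.δ_pos
  have hδ1 := S.δ_lt_one
  set y := (S.T : ℝ) / S.δ with hy
  have hTy : (S.T : ℝ) ≤ y := S.T_le_T_div
  have hy2 : 2 ≤ y := S.two_le_T_div
  have hy0 : 0 < y := by linarith
  have hexp : ∀ k : ℕ, Real.exp (-(k * S.lg)) = (y ^ k)⁻¹ := fun k => by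
    rw [Real.exp_neg, Real.exp_nat_mul, Setup.lg, Real.exp_log hy0]
  have h13 : Real.exp (-(13 * S.logTerm)) ≤ (y ^ 13)⁻¹ := by
    rw [← hexp 13]
    apply Real.exp_le_exp.2
    have := S.log_T_div_le_logTerm
    unfold Setup.lg
    push_cast
    linarith
  have h20 : Real.exp (-(20 * S.lg)) = (y ^ 20)⁻¹ := by
    rw [← hexp 20]
    norm_num
  have hδy : S.δ = S.T / y := by
    rw [hy]
    field_simp
  have hone : ∀ (a b : ℕ), a + 3 ≤ b → (S.T : ℝ) ^ (a + 1) * (y ^ b)⁻¹ ≤ S.δ * (1 / 4) := by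
    intro a b hab
    obtain ⟨c, rfl⟩ := Nat.exists_eq_add_of_le hab
    have h1 : (S.T : ℝ) ^ a ≤ y ^ a := by gcongr
    have h2 : (4 : ℝ) ≤ y ^ 2 := by nlinarith
    have h3 : (1 : ℝ) ≤ y ^ c := one_le_pow₀ (by linarith)
    rw [hδy, ← div_eq_mul_inv, div_mul_eq_mul_div, div_le_div_iff₀ (by positivity) hy0]
    calc (S.T : ℝ) ^ (a + 1) * y = S.T ^ a * S.T * y := by ring
      _ ≤ y ^ a * S.T * y := by gcongr
      _ = S.T * (1 / 4) * (y ^ a * y * 4 * 1) := by ring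
      _ ≤ S.T * (1 / 4) * (y ^ a * y * y ^ 2 * y ^ c) := by gcongr
      _ = _ := by ring
  have e1 := hone 3 13 (by norm_num)
  have e2 := hone 0 13 (by norm_num)
  have e3 := hone 5 20 (by norm_num)
  have e4 := hone 4 20 (by norm_num)
  have hi : 0 ≤ (y ^ 20)⁻¹ := by positivity
  rw [h20]
  norm_num at e1 e2 e3 e4
  have hTT : (S.T : ℝ) + 2 ≤ S.T ^ 2 := by nlinarith
  calc _ ≤ (S.T : ℝ) ^ 4 * (y ^ 13)⁻¹ + S.T * (y ^ 13)⁻¹ +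
      (S.T : ℝ) ^ 4 * S.T ^ 2 * (y ^ 20)⁻¹ + (S.T : ℝ) ^ 3 * S.T ^ 2 * (y ^ 20)⁻¹ := by gcongr
    _ = (S.T : ℝ) ^ 4 * (y ^ 13)⁻¹ + S.T * (y ^ 13)⁻¹ +
      (S.T : ℝ) ^ 6 * (y ^ 20)⁻¹ + (S.T : ℝ) ^ 5 * (y ^ 20)⁻¹ := by ring
    _ ≤ S.δ := by linarith

/-- The event on which the regret of the reduction is bounded has probability at least `1 - δ`. -/
theorem IsMasterRun.measureReal_not_good_le
    (hrun : IsMasterRun S W (S.falcon 4000) S.mrate P u obs) :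
    P.real {ω | ¬ MasterGood S W (fun s => u s ω) (fun s => obs s ω) (fun t =>
      masterProb (S.falcon 4000) S.T S.δ S.mrate (fun s => u s ω) (fun s => obs s ω) t)} ≤
      S.δ := by
  classical
  have hJ := playsIgw_master S u obs
  set p : ℕ → Ω → X → A → ℝ := fun t ω =>
    masterProb (S.falcon 4000) S.T S.δ S.mrate (fun s => u s ω) (fun s => obs s ω) t with hp
  set R := Finset.Icc 1 S.T with hR
  set N := Finset.range S.T with hN
  have hRc : R.card = S.T := by rw [hR, Nat.card_Icc]; omega
  set E1 := Real.exp (-(13 * S.logTerm)) with hE1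
  set E2 := Real.exp (-(20 * S.lg)) with hE2
  -- Which blocks and instances occur is random, so the union runs over all conceivable ones. The
  -- events `B3` are null.
  set B1 : ℕ × ℕ × ℕ × ℕ → Set Ω := fun x => {ω | ¬ Concentrated S W
    (S.ActiveIn (fun s => u s ω) (fun s => obs s ω) x.1 x.2.1 (x.2.2.1, x.2.2.2)) x.1
    (fun s => obs s ω) (fun t => p t ω)} with hB1
  set B2 : ℕ → Set Ω := fun b => {ω | ¬ Concentrated S W (fun _ => True) b
    (fun s => obs s ω) (fun t => p t ω)} with hB2
  set B3 : ℕ × ℕ → Set Ω := fun x => {ω | ¬ u x.1 ω x.2 ≤ 1} with hB3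
  set B4 : ℕ × ℕ × ℕ × ℕ × ℕ → Set Ω := fun x => {ω | x.2.2.2.1 ≤ x.2.2.1 ∧
    ¬ (((Finset.Ico x.2.1 x.2.2.2.2).filter fun τ => 2 ^ x.2.2.2.1 ∣ τ - x.1 ∧
        u τ ω x.2.2.2.1 ≤ S.sprob x.2.2.1 x.2.2.2.1).card : ℝ)
      ≤ 2 * S.sprob x.2.2.1 x.2.2.2.1 * ((Finset.Ico x.2.1 x.2.2.2.2).filter fun τ =>
        2 ^ x.2.2.2.1 ∣ τ - x.1).card + 20 * S.lg} with hB4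
  set B5 : ℕ × ℕ × ℕ × ℕ → Set Ω := fun x => {ω | x.2.2.1 ≤ x.2.1 ∧
    ¬ ((∀ b ∈ Finset.Ico x.1 x.2.2.2,
        Detectable S W (fun τ => u τ ω) (fun τ => obs τ ω) x.1 x.2.1 x.2.2.1 b →
          S.sprob x.2.1 x.2.2.1 < u b ω x.2.2.1) →
      S.sprob x.2.1 x.2.2.1 * ((Finset.Ico x.1 x.2.2.2).filter fun b =>
        Detectable S W (fun τ => u τ ω) (fun τ => obs τ ω) x.1 x.2.1 x.2.2.1 b).card ≤
          20 * S.lg)} with hB5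
  set F1 := R ×ˢ N ×ˢ N ×ˢ R with hF1
  set F4 := R ×ˢ R ×ˢ N ×ˢ N ×ˢ Finset.range (S.T + 2) with hF4
  set F5 := R ×ˢ N ×ˢ N ×ˢ Finset.range (S.T + 2) with hF5
  have hsub : {ω | ¬ MasterGood S W (fun s => u s ω) (fun s => obs s ω) (fun t => p t ω)} ⊆
      (⋃ x ∈ F1, B1 x) ∪ (⋃ b ∈ R, B2 b) ∪ (⋃ x ∈ R ×ˢ N, B3 x) ∪ (⋃ x ∈ F4, B4 x) ∪
        (⋃ x ∈ F5, B5 x) := by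
    intro ω hω
    by_contra hn
    simp only [Set.mem_union, not_or, Set.mem_iUnion, not_exists] at hn
    obtain ⟨⟨⟨⟨n1, n2⟩, n3⟩, n4⟩, n5⟩ := hn
    refine hω ⟨fun s hs n hn m hm b hb => ?_, fun b hb => ?_, fun t ht m hm => ?_,
      fun s hs b hb n hn m hm e he => ?_, fun s hs n hn m hm e he => ?_⟩
    · exact not_not.1 (n1 (s, n, m, b) (by
        simp only [hF1, hN, Finset.mem_product, Finset.mem_range]
        exact ⟨hs, hn, hm, hb⟩))
    · exact not_not.1 (n2 b hb)
    · exact not_not.1 (n3 (t, m) (by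
        simp only [hN, Finset.mem_product, Finset.mem_range]
        exact ⟨ht, hm⟩))
    · have h1 := n4 (s, b, n, m, e) (by
        simp only [hF4, hF5, hN, Finset.mem_product, Finset.mem_range]
        exact ⟨hs, hb, hn, by omega, by omega⟩)
      by_contra h2
      refine h1 ⟨hm, fun h3 => h2 ?_⟩
      convert h3
    · have h1 := n5 (s, n, m, e) (by
        simp only [hF5, hN, Finset.mem_product, Finset.mem_range]
        exact ⟨hs, hn, by omega, by omega⟩)
      intro h2
      by_contra h3
      refine h1 ⟨hm, fun h4 => h3 ?_⟩
      convert h4 h2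
  have m1 : P.real (⋃ x ∈ F1, B1 x) ≤ F1.card * E1 := measureReal_biUnion_le_mul _ _ fun x hx => by
    simp only [hF1, Finset.mem_product, hR, Finset.mem_Icc] at hx
    exact hrun.run.measureReal_not_concentrated_le hJ
      (Z := fun t ω => S.ActiveIn (fun s => u s ω) (fun s => obs s ω) x.1 x.2.1
        (x.2.2.1, x.2.2.2) t)
      (fun t ht => measurableSet_activeIn (m := preInfo u obs t) (Finset.mem_Icc.1 ht).1
        (measurable_seed_preInfo u obs) (measurable_obs_preInfo u obs) _ _ _) hx.1.1
  have m2 : P.real (⋃ b ∈ R, B2 b) ≤ R.card * E1 := measureReal_biUnion_le_mul _ _ fun b hb => by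
    exact hrun.run.measureReal_not_concentrated_le hJ (Z := fun _ _ => True)
      (fun t _ => @MeasurableSet.univ _ (preInfo u obs t)) (Finset.mem_Icc.1 hb).1
  have m3 : P.real (⋃ x ∈ R ×ˢ N, B3 x) ≤ (R ×ˢ N).card * 0 :=
    measureReal_biUnion_le_mul _ _ fun x hx =>
      (hrun.measureReal_unif (Finset.mem_product.1 hx).1 x.2).le
  have m4 : P.real (⋃ x ∈ F4, B4 x) ≤ F4.card * E2 := measureReal_biUnion_le_mul _ _ fun x hx => by
    simp only [hF4, hF5, Finset.mem_product, hR, Finset.mem_Icc, Finset.mem_range] at hx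
    by_cases hk : x.2.2.2.1 ≤ x.2.2.1
    · refine (measureReal_mono (fun ω hω => ?_) (measure_ne_top _ _)).trans
        (hrun.measureReal_counts_le (s := x.1) (b := x.2.1) (e := x.2.2.2.2) hk hx.2.1.1 (by omega))
      refine fun h3 => hω.2 ?_
      convert h3
    · have : B4 x = ∅ := by
        ext ω
        simp [hB4, hk]
      rw [this]
      simpa using (Real.exp_pos _).le
  have m5 : P.real (⋃ x ∈ F5, B5 x) ≤ F5.card * E2 := measureReal_biUnion_le_mul _ _ fun x hx => by
    simp only [hF5, Finset.mem_product, hR, Finset.mem_Icc, Finset.mem_range] at hx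
    by_cases hk : x.2.2.1 ≤ x.2.1
    · refine (measureReal_mono (fun ω hω => ?_) (measure_ne_top _ _)).trans
        (hrun.measureReal_detect_le (s := x.1) (e := x.2.2.2) hk hx.1.1 (by omega))
      refine fun h3 => hω.2 fun h4 => ?_
      convert h3 h4
    · have : B5 x = ∅ := by
        ext ω
        simp [hB5, hk]
      rw [this]
      simpa using (Real.exp_pos _).le
  have c1 : (F1.card : ℝ) = (S.T : ℝ) ^ 4 := by
    simp only [hF1, hN, Finset.card_product, hRc, Finset.card_range]
    push_cast
    ring
  have c4 : (F4.card : ℝ) = (S.T : ℝ) ^ 4 * (S.T + 2) := by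
    simp only [hF4, hF5, hN, Finset.card_product, hRc, Finset.card_range]
    push_cast
    ring
  have c5 : (F5.card : ℝ) = (S.T : ℝ) ^ 3 * (S.T + 2) := by
    simp only [hF5, hN, Finset.card_product, hRc, Finset.card_range]
    push_cast
    ring
  rw [c1] at m1
  rw [hRc] at m2
  rw [mul_zero] at m3
  rw [c4] at m4
  rw [c5] at m5
  have hfin := S.sum_failure_le
  have u0 := measureReal_mono hsub (measure_ne_top P _)
  have u1 := measureReal_union_le (μ := P) ((⋃ x ∈ F1, B1 x) ∪ (⋃ b ∈ R, B2 b) ∪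
    (⋃ x ∈ R ×ˢ N, B3 x) ∪ (⋃ x ∈ F4, B4 x)) (⋃ x ∈ F5, B5 x)
  have u2 := measureReal_union_le (μ := P) ((⋃ x ∈ F1, B1 x) ∪ (⋃ b ∈ R, B2 b) ∪
    (⋃ x ∈ R ×ˢ N, B3 x)) (⋃ x ∈ F4, B4 x)
  have u3 := measureReal_union_le (μ := P) ((⋃ x ∈ F1, B1 x) ∪ (⋃ b ∈ R, B2 b))
    (⋃ x ∈ R ×ˢ N, B3 x)
  have u4 := measureReal_union_le (μ := P) (⋃ x ∈ F1, B1 x) (⋃ b ∈ R, B2 b)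
  linarith

/-- The dynamic regret of the reduction with FALCON as base algorithm. -/
theorem IsMasterRun.dynRegret_bound
    (hrun : IsMasterRun S W (S.falcon 4000) S.mrate P u obs) :
    1 - S.δ ≤ P.real {ω | dynRegret S W (fun s => obs s ω) ≤
      10000000000000 * Real.log ((S.T : ℝ) / S.δ) ^ 5 *
        min (√(S.numA * S.logTerm * changes (drift S W) 1 S.T * (S.T : ℝ)))
          ((S.numA * S.logTerm * total (drift S W) 1 S.T) ^ (1 / 3 : ℝ) * (S.T : ℝ) ^ (2 / 3 : ℝ)
            + √(S.numA * S.logTerm * (S.T : ℝ)))} := by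
  set E := {ω | dynRegret S W (fun s => obs s ω) ≤
      10000000000000 * Real.log ((S.T : ℝ) / S.δ) ^ 5 *
        min (√(S.numA * S.logTerm * changes (drift S W) 1 S.T * (S.T : ℝ)))
          ((S.numA * S.logTerm * total (drift S W) 1 S.T) ^ (1 / 3 : ℝ) * (S.T : ℝ) ^ (2 / 3 : ℝ)
            + √(S.numA * S.logTerm * (S.T : ℝ)))} with hE
  have h1 := hrun.measureReal_not_good_le
  set G := {ω | ¬ MasterGood S W (fun s => u s ω) (fun s => obs s ω) (fun t =>
      masterProb (S.falcon 4000) S.T S.δ S.mrate (fun s => u s ω) (fun s => obs s ω) t)} with hG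
  have h2 : (1 : ℝ) ≤ P.real E + P.real G := by
    rw [← probReal_univ (μ := P)]
    refine (measureReal_mono (fun ω _ => ?_) (measure_ne_top _ _)).trans (measureReal_union_le _ _)
    by_cases hg : MasterGood S W (fun s => u s ω) (fun s => obs s ω) (fun t =>
      masterProb (S.falcon 4000) S.T S.δ S.mrate (fun s => u s ω) (fun s => obs s ω) t)
    · exact Or.inl (MasterContext.dynRegret_le ⟨hg, fun t => rfl,
        fun t => hrun.run.reward_mem t ω, fun t => isPolicy_falconProb _⟩)
    · exact Or.inr hg
  linarith

end MasterUnion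

end RealizableBandit

open RealizableBandit in
theorem mainTheorem9 :
    -- (a) the regression oracle is accurate in a nearly stationary environment
    (∀ b : ℝ, 0 < b → ∃ C : ℝ, 0 < C ∧
      ∀ (X A ι Ω : Type*) [MeasurableSpace X] [MeasurableSpace A] [MeasurableSingletonClass A]
        [Fintype A] [Fintype ι] [MeasurableSpace Ω]
        (S : Setup X A ι) (W : World X ι) (P : Measure Ω) [IsProbabilityMeasure P]
        (obs : ℕ → Ω → Obs X A) (c : ℝ), IsAloneRun S W (S.falcon c) P obs →
        ∀ t ∈ Finset.Icc 1 S.T, total (drift S W) 1 t ≤ b * S.rho t →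
          1 - S.δ / (S.T : ℝ) ≤
            P.real {ω | regressionError S W (fun s => obs s ω) t ≤ C * S.logTerm}) ∧
    -- (b) the inverse probabilities are controlled by the predicted regrets
    (∀ b : ℝ, 0 < b → ∃ C : ℝ, 0 < C ∧
      ∀ (X A ι : Type*) [MeasurableSpace X] [MeasurableSpace A] [MeasurableSingletonClass A]
        [Fintype A] [Fintype ι]
        (S : Setup X A ι) (W : World X ι) (obs : ℕ → Obs X A),
        ∀ t ∈ Finset.Icc 1 S.T, total (drift S W) 1 t ≤ b * S.rho t →
          ∀ π : X → A, Measurable π →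
            maxInvProb S W obs t π ≤ C * S.numA +
              ⨆ τ : Finset.Icc 1 (t - 1), S.gam ((τ : ℕ) + 1) * predRegret S W obs (τ : ℕ) π) ∧
    ∃ (c K C : ℝ) (k : ℕ), 0 < c ∧ 0 < K ∧ 0 < C ∧
      -- (c) FALCON satisfies the requirement on base algorithms
      (∀ (X A ι Ω : Type*) [MeasurableSpace X] [MeasurableSpace A] [MeasurableSingletonClass A]
        [Fintype A] [Fintype ι] [MeasurableSpace Ω]
        (S : Setup X A ι) (W : World X ι) (P : Measure Ω) [IsProbabilityMeasure P]
        (obs : ℕ → Ω → Obs X A), IsAloneRun S W (S.falcon c) P obs →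
        Assumption1 S W P obs
          (fun t ω => (S.falcon c).opt (history (fun s => obs s ω) t))
          (fun t => K * drift S W t) (fun t => K * S.rho t) ∧
        Assumption1 S W P obs
          (fun t ω => popOpt S W c (fun s => obs s ω) t)
          (fun t => K * drift S W t) (fun t => K * S.rho t) ∧
        (2 ≤ Fintype.card ι → ∀ t ∈ Finset.Icc 1 S.T,
          (t : ℝ) * (K * S.rho t) ≤ C * √(Real.log ((S.T : ℝ) / S.δ)) *
            (√(S.numA * (t : ℝ) * Real.log (Fintype.card ι : ℝ)) +
              S.numA * Real.log (Fintype.card ι : ℝ)))) ∧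
      -- (d) dynamic regret of the reduction with FALCON as base algorithm
      (∀ (X A ι Ω : Type*) [MeasurableSpace X] [MeasurableSpace A] [MeasurableSingletonClass A]
        [Fintype A] [Fintype ι] [MeasurableSpace Ω]
        (S : Setup X A ι) (W : World X ι) (P : Measure Ω) [IsProbabilityMeasure P]
        (u : ℕ → Ω → ℕ → ℝ) (obs : ℕ → Ω → Obs X A),
        IsMasterRun S W (S.falcon c) (fun t => K * S.rho t) P u obs →
        1 - S.δ ≤ P.real {ω | dynRegret S W (fun s => obs s ω) ≤
          C * Real.log ((S.T : ℝ) / S.δ) ^ k *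
            min (√(S.numA * S.logTerm * changes (drift S W) 1 S.T * (S.T : ℝ)))
              ((S.numA * S.logTerm * total (drift S W) 1 S.T) ^ (1 / 3 : ℝ)
                  * (S.T : ℝ) ^ (2 / 3 : ℝ)
                + √(S.numA * S.logTerm * (S.T : ℝ)))}) := by
  -- `c = 4000` is the bonus that ensures optimism. `K = 10⁶` is the factor built into `mrate`; (c)
  -- needs only `K ≥ 40000`, and `C ≥ 2K`.
  refine ⟨fun b hb => ⟨3 * b ^ 2 + 640, by positivity, ?_⟩, fun b hb => ⟨3 + b, by positivity, ?_⟩,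
    4000, 1000000, 10000000000000, 5, by norm_num, by norm_num, by norm_num, ?_, ?_⟩
  · intro X A ι Ω _ _ _ _ _ _ S W P _ obs c h t ht hd
    exact regressionError_bound h ht hd
  · intro X A ι _ _ _ _ _ S W obs t ht hd π hπ
    exact maxInvProb_le S W obs hb (Finset.mem_Icc.1 ht).1 hd hπ
  · intro X A ι Ω _ _ _ _ _ _ S W P _ obs h
    exact ⟨assumption1_falcon (by norm_num) h, assumption1_popOpt (by norm_num) h,
      fun hι t _ => mul_rate_le S (by norm_num) (by norm_num) hι t⟩
  · intro X A ι Ω _ _ _ _ _ _ S W P _ u obs h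
    exact IsMasterRun.dynRegret_bound h
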